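/- **Setting.** Let $t=(t_{n\alpha})_{n\ge 0,\,\alpha\in\mathbb Z}$ be complex numbers with $\sum_{n,\alpha}|t_{n\alpha}|r^n e^{c|\alpha|}<\infty$ for all $r,c>0$, and let $\Omega\subset\mathbb R$ be open. Consider families $g_{n+1},h_n,u_n,v_n$ $(n\ge1)$ of smooth complex functions of $(x,\theta_1,\theta_2)\in\Omega\times\mathbb R^2$, $2\pi$-periodic in $\theta_1,\theta_2$, whose generating series below converge near $\lambda=\infty$ together with all derivatives in $(x,\theta)$, locally uniformly in $x$ ("regular" fields). Put $$\mathcal U(\lambda)=\theta_1+\sum_{n\ge1}u_n\lambda^{-n},\qquad \mathcal M(\lambda)=\sum_{n,\alpha}n t_{n\alpha}\lambda^{n-1}e^{i\alpha\,\mathcal U(\lambda)}+x+\sum_{n\ge1}h_n\lambda^{-n-1},$$ $$\mathcal V(\lambda)=\sum_{n,\alpha}i\alpha\, t_{n\alpha}\lambda^{n}e^{i\alpha\,\mathcal U(\lambda)}+\theta_2+\sum_{n\ge1}v_n\lambda^{-n},\qquad \mathcal L=k+\sum_{n\ge1}g_{n+1}k^{-n},$$ and $\mathcal M=\mathcal M(\lambda)|_{\lambda=\mathcal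 L}$, $\mathcal U=\mathcal U(\lambda)|_{\lambda=\mathcal L}$, $\mathcal V=\mathcal V(\lambda)|_{\lambda=\mathcal L}$. With $$\{f,g\}=f_kg_x-f_xg_k+f_{\theta_1}g_{\theta_2}-f_{\theta_2}g_{\theta_1},$$ the fields satisfy the canonical relations (they are "on shell") if, for $k$ near $\infty$, $$\{\mathcal L,\mathcal M\}=\{\mathcal U,\mathcal V\}=1,\qquad \{\mathcal L,\mathcal U\}=\{\mathcal L,\mathcal V\}=\{\mathcal M,\mathcal U\}=\{\mathcal M,\mathcal V\}=0.$$ A further function $F=F(x)$ is adjoined. Let $\mathcal R[F]$ be the ring of functions of the state $(g,h,u,v,F)$ generated by the values of the coefficient fields, of their partial derivatives in $(x,\theta)$, and of $F$; the quantities $t,x,\theta$ are scalars. Let $\partial_F$ be the derivation with $\partial_F F=1$ that kills the fields. A *symbol* is a convergent Laurent–Fourier series $$A(\lambda,\mu,u,v)=\sum_{n\in\mathbb Z}\sum_{m\ge0}\sum_{\alpha,\beta\in\mathbb Z}a_{nm\alpha\beta}\,\lambda^n\mu^me^{i(\alpha u+\beta v)},$$ i.e. a function holomorphic for $|\lambda|>\rho$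 (some $\rho$) and all $\mu,u,v\in\mathbb C$, and $2\pi$-periodic in $u$ and $v$. On symbols put $$\{A,B\}_{\lambda\mu uv}=A_\lambda B_\mu-A_\mu B_\lambda+A_uB_v-A_vB_u .$$ Write $(\cdot)_{\le-1}$ for the part of negative powers of $k$, and $\operatorname{res}_\lambda\sum a_n\lambda^n=a_{-1}$. The symmetry $\delta_A$ is the derivation (directional derivative along a vector field on states) that fixes $t,x,\theta$ and is given by $$\delta_A Z=\{A(\mathcal L,\mathcal M,\mathcal U,\mathcal V)_{\le-1},\,Z\}\quad(Z=\mathcal L,\mathcal M,\mathcal U,\mathcal V),$$ $$\delta_AF=-\int_{T^2}\frac{d\theta_1d\theta_2}{(2\pi)^2}\operatorname{res}_\lambda\int_0^{\mathcal M(\lambda)}A(\lambda,\mu,\mathcal U(\lambda),\mathcal V(\lambda))\,d\mu .$$ **Theorem.** 1. At every regular state these formulas do define a vector field on states: there are variations of $g_n,h_n,u_n,v_n$, given by Laurent coefficients, that induce exactly the stated variations of $\mathcal L,\mathcal M,\mathcal U,\mathcal V$ for $k$ near $\infty$. At on-shell regular states it is tangent to the six canonical relations. The symbols are closed under $\{\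 ,\ \}_{\lambda\mu uv}$, and $\delta_A$ is linear in $A$. 2. At every on-shell regular state and on every element of $\mathcal R[F]$ (all derivatives involved exist), $$[\delta_A,\delta_B]=\delta_{\{A,B\}_{\lambda\mu uv}}+c(A,B)\,\partial_F,\qquad [\delta_A,\partial_F]=0,$$ where $$c(A,B)=\int_0^{2\pi}\!\!\int_0^{2\pi}\frac{du\,dv}{(2\pi)^2}\operatorname{res}_\lambda A(\lambda,0,u,v)\,\partial_\lambda B(\lambda,0,u,v).$$ 3. $c$ is a 2-cocycle of the Poisson algebra of symbols: it is bilinear, $c(A,B)=-c(B,A)$, and $$c(\{A,B\},C)+c(\{B,C\},A)+c(\{C,A\},B)=0 .$$ Thus the extended symmetries realize a one-dimensional central extension of the four-dimensional Poisson algebra. It is not necessary to assume that $\theta\mapsto(\mathcal U(\lambda),\mathcal V(\lambda))$ is a diffeomorphism of the torus for $\lambda$ near $\infty$. -/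

import Mathlib

open Filter Topology Set MeasureTheory
open scoped ContDiff Real

namespace Toroidal

noncomputable section

/-! ### Symbols: Laurent-Fourier series and their Poisson algebra -/

/-- A function of `(lambda, mu, u, v)`. -/
abbrev Symbol : Type := ℂ → ℂ → ℂ → ℂ → ℂ

/-- `A` is the sum of a convergent Laurent-Fourier series
`∑ a n m α β * lambda ^ n * mu ^ m * exp (i (α u + β v))`, with `n` in `ℤ`, `m` in `ℕ`,
`α, β` in `ℤ`, for `lambda` in a punctured neighbourhood of infinity and all `mu, u, v`.
Equivalently, it is holomorphic there and `2π`-periodic in `u` and in `v`. -/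
def IsSymbol (A : Symbol) : Prop :=
  ∃ ρ : ℝ,
    DifferentiableOn ℂ (fun p : ℂ × ℂ × ℂ × ℂ => A p.1 p.2.1 p.2.2.1 p.2.2.2)
      {p | ρ < ‖p.1‖} ∧
    ∀ l m u v : ℂ, ρ < ‖l‖ →
      A l m (u + 2 * π) v = A l m u v ∧ A l m u (v + 2 * π) = A l m u v

/-- The four-dimensional Poisson bracket in `(lambda, mu, u, v)`. -/
def poisson (A B : Symbol) : Symbol := fun l m u v =>
  deriv (fun z => A z m u v) l * deriv (fun z => B l z u v) m
    - deriv (fun z => A l z u v) m * deriv (fun z => B z m u v) l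
    + deriv (fun z => A l m z v) u * deriv (fun z => B l m u z) v
    - deriv (fun z => A l m u z) v * deriv (fun z => B l m z v) u

/-! ### Laurent coefficients at infinity -/

/-- The residue `∑ a n * z ^ n ↦ a (-1)` of a function that is holomorphic in a punctured
neighbourhood of infinity: the integral over the circle of radius `K`, which does not depend
on `K` once `K` is large. -/
def res (f : ℂ → ℂ) : ℂ :=
  limUnder atTop (fun K : ℝ => (2 * π * Complex.I)⁻¹ * ∮ z in C(0, K), f z)

/-- The coefficient of `z ^ n` in the Laurent expansion of `f` at infinity. -/
def laurentCoeff (f : ℂ → ℂ) (n : ℤ) : ℂ := res (fun z => z ^ (-n - 1) * f z)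

/-- The average over the torus. -/
def torusMean (f : ℝ → ℝ → ℂ) : ℂ :=
  ((2 * π : ℂ) ^ 2)⁻¹ * ∫ a in (0 : ℝ)..(2 * π), ∫ b in (0 : ℝ)..(2 * π), f a b

/-- The cocycle: the average over real `u, v` of the residue in `lambda` of
`A(lambda,0,u,v)` times the `lambda`-derivative of `B(lambda,0,u,v)`. -/
def cocycle (A B : Symbol) : ℂ :=
  torusMean (fun u v => res (fun l => A l 0 u v * deriv (fun z => B z 0 u v) l))

/-! ### Functions of `(k, x, θ₁, θ₂)` -/

/-- A function of `(k, x, θ₁, θ₂)` with `k` complex and `x, θ₁, θ₂` real. -/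
abbrev PhaseFun : Type := ℂ → ℝ → ℝ → ℝ → ℂ

def dk (f : PhaseFun) : PhaseFun := fun k x a b => deriv (fun z => f z x a b) k
def dx (f : PhaseFun) : PhaseFun := fun k x a b => deriv (fun z => f k z a b) x
def dθ₁ (f : PhaseFun) : PhaseFun := fun k x a b => deriv (fun z => f k x z b) a
def dθ₂ (f : PhaseFun) : PhaseFun := fun k x a b => deriv (fun z => f k x a z) b

/-- The bracket `{f, g} = {f, g}_{kx} + {f, g}_θ`. -/
def bracket (f g : PhaseFun) : PhaseFun := fun k x a b =>
  (dk f k x a b * dx g k x a b - dx f k x a b * dk g k x a b)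
    + (dθ₁ f k x a b * dθ₂ g k x a b - dθ₂ f k x a b * dθ₁ g k x a b)

/-- The part of strictly negative powers of `k`. -/
def negPart (f : PhaseFun) : PhaseFun := fun k x a b =>
  ∑' n : ℕ, laurentCoeff (fun z => f z x a b) (-(n + 1 : ℤ)) * k ^ (-(n + 1 : ℤ))

/-! ### The fields of the toroidal model -/

/-- The coefficient fields, as functions of `(x, θ₁, θ₂)`, and the function `F` of `x`, at
given values of the times. The numbering starts at `0`: `g n`, `h n`, `u n`, `v n` are the
coefficients of `k ^ (-n-1)`, `lambda ^ (-n-2)`, `lambda ^ (-n-1)`, `lambda ^ (-n-1)`. -/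
structure State where
  g : ℕ → ℝ → ℝ → ℝ → ℂ
  h : ℕ → ℝ → ℝ → ℝ → ℂ
  u : ℕ → ℝ → ℝ → ℝ → ℂ
  v : ℕ → ℝ → ℝ → ℝ → ℂ
  F : ℝ → ℂ

/-- The state `s + ε Y`. -/
def State.shift (s Y : State) (ε : ℝ) : State where
  g n x a b := s.g n x a b + ε * Y.g n x a b
  h n x a b := s.h n x a b + ε * Y.h n x a b
  u n x a b := s.u n x a b + ε * Y.u n x a b
  v n x a b := s.v n x a b + ε * Y.v n x a b
  F x := s.F x + ε * Y.F x

/-- The times `t n α` for which the explicit sums over the times in the series converge for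
all values of the spectral parameter. -/
def EntireTimes (t : ℕ → ℤ → ℂ) : Prop :=
  ∀ r c : ℝ, 0 < r → 0 < c →
    Summable (fun p : ℕ × ℤ => ‖t p.1 p.2‖ * r ^ p.1 * Real.exp (c * |(p.2 : ℝ)|))

/-- `∑ n t_{nα} lambda ^ (n-1) exp (iαw)`. -/
def timeM (t : ℕ → ℤ → ℂ) (l w : ℂ) : ℂ :=
  ∑' p : ℕ × ℤ, (p.1 : ℂ) * t p.1 p.2 * l ^ ((p.1 : ℤ) - 1) * Complex.exp (Complex.I * p.2 * w)

/-- `∑ i α t_{nα} lambda ^ n exp (iαw)`. -/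
def timeV (t : ℕ → ℤ → ℂ) (l w : ℂ) : ℂ :=
  ∑' p : ℕ × ℤ, Complex.I * p.2 * t p.1 p.2 * l ^ p.1 * Complex.exp (Complex.I * p.2 * w)

/-- The series `𝓤(lambda)`. -/
def serU (s : State) : PhaseFun := fun l x a b =>
  a + ∑' n : ℕ, s.u n x a b * l ^ (-(n + 1 : ℤ))

/-- The series `𝓜(lambda)`. -/
def serM (t : ℕ → ℤ → ℂ) (s : State) : PhaseFun := fun l x a b =>
  timeM t l (serU s l x a b) + x + ∑' n : ℕ, s.h n x a b * l ^ (-(n + 2 : ℤ))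

/-- The series `𝓥(lambda)`. -/
def serV (t : ℕ → ℤ → ℂ) (s : State) : PhaseFun := fun l x a b =>
  timeV t l (serU s l x a b) + b + ∑' n : ℕ, s.v n x a b * l ^ (-(n + 1 : ℤ))

/-- The Lax function `𝓛`. -/
def laxL (s : State) : PhaseFun := fun k x a b =>
  k + ∑' n : ℕ, s.g n x a b * k ^ (-(n + 1 : ℤ))

/-- `𝓜 = 𝓜(lambda)` at `lambda = 𝓛`. -/
def laxM (t : ℕ → ℤ → ℂ) (s : State) : PhaseFun := fun k x a b =>
  serM t s (laxL s k x a b) x a b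

/-- `𝓤 = 𝓤(lambda)` at `lambda = 𝓛`. -/
def laxU (s : State) : PhaseFun := fun k x a b => serU s (laxL s k x a b) x a b

/-- `𝓥 = 𝓥(lambda)` at `lambda = 𝓛`. -/
def laxV (t : ℕ → ℤ → ℂ) (s : State) : PhaseFun := fun k x a b =>
  serV t s (laxL s k x a b) x a b

/-- A family of smooth doubly periodic functions of `θ`, for `x` in `Ω`, whose generating
series `∑ z n * k ^ (-n-1)` converges near `k = ∞`, together with all its derivatives, locally
uniformly in `x`. -/
def RegularFamily (Ω : Set ℝ) (z : ℕ → ℝ → ℝ → ℝ → ℂ) : Prop :=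
  (∀ n, ContDiffOn ℝ ∞ (fun q : ℝ × ℝ × ℝ => z n q.1 q.2.1 q.2.2) (Ω ×ˢ univ)) ∧
  (∀ n, ∀ x ∈ Ω, ∀ a b, z n x (a + 2 * π) b = z n x a b ∧ z n x a (b + 2 * π) = z n x a b) ∧
  ∀ x₀ ∈ Ω, ∃ ρ : ℝ, ∃ W ∈ 𝓝 x₀, ∀ j : ℕ, ∃ C : ℝ, ∀ n, ∀ x ∈ W, ∀ a b : ℝ,
    ‖iteratedFDeriv ℝ j (fun q : ℝ × ℝ × ℝ => z n q.1 q.2.1 q.2.2) (x, a, b)‖ ≤ C * ρ ^ n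

/-- The four families of coefficient fields are regular for `x` in `Ω`. -/
def Regular (Ω : Set ℝ) (s : State) : Prop :=
  RegularFamily Ω s.g ∧ RegularFamily Ω s.h ∧ RegularFamily Ω s.u ∧ RegularFamily Ω s.v

/-- The six canonical relations, for `x` in `Ω` and `k` near infinity. -/
def Canonical (t : ℕ → ℤ → ℂ) (Ω : Set ℝ) (s : State) : Prop :=
  ∀ x ∈ Ω, ∀ a b : ℝ, ∀ᶠ k in Bornology.cobounded ℂ,
    bracket (laxL s) (laxM t s) k x a b = 1 ∧ bracket (laxU s) (laxV t s) k x a b = 1 ∧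
    bracket (laxL s) (laxU s) k x a b = 0 ∧ bracket (laxL s) (laxV t s) k x a b = 0 ∧
    bracket (laxM t s) (laxU s) k x a b = 0 ∧ bracket (laxM t s) (laxV t s) k x a b = 0

/-! ### The symmetries -/

/-- `A(𝓛, 𝓜, 𝓤, 𝓥)`. -/
def subst (t : ℕ → ℤ → ℂ) (A : Symbol) (s : State) : PhaseFun := fun k x a b =>
  A (laxL s k x a b) (laxM t s k x a b) (laxU s k x a b) (laxV t s k x a b)

/-- The required variation `{A(𝓛,𝓜,𝓤,𝓥)_{≤ -1}, Z}` of a function `Z` of `(k, x, θ)`. -/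
def variation (t : ℕ → ℤ → ℂ) (A : Symbol) (s : State) (Z : PhaseFun) : PhaseFun :=
  bracket (negPart (subst t A s)) Z

/-- For `Z = Z(lambda)` at `lambda = 𝓛`, the variation of `Z(lambda)` at fixed `lambda`,
evaluated at `lambda = 𝓛`: by the chain rule, the variation of `Z` minus
`(∂ Z(lambda) / ∂ lambda)` times the variation of `𝓛`. -/
def serVariation (t : ℕ → ℤ → ℂ) (A : Symbol) (s : State) (Zser Z : PhaseFun) : PhaseFun :=
  fun k x a b => variation t A s Z k x a b
    - dk Zser (laxL s k x a b) x a b * variation t A s (laxL s) k x a b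

/-- The coefficient of `𝓛 ^ (-m)` in the expansion of `f` in powers of `𝓛`, which is the
residue in `k` of `𝓛 ^ (m-1) * f * ∂𝓛/∂k`. -/
def coeffInL (s : State) (f : PhaseFun) (m : ℕ) (x a b : ℝ) : ℂ :=
  res (fun k => laxL s k x a b ^ ((m : ℤ) - 1) * f k x a b * dk (laxL s) k x a b)

/-- The integral of `A(l, μ, u, v)` over `μ` from `0` to `m`, along the segment. -/
def primitive (A : Symbol) (l m u v : ℂ) : ℂ :=
  m * ∫ r in (0 : ℝ)..1, A l (r * m) u v

/-- The symmetry attached to the symbol `A`, as a vector field on states. The components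
`g, h, u, v` are read off from the required variations
`δ 𝓛 = {A_{≤ -1}, 𝓛}`, `δ 𝓜 = {A_{≤ -1}, 𝓜}`, `δ 𝓤 = {A_{≤ -1}, 𝓤}`, `δ 𝓥 = {A_{≤ -1}, 𝓥}`,
with `x, θ` and the times kept fixed; the subtracted terms are the variations of the explicit
sums over the times, which depend on the fields through `𝓤(lambda)`. -/
def symmetry (t : ℕ → ℤ → ℂ) (A : Symbol) (s : State) : State where
  g n x a b := laurentCoeff (fun k => variation t A s (laxL s) k x a b) (-(n + 1 : ℤ))
  h n x a b := coeffInL s (fun k x a b => serVariation t A s (serM t s) (laxM t s) k x a b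
    - deriv (fun w => timeM t (laxL s k x a b) w) (laxU s k x a b)
      * serVariation t A s (serU s) (laxU s) k x a b) (n + 2) x a b
  u n x a b := coeffInL s (serVariation t A s (serU s) (laxU s)) (n + 1) x a b
  v n x a b := coeffInL s (fun k x a b => serVariation t A s (serV t s) (laxV t s) k x a b
    - deriv (fun w => timeV t (laxL s k x a b) w) (laxU s k x a b)
      * serVariation t A s (serU s) (laxU s) k x a b) (n + 1) x a b
  F x := - torusMean (fun a b => res (fun l =>
    primitive A l (serM t s l x a b) (serU s l x a b) (serV t s l x a b)))

/-! ### Functions of the state, and derivations -/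

/-- The derivative of a function of the state along a vector field. -/
def along (X : State → State) (Φ : State → ℂ) (s : State) : ℂ :=
  deriv (fun ε : ℝ => Φ (s.shift (X s) ε)) 0

/-- The derivation `δ_A`. -/
def delta (t : ℕ → ℤ → ℂ) (A : Symbol) : (State → ℂ) → State → ℂ := along (symmetry t A)

/-- The derivation `∂_F`. -/
def partialF : (State → ℂ) → State → ℂ := along (fun _ =>
  { g := fun _ _ _ _ => 0, h := fun _ _ _ _ => 0, u := fun _ _ _ _ => 0,
    v := fun _ _ _ _ => 0, F := fun _ => 1 })

/-- The partial derivative of order `(i, j, l)` in `(x, θ₁, θ₂)`. -/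
def jet (i j l : ℕ) (z : ℝ → ℝ → ℝ → ℂ) (x a b : ℝ) : ℂ :=
  iteratedDeriv i (fun x' => iteratedDeriv j (fun a' => iteratedDeriv l (fun b' =>
    z x' a' b') b) a) x

/-- The functions of the state given by the partial derivatives of the coefficient fields and
by `F`, at all points with `x` in `Ω`. -/
def generators (Ω : Set ℝ) : Set (State → ℂ) :=
  {Φ | ∃ x ∈ Ω, ∃ a b : ℝ, ∃ n i j l : ℕ,
    Φ = (fun s => jet i j l (s.g n) x a b) ∨ Φ = (fun s => jet i j l (s.h n) x a b) ∨
    Φ = (fun s => jet i j l (s.u n) x a b) ∨ Φ = (fun s => jet i j l (s.v n) x a b)} ∪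
  {Φ | ∃ x ∈ Ω, Φ = fun s => s.F x}

/-- The ring generated by the fields, their derivatives, and `F`; the variables
`t, x, θ` enter as scalars. -/
def ringRF (Ω : Set ℝ) : Subalgebra ℂ (State → ℂ) := Algebra.adjoin ℂ (generators Ω)

end

end Toroidal

open Toroidal

namespace Toroidal

set_option linter.unusedSectionVars false

noncomputable section

/-! ### Integrals over an interval depending on parameters -/

section ParametricIntegral

/-! Write `f_A` for the symbol `A` evaluated at the four Lax functions `L, M, U, V` and `N_A` for
its negative part in `k`. The symmetry is bracketing with `N_A`, applied to `L, M, U, V` and hence,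
by the chain rule, to every `f_B`. Tangency to the canonical relations is therefore the Jacobi
identity (`hasDerivAt_bracket`).

On shell `(L, M, U, V)` are canonical coordinates, so that `A ↦ f_A` is a Poisson map (`br_fA_fA`).
Splitting `f_A` and `f_B` into entire and negative parts and taking the negative part of `{f_A,
f_B}` yields the zero-curvature identity `N_{A,B} = δ_A N_B - δ_B N_A - {N_A, N_B}` (`negU_br`,
`fN_poisson`). Together with Jacobi it gives the commutator on `L`. For the coefficient fields of
`M, U, V` the chain rule at `λ = L` separates the variation at fixed `λ` from the variation of `L`;
the second-order terms of the chain rule are symmetric in `A` and `B` and cancel (`commutator_vel`).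

The anomaly arises only on `F`. After the substitution `λ = L(k)` the variation along `A` of `δ_B F`
becomes minus the averaged residue of `(∂_k N_A) f_B`, up to a Jacobian in `(k, θ₁, θ₂)`, which is a
total divergence (`mres_dε`). Antisymmetrizing gives the averaged residue of `A ∂_λ B` along the
series (`res_mul_pd_fst`). On the other hand the primitive in `μ` of `{A, B}` equals `(A B_λ)` at `μ
= 0` minus `A B_λ`, up to partial derivatives of other primitives (`primitive_poisson`). On shell
these partial derivatives complete to divergences, and the only survivor is the boundary term `(A
B_λ)(λ, 0, U, V)` multiplied by `{U, V}_θ = 1` (`mres_primitive_poisson`). Its average is the one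
over real `(u, v)`: the map `θ ↦ (U, V)` is joined to the identity by a straight homotopy through
maps with the same quasi-periods, along which the integral is constant (`mres_degree`). The values
may be complex because symbols are entire in `u` and `v`, and invertibility of the map plays no
role.

The cocycle identities are integrations by parts of the same kind at `μ = 0`. On the ring all
assertions are equalities of derivations, hence are checked on generators (`DerAt.eq_on_ringRF`).

Variations are derivatives at `ε = 0` along straight segments `s + ε X(s)`. Such a segment need not
stay on shell, so the vector fields are studied at every state with well-behaved generating series,
and the canonical relations are used at `ε = 0` only. The analysis rests on `HolSmooth`: joint
smoothness and holomorphy in `k` near infinity, uniform in the parameters `(ε, x, θ₁, θ₂)`. Cauchy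
integrals over fixed circles show that this class is stable under derivatives, negative parts and
changes of the spectral variable. -/

theorem hasFDerivAt_intervalIntegral_of_continuousAt {𝕜 : Type*} [RCLike 𝕜] {X G : Type*}
    [NormedAddCommGroup X] [NormedSpace 𝕜 X] [NormedAddCommGroup G] [NormedSpace ℝ G]
    [NormedSpace 𝕜 G] {F : X → ℝ → G} {F' : X → ℝ → X →L[𝕜] G} {x₀ : X} {α β : ℝ}
    (hab : α ≤ β)
    (hF : ∀ t ∈ Icc α β, ContinuousAt (fun p : X × ℝ => F p.1 p.2) (x₀, t))
    (hF' : ∀ t ∈ Icc α β, ContinuousAt (fun p : X × ℝ => F' p.1 p.2) (x₀, t))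
    (hd : ∀ t ∈ Icc α β, ∀ᶠ p : X × ℝ in 𝓝 (x₀, t),
      ContinuousAt (fun t' => F p.1 t') p.2 ∧
        HasFDerivAt (fun x => F x p.2) (F' p.1 p.2) p.1) :
    HasFDerivAt (fun x => ∫ t in α..β, F x t) (∫ t in α..β, F' x₀ t) x₀ := by
  have h1 := isCompact_Icc.eventually_forall_of_forall_eventually (x₀ := x₀)
    (K := Icc α β) (P := fun x t => ContinuousAt (fun t' => F x t') t ∧
        HasFDerivAt (fun x => F x t) (F' x t) x) hd
  have hc' : ContinuousOn (fun t => F' x₀ t) (Icc α β) := fun t ht =>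
    ((hF' t ht).comp (f := fun t' : ℝ => (x₀, t')) (by fun_prop)).continuousWithinAt
  have hc : ContinuousOn (fun t => F x₀ t) (Icc α β) := fun t ht =>
    ((hF t ht).comp (f := fun t' : ℝ => (x₀, t')) (by fun_prop)).continuousWithinAt
  -- Continuity along the compact segment bounds `F'` by `C` there, hence by `C + 1` for all
  -- parameters near `x₀`; this constant is the dominating function.
  obtain ⟨C, hC⟩ := isCompact_Icc.exists_bound_of_continuousOn hc'
  have h2 := isCompact_Icc.eventually_forall_of_forall_eventually (x₀ := x₀)
    (K := Icc α β) (P := fun x t => ‖F' x t‖ ≤ C + 1) (by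
      intro t ht
      have := (hF' t ht).norm.eventually (gt_mem_nhds (lt_of_le_of_lt (hC t ht) (lt_add_one C)))
      filter_upwards [this] with p hp using hp.le)
  have hu : Set.uIoc α β ⊆ Icc α β := by rw [uIoc_of_le hab]; exact Ioc_subset_Icc_self
  refine intervalIntegral.hasFDerivAt_integral_of_dominated_of_fderiv_le
    (bound := fun _ => C + 1) (h1.and h2) ?_ ?_ ?_ ?_ ?_ ?_
  · filter_upwards [h1] with x hx
    refine ContinuousOn.aestronglyMeasurable (fun t ht => ?_) measurableSet_uIoc
    exact (hx t (hu ht)).1.continuousWithinAt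
  · exact (hc.mono (by rw [uIcc_of_le hab])).intervalIntegrable
  · exact (hc'.mono hu).aestronglyMeasurable measurableSet_uIoc
  · exact Eventually.of_forall fun t ht x hx => hx.2 t (hu ht)
  · exact intervalIntegrable_const
  · exact Eventually.of_forall fun t ht x hx => (hx.1 t (hu ht)).2

theorem hasFDerivAt_intervalIntegral {X G : Type*}
    [NormedAddCommGroup X] [NormedSpace ℝ X] [NormedAddCommGroup G] [NormedSpace ℝ G]
    {F : X × ℝ → G} {x₀ : X} {α β : ℝ} (hab : α ≤ β)
    (hF : ∀ t ∈ Icc α β, ContDiffAt ℝ 1 F (x₀, t)) :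
    HasFDerivAt (fun x => ∫ t in α..β, F (x, t))
      (∫ t in α..β, (fderiv ℝ F (x₀, t)).comp (ContinuousLinearMap.inl ℝ X ℝ)) x₀ := by
  refine hasFDerivAt_intervalIntegral_of_continuousAt hab (F := fun x t => F (x, t))
    (F' := fun x t => (fderiv ℝ F (x, t)).comp (ContinuousLinearMap.inl ℝ X ℝ)) ?_ ?_ ?_
  · exact fun t ht => (hF t ht).continuousAt
  · intro t ht
    have := ((hF t ht).fderiv_right (m := 0) (by simp)).continuousAt
    exact this.clm_comp continuousAt_const
  · intro t ht
    filter_upwards [(hF t ht).eventually (by simp)] with p hp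
    have h := (hp.differentiableAt (by simp)).hasFDerivAt
    refine ⟨hp.continuousAt.comp (f := fun t' : ℝ => (p.1, t')) (by fun_prop), ?_⟩
    exact h.comp p.1 (hasFDerivAt_prodMk_left p.1 p.2)

theorem continuousAt_intervalIntegral {X G : Type*} [TopologicalSpace X]
    [FirstCountableTopology X] [NormedAddCommGroup G] [NormedSpace ℝ G]
    {F : X × ℝ → G} {x₀ : X} {α β : ℝ} (hab : α ≤ β)
    (hF : ∀ t ∈ Icc α β, ∀ᶠ p in 𝓝 (x₀, t), ContinuousAt F p) :
    ContinuousAt (fun x => ∫ t in α..β, F (x, t)) x₀ := by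
  have h1 := isCompact_Icc.eventually_forall_of_forall_eventually (x₀ := x₀)
    (K := Icc α β) (P := fun x t => ContinuousAt F (x, t)) hF
  have hcont : ∀ x, (∀ t ∈ Icc α β, ContinuousAt F (x, t)) →
      ContinuousOn (fun t => F (x, t)) (Icc α β) := fun x hx t ht =>
    ((hx t ht).comp (f := fun t' : ℝ => (x, t')) (by fun_prop)).continuousWithinAt
  obtain ⟨C, hC⟩ := isCompact_Icc.exists_bound_of_continuousOn (hcont _ h1.self_of_nhds)
  have h2 := isCompact_Icc.eventually_forall_of_forall_eventually (x₀ := x₀)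
    (K := Icc α β) (P := fun x t => ‖F (x, t)‖ ≤ C + 1) (by
      intro t ht
      filter_upwards [(h1.self_of_nhds t ht).norm.eventually
        (gt_mem_nhds (lt_of_le_of_lt (hC t ht) (lt_add_one C)))] with p hp using hp.le)
  have hu : Set.uIoc α β ⊆ Icc α β := by rw [uIoc_of_le hab]; exact Ioc_subset_Icc_self
  refine intervalIntegral.continuousAt_of_dominated_interval (bound := fun _ => C + 1) ?_ ?_
    intervalIntegrable_const ?_
  · filter_upwards [h1] with x hx
    exact ((hcont x hx).mono hu).aestronglyMeasurable measurableSet_uIoc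
  · filter_upwards [h2] with x hx
    exact Eventually.of_forall fun t ht => hx t (hu ht)
  · exact Eventually.of_forall fun t ht => (h1.self_of_nhds t (hu ht)).comp
      (f := fun x' : X => (x', t)) (by fun_prop)

/-- One order of smoothness is given away, since the base case deduces continuity from
differentiability; for smooth integrands this costs nothing. The target space is quantified inside
the induction because each step replaces it by a space of linear maps. -/
theorem contDiffAt_intervalIntegral_nat {X : Type} [NormedAddCommGroup X] [NormedSpace ℝ X]
    {α β : ℝ} (hab : α ≤ β) (n : ℕ) :
    ∀ {G : Type} [NormedAddCommGroup G] [NormedSpace ℝ G] {F : X × ℝ → G} {x₀ : X},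
    (∀ t ∈ Icc α β, ContDiffAt ℝ (n + 1 : ℕ) F (x₀, t)) →
    ContDiffAt ℝ n (fun x => ∫ t in α..β, F (x, t)) x₀ := by
  induction n with
  | zero =>
    intro G _ _ F x₀ hF
    have key : ∀ᶠ x in 𝓝 x₀, ∀ t ∈ Icc α β, ContDiffAt ℝ 1 F (x, t) :=
      isCompact_Icc.eventually_forall_of_forall_eventually
        (fun t ht => (hF t ht).eventually (by simp))
    rw [Nat.cast_zero, contDiffAt_zero]
    exact ⟨_, key, fun x hx =>
      (hasFDerivAt_intervalIntegral hab hx).continuousAt.continuousWithinAt⟩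
  | succ n ih =>
    intro G _ _ F x₀ hF
    have key : ∀ᶠ x in 𝓝 x₀, ∀ t ∈ Icc α β, ContDiffAt ℝ 1 F (x, t) :=
      isCompact_Icc.eventually_forall_of_forall_eventually
        (fun t ht => ((hF t ht).of_le (by norm_cast; omega)).eventually (by simp))
    rw [Nat.cast_succ, contDiffAt_succ_iff_hasFDerivAt]
    refine ⟨fun x => ∫ t in α..β, (fderiv ℝ F (x, t)).comp (ContinuousLinearMap.inl ℝ X ℝ),
      ⟨_, key, fun x hx => hasFDerivAt_intervalIntegral hab hx⟩, ?_⟩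
    refine ih (F := fun p : X × ℝ => (fderiv ℝ F p).comp (ContinuousLinearMap.inl ℝ X ℝ)) ?_
    intro t ht
    exact ((hF t ht).fderiv_right (m := (n + 1 : ℕ)) (by norm_cast)).clm_comp contDiffAt_const

theorem contDiffAt_intervalIntegral {X G : Type} [NormedAddCommGroup X] [NormedSpace ℝ X]
    [NormedAddCommGroup G] [NormedSpace ℝ G] {α β : ℝ} (hab : α ≤ β) {F : X × ℝ → G} {x₀ : X}
    (hF : ∀ t ∈ Icc α β, ContDiffAt ℝ ∞ F (x₀, t)) :
    ContDiffAt ℝ ∞ (fun x => ∫ t in α..β, F (x, t)) x₀ := by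
  rw [contDiffAt_infty]
  exact fun n => contDiffAt_intervalIntegral_nat hab n
    fun t ht => (hF t ht).of_le (by exact_mod_cast le_top)

theorem fderiv_intervalIntegral_apply {X G : Type*}
    [NormedAddCommGroup X] [NormedSpace ℝ X] [NormedAddCommGroup G] [NormedSpace ℝ G]
    [CompleteSpace G]
    {F : X × ℝ → G} {x₀ : X} {α β : ℝ} (hab : α ≤ β)
    (hF : ∀ t ∈ Icc α β, ContDiffAt ℝ 1 F (x₀, t)) (v : X) :
    fderiv ℝ (fun x => ∫ t in α..β, F (x, t)) x₀ v
      = ∫ t in α..β, fderiv ℝ (fun x => F (x, t)) x₀ v := by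
  rw [(hasFDerivAt_intervalIntegral hab hF).fderiv, ContinuousLinearMap.intervalIntegral_apply]
  · refine intervalIntegral.integral_congr fun t ht => ?_
    rw [uIcc_of_le hab] at ht
    have h := ((hF t ht).differentiableAt (by simp)).hasFDerivAt
    have := HasFDerivAt.comp x₀ h (hasFDerivAt_prodMk_left (𝕜 := ℝ) x₀ t)
    exact (congrArg (fun T => T v) this.fderiv).symm
  · refine ContinuousOn.intervalIntegrable fun t ht => ?_
    rw [uIcc_of_le hab] at ht
    have h := ((hF t ht).fderiv_right (m := 0) (by simp)).continuousAt
    exact ((h.comp (f := fun t' : ℝ => (x₀, t')) (by fun_prop)).clm_comp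
      continuousAt_const).continuousWithinAt

end ParametricIntegral

/-! ### Holomorphic functions of several variables -/

section SeveralVariables

variable {X : Type*} [NormedAddCommGroup X] [NormedSpace ℂ X] {U : Set X} {f : X → ℂ}

/-- Cauchy's formula on the complex line through `p` in the direction `v`. A derivative written as
an integral of `f` inherits the regularity of `f`, which is the route to smoothness of holomorphic
functions of several variables. -/
theorem fderiv_apply_eq_circleIntegral (hf : DifferentiableOn ℂ f U) {p v : X} {R : ℝ}
    (hR : 0 < R) (h : ∀ z : ℂ, ‖z‖ ≤ R → p + z • v ∈ U) (hU : IsOpen U) :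
    fderiv ℂ f p v = (2 * π * Complex.I)⁻¹ * ∮ z in C(0, R), z ^ (-2 : ℤ) * f (p + z • v) := by
  have hg : ∀ z : ℂ, ‖z‖ ≤ R → HasDerivAt (fun z : ℂ => f (p + z • v))
      (fderiv ℂ f (p + z • v) v) z := by
    intro z hz
    have h1 := ((hf _ (h z hz)).differentiableAt (hU.mem_nhds (h z hz))).hasFDerivAt
    have h2 : HasDerivAt (fun z : ℂ => p + z • v) v z := by
      simpa using ((hasDerivAt_id z).smul_const v).const_add p
    exact h1.comp_hasDerivAt z h2
  have hd : DiffContOnCl ℂ (fun z : ℂ => f (p + z • v)) (Metric.ball 0 R) := by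
    refine DifferentiableOn.diffContOnCl fun z hz => ?_
    have : ‖z‖ ≤ R := by
      simpa using Metric.closure_ball_subset_closedBall hz
    exact (hg z this).differentiableAt.differentiableWithinAt
  have h3 := hd.deriv_eq_smul_circleIntegral (c := 0) (R := R) hR
  have h0 := (hg 0 (by simpa using hR.le)).deriv
  simp only [zero_smul, add_zero] at h0
  have h4 : (2 * π * Complex.I : ℂ) ≠ 0 := by simp [Real.pi_ne_zero]
  rw [← h0, eq_inv_mul_iff_mul_eq₀ h4, ← smul_eq_mul, ← h3]
  simp [zpow_neg]

theorem exists_radius_forall_add_smul_mem (hU : IsOpen U) {p₀ : X} (hp : p₀ ∈ U) (v : X) :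
    ∃ R : ℝ, 0 < R ∧ ∀ᶠ p in 𝓝 p₀, ∀ z : ℂ, ‖z‖ ≤ R → p + z • v ∈ U := by
  obtain ⟨δ, hδ, hb⟩ := Metric.isOpen_iff.1 hU p₀ hp
  have hv : 0 < ‖v‖ + 1 := by positivity
  refine ⟨δ / 2 / (‖v‖ + 1), by positivity, ?_⟩
  filter_upwards [Metric.ball_mem_nhds p₀ (half_pos hδ)] with p hp z hz
  refine hb ?_
  rw [Metric.mem_ball, dist_eq_norm] at *
  have h1 : ‖z • v‖ ≤ δ / 2 := by
    rw [norm_smul]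
    calc ‖z‖ * ‖v‖ ≤ (δ / 2 / (‖v‖ + 1)) * (‖v‖ + 1) := by gcongr; linarith
      _ = δ / 2 := by field_simp
  calc ‖p + z • v - p₀‖ = ‖(p - p₀) + z • v‖ := by congr 1; abel
    _ ≤ ‖p - p₀‖ + ‖z • v‖ := norm_add_le _ _
    _ < δ := by linarith

theorem continuousOn_fderiv_apply (hU : IsOpen U) (hf : DifferentiableOn ℂ f U) (v : X) :
    ContinuousOn (fun p => fderiv ℂ f p v) U := by
  intro p₀ hp₀
  obtain ⟨R, hR, hev⟩ := exists_radius_forall_add_smul_mem hU hp₀ v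
  refine ContinuousAt.continuousWithinAt (ContinuousAt.congr ?_
    (hev.mono fun p hp => (fderiv_apply_eq_circleIntegral hf hR hp hU).symm))
  refine continuousAt_const.mul ?_
  simp only [circleIntegral]
  refine continuousAt_intervalIntegral (F := fun p : X × ℝ => deriv (circleMap 0 R) p.2 •
    ((circleMap 0 R p.2) ^ (-2 : ℤ) * f (p.1 + circleMap 0 R p.2 • v))) (by positivity) ?_
  intro t ht
  filter_upwards [hev.prod_inl_nhds t] with p hp
  have hm := hp (circleMap 0 R p.2) (by simp [abs_of_pos hR])
  have h1 : ContinuousAt f (p.1 + circleMap 0 R p.2 • v) := hf.continuousOn.continuousAt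
    (hU.mem_nhds hm)
  have h2 : ContinuousAt (circleMap 0 R) p.2 := (continuous_circleMap 0 R).continuousAt
  have h3 : ContinuousAt (fun p : X × ℝ => p.1 + circleMap 0 R p.2 • v) p :=
    continuousAt_fst.add ((h2.comp continuousAt_snd).smul continuousAt_const)
  have h6 : ContinuousAt (fun p : X × ℝ => deriv (circleMap 0 R) p.2) p := by
    simp only [deriv_circleMap]
    exact (h2.comp continuousAt_snd).mul continuousAt_const
  have h7 : ContinuousAt (fun p : X × ℝ => (circleMap 0 R p.2) ^ (-2 : ℤ)) p :=
    (h2.comp continuousAt_snd).zpow₀ _ (Or.inl (by simp [hR.ne']))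
  exact h6.smul (h7.mul (ContinuousAt.comp
    (f := fun p : X × ℝ => p.1 + circleMap 0 R p.2 • v) h1 h3))

variable [FiniteDimensional ℂ X]

/-- Differentiation under the Cauchy integral. The domination needs continuity of `fderiv` in
operator norm; in finite dimension this follows from continuity in each direction. -/
theorem differentiableOn_fderiv_apply (hU : IsOpen U) (hf : DifferentiableOn ℂ f U) (v : X) :
    DifferentiableOn ℂ (fun p => fderiv ℂ f p v) U := by
  have hc : ContinuousOn (fderiv ℂ f) U :=
    (continuousOn_clm_apply (𝕜 := ℂ) (E := X) (F := ℂ)).2 fun v =>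
      continuousOn_fderiv_apply hU hf v
  intro p₀ hp₀
  obtain ⟨R, hR, hev⟩ := exists_radius_forall_add_smul_mem hU hp₀ v
  refine DifferentiableAt.differentiableWithinAt (DifferentiableAt.congr_of_eventuallyEq ?_
    (hev.mono fun p hp => (fderiv_apply_eq_circleIntegral hf hR hp hU)))
  refine (differentiableAt_const _).mul ?_
  simp only [circleIntegral]
  have hm : ∀ t : ℝ, ∀ᶠ q : X × ℝ in 𝓝 (p₀, t), q.1 + circleMap 0 R q.2 • v ∈ U := by
    intro t
    filter_upwards [hev.prod_inl_nhds t] with q hq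
    exact hq (circleMap 0 R q.2) (by simp [abs_of_pos hR])
  have h3 : ∀ q : X × ℝ, ContinuousAt (fun p : X × ℝ => p.1 + circleMap 0 R p.2 • v) q :=
    fun q => continuousAt_fst.add (((continuous_circleMap 0 R).continuousAt.comp
      continuousAt_snd).smul continuousAt_const)
  have h4 : ∀ q : X × ℝ, ContinuousAt (fun p : X × ℝ => deriv (circleMap 0 R) p.2 *
      (circleMap 0 R p.2) ^ (-2 : ℤ)) q := by
    intro q
    have h2 : ContinuousAt (circleMap 0 R) q.2 := (continuous_circleMap 0 R).continuousAt
    simp only [deriv_circleMap]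
    exact ((h2.comp continuousAt_snd).mul continuousAt_const).mul
      ((h2.comp continuousAt_snd).zpow₀ _ (Or.inl (by simp [hR.ne'])))
  have h5 : ∀ q : X × ℝ, q.1 + circleMap 0 R q.2 • v ∈ U →
      ContinuousAt (fun p : X × ℝ => deriv (circleMap 0 R) p.2 •
    ((circleMap 0 R p.2) ^ (-2 : ℤ) * f (p.1 + circleMap 0 R p.2 • v))) q := by
    intro q hq
    simp only [smul_eq_mul, ← mul_assoc]
    exact (h4 q).mul (ContinuousAt.comp (f := fun p : X × ℝ => p.1 + circleMap 0 R p.2 • v)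
      (hf.continuousOn.continuousAt (hU.mem_nhds hq)) (h3 q))
  refine (hasFDerivAt_intervalIntegral_of_continuousAt (𝕜 := ℂ)
    (F := fun p t => deriv (circleMap 0 R) t •
    ((circleMap 0 R t) ^ (-2 : ℤ) * f (p + circleMap 0 R t • v)))
    (F' := fun p t => (deriv (circleMap 0 R) t * (circleMap 0 R t) ^ (-2 : ℤ)) •
      fderiv ℂ f (p + circleMap 0 R t • v)) (by positivity) ?_ ?_ ?_).differentiableAt
  · exact fun t _ => h5 (p₀, t) (hm t).self_of_nhds
  · exact fun t _ => (h4 (p₀, t)).smul (ContinuousAt.comp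
      (f := fun p : X × ℝ => p.1 + circleMap 0 R p.2 • v)
      (hc.continuousAt (hU.mem_nhds (hm t).self_of_nhds)) (h3 _))
  · intro t _
    filter_upwards [hm t] with q hq
    refine ⟨(h5 q hq).comp (f := fun t' : ℝ => (q.1, t')) (by fun_prop), ?_⟩
    have h6 := (hf.differentiableAt (hU.mem_nhds hq)).hasFDerivAt
    have h7 : HasFDerivAt (fun x => f (x + circleMap 0 R q.2 • v))
        (fderiv ℂ f (q.1 + circleMap 0 R q.2 • v)) q.1 := by
      rw [hasFDerivAt_comp_add_right]
      exact h6
    exact (h7.const_smul (deriv (circleMap 0 R) q.2 * (circleMap 0 R q.2) ^ (-2 : ℤ))).congr_of_eventuallyEq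
      (Eventually.of_forall fun x => by simp only [smul_eq_mul, Pi.smul_apply, mul_assoc])

theorem contDiffOn_of_differentiableOn (hU : IsOpen U) (hf : DifferentiableOn ℂ f U) :
    ContDiffOn ℂ ∞ f U := by
  rw [contDiffOn_infty]
  intro n
  induction n generalizing f with
  | zero => simpa using hf.continuousOn
  | succ n ih =>
    rw [Nat.cast_succ, contDiffOn_succ_iff_fderiv_of_isOpen hU]
    refine ⟨hf, by simp, ?_⟩
    rw [contDiffOn_clm_apply]
    exact fun v => ih (differentiableOn_fderiv_apply hU hf v)

theorem contDiffAt_real_of_differentiableOn [NormedSpace ℝ X] [IsScalarTower ℝ ℂ X]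
    (hU : IsOpen U) (hf : DifferentiableOn ℂ f U) {p : X}
    (hp : p ∈ U) : ContDiffAt ℝ ∞ f p :=
  ((contDiffOn_of_differentiableOn hU hf).contDiffAt (hU.mem_nhds hp)).restrict_scalars ℝ

end SeveralVariables

/-! ### Functions that are holomorphic in `k` near infinity and smooth in parameters -/

section HolSmooth

variable {E : Type} [NormedAddCommGroup E] [NormedSpace ℝ E]
  {G : Type} [NormedAddCommGroup G] [NormedSpace ℂ G]

/-- Neighbourhoods of `k = ∞`, uniformly for parameters near `q`. -/
abbrev nearInf (q : E) : Filter (ℂ × E) := Bornology.cobounded ℂ ×ˢ 𝓝 q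

/-- `f` is smooth and holomorphic in `k`, for `k` near infinity and parameters near `q`. -/
def HolSmooth (f : ℂ × E → G) (q : E) : Prop :=
  ∀ᶠ p in nearInf q, ContDiffAt ℝ ∞ f p ∧ DifferentiableAt ℂ (fun z => f (z, p.2)) p.1

/-- The directional derivative. -/
def pd {X : Type} [NormedAddCommGroup X] [NormedSpace ℝ X] (v : X) (f : X → G) : X → G :=
  fun p => fderiv ℝ f p v

theorem eventually_nearInf {q : E} {P : ℂ × E → Prop} :
    (∀ᶠ p in nearInf q, P p) ↔
      ∃ ρ : ℝ, 0 < ρ ∧ ∀ᶠ q' in 𝓝 q, ∀ k : ℂ, ρ < ‖k‖ → P (k, q') := by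
  have hb := (Metric.hasBasis_cobounded_compl_closedBall (0 : ℂ)).prod (𝓝 q).basis_sets
  constructor
  · intro h
    obtain ⟨⟨ρ, W⟩, ⟨-, hW⟩, h⟩ := hb.eventually_iff.1 h
    refine ⟨max ρ 1, by positivity, ?_⟩
    filter_upwards [hW] with q' hq' k hk
    refine h ⟨?_, hq'⟩
    simpa using (lt_of_le_of_lt (le_max_left ρ 1) hk)
  · rintro ⟨ρ, -, h⟩
    refine hb.eventually_iff.2 ⟨(ρ, {q' | ∀ k : ℂ, ρ < ‖k‖ → P (k, q')}), ⟨trivial, h⟩, ?_⟩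
    rintro ⟨k, q'⟩ ⟨hk, hq'⟩
    exact hq' k (by simpa using hk)

theorem Eventually.nearInf_nhds {q : E} {P : ℂ × E → Prop} (h : ∀ᶠ p in nearInf q, P p) :
    ∀ᶠ p in nearInf q, ∀ᶠ p' in 𝓝 p, P p' := by
  obtain ⟨ρ, h0, h⟩ := eventually_nearInf.1 h
  refine eventually_nearInf.2 ⟨ρ, h0, ?_⟩
  filter_upwards [eventually_eventually_nhds.2 h] with q' hq' k hk
  rw [nhds_prod_eq]
  have h1 : ∀ᶠ k' in 𝓝 k, ρ < ‖k'‖ := continuous_norm.continuousAt.eventually (lt_mem_nhds hk)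
  filter_upwards [h1.prod_mk hq'] with p hp using hp.2 p.1 hp.1

theorem Eventually.nearInf_param {q : E} {P : ℂ × E → Prop} (h : ∀ᶠ p in nearInf q, P p) :
    ∀ᶠ q' in 𝓝 q, ∀ᶠ p in nearInf q', P p := by
  obtain ⟨ρ, h0, h⟩ := eventually_nearInf.1 h
  filter_upwards [eventually_eventually_nhds.2 h] with q' hq'
  exact eventually_nearInf.2 ⟨ρ, h0, hq'⟩

theorem Eventually.nearInf_self {q : E} {P : ℂ × E → Prop} (h : ∀ᶠ p in nearInf q, P p) :
    ∀ᶠ k in Bornology.cobounded ℂ, P (k, q) :=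
  (tendsto_id.prodMk (tendsto_const_nhds (x := q))).eventually h

theorem eventually_cobounded_iff {P : ℂ → Prop} :
    (∀ᶠ k in Bornology.cobounded ℂ, P k) ↔ ∃ ρ : ℝ, 0 < ρ ∧ ∀ k : ℂ, ρ < ‖k‖ → P k := by
  constructor
  · intro h
    obtain ⟨ρ, -, h⟩ := (Metric.hasBasis_cobounded_compl_closedBall (0 : ℂ)).eventually_iff.1 h
    exact ⟨max ρ 1, by positivity, fun k hk =>
      h (by simpa using (lt_of_le_of_lt (le_max_left ρ 1) hk))⟩
  · rintro ⟨ρ, -, h⟩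
    exact (Metric.hasBasis_cobounded_compl_closedBall (0 : ℂ)).eventually_iff.2
      ⟨ρ, trivial, fun k hk => h k (by simpa using hk)⟩

theorem tendsto_param_nearInf {E' : Type} [NormedAddCommGroup E'] {q : E} {κ : ℂ × E → ℂ}
    {φ : E → E'} (hκ : Tendsto κ (nearInf q) (Bornology.cobounded ℂ)) (hφ : ContinuousAt φ q) :
    Tendsto (fun p => (κ p, φ p.2)) (nearInf q) (nearInf (φ q)) :=
  hκ.prodMk (hφ.tendsto.comp tendsto_snd)

namespace HolSmooth

variable {q : E} {f g : ℂ × E → ℂ}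

theorem param {f : ℂ × E → G} (h : HolSmooth f q) : ∀ᶠ q' in 𝓝 q, HolSmooth f q' :=
  Eventually.nearInf_param h

theorem congr {f g : ℂ × E → G} (hf : HolSmooth f q) (h : g =ᶠ[nearInf q] f) :
    HolSmooth g q := by
  filter_upwards [hf, Eventually.nearInf_nhds h] with p hp hp'
  refine ⟨hp.1.congr_of_eventuallyEq hp', hp.2.congr_of_eventuallyEq ?_⟩
  have : Tendsto (fun z : ℂ => (z, p.2)) (𝓝 p.1) (𝓝 p) :=
    (Continuous.prodMk_left p.2).tendsto p.1
  exact this.eventually hp'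

theorem const (c : G) : HolSmooth (fun _ : ℂ × E => c) q :=
  Eventually.of_forall fun _ => ⟨contDiffAt_const, differentiableAt_const _⟩

theorem fst : HolSmooth (fun p : ℂ × E => p.1) q :=
  Eventually.of_forall fun _ => ⟨contDiffAt_fst, differentiableAt_id⟩

theorem of_param {g : E → ℂ} (hg : ∀ᶠ q' in 𝓝 q, ContDiffAt ℝ ∞ g q') :
    HolSmooth (fun p : ℂ × E => g p.2) q := by
  have := (tendsto_snd (f := Bornology.cobounded ℂ) (g := 𝓝 q)).eventually hg
  filter_upwards [this] with p hp
  exact ⟨hp.comp p contDiffAt_snd, differentiableAt_const _⟩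

theorem add (hf : HolSmooth f q) (hg : HolSmooth g q) : HolSmooth (fun p => f p + g p) q := by
  filter_upwards [hf, hg] with p h1 h2
  exact ⟨h1.1.add h2.1, h1.2.add h2.2⟩

theorem sub (hf : HolSmooth f q) (hg : HolSmooth g q) : HolSmooth (fun p => f p - g p) q := by
  filter_upwards [hf, hg] with p h1 h2
  exact ⟨h1.1.sub h2.1, h1.2.sub h2.2⟩

theorem mul (hf : HolSmooth f q) (hg : HolSmooth g q) : HolSmooth (fun p => f p * g p) q := by
  filter_upwards [hf, hg] with p h1 h2
  exact ⟨h1.1.mul h2.1, h1.2.mul h2.2⟩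

theorem prodMk {G' : Type} [NormedAddCommGroup G'] [NormedSpace ℂ G'] {f : ℂ × E → G}
    {g : ℂ × E → G'} (hf : HolSmooth f q) (hg : HolSmooth g q) :
    HolSmooth (fun p => (f p, g p)) q := by
  filter_upwards [hf, hg] with p h1 h2
  exact ⟨h1.1.prodMk h2.1, h1.2.prodMk h2.2⟩

theorem eventually_ne_zero (q : E) : ∀ᶠ p in nearInf q, p.1 ≠ 0 :=
  eventually_nearInf.2 ⟨1, one_pos, Eventually.of_forall fun q' k hk h => by
    rw [show k = 0 from h, norm_zero] at hk; linarith⟩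

/-- Composition with a holomorphic function of several variables. -/
theorem holomorphic_comp {Y : Type} [NormedAddCommGroup Y] [NormedSpace ℂ Y]
    [FiniteDimensional ℂ Y] {U : Set Y} (hU : IsOpen U) {F : Y → ℂ} (hF : DifferentiableOn ℂ F U)
    {c : ℂ × E → Y} (hc : HolSmooth c q) (hm : ∀ᶠ p in nearInf q, c p ∈ U) :
    HolSmooth (fun p => F (c p)) q := by
  filter_upwards [hc, hm] with p h1 h2
  refine ⟨(contDiffAt_real_of_differentiableOn hU hF h2).comp p h1.1, ?_⟩
  exact DifferentiableAt.comp (f := fun z => c (z, p.2)) p.1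
    (hF.differentiableAt (hU.mem_nhds h2)) h1.2

theorem zpow (n : ℤ) (hf : HolSmooth f q) (h0 : ∀ᶠ p in nearInf q, f p ≠ 0) :
    HolSmooth (fun p => f p ^ n) q :=
  holomorphic_comp (F := fun z : ℂ => z ^ n) (isOpen_compl_singleton (x := (0 : ℂ)))
    (fun _ hz => (differentiableAt_zpow.2 (Or.inl hz)).differentiableWithinAt) hf h0

theorem fst_zpow (n : ℤ) : HolSmooth (fun p : ℂ × E => p.1 ^ n) q :=
  zpow n fst (eventually_ne_zero q)

theorem inv (hf : HolSmooth f q) (h0 : ∀ᶠ p in nearInf q, f p ≠ 0) :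
    HolSmooth (fun p => (f p)⁻¹) q := by
  simpa using zpow (-1) hf h0

/-- Composition with a change of the variable `k` and of the parameters. -/
theorem comp {E' : Type} [NormedAddCommGroup E'] [NormedSpace ℝ E'] {φ : E → E'} {κ : ℂ × E → ℂ}
    {f : ℂ × E' → ℂ} (hf : HolSmooth f (φ q)) (hκ : HolSmooth κ q)
    (ht : Tendsto κ (nearInf q) (Bornology.cobounded ℂ))
    (hφ : ∀ᶠ q' in 𝓝 q, ContDiffAt ℝ ∞ φ q') :
    HolSmooth (fun p => f (κ p, φ p.2)) q := by
  have h2 := (tendsto_param_nearInf ht hφ.self_of_nhds.continuousAt).eventually hf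
  have h3 := (tendsto_snd (f := Bornology.cobounded ℂ) (g := 𝓝 q)).eventually hφ
  filter_upwards [hκ, h2, h3] with p h1 h2 h3
  refine ⟨h2.1.comp p (h1.1.prodMk (h3.comp p contDiffAt_snd)), ?_⟩
  exact DifferentiableAt.comp (g := fun z => f (z, φ p.2)) (f := fun z => κ (z, p.2)) p.1
    h2.2 h1.2

theorem comp_left {κ : ℂ × E → ℂ} (hf : HolSmooth f q) (hκ : HolSmooth κ q)
    (ht : Tendsto κ (nearInf q) (Bornology.cobounded ℂ)) :
    HolSmooth (fun p => f (κ p, p.2)) q :=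
  comp (φ := id) hf hκ ht (Eventually.of_forall fun _ => contDiffAt_id)

theorem comp_right {E' : Type} [NormedAddCommGroup E'] [NormedSpace ℝ E'] {φ : E → E'}
    {f : ℂ × E' → ℂ} (hf : HolSmooth f (φ q)) (hφ : ∀ᶠ q' in 𝓝 q, ContDiffAt ℝ ∞ φ q') :
    HolSmooth (fun p => f (p.1, φ p.2)) q :=
  comp hf fst tendsto_fst hφ

end HolSmooth

/-! ### Directional derivatives -/

section pd

variable {X : Type} [NormedAddCommGroup X] [NormedSpace ℝ X] {f g : X → ℂ} {p : X}

theorem contDiffAt_pd (hf : ContDiffAt ℝ ∞ f p) (v : X) : ContDiffAt ℝ ∞ (pd v f) p :=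
  (hf.fderiv_right (m := ∞) (by simp)).clm_apply contDiffAt_const

theorem pd_congr (h : f =ᶠ[𝓝 p] g) (v : X) : pd v f p = pd v g p := by
  simp only [pd, h.fderiv_eq]

theorem pd_const (c : ℂ) (v : X) : pd v (fun _ : X => c) p = 0 := by simp [pd]

theorem pd_add (hf : DifferentiableAt ℝ f p) (hg : DifferentiableAt ℝ g p) (v : X) :
    pd v (fun p => f p + g p) p = pd v f p + pd v g p := by
  simp only [pd]; rw [fderiv_fun_add hf hg]; rfl

theorem pd_sub (hf : DifferentiableAt ℝ f p) (hg : DifferentiableAt ℝ g p) (v : X) :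
    pd v (fun p => f p - g p) p = pd v f p - pd v g p := by
  simp only [pd]; rw [fderiv_fun_sub hf hg]; rfl

theorem pd_mul (hf : DifferentiableAt ℝ f p) (hg : DifferentiableAt ℝ g p) (v : X) :
    pd v (fun p => f p * g p) p = pd v f p * g p + f p * pd v g p := by
  simp only [pd]; rw [fderiv_fun_mul hf hg]
  simp [mul_comm, add_comm]

theorem pd_const_mul (c : ℂ) (hf : DifferentiableAt ℝ f p) (v : X) :
    pd v (fun p => c * f p) p = c * pd v f p := by
  rw [pd_mul (differentiableAt_const c) hf, pd_const]; ring

theorem pd_comm (hf : ContDiffAt ℝ ∞ f p) (v w : X) : pd v (pd w f) p = pd w (pd v f) p := by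
  have hs : IsSymmSndFDerivAt ℝ f p :=
    hf.isSymmSndFDerivAt (by simpa using WithTop.coe_le_coe.2 (le_top (a := (2 : ℕ∞))))
  have h1 : DifferentiableAt ℝ (fderiv ℝ f) p :=
    (hf.fderiv_right (m := ∞) (by simp)).differentiableAt (by simp)
  have h2 : ∀ u w : X, pd u (pd w f) p = fderiv ℝ (fderiv ℝ f) p u w := by
    intro u w
    change fderiv ℝ (fun y => fderiv ℝ f y w) p u = _
    rw [fderiv_clm_apply h1 (differentiableAt_const w)]
    simp
  rw [h2, h2, hs.eq]

/-- The chain rule for a complex differentiable outer function. -/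
theorem pd_holomorphic_comp {Y : Type} [NormedAddCommGroup Y] [NormedSpace ℂ Y] {F : Y → ℂ}
    {c : X → Y} (hF : DifferentiableAt ℂ F (c p)) (hc : DifferentiableAt ℝ c p) (v : X) :
    pd v (fun p => F (c p)) p = fderiv ℂ F (c p) (pd v c p) := by
  have := (hF.hasFDerivAt.restrictScalars ℝ).comp p hc.hasFDerivAt
  simp only [pd]
  have h2 := this.fderiv
  rw [show (fun p => F (c p)) = F ∘ c from rfl, h2]; rfl

end pd

theorem fderiv_real_of_complex {f : ℂ × E → ℂ} {p : ℂ × E} (hf : DifferentiableAt ℝ f p)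
    (hc : DifferentiableAt ℂ (fun z => f (z, p.2)) p.1) (c : ℂ) :
    fderiv ℝ f p (c, 0) = c * deriv (fun z => f (z, p.2)) p.1 := by
  have h1 : HasFDerivAt (fun z : ℂ => f (z, p.2)) _ p.1 :=
    HasFDerivAt.comp p.1 (f := fun z : ℂ => (z, p.2)) hf.hasFDerivAt
      (hasFDerivAt_prodMk_left (𝕜 := ℝ) p.1 p.2)
  have h2 : HasFDerivAt (fun z : ℂ => f (z, p.2)) _ p.1 :=
    hc.hasDerivAt.hasFDerivAt.restrictScalars ℝ
  have := congrArg (fun T => T c) (h1.unique h2)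
  simpa using this

theorem pd_fst_eq_deriv {f : ℂ × E → ℂ} {p : ℂ × E} (hf : DifferentiableAt ℝ f p)
    (hc : DifferentiableAt ℂ (fun z => f (z, p.2)) p.1) :
    pd (1, 0) f p = deriv (fun z => f (z, p.2)) p.1 := by
  simpa [pd] using fderiv_real_of_complex hf hc 1

theorem pd_fst_smul {f : ℂ × E → ℂ} {p : ℂ × E} (hf : DifferentiableAt ℝ f p)
    (hc : DifferentiableAt ℂ (fun z => f (z, p.2)) p.1) (c : ℂ) :
    pd (c, 0) f p = c * pd (1, 0) f p := by
  rw [pd_fst_eq_deriv hf hc]; exact fderiv_real_of_complex hf hc c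

theorem differentiableAt_complex_of_cauchyRiemann {f : ℂ × E → ℂ} {p : ℂ × E}
    (hf : DifferentiableAt ℝ f p) (hc : pd (Complex.I, 0) f p = Complex.I * pd (1, 0) f p) :
    DifferentiableAt ℂ (fun z => f (z, p.2)) p.1 := by
  have h1 : HasFDerivAt (fun z : ℂ => f (z, p.2)) _ p.1 :=
    HasFDerivAt.comp p.1 (f := fun z : ℂ => (z, p.2)) hf.hasFDerivAt
      (hasFDerivAt_prodMk_left (𝕜 := ℝ) p.1 p.2)
  have h2 : HasDerivAt (fun z : ℂ => f (z, p.2)) (pd (1, 0) f p) p.1 := by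
    rw [hasDerivAt_iff_hasFDerivAt]
    refine hasFDerivAt_of_restrictScalars ℝ h1 ?_
    refine ContinuousLinearMap.ext fun z => ?_
    have h3 : ((z, 0) : ℂ × E) = z.re • (1, 0) + z.im • (Complex.I, 0) := by
      ext <;> simp
    simp only [pd] at hc
    simp only [ContinuousLinearMap.coe_restrictScalars', 
      ContinuousLinearMap.comp_apply,
      ContinuousLinearMap.inl_apply, smul_eq_mul, pd, ContinuousLinearMap.toSpanSingleton_apply]
    rw [h3, map_add, map_smul, map_smul, hc]
    simp only [Complex.real_smul]
    conv_lhs => rw [← Complex.re_add_im z]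
    ring
  exact h2.differentiableAt

namespace HolSmooth

variable {q : E} {f g : ℂ × E → ℂ}

/-- Commuting second derivatives carry the Cauchy-Riemann equation from `f` to its directional
derivatives, so holomorphy in `k` is not lost. -/
theorem pd (hf : HolSmooth f q) (v : ℂ × E) : HolSmooth (pd v f) q := by
  filter_upwards [hf, Eventually.nearInf_nhds hf] with p hp hp'
  refine ⟨contDiffAt_pd hp.1 v, differentiableAt_complex_of_cauchyRiemann
    ((contDiffAt_pd hp.1 v).differentiableAt (by simp)) ?_⟩
  rw [pd_comm hp.1, pd_comm hp.1 (1, 0), ← pd_const_mul _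
    ((contDiffAt_pd hp.1 _).differentiableAt (by simp))]
  refine pd_congr ?_ v
  filter_upwards [hp'] with p' hp'
  exact pd_fst_smul (hp'.1.differentiableAt (by simp)) hp'.2 Complex.I

theorem pd_congr (h : f =ᶠ[nearInf q] g) (v : ℂ × E) :
    Toroidal.pd v f =ᶠ[nearInf q] Toroidal.pd v g :=
  (Eventually.nearInf_nhds h).mono fun _ hp => Toroidal.pd_congr hp v

end HolSmooth

/-- The chain rule for a change of the variable `k`. -/
theorem pd_comp_left {f κ : ℂ × E → ℂ} {p : ℂ × E} (hf : DifferentiableAt ℝ f (κ p, p.2))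
    (hc : DifferentiableAt ℂ (fun z => f (z, p.2)) (κ p)) (hκ : DifferentiableAt ℝ κ p)
    (v : ℂ × E) :
    pd v (fun p => f (κ p, p.2)) p
      = pd (0, v.2) f (κ p, p.2) + pd (1, 0) f (κ p, p.2) * pd v κ p := by
  have h1 : HasFDerivAt (fun p : ℂ × E => (κ p, p.2))
      ((fderiv ℝ κ p).prod (ContinuousLinearMap.snd ℝ ℂ E)) p :=
    hκ.hasFDerivAt.prodMk hasFDerivAt_snd
  have h2 := HasFDerivAt.comp p (f := fun p : ℂ × E => (κ p, p.2)) hf.hasFDerivAt h1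
  have h3 : pd v (fun p => f (κ p, p.2)) p = fderiv ℝ f (κ p, p.2) (pd v κ p, v.2) := by
    simp only [pd]
    exact congrArg (fun T => T v) h2.fderiv
  rw [h3, show (pd v κ p, v.2) = ((0, v.2) : ℂ × E) + (pd v κ p, 0) by simp, map_add]
  have := pd_fst_smul hf hc (pd v κ p)
  simp only [pd] at this ⊢
  rw [this, mul_comm]

end HolSmooth

/-! ### Residues and Laurent expansions of functions of one variable -/

/-- `f` is holomorphic in a punctured neighbourhood of infinity. -/
def HolInf (f : ℂ → ℂ) : Prop := ∀ᶠ z in Bornology.cobounded ℂ, DifferentiableAt ℂ f z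

/-- The normalized integral over a circle around the origin. -/
def circ (R : ℝ) (f : ℂ → ℂ) : ℂ := (2 * π * Complex.I)⁻¹ * ∮ z in C(0, R), f z

/-- The part of negative powers of a function of one variable. -/
def neg₁ (f : ℂ → ℂ) (k : ℂ) : ℂ :=
  ∑' n : ℕ, laurentCoeff f (-(n + 1 : ℤ)) * k ^ (-(n + 1 : ℤ))

section OneVariable

variable {f g : ℂ → ℂ} {ρ R : ℝ}

theorem circ_eq_circ (h0 : 0 < R) {R' : ℝ} (hR' : R ≤ R')
    (hf : ∀ z, R ≤ ‖z‖ → DifferentiableAt ℂ f z) : circ R' f = circ R f := by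
  unfold circ
  rw [Complex.circleIntegral_eq_of_differentiable_on_annulus_off_countable h0 hR'
    countable_empty]
  · intro z hz
    exact (hf z (by simpa using hz.2)).continuousAt.continuousWithinAt
  · intro z hz
    exact hf z (by simpa using (not_le.1 (fun h => hz.1.2 (by simpa using h))).le)

/-- By Cauchy's theorem the circle integrals are constant for large radius, so the limit defining
`res` is attained. -/
theorem res_eq_circ (h0 : 0 < R) (hf : ∀ z, R ≤ ‖z‖ → DifferentiableAt ℂ f z) :
    res f = circ R f := by
  refine Tendsto.limUnder_eq ((tendsto_const_nhds (x := circ R f)).congr' ?_)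
  filter_upwards [eventually_ge_atTop R] with K hK
  exact (circ_eq_circ h0 hK hf).symm

theorem HolInf.exists_radius (hf : HolInf f) :
    ∃ R : ℝ, 0 < R ∧ ∀ z, R ≤ ‖z‖ → DifferentiableAt ℂ f z := by
  obtain ⟨ρ, h0, h⟩ := eventually_cobounded_iff.1 hf
  exact ⟨ρ + 1, by linarith, fun z hz => h z (by linarith)⟩

theorem HolInf.mul (hf : HolInf f) (hg : HolInf g) : HolInf (fun z => f z * g z) :=
  (hf.and hg).mono fun _ h => h.1.mul h.2

theorem HolInf.const (c : ℂ) : HolInf (fun _ => c) :=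
  Eventually.of_forall fun _ => differentiableAt_const _

theorem cobounded_ne_zero : ∀ᶠ z : ℂ in Bornology.cobounded ℂ, z ≠ 0 :=
  eventually_cobounded_iff.2 ⟨1, one_pos, fun z hz h => by simp [h] at hz; linarith⟩

theorem HolInf.zpow (n : ℤ) : HolInf (fun z => z ^ n) :=
  cobounded_ne_zero.mono fun _ hz => differentiableAt_zpow.2 (Or.inl hz)

theorem eventually_cobounded_nhds {P : ℂ → Prop} (h : ∀ᶠ z in Bornology.cobounded ℂ, P z) :
    ∀ᶠ z in Bornology.cobounded ℂ, ∀ᶠ z' in 𝓝 z, P z' := by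
  obtain ⟨ρ, h0, h⟩ := eventually_cobounded_iff.1 h
  refine eventually_cobounded_iff.2 ⟨ρ, h0, fun k hk => ?_⟩
  filter_upwards [continuous_norm.continuousAt.eventually (lt_mem_nhds hk)] with z hz using h z hz

theorem HolInf.deriv (hf : HolInf f) : HolInf (deriv f) := by
  filter_upwards [eventually_cobounded_nhds hf] with z hz
  obtain ⟨U, hU, ho, hz'⟩ := eventually_nhds_iff.1 hz
  exact (DifferentiableOn.deriv (fun w hw => (hU w hw).differentiableWithinAt) ho).differentiableAt
    (ho.mem_nhds hz')

theorem res_congr (h : f =ᶠ[Bornology.cobounded ℂ] g) : res f = res g := by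
  obtain ⟨ρ, h0, h⟩ := eventually_cobounded_iff.1 h
  unfold res limUnder
  congr 1
  refine Filter.map_congr ?_
  filter_upwards [eventually_gt_atTop ρ] with K hK
  rw [circleIntegral.integral_congr (by linarith)]
  intro z hz
  exact h z (by simp at hz; linarith)

theorem circleIntegrable_of_differentiableAt (h0 : 0 < R)
    (hf : ∀ z, R ≤ ‖z‖ → DifferentiableAt ℂ f z) : CircleIntegrable f 0 R :=
  ContinuousOn.circleIntegrable h0.le fun z hz =>
    (hf z (by simp at hz; exact hz.ge)).continuousAt.continuousWithinAt

theorem res_add (hf : HolInf f) (hg : HolInf g) : res (fun z => f z + g z) = res f + res g := by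
  obtain ⟨R, h0, h⟩ := eventually_cobounded_iff.1 (hf.and hg)
  have h1 : ∀ z, R + 1 ≤ ‖z‖ → DifferentiableAt ℂ f z := fun z hz => (h z (by linarith)).1
  have h2 : ∀ z, R + 1 ≤ ‖z‖ → DifferentiableAt ℂ g z := fun z hz => (h z (by linarith)).2
  have hR : 0 < R + 1 := by linarith
  rw [res_eq_circ hR h1, res_eq_circ hR h2,
    res_eq_circ (f := fun z => f z + g z) hR fun z hz => (h1 z hz).add (h2 z hz)]
  unfold circ
  rw [circleIntegral.integral_add (circleIntegrable_of_differentiableAt hR h1)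
    (circleIntegrable_of_differentiableAt hR h2), mul_add]

theorem res_const_mul (c : ℂ) (hf : HolInf f) : res (fun z => c * f z) = c * res f := by
  obtain ⟨R, h0, h⟩ := hf.exists_radius
  rw [res_eq_circ h0 h, res_eq_circ h0 fun z hz => (h z hz).const_mul c]
  unfold circ
  rw [circleIntegral.integral_const_mul]
  ring

theorem res_deriv (hf : HolInf f) : res (deriv f) = 0 := by
  obtain ⟨ρ, h0, h⟩ := eventually_cobounded_iff.1 (hf.and hf.deriv)
  have hR : 0 < ρ + 1 := by linarith
  rw [res_eq_circ hR fun z hz => (h z (by linarith)).2]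
  unfold circ
  rw [circleIntegral.integral_eq_zero_of_hasDerivWithinAt hR.le (f := f), mul_zero]
  intro z hz
  refine (h z ?_).1.hasDerivAt.hasDerivWithinAt
  simp at hz; linarith

theorem circ_eq_zero_of_differentiable (hf : Differentiable ℂ f) (h0 : 0 ≤ R) : circ R f = 0 := by
  unfold circ
  rw [Complex.circleIntegral_eq_zero_of_differentiable_on_off_countable h0 countable_empty
    hf.continuous.continuousOn fun z _ => hf z, mul_zero]

theorem res_eq_zero_of_differentiable (hf : Differentiable ℂ f) : res f = 0 := by
  rw [res_eq_circ one_pos fun z _ => hf z, circ_eq_zero_of_differentiable hf zero_le_one]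

/-- The Cauchy integral representing the negative part. -/
def cauchyNeg (R : ℝ) (f : ℂ → ℂ) (k : ℂ) : ℂ := circ R (fun z => f z * (k - z)⁻¹)

theorem laurentCoeff_eq_circ (h0 : 0 < R) (hf : ∀ z, R ≤ ‖z‖ → DifferentiableAt ℂ f z) (n : ℤ) :
    laurentCoeff f n = circ R (fun z => z ^ (-n - 1) * f z) := by
  refine res_eq_circ h0 fun z hz => ?_
  have : z ≠ 0 := fun h => by simp [h] at hz; linarith
  exact (differentiableAt_zpow.2 (Or.inl this)).mul (hf z hz)

/-- The geometric expansion of the Cauchy kernel `(k - z)⁻¹` on `|z| = R < |k|`, integrated term by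
term. -/
theorem hasSum_cauchyNeg (h0 : 0 < R) (hf : ∀ z, R ≤ ‖z‖ → DifferentiableAt ℂ f z) {k : ℂ}
    (hk : R < ‖k‖) : HasSum (fun n : ℕ => laurentCoeff f (-(n + 1 : ℤ)) * k ^ (-(n + 1 : ℤ)))
      (cauchyNeg R f k) := by
  have hk0 : k ≠ 0 := fun h => by simp [h] at hk; linarith
  have hkp : 0 < ‖k‖ := by linarith
  have hc : ContinuousOn f (Metric.sphere 0 R) := fun z hz =>
    (hf z (by simp at hz; exact hz.ge)).continuousAt.continuousWithinAt
  obtain ⟨C, hC⟩ := (isCompact_sphere (0 : ℂ) R).exists_bound_of_continuousOn hc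
  have key : HasSum (fun n : ℕ => ∮ z in C(0, R), f z * (z ^ n * k ^ (-(n + 1 : ℤ))))
      (∮ z in C(0, R), f z * (k - z)⁻¹) := by
    simp only [circleIntegral]
    have hcm : Continuous (fun θ : ℝ => circleMap 0 R θ) := continuous_circleMap 0 R
    have hfc : Continuous (fun θ : ℝ => f (circleMap 0 R θ)) :=
      hc.comp_continuous hcm fun θ => by simp [h0.le]
    refine intervalIntegral.hasSum_integral_of_dominated_convergence
      (fun n _ => R * (C * ‖k‖⁻¹) * (R / ‖k‖) ^ n) ?_ ?_ ?_ ?_ ?_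
    · intro n
      refine (Continuous.aestronglyMeasurable ?_)
      simp only [deriv_circleMap, smul_eq_mul]
      exact (hcm.mul continuous_const).mul (hfc.mul ((hcm.pow n).mul continuous_const))
    · intro n
      refine Eventually.of_forall fun θ _ => ?_
      have h1 := hC (circleMap 0 R θ) (by simp [h0.le])
      have h2 : ‖k ^ (-(n + 1 : ℤ))‖ = ‖k‖⁻¹ * (‖k‖⁻¹) ^ n := by
        rw [norm_zpow, zpow_neg, ← Nat.cast_succ, zpow_natCast, pow_succ, mul_inv, inv_pow,
          mul_comm]
      simp only [deriv_circleMap, smul_eq_mul, norm_mul, norm_pow, h2, norm_circleMap_zero,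
        Complex.norm_I, mul_one, abs_of_pos h0]
      calc R * (‖f (circleMap 0 R θ)‖ * (R ^ n * (‖k‖⁻¹ * ‖k‖⁻¹ ^ n)))
          ≤ R * (C * (R ^ n * (‖k‖⁻¹ * ‖k‖⁻¹ ^ n))) := by gcongr
        _ = R * (C * ‖k‖⁻¹) * (R / ‖k‖) ^ n := by rw [div_eq_mul_inv, mul_pow]; ring
    · refine Eventually.of_forall fun θ _ => ?_
      exact (summable_geometric_of_lt_one (by positivity) ((div_lt_one hkp).2 hk)).mul_left _
    · exact intervalIntegrable_const
    · refine Eventually.of_forall fun θ _ => ?_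
      have h1 : ‖circleMap 0 R θ / k‖ < 1 := by
        rw [norm_div, norm_circleMap_zero, abs_of_pos h0]
        exact (div_lt_one hkp).2 hk
      have h2 := (hasSum_geometric_of_norm_lt_one h1).mul_left
        (deriv (circleMap 0 R) θ * f (circleMap 0 R θ) * k⁻¹)
      have hne : k - circleMap 0 R θ ≠ 0 := by
        intro h
        rw [sub_eq_zero] at h
        rw [h, norm_circleMap_zero, abs_of_pos h0] at hk
        exact lt_irrefl _ hk
      have h3 : ∀ n : ℕ, deriv (circleMap 0 R) θ • (f (circleMap 0 R θ) *
          (circleMap 0 R θ ^ n * k ^ (-(n + 1 : ℤ))))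
          = deriv (circleMap 0 R) θ * f (circleMap 0 R θ) * k⁻¹ * (circleMap 0 R θ / k) ^ n := by
        intro n
        rw [zpow_neg, ← Nat.cast_succ, zpow_natCast, pow_succ, div_pow, mul_inv]
        simp only [smul_eq_mul]
        field_simp
      have h4 : deriv (circleMap 0 R) θ • (f (circleMap 0 R θ) * (k - circleMap 0 R θ)⁻¹)
          = deriv (circleMap 0 R) θ * f (circleMap 0 R θ) * k⁻¹ *
            (1 - circleMap 0 R θ / k)⁻¹ := by
        have h5 : 1 - circleMap 0 R θ / k = (k - circleMap 0 R θ) / k := by field_simp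
        simp only [smul_eq_mul]
        rw [h5]
        field_simp
      simp only [h3, h4]
      exact h2
  have h3 := key.mul_left ((2 * π * Complex.I)⁻¹)
  have h4 : ∀ n : ℕ, laurentCoeff f (-(n + 1 : ℤ)) * k ^ (-(n + 1 : ℤ))
      = (2 * π * Complex.I)⁻¹ * ∮ z in C(0, R), f z * (z ^ n * k ^ (-(n + 1 : ℤ))) := by
    intro n
    rw [laurentCoeff_eq_circ h0 hf, circ, mul_assoc, mul_comm _ (k ^ (-(n + 1 : ℤ))),
      ← circleIntegral.integral_const_mul]
    congr 2
    funext z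
    rw [show (-(-(n + 1 : ℤ)) - 1) = n by ring, zpow_natCast]
    ring
  simp only [h4]
  exact h3

theorem neg₁_eq_cauchyNeg (h0 : 0 < R) (hf : ∀ z, R ≤ ‖z‖ → DifferentiableAt ℂ f z) {k : ℂ}
    (hk : R < ‖k‖) : neg₁ f k = cauchyNeg R f k :=
  (hasSum_cauchyNeg h0 hf hk).tsum_eq

theorem hasSum_neg₁ (hf : HolInf f) : ∀ᶠ k in Bornology.cobounded ℂ,
    HasSum (fun n : ℕ => laurentCoeff f (-(n + 1 : ℤ)) * k ^ (-(n + 1 : ℤ))) (neg₁ f k) := by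
  obtain ⟨R, h0, h⟩ := hf.exists_radius
  refine eventually_cobounded_iff.2 ⟨R, h0, fun k hk => ?_⟩
  rw [neg₁_eq_cauchyNeg h0 h hk]
  exact hasSum_cauchyNeg h0 h hk

/-- `f` is bounded by a multiple of `k ^ (-n)` near infinity. -/
def OInf (n : ℕ) (f : ℂ → ℂ) : Prop := f =O[Bornology.cobounded ℂ] fun k => (k⁻¹) ^ n

/-- For `|k| > 2R` and `|z| = R` the Cauchy kernel is at most `2 / |k|`. -/
theorem neg₁_OInf (hf : HolInf f) : OInf 1 (neg₁ f) := by
  obtain ⟨R, h0, h⟩ := hf.exists_radius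
  have hc : ContinuousOn f (Metric.sphere 0 R) := fun z hz =>
    (h z (by simp at hz; exact hz.ge)).continuousAt.continuousWithinAt
  obtain ⟨C, hC⟩ := (isCompact_sphere (0 : ℂ) R).exists_bound_of_continuousOn hc
  have hC0 : 0 ≤ C := (norm_nonneg _).trans (hC R (by simp [h0.le]))
  refine Asymptotics.IsBigO.of_bound (R * (2 * C)) (eventually_cobounded_iff.2
    ⟨2 * R, by linarith, fun k hk => ?_⟩)
  have hkp : 0 < ‖k‖ := by linarith
  rw [neg₁_eq_cauchyNeg h0 h (by linarith), cauchyNeg, circ, ← smul_eq_mul]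
  refine (circleIntegral.norm_two_pi_i_inv_smul_integral_le_of_norm_le_const h0.le
    (C := 2 * C * ‖k‖⁻¹) fun z hz => ?_).trans (le_of_eq (by simp; ring))
  have hz' : ‖z‖ = R := by simpa using hz
  have h1 : ‖k‖ / 2 ≤ ‖k - z‖ := by
    have := norm_sub_norm_le k z
    linarith
  rw [norm_mul, norm_inv]
  calc ‖f z‖ * ‖k - z‖⁻¹ ≤ C * (‖k‖ / 2)⁻¹ := by
        gcongr
        exact hC z hz
    _ = 2 * C * ‖k‖⁻¹ := by rw [inv_div]; ring

theorem tendsto_inv_pow (n : ℕ) (hn : n ≠ 0) :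
    Tendsto (fun k : ℂ => (k⁻¹) ^ n) (Bornology.cobounded ℂ) (𝓝 0) := by
  simpa [hn] using (Filter.tendsto_inv₀_cobounded (α := ℂ)).pow n

theorem OInf.tendsto {n : ℕ} (hf : OInf (n + 1) f) : Tendsto f (Bornology.cobounded ℂ) (𝓝 0) :=
  Asymptotics.IsBigO.trans_tendsto hf (tendsto_inv_pow _ (by simp))

theorem OInf.mono {m n : ℕ} (hf : OInf n f) (h : m ≤ n) : OInf m f := by
  refine Asymptotics.IsBigO.trans hf (Asymptotics.IsBigO.of_bound 1 (eventually_cobounded_iff.2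
    ⟨1, one_pos, fun k hk => ?_⟩))
  simp only [norm_pow, norm_inv, one_mul]
  exact pow_le_pow_of_le_one (by positivity) (inv_le_one_of_one_le₀ hk.le) h

theorem OInf.add {n : ℕ} (hf : OInf n f) (hg : OInf n g) : OInf n (fun z => f z + g z) :=
  Asymptotics.IsBigO.add hf hg

theorem OInf.sub {n : ℕ} (hf : OInf n f) (hg : OInf n g) : OInf n (fun z => f z - g z) :=
  Asymptotics.IsBigO.sub hf hg

theorem OInf.mul {m n : ℕ} (hf : OInf m f) (hg : OInf n g) : OInf (m + n) (fun z => f z * g z) := by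
  simpa only [OInf, pow_add] using Asymptotics.IsBigO.mul hf hg

theorem OInf.const (c : ℂ) : OInf 0 (fun _ => c) := by
  simpa [OInf] using Asymptotics.isBigO_const_const c (one_ne_zero (α := ℂ)) _

theorem OInf.congr {n : ℕ} (hf : OInf n f) (h : g =ᶠ[Bornology.cobounded ℂ] f) : OInf n g :=
  h.trans_isBigO hf

/-- The divided difference `dslope f k` is holomorphic across `k`, so its integrals over the two
circles agree. Since `k` has winding number one for the outer circle and zero for the inner one,
unfolding the divided difference gives the formula. -/
theorem cauchy_annulus (h0 : 0 < R) (hf : ∀ z, R ≤ ‖z‖ → DifferentiableAt ℂ f z) {k : ℂ}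
    (hk : R < ‖k‖) {R' : ℝ} (hk' : ‖k‖ < R') :
    f k = circ R' (fun z => (z - k)⁻¹ * f z) + cauchyNeg R f k := by
  have hd : ∀ z, R ≤ ‖z‖ → DifferentiableAt ℂ (dslope f k) z := by
    intro z hz
    by_cases hzk : z = k
    · subst hzk
      have ho : IsOpen {w : ℂ | R < ‖w‖} := isOpen_lt continuous_const continuous_norm
      exact ((Complex.differentiableOn_dslope (ho.mem_nhds hk)).2
        fun w hw => (hf w (le_of_lt hw)).differentiableWithinAt).differentiableAt (ho.mem_nhds hk)
    · exact (differentiableAt_dslope_of_ne hzk).2 (hf z hz)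
  have h1 := circ_eq_circ (R' := R') h0 (by linarith) hd
  have h2 : ∀ r : ℝ, 0 < r → R ≤ r → r ≠ ‖k‖ → circ r (dslope f k)
      = circ r (fun z => (z - k)⁻¹ * f z) - f k * circ r (fun z => (z - k)⁻¹) := by
    intro r hr0 hr hrk
    have hne : ∀ z ∈ Metric.sphere (0 : ℂ) r, z ≠ k := by
      rintro z hz rfl
      exact hrk (by simpa using hz.symm)
    have hi : CircleIntegrable (fun z => (z - k)⁻¹) 0 r :=
      ContinuousOn.circleIntegrable hr0.le fun z hz =>
        ((continuousAt_id.sub continuousAt_const).inv₀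
          (sub_ne_zero.2 (hne z hz))).continuousWithinAt
    have hi2 : CircleIntegrable (fun z => (z - k)⁻¹ * f z) 0 r :=
      ContinuousOn.circleIntegrable hr0.le fun z hz =>
        (((continuousAt_id.sub continuousAt_const).inv₀ (sub_ne_zero.2 (hne z hz))).mul
          (hf z (by simp at hz; linarith)).continuousAt).continuousWithinAt
    unfold circ
    rw [show (∮ z in C(0, r), dslope f k z)
        = ∮ z in C(0, r), ((z - k)⁻¹ * f z - f k * (z - k)⁻¹) from ?_,
      circleIntegral.integral_sub hi2 (g := fun z => f k * (z - k)⁻¹)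
        (hi.const_mul (f k)), circleIntegral.integral_const_mul]
    · ring
    · refine circleIntegral.integral_congr hr0.le fun z hz => ?_
      rw [dslope_of_ne _ (hne z hz), slope_def_field]
      ring
  have hpi : (2 * π * Complex.I : ℂ) ≠ 0 := by simp [Real.pi_ne_zero]
  have h3 : circ R' (fun z => (z - k)⁻¹) = 1 := by
    unfold circ
    rw [circleIntegral.integral_sub_inv_of_mem_ball (by simpa using hk'), inv_mul_cancel₀ hpi]
  have h4 : circ R (fun z => (z - k)⁻¹) = 0 := by
    unfold circ
    have hne : ∀ z ∈ Metric.closedBall (0 : ℂ) R, z - k ≠ 0 := by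
      intro z hz h
      rw [sub_eq_zero] at h
      rw [← h] at hk
      simp at hz; linarith
    have hdz : ∀ z ∈ Metric.closedBall (0 : ℂ) R, DifferentiableAt ℂ (fun z => (z - k)⁻¹) z :=
      fun z hz => (differentiableAt_id.sub (differentiableAt_const k)).inv (hne z hz)
    rw [Complex.circleIntegral_eq_zero_of_differentiable_on_off_countable h0.le countable_empty
      (fun z hz => (hdz z hz).continuousAt.continuousWithinAt)
      fun z hz => hdz z (Metric.ball_subset_closedBall hz.1), mul_zero]
  rw [h2 R' (by linarith) (by linarith) hk'.ne', h2 R h0 le_rfl hk.ne, h3, h4] at h1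
  have h5 : cauchyNeg R f k = - circ R (fun z => (z - k)⁻¹ * f z) := by
    unfold cauchyNeg circ
    rw [← mul_neg, ← neg_one_mul (∮ z in C(0, R), _),
      ← circleIntegral.integral_const_mul (-1 : ℂ)]
    congr 2
    funext z
    change f z * (k - z)⁻¹ = _
    rw [← neg_sub z k, inv_neg]; ring
  rw [h5]
  linear_combination -h1

theorem differentiableOn_circ_inv (h0 : 0 < R) (hf : CircleIntegrable f 0 R) :
    DifferentiableOn ℂ (fun k => circ R (fun z => (z - k)⁻¹ * f z)) (Metric.ball 0 R) := by
  lift R to NNReal using h0.le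
  have := (hasFPowerSeriesOn_cauchy_integral hf (by exact_mod_cast h0)).differentiableOn
  rw [Metric.eball_coe] at this
  exact this

/-- The Laurent decomposition at infinity. -/
theorem HolInf.exists_entire (hf : HolInf f) :
    ∃ P : ℂ → ℂ, Differentiable ℂ P ∧
      (fun z => f z - neg₁ f z) =ᶠ[Bornology.cobounded ℂ] P := by
  obtain ⟨R, h0, h⟩ := hf.exists_radius
  let Q : ℝ → ℂ → ℂ := fun r k => circ r (fun z => (z - k)⁻¹ * f z)
  -- The entire part is glued from the Cauchy integral over a large circle, holomorphic in its disc,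
  -- and `f` minus its negative part outside; by `cauchy_annulus` the two agree on the overlap.
  let P : ℂ → ℂ := fun k => if ‖k‖ < R + 1 then Q (R + 1) k else f k - cauchyNeg R f k
  have hQ : ∀ r, R ≤ r → DifferentiableOn ℂ (Q r) (Metric.ball 0 r) := fun r hr =>
    differentiableOn_circ_inv (by linarith)
      (circleIntegrable_of_differentiableAt (by linarith) fun z hz => h z (by linarith))
  have hP1 : ∀ k, R < ‖k‖ → P k = f k - cauchyNeg R f k := by
    intro k hk
    by_cases hk' : ‖k‖ < R + 1
    · have := cauchy_annulus h0 h hk hk'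
      simp only [P, if_pos hk']
      exact (sub_eq_of_eq_add this).symm
    · simp only [P, if_neg hk']
  refine ⟨P, fun k => ?_, eventually_cobounded_iff.2 ⟨R, h0, fun k hk => ?_⟩⟩
  · by_cases hk' : ‖k‖ < R + 1
    · refine DifferentiableAt.congr_of_eventuallyEq ((hQ (R + 1) (by linarith)).differentiableAt
        (Metric.isOpen_ball.mem_nhds (by simpa using hk'))) ?_
      filter_upwards [continuous_norm.continuousAt.eventually (gt_mem_nhds hk')] with z hz
      simp only [P, if_pos hz]
    · push Not at hk'
      refine DifferentiableAt.congr_of_eventuallyEq ((hQ (‖k‖ + 1) (by linarith)).differentiableAt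
        (Metric.isOpen_ball.mem_nhds (by simp))) ?_
      filter_upwards [continuous_norm.continuousAt.eventually (lt_mem_nhds (show R < ‖k‖ by linarith)),
        continuous_norm.continuousAt.eventually (gt_mem_nhds (lt_add_one ‖k‖))] with z hz hz'
      rw [hP1 z hz]
      exact sub_eq_of_eq_add (cauchy_annulus h0 h hz hz')
  · simp only [neg₁_eq_cauchyNeg h0 h hk, hP1 k hk]

/-- The entire part in the Laurent decomposition tends to zero at infinity, hence vanishes by
Liouville's theorem. -/
theorem neg₁_eventuallyEq (hf : HolInf f) (ht : Tendsto f (Bornology.cobounded ℂ) (𝓝 0)) :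
    neg₁ f =ᶠ[Bornology.cobounded ℂ] f := by
  obtain ⟨P, hP, h⟩ := hf.exists_entire
  have h1 : Tendsto P (Bornology.cobounded ℂ) (𝓝 0) := by
    refine Tendsto.congr' h ?_
    simpa using ht.sub (neg₁_OInf hf).tendsto
  rw [Metric.cobounded_eq_cocompact] at h1
  filter_upwards [h] with z hz
  rw [hP.apply_eq_of_tendsto_cocompact z h1] at hz
  exact (sub_eq_zero.1 hz).symm

theorem OInf.of_tendsto (hf : HolInf f) (ht : Tendsto f (Bornology.cobounded ℂ) (𝓝 0)) :
    OInf 1 f :=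
  (neg₁_OInf hf).congr (neg₁_eventuallyEq hf ht).symm

/-- Cauchy's estimate on the disc of radius `|k| / 2` about `k`, which gains one power of `k⁻¹`. -/
theorem OInf.deriv {n : ℕ} (hf : HolInf f) (h : OInf n f) : OInf (n + 1) (deriv f) := by
  obtain ⟨C, hC0, hC⟩ := h.exists_pos
  obtain ⟨R, h0, hR⟩ := eventually_cobounded_iff.1 (hC.bound.and hf)
  refine Asymptotics.IsBigO.of_bound (C * 2 ^ (n + 1)) (eventually_cobounded_iff.2
    ⟨2 * R, by linarith, fun k hk => ?_⟩)
  have hkp : 0 < ‖k‖ := by linarith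
  have hz : ∀ z ∈ Metric.closedBall k (‖k‖ / 2), ‖k‖ / 2 ≤ ‖z‖ := by
    intro z hz
    have h1 : ‖z - k‖ ≤ ‖k‖ / 2 := by simpa [dist_eq_norm] using hz
    have h2 := norm_sub_norm_le k z
    rw [norm_sub_rev] at h2
    linarith
  have hd : DiffContOnCl ℂ f (Metric.ball k (‖k‖ / 2)) := by
    refine DifferentiableOn.diffContOnCl fun z hz' => ?_
    have h2 := hz z (Metric.closure_ball_subset_closedBall hz')
    exact (hR z (by linarith)).2.differentiableWithinAt
  refine (Complex.norm_deriv_le_of_forall_mem_sphere_norm_le (by linarith) hd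
    (C := C * (2 / ‖k‖) ^ n) fun z hz' => ?_).trans (le_of_eq ?_)
  · have h2 := hz z (Metric.sphere_subset_closedBall hz')
    refine (hR z (by linarith)).1.trans ?_
    rw [norm_pow, norm_inv]
    gcongr
    rw [inv_le_comm₀ (by linarith) (by positivity), inv_div]
    exact h2
  · rw [norm_pow, norm_inv, pow_succ, pow_succ, div_pow, inv_pow]
    field_simp

/-- The normalized integral over the circle of radius `K` is `O(1 / K)`, but does not depend on `K`.
-/
theorem res_eq_zero_of_OInf (hf : HolInf f) (h : OInf 2 f) : res f = 0 := by
  obtain ⟨C, hC0, hC⟩ := h.exists_pos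
  obtain ⟨R, h0, hR⟩ := eventually_cobounded_iff.1 (hC.bound.and hf)
  have h1 : ∀ K : ℝ, R < K → ‖res f‖ ≤ C * K⁻¹ := by
    intro K hK
    have hK0 : 0 < K := by linarith
    rw [res_eq_circ hK0 fun z hz => (hR z (by linarith)).2, circ, ← smul_eq_mul]
    refine (circleIntegral.norm_two_pi_i_inv_smul_integral_le_of_norm_le_const hK0.le
      (C := C * (K⁻¹) ^ 2) fun z hz => ?_).trans (le_of_eq (by field_simp))
    have hz' : ‖z‖ = K := by simpa using hz
    have := (hR z (by linarith)).1
    simpa [hz'] using this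
  have h2 : Tendsto (fun K : ℝ => C * K⁻¹) atTop (𝓝 0) := by
    simpa using (tendsto_inv_atTop_zero (𝕜 := ℝ)).const_mul C
  have h3 : ‖res f‖ ≤ 0 := ge_of_tendsto h2 ((eventually_gt_atTop R).mono h1)
  exact norm_le_zero_iff.1 h3

/-- `f` agrees near infinity with an entire function. -/
def EntireAtInf (f : ℂ → ℂ) : Prop :=
  ∃ P : ℂ → ℂ, Differentiable ℂ P ∧ f =ᶠ[Bornology.cobounded ℂ] P

theorem EntireAtInf.sub (hf : EntireAtInf f) (hg : EntireAtInf g) :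
    EntireAtInf (fun z => f z - g z) := by
  obtain ⟨P, hP, h⟩ := hf
  obtain ⟨Q, hQ, h'⟩ := hg
  exact ⟨fun z => P z - Q z, hP.sub hQ, h.sub h'⟩

theorem EntireAtInf.add (hf : EntireAtInf f) (hg : EntireAtInf g) :
    EntireAtInf (fun z => f z + g z) := by
  obtain ⟨P, hP, h⟩ := hf
  obtain ⟨Q, hQ, h'⟩ := hg
  exact ⟨fun z => P z + Q z, hP.add hQ, h.add h'⟩

theorem EntireAtInf.mul (hf : EntireAtInf f) (hg : EntireAtInf g) :
    EntireAtInf (fun z => f z * g z) := by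
  obtain ⟨P, hP, h⟩ := hf
  obtain ⟨Q, hQ, h'⟩ := hg
  exact ⟨fun z => P z * Q z, hP.mul hQ, h.mul h'⟩

theorem EntireAtInf.congr (hf : EntireAtInf f) (h : g =ᶠ[Bornology.cobounded ℂ] f) :
    EntireAtInf g := by
  obtain ⟨P, hP, h'⟩ := hf
  exact ⟨P, hP, h.trans h'⟩

theorem EntireAtInf.deriv (hf : EntireAtInf f) : EntireAtInf (deriv f) := by
  obtain ⟨P, hP, h⟩ := hf
  refine ⟨_root_.deriv P, hP.deriv, ?_⟩
  filter_upwards [eventually_cobounded_nhds h] with z hz using EventuallyEq.deriv_eq hz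

theorem EntireAtInf.res_eq_zero (hf : EntireAtInf f) : res f = 0 := by
  obtain ⟨P, hP, h⟩ := hf
  rw [res_congr h, res_eq_zero_of_differentiable hP]

theorem laurentCoeff_congr (h : f =ᶠ[Bornology.cobounded ℂ] g) (n : ℤ) :
    laurentCoeff f n = laurentCoeff g n :=
  res_congr (h.mono fun z hz => by simp only [hz])

theorem neg₁_congr (h : f =ᶠ[Bornology.cobounded ℂ] g) : neg₁ f = neg₁ g := by
  funext k
  simp only [neg₁, laurentCoeff_congr h]

theorem EntireAtInf.neg₁_eq_zero (hf : EntireAtInf f) : neg₁ f = fun _ => 0 := by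
  funext k
  have : ∀ n : ℕ, laurentCoeff f (-(n + 1 : ℤ)) = 0 := by
    intro n
    unfold laurentCoeff
    rw [show (-(-(n + 1 : ℤ)) - 1) = n by ring]
    refine EntireAtInf.res_eq_zero (EntireAtInf.mul ⟨fun z => z ^ n, differentiable_pow n, ?_⟩ hf)
    exact Eventually.of_forall fun z => zpow_natCast z n
  simp only [neg₁, this, zero_mul, tsum_zero]

theorem HolInf.entireAtInf_sub_neg₁ (hf : HolInf f) : EntireAtInf (fun z => f z - Toroidal.neg₁ f z) :=
  hf.exists_entire

theorem laurentCoeff_add (hf : HolInf f) (hg : HolInf g) (n : ℤ) :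
    laurentCoeff (fun z => f z + g z) n = laurentCoeff f n + laurentCoeff g n := by
  unfold laurentCoeff
  simp only [mul_add]
  exact res_add ((HolInf.zpow _).mul hf) ((HolInf.zpow _).mul hg)

theorem laurentCoeff_const_mul (c : ℂ) (hf : HolInf f) (n : ℤ) :
    laurentCoeff (fun z => c * f z) n = c * laurentCoeff f n := by
  unfold laurentCoeff
  rw [← res_const_mul c ((HolInf.zpow _).mul hf)]
  exact res_congr (Eventually.of_forall fun z => by ring)

theorem neg₁_add (hf : HolInf f) (hg : HolInf g) :
    neg₁ (fun z => f z + g z) =ᶠ[Bornology.cobounded ℂ] fun z => neg₁ f z + neg₁ g z := by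
  filter_upwards [hasSum_neg₁ hf, hasSum_neg₁ hg] with z h1 h2
  refine HasSum.tsum_eq ?_
  simp only [laurentCoeff_add hf hg, add_mul]
  exact h1.add h2

theorem neg₁_const_mul (c : ℂ) (hf : HolInf f) (k : ℂ) :
    neg₁ (fun z => c * f z) k = c * neg₁ f k := by
  simp only [neg₁, laurentCoeff_const_mul c hf, mul_assoc, tsum_mul_left]

theorem neg₁_sub (hf : HolInf f) (hg : HolInf g) :
    neg₁ (fun z => f z - g z) =ᶠ[Bornology.cobounded ℂ] fun z => neg₁ f z - neg₁ g z := by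
  filter_upwards [neg₁_add hf ((HolInf.const (-1)).mul hg)] with z h1
  rw [neg₁_const_mul _ hg] at h1
  simpa [sub_eq_add_neg] using h1

end OneVariable

/-! ### Residues and negative parts depending on parameters -/

/-- The identity theorem; the exterior of a disc is connected, being the image of a half-plane under
the exponential. It upgrades relations known only beyond some unspecified radius to the whole domain
of holomorphy. -/
theorem eqOn_zero_of_eventually_cobounded {f : ℂ → ℂ} {R : ℝ} (h0 : 0 < R)
    (hf : ∀ z, R < ‖z‖ → DifferentiableAt ℂ f z)
    (h : ∀ᶠ z in Bornology.cobounded ℂ, f z = 0) : ∀ z, R < ‖z‖ → f z = 0 := by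
  have ho : IsOpen {w : ℂ | R < ‖w‖} := isOpen_lt continuous_const continuous_norm
  have hpre : IsPreconnected {w : ℂ | R < ‖w‖} := by
    have h1 : {w : ℂ | R < ‖w‖} = Complex.exp '' {w : ℂ | Real.log R < w.re} := by
      ext w
      constructor
      · intro hw
        have hw' : R < ‖w‖ := hw
        have hw0 : w ≠ 0 := norm_pos_iff.1 (h0.trans hw')
        refine ⟨Complex.log w, ?_, Complex.exp_log hw0⟩
        change Real.log R < _
        rw [Complex.log_re]
        exact Real.log_lt_log h0 hw'
      · rintro ⟨v, hv, rfl⟩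
        change R < _
        rw [Complex.norm_exp]
        exact (Real.log_lt_iff_lt_exp h0).1 hv
    rw [h1]
    exact ((convex_halfSpace_re_gt _).isPreconnected).image _ Complex.continuous_exp.continuousOn
  have han : AnalyticOnNhd ℂ f {w : ℂ | R < ‖w‖} :=
    DifferentiableOn.analyticOnNhd (fun z hz => (hf z hz).differentiableWithinAt) ho
  obtain ⟨ρ, hρ, h2⟩ := eventually_cobounded_iff.1 (eventually_cobounded_nhds h)
  have hz0 : max ρ R < ‖((max ρ R + 1 : ℝ) : ℂ)‖ := by
    rw [Complex.norm_real, Real.norm_eq_abs, abs_of_pos (by positivity)]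
    linarith
  intro z hz
  exact han.eqOn_zero_of_preconnected_of_eventuallyEq_zero hpre
    (z₀ := ((max ρ R + 1 : ℝ) : ℂ)) ((le_max_right _ _).trans_lt hz0)
    (h2 _ ((le_max_left _ _).trans_lt hz0)) hz

theorem contDiffAt_circle_integrand {X : Type} [NormedAddCommGroup X] [NormedSpace ℝ X] {x₀ : X}
    {g : ℂ × X → ℂ} {R : ℝ} {t : ℝ} (hg : ContDiffAt ℝ ∞ g (circleMap 0 R t, x₀)) :
    ContDiffAt ℝ ∞ (fun p : X × ℝ => deriv (circleMap 0 R) p.2 • g (circleMap 0 R p.2, p.1))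
      (x₀, t) := by
  have hc : ContDiff ℝ ∞ (circleMap 0 R) := contDiff_circleMap 0 R
  simp only [deriv_circleMap]
  simp only [smul_eq_mul]
  have h1 : ContDiffAt ℝ ∞ (fun p : X × ℝ => circleMap 0 R p.2) (x₀, t) :=
    hc.contDiffAt.comp (x₀, t) contDiffAt_snd
  exact (h1.mul contDiffAt_const).mul (ContDiffAt.comp
    (f := fun p : X × ℝ => (circleMap 0 R p.2, p.1)) (x₀, t) hg (h1.prodMk contDiffAt_fst))

section circ

variable {X : Type} [NormedAddCommGroup X] [NormedSpace ℝ X] {x₀ : X} {g : ℂ × X → ℂ} {R : ℝ}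

theorem contDiffAt_circ (h0 : 0 < R)
    (hg : ∀ z, ‖z‖ = R → ContDiffAt ℝ ∞ g (z, x₀)) :
    ContDiffAt ℝ ∞ (fun x => circ R (fun z => g (z, x))) x₀ := by
  unfold circ circleIntegral
  exact contDiffAt_const.mul (contDiffAt_intervalIntegral
    (F := fun p : X × ℝ => deriv (circleMap 0 R) p.2 • g (circleMap 0 R p.2, p.1))
    (by positivity) fun t _ => contDiffAt_circle_integrand (hg _ (by simp [abs_of_pos h0])))

theorem pd_circ (h0 : 0 < R)
    (hg : ∀ z, ‖z‖ = R → ContDiffAt ℝ ∞ g (z, x₀)) (v : X) :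
    pd v (fun x => circ R (fun z => g (z, x))) x₀ = circ R (fun z => pd (0, v) g (z, x₀)) := by
  have hd : ∀ t ∈ Icc 0 (2 * π), ContDiffAt ℝ ∞ (fun p : X × ℝ =>
      deriv (circleMap 0 R) p.2 • g (circleMap 0 R p.2, p.1)) (x₀, t) := fun t _ =>
    contDiffAt_circle_integrand (hg _ (by simp [abs_of_pos h0]))
  have h1 := contDiffAt_intervalIntegral (by positivity) hd
  unfold circ circleIntegral
  rw [pd_const_mul _ (h1.differentiableAt (by simp))]
  congr 1
  unfold pd
  rw [fderiv_intervalIntegral_apply (F := fun p : X × ℝ =>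
      deriv (circleMap 0 R) p.2 • g (circleMap 0 R p.2, p.1)) (by positivity)
      fun t ht => (hd t ht).of_le (by exact_mod_cast le_top)]
  refine intervalIntegral.integral_congr fun t ht => ?_
  have h2 : HasFDerivAt g _ (circleMap 0 R t, x₀) :=
    ((hg (circleMap 0 R t) (by simp [abs_of_pos h0])).differentiableAt (by simp)).hasFDerivAt
  have h3 : HasFDerivAt (fun x => deriv (circleMap 0 R) t • g (circleMap 0 R t, x)) _ x₀ :=
    (h2.comp x₀ (hasFDerivAt_prodMk_right (𝕜 := ℝ) (circleMap 0 R t) x₀)).const_smul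
    (deriv (circleMap 0 R) t)
  exact congrArg (fun T => T v) h3.fderiv

end circ

variable {E : Type} [NormedAddCommGroup E] [NormedSpace ℝ E] {q : E} {f g : ℂ × E → ℂ}

/-- The part of negative powers of a function depending on parameters. -/
def negU (f : ℂ × E → ℂ) : ℂ × E → ℂ := fun p => neg₁ (fun z => f (z, p.2)) p.1

namespace HolSmooth

theorem exists_radius (hf : HolSmooth f q) : ∃ R : ℝ, 0 < R ∧ ∀ᶠ q' in 𝓝 q, ∀ z : ℂ, R ≤ ‖z‖ →
    ContDiffAt ℝ ∞ f (z, q') ∧ DifferentiableAt ℂ (fun z => f (z, q')) z := by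
  obtain ⟨ρ, h0, h⟩ := eventually_nearInf.1 hf
  exact ⟨ρ + 1, by linarith, h.mono fun q' hq' z hz => hq' z (by linarith)⟩

theorem holInf (hf : HolSmooth f q) : HolInf (fun z => f (z, q)) :=
  (Eventually.nearInf_self hf).mono fun _ h => h.2

/-- The canonical relations are assumed for large `k` with a radius that may depend on the point
`(x, θ)`. Analytic continuation makes that radius uniform, so that the relations can be
differentiated in the parameters. -/
theorem eventually_eq_zero (hf : HolSmooth f q)
    (h : ∀ᶠ q' in 𝓝 q, ∀ᶠ z in Bornology.cobounded ℂ, f (z, q') = 0) :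
    ∀ᶠ p in nearInf q, f p = 0 := by
  obtain ⟨R, h0, hR⟩ := hf.exists_radius
  refine eventually_nearInf.2 ⟨R, h0, ?_⟩
  filter_upwards [hR, h] with q' h1 h2
  exact eqOn_zero_of_eventually_cobounded h0 (fun z hz => (h1 z hz.le).2) h2

theorem eventuallyEq (hf : HolSmooth f q) (hg : HolSmooth g q)
    (h : ∀ᶠ q' in 𝓝 q, ∀ᶠ z in Bornology.cobounded ℂ, f (z, q') = g (z, q')) :
    f =ᶠ[nearInf q] g := by
  filter_upwards [(hf.sub hg).eventually_eq_zero (h.mono fun q' hq' => hq'.mono fun z hz =>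
    sub_eq_zero.2 hz)] with p hp using sub_eq_zero.1 hp

theorem contDiffAt_res (hf : HolSmooth f q) :
    ContDiffAt ℝ ∞ (fun q' => res (fun z => f (z, q'))) q := by
  obtain ⟨R, h0, hR⟩ := hf.exists_radius
  refine (contDiffAt_circ (g := f) h0 fun z hz =>
    (hR.self_of_nhds z hz.ge).1).congr_of_eventuallyEq ?_
  filter_upwards [hR] with q' hq' using res_eq_circ h0 fun z hz => (hq' z hz).2

theorem exists_radius₂ (hf : HolSmooth f q) (hg : HolSmooth g q) :
    ∃ R : ℝ, 0 < R ∧ ∀ᶠ q' in 𝓝 q, ∀ z : ℂ, R ≤ ‖z‖ →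
    (ContDiffAt ℝ ∞ f (z, q') ∧ DifferentiableAt ℂ (fun z => f (z, q')) z) ∧
    ContDiffAt ℝ ∞ g (z, q') ∧ DifferentiableAt ℂ (fun z => g (z, q')) z := by
  obtain ⟨R, h0, h⟩ := hf.exists_radius
  obtain ⟨R', _, h'⟩ := hg.exists_radius
  refine ⟨max R R', by positivity, ?_⟩
  filter_upwards [h, h'] with q' h1 h2 z hz
  exact ⟨h1 z ((le_max_left _ _).trans hz), h2 z ((le_max_right _ _).trans hz)⟩

theorem pd_res (hf : HolSmooth f q) (v : E) :
    Toroidal.pd v (fun q' => res (fun z => f (z, q'))) q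
      = res (fun z => Toroidal.pd (0, v) f (z, q)) := by
  obtain ⟨R, h0, hR⟩ := exists_radius₂ hf (hf.pd (0, v))
  rw [res_eq_circ h0 fun z hz => (hR.self_of_nhds z hz).2.2,
    ← pd_circ h0 fun z hz => (hR.self_of_nhds z hz.ge).1.1]
  refine Toroidal.pd_congr ?_ v
  filter_upwards [hR] with q' hq' using res_eq_circ h0 fun z hz => (hq' z hz).1.2

theorem pd_fst_eq_deriv (hf : HolSmooth f q) :
    (fun z => Toroidal.pd (1, 0) f (z, q)) =ᶠ[Bornology.cobounded ℂ] deriv (fun z => f (z, q)) := by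
  filter_upwards [Eventually.nearInf_self hf] with z hz
  exact Toroidal.pd_fst_eq_deriv (hz.1.differentiableAt (by simp)) hz.2

theorem res_pd_fst (hf : HolSmooth f q) : res (fun z => Toroidal.pd (1, 0) f (z, q)) = 0 := by
  rw [res_congr hf.pd_fst_eq_deriv, res_deriv hf.holInf]

end HolSmooth

theorem contDiffAt_cauchyNeg_integrand {R : ℝ} {p : ℂ × E}
    (hR : ∀ z : ℂ, R ≤ ‖z‖ → ContDiffAt ℝ ∞ f (z, p.2)) (hp : R < ‖p.1‖) (z : ℂ) (hz : ‖z‖ = R) :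
    ContDiffAt ℝ ∞ (fun x : ℂ × ℂ × E => f (x.1, x.2.2) * (x.2.1 - x.1)⁻¹) (z, p) := by
  refine ContDiffAt.mul ?_ ?_
  · exact ContDiffAt.comp (f := fun x : ℂ × ℂ × E => (x.1, x.2.2)) (z, p) (hR z hz.ge)
      (contDiffAt_fst.prodMk contDiffAt_snd.snd)
  · refine ContDiffAt.inv ?_ ?_
    · exact contDiffAt_snd.fst.sub contDiffAt_fst
    · intro h
      have : p.1 = z := sub_eq_zero.1 h
      rw [this, hz] at hp
      exact lt_irrefl _ hp

theorem HolSmooth.negU_eq_cauchyNeg (hf : HolSmooth f q) : ∃ R : ℝ, 0 < R ∧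
    ∀ᶠ p : ℂ × E in nearInf q, R < ‖p.1‖ ∧ (∀ z : ℂ, R ≤ ‖z‖ → ContDiffAt ℝ ∞ f (z, p.2) ∧
      DifferentiableAt ℂ (fun z => f (z, p.2)) z) ∧
      negU f p = circ R (fun z => f (z, p.2) * (p.1 - z)⁻¹) := by
  obtain ⟨R, h0, hR⟩ := hf.exists_radius
  refine ⟨R, h0, eventually_nearInf.2 ⟨R, h0, ?_⟩⟩
  filter_upwards [hR] with q' hq' k hk
  exact ⟨hk, hq', neg₁_eq_cauchyNeg h0 (fun z hz => (hq' z hz).2) hk⟩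

theorem HolSmooth.negU (hf : HolSmooth f q) : HolSmooth (negU f) q := by
  obtain ⟨R, h0, hR⟩ := hf.negU_eq_cauchyNeg
  filter_upwards [hR, Eventually.nearInf_nhds hR] with p hp hp'
  refine ⟨?_, ?_⟩
  · refine (contDiffAt_circ (g := fun x : ℂ × ℂ × E => f (x.1, x.2.2) * (x.2.1 - x.1)⁻¹) h0
      (contDiffAt_cauchyNeg_integrand (fun z hz => (hp.2.1 z hz).1)
        hp.1)).congr_of_eventuallyEq ?_
    filter_upwards [hp'] with p' hp' using hp'.2.2
  · have h1 : ∀ k, R < ‖k‖ → neg₁ (fun z => f (z, p.2)) k = f (k, p.2) -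
        circ (‖k‖ + 1) (fun z => (z - k)⁻¹ * f (z, p.2)) := by
      intro k hk
      rw [neg₁_eq_cauchyNeg h0 (fun z hz => (hp.2.1 z hz).2) hk]
      have := cauchy_annulus h0 (fun z hz => (hp.2.1 z hz).2) hk (lt_add_one _)
      linear_combination -this
    -- Near `p.1` the negative part is `f` minus the Cauchy integral over a circle enclosing `p.1`,
    -- and that integral is holomorphic inside its circle.
    have h2 : ∀ᶠ k in 𝓝 p.1, neg₁ (fun z => f (z, p.2)) k = f (k, p.2) -
        circ (‖p.1‖ + 1) (fun z => (z - k)⁻¹ * f (z, p.2)) := by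
      filter_upwards [continuous_norm.continuousAt.eventually (lt_mem_nhds hp.1),
        continuous_norm.continuousAt.eventually (gt_mem_nhds (lt_add_one ‖p.1‖))] with k hk hk'
      rw [neg₁_eq_cauchyNeg h0 (fun z hz => (hp.2.1 z hz).2) hk]
      have := cauchy_annulus h0 (fun z hz => (hp.2.1 z hz).2) hk hk'
      linear_combination -this
    refine DifferentiableAt.congr_of_eventuallyEq ((hp.2.1 p.1 hp.1.le).2.sub ?_) h2
    exact (differentiableOn_circ_inv (by linarith [norm_nonneg p.1])
      (circleIntegrable_of_differentiableAt (by linarith [norm_nonneg p.1])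
        fun z hz => (hp.2.1 z (by linarith [hp.1])).2)).differentiableAt
      (Metric.isOpen_ball.mem_nhds (by simp))

/-- In the Cauchy integral over a fixed circle the kernel does not involve the parameters, so the
derivative falls on `f` alone. -/
theorem pd_negU (hf : HolSmooth f q) (v : E) :
    Toroidal.pd (0, v) (Toroidal.negU f) =ᶠ[nearInf q] Toroidal.negU (Toroidal.pd (0, v) f) := by
  obtain ⟨R, h0, hR⟩  := HolSmooth.exists_radius₂ hf (hf.pd (0, v))
  refine eventually_nearInf.2 ⟨R, h0, ?_⟩
  filter_upwards [eventually_eventually_nhds.2 hR] with q' hq' k hk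
  have h1 := hq'.self_of_nhds
  have h2 : Toroidal.negU f =ᶠ[𝓝 (k, q')] fun p =>
      circ R (fun z => f (z, p.2) * (p.1 - z)⁻¹) := by
    rw [EventuallyEq, nhds_prod_eq]
    filter_upwards [(continuous_norm.continuousAt.eventually (lt_mem_nhds hk)).prod_mk hq']
      with p hp
    exact neg₁_eq_cauchyNeg h0 (fun z hz => (hp.2 z hz).1.2) hp.1
  rw [Toroidal.pd_congr h2, pd_circ (g := fun x : ℂ × ℂ × E => f (x.1, x.2.2) * (x.2.1 - x.1)⁻¹) h0
    (contDiffAt_cauchyNeg_integrand (p := (k, q')) (fun z hz => (h1 z hz).1.1) hk),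
    Toroidal.negU, neg₁_eq_cauchyNeg h0 (fun z hz => (h1 z hz).2.2) hk]
  unfold cauchyNeg circ
  congr 1
  refine circleIntegral.integral_congr h0.le fun z hz => ?_
  have hz' : ‖z‖ = R := by simpa using hz
  have hne : k - z ≠ 0 := by
    intro h
    rw [sub_eq_zero.1 h, hz'] at hk
    exact lt_irrefl _ hk
  have h3 : HasFDerivAt f _ (z, q') :=
    ((h1 z hz'.ge).1.1.differentiableAt (by simp)).hasFDerivAt
  have h4 : HasFDerivAt (fun x : ℂ × ℂ × E => (x.1, x.2.2))
      ((ContinuousLinearMap.fst ℝ ℂ (ℂ × E)).prod ((ContinuousLinearMap.snd ℝ ℂ E).comp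
        (ContinuousLinearMap.snd ℝ ℂ (ℂ × E)))) (z, k, q') :=
    hasFDerivAt_fst.prodMk (hasFDerivAt_snd.comp (z, k, q') hasFDerivAt_snd)
  have h5 : HasFDerivAt (fun x : ℂ × ℂ × E => f (x.1, x.2.2)) _ (z, k, q') :=
    HasFDerivAt.comp (z, k, q') (f := fun x : ℂ × ℂ × E => (x.1, x.2.2)) h3 h4
  have h6 : DifferentiableAt ℝ (fun x : ℂ × ℂ × E => (x.2.1 - x.1)⁻¹) (z, k, q') :=
    DifferentiableAt.inv (by fun_prop) hne
  have h7 : HasFDerivAt (fun x : ℂ × ℂ × E => x.2.1 - x.1)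
      ((ContinuousLinearMap.fst ℝ ℂ E).comp (ContinuousLinearMap.snd ℝ ℂ (ℂ × E))
        - ContinuousLinearMap.fst ℝ ℂ (ℂ × E)) (z, k, q') :=
    (hasFDerivAt_fst.comp (z, k, q') hasFDerivAt_snd).sub hasFDerivAt_fst
  have h8 : pd (0, 0, v) (fun x : ℂ × ℂ × E => (x.2.1 - x.1)⁻¹) (z, k, q') = 0 := by
    rw [pd_holomorphic_comp (F := fun w : ℂ => w⁻¹) (p := (z, k, q'))
      (c := fun x : ℂ × ℂ × E => x.2.1 - x.1) (differentiableAt_inv hne) h7.differentiableAt]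
    have : pd (0, 0, v) (fun x : ℂ × ℂ × E => x.2.1 - x.1) (z, k, q') = 0 := by
      unfold pd
      rw [h7.fderiv]; simp
    rw [this, map_zero]
  have h9 : pd (0, 0, v) (fun x : ℂ × ℂ × E => f (x.1, x.2.2)) (z, k, q')
      = pd (0, v) f (z, q') := by
    have := congrArg (fun T => T (0, 0, v)) h5.fderiv
    simpa [pd, Function.comp_def] using this
  change pd (0, 0, v) (fun x : ℂ × ℂ × E => f (x.1, x.2.2) * (x.2.1 - x.1)⁻¹) (z, k, q') = _
  rw [pd_mul h5.differentiableAt h6, h8, h9]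
  ring

namespace HolSmooth

/-- `f` vanishes at infinity, for parameters near `q`. -/
def Vanishes (f : ℂ × E → ℂ) (q : E) : Prop :=
  ∀ᶠ q' in 𝓝 q, Tendsto (fun z => f (z, q')) (Bornology.cobounded ℂ) (𝓝 0)

theorem eq_negU (hf : HolSmooth f q) (h : Vanishes f q) : Toroidal.negU f =ᶠ[nearInf q] f := by
  refine hf.negU.eventuallyEq hf ?_
  filter_upwards [h, hf.param] with q' h1 h2
  filter_upwards [neg₁_eventuallyEq h2.holInf h1] with z hz
  simpa only [Toroidal.negU] using hz

theorem vanishes_negU (hf : HolSmooth f q) : Vanishes (Toroidal.negU f) q := by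
  filter_upwards [hf.param] with q' h
  exact (neg₁_OInf h.holInf).tendsto

theorem vanishes_congr (h : f =ᶠ[nearInf q] g) (hf : Vanishes g q) : Vanishes f q := by
  filter_upwards [Eventually.nearInf_param h, hf] with q' h1 h2
  exact h2.congr' ((Eventually.nearInf_self h1).mono fun z hz => hz.symm)

/-- A function that vanishes at infinity is its own negative part, so its parameter derivative is
again a negative part. -/
theorem vanishes_pd (hf : HolSmooth f q) (h : Vanishes f q) (v : E) :
    Vanishes (Toroidal.pd (0, v) f) q := by
  have h1 := (HolSmooth.pd_congr (hf.eq_negU h) (0, v)).symm.trans (Toroidal.pd_negU hf v)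
  exact vanishes_congr h1 (hf.pd (0, v)).vanishes_negU

theorem Vanishes.oInf (h : Vanishes f q) (hf : HolSmooth f q) : OInf 1 (fun z => f (z, q)) :=
  OInf.of_tendsto hf.holInf h.self_of_nhds

theorem oInf_pd_fst (hf : HolSmooth f q) {n : ℕ} (h : OInf n (fun z => f (z, q))) :
    OInf (n + 1) (fun z => Toroidal.pd (1, 0) f (z, q)) :=
  (OInf.deriv hf.holInf h).congr hf.pd_fst_eq_deriv

end HolSmooth

/-! ### The bracket on functions of `(k, ε, x, θ₁, θ₂)` -/

/-- The parameters `(ε, x, θ₁, θ₂)`, where `ε` is the parameter of a family of states. -/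
abbrev Par : Type := ℝ × ℝ × ℝ × ℝ

def vk : ℂ × Par := (1, 0)
def vε : ℂ × Par := (0, 1, 0, 0, 0)
def vx : ℂ × Par := (0, 0, 1, 0, 0)
def v₁ : ℂ × Par := (0, 0, 0, 1, 0)
def v₂ : ℂ × Par := (0, 0, 0, 0, 1)

/-- The bracket in `(θ₁, θ₂)`. -/
def brθ (f g : ℂ × Par → ℂ) : ℂ × Par → ℂ := fun p =>
  pd v₁ f p * pd v₂ g p - pd v₂ f p * pd v₁ g p

/-- The bracket `{f, g}_{kx} + {f, g}_θ`. -/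
def br (f g : ℂ × Par → ℂ) : ℂ × Par → ℂ := fun p =>
  (pd vk f p * pd vx g p - pd vx f p * pd vk g p) + (pd v₁ f p * pd v₂ g p - pd v₂ f p * pd v₁ g p)

section br

variable {f g h : ℂ × Par → ℂ} {p : ℂ × Par} {q : Par}

theorem dAt {X : Type} [NormedAddCommGroup X] [NormedSpace ℝ X] {f : X → ℂ} {p : X}
    (hf : ContDiffAt ℝ ∞ f p) : DifferentiableAt ℝ f p :=
  hf.differentiableAt (by simp)

theorem contDiffAt_br (hf : ContDiffAt ℝ ∞ f p) (hg : ContDiffAt ℝ ∞ g p) :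
    ContDiffAt ℝ ∞ (br f g) p :=
  (((contDiffAt_pd hf _).mul (contDiffAt_pd hg _)).sub
    ((contDiffAt_pd hf _).mul (contDiffAt_pd hg _))).add
  (((contDiffAt_pd hf _).mul (contDiffAt_pd hg _)).sub
    ((contDiffAt_pd hf _).mul (contDiffAt_pd hg _)))

theorem HolSmooth.brθ (hf : HolSmooth f q) (hg : HolSmooth g q) : HolSmooth (brθ f g) q :=
  ((hf.pd _).mul (hg.pd _)).sub ((hf.pd _).mul (hg.pd _))

theorem HolSmooth.br (hf : HolSmooth f q) (hg : HolSmooth g q) : HolSmooth (br f g) q :=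
  (((hf.pd _).mul (hg.pd _)).sub ((hf.pd _).mul (hg.pd _))).add
    (((hf.pd _).mul (hg.pd _)).sub ((hf.pd _).mul (hg.pd _)))

theorem br_congr {f' g' : ℂ × Par → ℂ} (hf : f =ᶠ[𝓝 p] f') (hg : g =ᶠ[𝓝 p] g') :
    br f g p = br f' g' p := by
  simp only [br, pd_congr hf, pd_congr hg]

theorem br_congr_nearInf {f' g' : ℂ × Par → ℂ} (hf : f =ᶠ[nearInf q] f')
    (hg : g =ᶠ[nearInf q] g') : br f g =ᶠ[nearInf q] br f' g' := by
  filter_upwards [Eventually.nearInf_nhds hf, Eventually.nearInf_nhds hg] with p h1 h2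
  exact br_congr h1 h2

theorem pd_br (hf : ContDiffAt ℝ ∞ f p) (hg : ContDiffAt ℝ ∞ g p) (v : ℂ × Par) :
    pd v (br f g) p = br (pd v f) g p + br f (pd v g) p := by
  have df : ∀ w, DifferentiableAt ℝ (pd w f) p := fun w => dAt (contDiffAt_pd hf w)
  have dg : ∀ w, DifferentiableAt ℝ (pd w g) p := fun w => dAt (contDiffAt_pd hg w)
  unfold br
  have dm : ∀ w w', DifferentiableAt ℝ (fun p => pd w f p * pd w' g p) p := fun w w' =>
    (df w).fun_mul (dg w')
  rw [pd_add ((dm vk vx).fun_sub (dm vx vk)) ((dm v₁ v₂).fun_sub (dm v₂ v₁)),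
    pd_sub (dm vk vx) (dm vx vk), pd_sub (dm v₁ v₂) (dm v₂ v₁),
    pd_mul (df _) (dg _), pd_mul (df _) (dg _), pd_mul (df _) (dg _), pd_mul (df _) (dg _),
    pd_comm hf v, pd_comm hf v, pd_comm hf v, pd_comm hf v,
    pd_comm hg v, pd_comm hg v, pd_comm hg v, pd_comm hg v]
  ring

theorem br_sub_left (hf : DifferentiableAt ℝ f p) (hg : DifferentiableAt ℝ g p) :
    br (fun p => f p - g p) h p = br f h p - br g h p := by
  simp only [br, pd_sub hf hg]; ring

theorem br_const_right (c : ℂ) : br f (fun _ => c) p = 0 := by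
  simp only [br, pd_const]; ring

-- The bracket has constant coefficients, so after the Leibniz rule only the symmetry of second
-- derivatives is needed; it is used to put all mixed derivatives into one fixed order.
set_option maxHeartbeats 800000 in
theorem br_jacobi (hf : ContDiffAt ℝ ∞ f p) (hg : ContDiffAt ℝ ∞ g p) (hh : ContDiffAt ℝ ∞ h p) :
    br f (br g h) p = br (br f g) h p + br g (br f h) p := by
  have e : ∀ {F : ℂ × Par → ℂ}, ContDiffAt ℝ ∞ F p →
      pd vx (pd vk F) p = pd vk (pd vx F) p ∧ pd v₁ (pd vk F) p = pd vk (pd v₁ F) p ∧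
      pd v₂ (pd vk F) p = pd vk (pd v₂ F) p ∧ pd v₁ (pd vx F) p = pd vx (pd v₁ F) p ∧
      pd v₂ (pd vx F) p = pd vx (pd v₂ F) p ∧ pd v₂ (pd v₁ F) p = pd v₁ (pd v₂ F) p :=
    fun hF => ⟨pd_comm hF _ _, pd_comm hF _ _, pd_comm hF _ _, pd_comm hF _ _, pd_comm hF _ _,
      pd_comm hF _ _⟩
  obtain ⟨a1, a2, a3, a4, a5, a6⟩ := e hf
  obtain ⟨b1, b2, b3, b4, b5, b6⟩ := e hg
  obtain ⟨c1, c2, c3, c4, c5, c6⟩ := e hh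
  have e1 : br f (br g h) p = (pd vk f p * pd vx (br g h) p - pd vx f p * pd vk (br g h) p)
      + (pd v₁ f p * pd v₂ (br g h) p - pd v₂ f p * pd v₁ (br g h) p) := rfl
  have e2 : br (br f g) h p = (pd vk (br f g) p * pd vx h p - pd vx (br f g) p * pd vk h p)
      + (pd v₁ (br f g) p * pd v₂ h p - pd v₂ (br f g) p * pd v₁ h p) := rfl
  have e3 : br g (br f h) p = (pd vk g p * pd vx (br f h) p - pd vx g p * pd vk (br f h) p)
      + (pd v₁ g p * pd v₂ (br f h) p - pd v₂ g p * pd v₁ (br f h) p) := rfl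
  rw [e1, e2, e3]
  simp only [pd_br hg hh, pd_br hf hg, pd_br hf hh]
  simp only [br, a1, a2, a3, a4, a5, a6, b1, b2, b3, b4, b5, b6, c1, c2, c3, c4, c5, c6]
  ring

end br

/-! ### Families of functions of `(k, x, θ₁, θ₂)` -/

/-- A family of functions of `(k, x, θ₁, θ₂)`, as one function. -/
def unc (F : ℝ → PhaseFun) : ℂ × Par → ℂ := fun p => F p.2.1 p.1 p.2.2.1 p.2.2.2.1 p.2.2.2.2

section unc

variable {F G : ℝ → PhaseFun} {ε x a b : ℝ} {k : ℂ} {q : Par}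

theorem deriv_param {f : ℂ × Par → ℂ} {γ : ℝ → ℂ × Par} {t : ℝ} {v : ℂ × Par}
    (hf : DifferentiableAt ℝ f (γ t)) (hγ : HasDerivAt γ v t) :
    HasDerivAt (fun s => f (γ s)) (pd v f (γ t)) t :=
  hf.hasFDerivAt.comp_hasDerivAt t hγ

theorem hasDerivAt_ε {f : ℂ × Par → ℂ} (hf : DifferentiableAt ℝ f (k, ε, x, a, b)) :
    HasDerivAt (fun s => f (k, s, x, a, b)) (pd vε f (k, ε, x, a, b)) ε := by
  refine deriv_param (γ := fun s => (k, s, x, a, b)) hf ?_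
  exact (hasDerivAt_const _ _).prodMk ((hasDerivAt_id _).prodMk ((hasDerivAt_const _ _).prodMk
    ((hasDerivAt_const _ _).prodMk (hasDerivAt_const _ _))))

theorem hasDerivAt_x {f : ℂ × Par → ℂ} (hf : DifferentiableAt ℝ f (k, ε, x, a, b)) :
    HasDerivAt (fun s => f (k, ε, s, a, b)) (pd vx f (k, ε, x, a, b)) x := by
  refine deriv_param (γ := fun s => (k, ε, s, a, b)) hf ?_
  exact (hasDerivAt_const _ _).prodMk ((hasDerivAt_const _ _).prodMk ((hasDerivAt_id _).prodMk
    ((hasDerivAt_const _ _).prodMk (hasDerivAt_const _ _))))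

theorem hasDerivAt_θ₁ {f : ℂ × Par → ℂ} (hf : DifferentiableAt ℝ f (k, ε, x, a, b)) :
    HasDerivAt (fun s => f (k, ε, x, s, b)) (pd v₁ f (k, ε, x, a, b)) a := by
  refine deriv_param (γ := fun s => (k, ε, x, s, b)) hf ?_
  exact (hasDerivAt_const _ _).prodMk ((hasDerivAt_const _ _).prodMk ((hasDerivAt_const _ _).prodMk
    ((hasDerivAt_id _).prodMk (hasDerivAt_const _ _))))

theorem hasDerivAt_θ₂ {f : ℂ × Par → ℂ} (hf : DifferentiableAt ℝ f (k, ε, x, a, b)) :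
    HasDerivAt (fun s => f (k, ε, x, a, s)) (pd v₂ f (k, ε, x, a, b)) b := by
  refine deriv_param (γ := fun s => (k, ε, x, a, s)) hf ?_
  exact (hasDerivAt_const _ _).prodMk ((hasDerivAt_const _ _).prodMk ((hasDerivAt_const _ _).prodMk
    ((hasDerivAt_const _ _).prodMk (hasDerivAt_id _))))

theorem dk_eq (hf : DifferentiableAt ℝ (unc F) (k, ε, x, a, b))
    (hc : DifferentiableAt ℂ (fun z => unc F (z, ε, x, a, b)) k) :
    dk (F ε) k x a b = pd vk (unc F) (k, ε, x, a, b) :=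
  (pd_fst_eq_deriv (p := (k, ε, x, a, b)) hf hc).symm

theorem dx_eq (hf : DifferentiableAt ℝ (unc F) (k, ε, x, a, b)) :
    dx (F ε) k x a b = pd vx (unc F) (k, ε, x, a, b) := (hasDerivAt_x hf).deriv

theorem dθ₁_eq (hf : DifferentiableAt ℝ (unc F) (k, ε, x, a, b)) :
    dθ₁ (F ε) k x a b = pd v₁ (unc F) (k, ε, x, a, b) := (hasDerivAt_θ₁ hf).deriv

theorem dθ₂_eq (hf : DifferentiableAt ℝ (unc F) (k, ε, x, a, b)) :
    dθ₂ (F ε) k x a b = pd v₂ (unc F) (k, ε, x, a, b) := (hasDerivAt_θ₂ hf).deriv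

theorem unc_dk (hF : HolSmooth (unc F) q) : unc (fun ε => dk (F ε)) =ᶠ[nearInf q] pd vk (unc F) := by
  filter_upwards [hF] with p hp using dk_eq (dAt hp.1) hp.2

theorem unc_bracket (hF : HolSmooth (unc F) q) (hG : HolSmooth (unc G) q) :
    unc (fun ε => bracket (F ε) (G ε)) =ᶠ[nearInf q] br (unc F) (unc G) := by
  filter_upwards [hF, hG] with ⟨k, ε, x, a, b⟩ hp hp'
  change bracket (F ε) (G ε) k x a b = _
  simp only [bracket, br, dk_eq (dAt hp.1) hp.2, dk_eq (dAt hp'.1) hp'.2, dx_eq (dAt hp.1),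
    dx_eq (dAt hp'.1), dθ₁_eq (dAt hp.1), dθ₁_eq (dAt hp'.1), dθ₂_eq (dAt hp.1), dθ₂_eq (dAt hp'.1)]

end unc

/-! ### Generating series of families of coefficients -/

/-- The generating series `∑ z n * k ^ (-n-1)`. -/
def gen (z : ℝ → ℕ → ℝ → ℝ → ℝ → ℂ) : ℂ × Par → ℂ := fun p =>
  ∑' n : ℕ, z p.2.1 n p.2.2.1 p.2.2.2.1 p.2.2.2.2 * p.1 ^ (-(n + 1 : ℤ))

/-- The family `z` consists of the Laurent coefficients of a function that is smooth and
holomorphic near infinity, and vanishes there, for `x` in `Ω`. -/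
def NiceGen (Ω : Set ℝ) (z : ℝ → ℕ → ℝ → ℝ → ℝ → ℂ) : Prop :=
  ∀ ε, ∀ x ∈ Ω, ∀ a b, HolSmooth (gen z) (ε, x, a, b) ∧ HolSmooth.Vanishes (gen z) (ε, x, a, b) ∧
    ∀ n : ℕ, z ε n x a b = laurentCoeff (fun k => gen z (k, ε, x, a, b)) (-(n + 1 : ℤ))

section gen

variable {Ω : Set ℝ} {z y : ℝ → ℕ → ℝ → ℝ → ℝ → ℂ}

theorem eventually_mem_nearInf (hΩ : IsOpen Ω) {q : Par} (hq : q.2.1 ∈ Ω) :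
    ∀ᶠ q' : Par in 𝓝 q, q'.2.1 ∈ Ω :=
  (continuous_fst.comp continuous_snd).continuousAt.eventually (hΩ.mem_nhds hq)

theorem gen_eq_of_laurentCoeff (hΩ : IsOpen Ω) {G : ℂ × Par → ℂ}
    (h1 : ∀ q : Par, q.2.1 ∈ Ω → HolSmooth G q)
    (h2 : ∀ q : Par, q.2.1 ∈ Ω → HolSmooth.Vanishes G q)
    (h3 : ∀ ε, ∀ x ∈ Ω, ∀ a b, ∀ n : ℕ,
      z ε n x a b = laurentCoeff (fun k => G (k, ε, x, a, b)) (-(n + 1 : ℤ)))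
    {q : Par} (hq : q.2.1 ∈ Ω) : gen z =ᶠ[nearInf q] G := by
  have h4 : gen z =ᶠ[nearInf q] negU G := by
    have := (tendsto_snd (f := Bornology.cobounded ℂ) (g := 𝓝 q)).eventually
      (eventually_mem_nearInf hΩ hq)
    filter_upwards [this] with ⟨k, ε, x, a, b⟩ hp
    simp only [gen, negU, neg₁, h3 ε x hp a b]
  exact h4.trans ((h1 q hq).eq_negU (h2 q hq))

theorem NiceGen.of_laurentCoeff (hΩ : IsOpen Ω) {G : ℂ × Par → ℂ}
    (h1 : ∀ q : Par, q.2.1 ∈ Ω → HolSmooth G q)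
    (h2 : ∀ q : Par, q.2.1 ∈ Ω → HolSmooth.Vanishes G q)
    (h3 : ∀ ε, ∀ x ∈ Ω, ∀ a b, ∀ n : ℕ,
      z ε n x a b = laurentCoeff (fun k => G (k, ε, x, a, b)) (-(n + 1 : ℤ))) : NiceGen Ω z := by
  intro ε x hx a b
  have h := gen_eq_of_laurentCoeff hΩ h1 h2 h3 (q := (ε, x, a, b)) hx
  refine ⟨(h1 _ hx).congr h, HolSmooth.vanishes_congr h (h2 _ hx), fun n => ?_⟩
  rw [h3 ε x hx, laurentCoeff_congr (Eventually.nearInf_self h)]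

/-- A shift of a family along another one, as a family depending on `ε`. -/
theorem NiceGen.shift (hΩ : IsOpen Ω) {z y : ℕ → ℝ → ℝ → ℝ → ℂ} (hz : NiceGen Ω (fun _ => z))
    (hy : NiceGen Ω (fun _ => y)) : NiceGen Ω (fun ε n x a b => z n x a b + ε * y n x a b) ∧
    ∀ q : Par, q.2.1 ∈ Ω → gen (fun ε n x a b => z n x a b + ε * y n x a b) =ᶠ[nearInf q]
      fun p => gen (fun _ => z) p + p.2.1 * gen (fun _ => y) p := by
  have hs : ∀ q : Par, HolSmooth (fun p : ℂ × Par => ((p.2.1 : ℝ) : ℂ)) q := fun q =>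
    HolSmooth.of_param (g := fun q : Par => ((q.1 : ℝ) : ℂ))
      (Eventually.of_forall fun q' => (Complex.ofRealCLM.contDiff.comp contDiff_fst).contDiffAt)
  have h1 : ∀ q : Par, q.2.1 ∈ Ω → HolSmooth (fun p =>
      gen (fun _ => z) p + p.2.1 * gen (fun _ => y) p) q := fun q hq =>
    (hz q.1 q.2.1 hq q.2.2.1 q.2.2.2).1.add ((hs q).mul (hy q.1 q.2.1 hq q.2.2.1 q.2.2.2).1)
  have h2 : ∀ q : Par, q.2.1 ∈ Ω → HolSmooth.Vanishes (fun p =>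
      gen (fun _ => z) p + p.2.1 * gen (fun _ => y) p) q := by
    intro q hq
    filter_upwards [(hz q.1 q.2.1 hq q.2.2.1 q.2.2.2).2.1,
      (hy q.1 q.2.1 hq q.2.2.1 q.2.2.2).2.1] with q' h1 h2
    simpa using h1.add (h2.const_mul (q'.1 : ℂ))
  have h3 : ∀ ε : ℝ, ∀ x ∈ Ω, ∀ a b, ∀ n : ℕ, z n x a b + ε * y n x a b
      = laurentCoeff (fun k => gen (fun _ => z) (k, ε, x, a, b) +
        ε * gen (fun _ => y) (k, ε, x, a, b)) (-(n + 1 : ℤ)) := by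
    intro ε x hx a b n
    obtain ⟨a1, -, a3⟩ := hz ε x hx a b
    obtain ⟨b1, -, b3⟩ := hy ε x hx a b
    rw [laurentCoeff_add a1.holInf ((HolInf.const _).mul b1.holInf),
      laurentCoeff_const_mul _ b1.holInf, ← a3, ← b3]
  exact ⟨NiceGen.of_laurentCoeff hΩ h1 h2 h3, fun q hq => gen_eq_of_laurentCoeff hΩ h1 h2 h3 hq⟩

/-- The members of a family depending on `ε`. -/
theorem NiceGen.slice (hz : NiceGen Ω z) (ε₀ : ℝ) : NiceGen Ω (fun _ => z ε₀) := by
  intro ε x hx a b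
  obtain ⟨h1, h2, h3⟩ := hz ε₀ x hx a b
  have hφ : ContDiff ℝ ∞ (fun q : Par => ((ε₀, q.2) : Par)) :=
    contDiff_const.prodMk contDiff_snd
  refine ⟨HolSmooth.comp_right (φ := fun q : Par => ((ε₀, q.2) : Par)) (q := (ε, x, a, b))
    (f := gen z) h1 (Eventually.of_forall fun q => hφ.contDiffAt), ?_, h3⟩
  exact (hφ.continuous.tendsto (ε, x, a, b)).eventually h2

end gen

/-! ### The sums over the times -/

/-- The entire function whose partial derivatives are `timeM` and `timeV`. -/
def timeT (t : ℕ → ℤ → ℂ) (p : ℂ × ℂ) : ℂ :=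
  ∑' i : ℕ × ℤ, t i.1 i.2 * p.1 ^ i.1 * Complex.exp (Complex.I * i.2 * p.2)

section times

variable {t : ℕ → ℤ → ℂ}

theorem norm_exp_I_mul_le {α : ℤ} {w : ℂ} {r : ℝ} (hw : ‖w‖ ≤ r) :
    ‖Complex.exp (Complex.I * α * w)‖ ≤ Real.exp (r * |(α : ℝ)|) := by
  rw [Complex.norm_exp]
  refine Real.exp_le_exp.2 ((Complex.re_le_norm _).trans ?_)
  rw [norm_mul, norm_mul, Complex.norm_I, one_mul, Complex.norm_intCast, mul_comm]
  gcongr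

/-- Exhibiting both time sums as partial derivatives of a single entire function of two variables
yields their joint holomorphy at once. -/
theorem hasFDerivAt_timeT (ht : EntireTimes t) (p : ℂ × ℂ) :
    ∃ T : ℂ × ℂ →L[ℂ] ℂ, HasFDerivAt (timeT t) T p ∧ T (1, 0) = timeM t p.1 p.2 ∧
      T (0, 1) = timeV t p.1 p.2 := by
  obtain ⟨r, hr1, hrp⟩ : ∃ r : ℝ, 1 ≤ r ∧ p ∈ Metric.ball (0 : ℂ × ℂ) r :=
    ⟨‖p‖ + 1, by linarith [norm_nonneg p], by simp⟩
  let c₁ : ℕ × ℤ → ℂ × ℂ → ℂ := fun i p =>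
    (i.1 : ℂ) * t i.1 i.2 * p.1 ^ (i.1 - 1) * Complex.exp (Complex.I * i.2 * p.2)
  let c₂ : ℕ × ℤ → ℂ × ℂ → ℂ := fun i p =>
    Complex.I * i.2 * t i.1 i.2 * p.1 ^ i.1 * Complex.exp (Complex.I * i.2 * p.2)
  let f' : ℕ × ℤ → ℂ × ℂ → ℂ × ℂ →L[ℂ] ℂ := fun i p =>
    c₁ i p • ContinuousLinearMap.fst ℂ ℂ ℂ + c₂ i p • ContinuousLinearMap.snd ℂ ℂ ℂ
  have hf : ∀ i : ℕ × ℤ, ∀ p : ℂ × ℂ, HasFDerivAt (fun p : ℂ × ℂ =>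
      t i.1 i.2 * p.1 ^ i.1 * Complex.exp (Complex.I * i.2 * p.2)) (f' i p) p := by
    intro i p
    have h1 : HasFDerivAt (fun p : ℂ × ℂ => p.1 ^ i.1) _ p :=
      (hasDerivAt_pow i.1 p.1).comp_hasFDerivAt p (hasFDerivAt_fst (𝕜 := ℂ) (F := ℂ))
    have h2 : HasFDerivAt (fun p : ℂ × ℂ => Complex.I * i.2 * p.2) _ p :=
      (hasFDerivAt_snd (𝕜 := ℂ) (E := ℂ) (F := ℂ)).const_mul (Complex.I * i.2)
    have h3 := (h1.const_mul (t i.1 i.2)).mul h2.cexp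
    refine h3.congr_fderiv ?_
    refine ContinuousLinearMap.ext fun x => ?_
    simp [f', c₁, c₂]
    ring
  -- Differentiation brings down the factors `n` and `α`; they are absorbed by `n ≤ 2 ^ n` and `|α|
  -- ≤ exp |α|`, whence the radius `2 * r` and the exponent `r + 1`.
  have hu := (ht (2 * r) (r + 1) (by linarith) (by linarith)).mul_left 2
  have hbound : ∀ i : ℕ × ℤ, ∀ p ∈ Metric.ball (0 : ℂ × ℂ) r, ‖f' i p‖ ≤
      2 * (‖t i.1 i.2‖ * (2 * r) ^ i.1 * Real.exp ((r + 1) * |(i.2 : ℝ)|)) := by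
    intro i p hp
    have hp' : ‖p‖ < r := by simpa using hp
    have hp1 : ‖p.1‖ ≤ r := (norm_fst_le p).trans hp'.le
    have hp2 : ‖p.2‖ ≤ r := (norm_snd_le p).trans hp'.le
    have he := norm_exp_I_mul_le (α := i.2) hp2
    have hn : (i.1 : ℝ) ≤ 2 ^ i.1 := by exact_mod_cast (Nat.lt_two_pow_self).le
    have hα : |(i.2 : ℝ)| ≤ Real.exp |(i.2 : ℝ)| := by
      linarith [Real.add_one_le_exp |(i.2 : ℝ)|]
    have hexp : Real.exp ((r + 1) * |(i.2 : ℝ)|)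
      = Real.exp (r * |(i.2 : ℝ)|) * Real.exp |(i.2 : ℝ)| := by rw [← Real.exp_add]; ring_nf
    have h1 : ‖c₁ i p‖ ≤ ‖t i.1 i.2‖ * (2 * r) ^ i.1 * Real.exp ((r + 1) * |(i.2 : ℝ)|) := by
      simp only [c₁, norm_mul, norm_pow, Complex.norm_natCast]
      calc (i.1 : ℝ) * ‖t i.1 i.2‖ * ‖p.1‖ ^ (i.1 - 1) * ‖Complex.exp (Complex.I * i.2 * p.2)‖
          ≤ 2 ^ i.1 * ‖t i.1 i.2‖ * r ^ i.1 * Real.exp (r * |(i.2 : ℝ)|) := by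
            gcongr
            exact (pow_le_pow_left₀ (norm_nonneg _) hp1 _).trans
              (pow_le_pow_right₀ hr1 (Nat.sub_le _ _))
        _ ≤ 2 ^ i.1 * ‖t i.1 i.2‖ * r ^ i.1 * Real.exp ((r + 1) * |(i.2 : ℝ)|) := by
            gcongr; linarith
        _ = _ := by rw [mul_pow]; ring
    have h2 : ‖c₂ i p‖ ≤ ‖t i.1 i.2‖ * (2 * r) ^ i.1 * Real.exp ((r + 1) * |(i.2 : ℝ)|) := by
      simp only [c₂, norm_mul, norm_pow, Complex.norm_intCast, Complex.norm_I, one_mul]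
      calc |(i.2 : ℝ)| * ‖t i.1 i.2‖ * ‖p.1‖ ^ i.1 * ‖Complex.exp (Complex.I * i.2 * p.2)‖
          ≤ Real.exp |(i.2 : ℝ)| * ‖t i.1 i.2‖ * (2 * r) ^ i.1 * Real.exp (r * |(i.2 : ℝ)|) := by
            gcongr; linarith
        _ = _ := by rw [hexp]; ring
    calc ‖f' i p‖ ≤ ‖c₁ i p • ContinuousLinearMap.fst ℂ ℂ ℂ‖
          + ‖c₂ i p • ContinuousLinearMap.snd ℂ ℂ ℂ‖ := norm_add_le _ _
      _ ≤ ‖c₁ i p‖ * 1 + ‖c₂ i p‖ * 1 := by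
          rw [norm_smul, norm_smul]
          gcongr
          · exact ContinuousLinearMap.norm_fst_le ℂ ℂ ℂ
          · exact ContinuousLinearMap.norm_snd_le ℂ ℂ ℂ
      _ ≤ _ := by linarith
  have h0 : Summable fun i : ℕ × ℤ =>
      t i.1 i.2 * p.1 ^ i.1 * Complex.exp (Complex.I * i.2 * p.2) := by
    have hp' : ‖p‖ < r := by simpa using hrp
    refine Summable.of_norm_bounded (ht r r (by linarith) (by linarith)) fun i => ?_
    rw [norm_mul, norm_mul, norm_pow]
    gcongr
    · exact (norm_fst_le p).trans hp'.le
    · exact norm_exp_I_mul_le ((norm_snd_le p).trans hp'.le)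
  have hd := hasFDerivAt_tsum_of_isPreconnected hu Metric.isOpen_ball
    (convex_ball (0 : ℂ × ℂ) r).isPreconnected (fun i p _ => hf i p) hbound hrp h0 hrp
  have hs : Summable fun i => f' i p := Summable.of_norm_bounded hu fun i => hbound i p hrp
  refine ⟨_, hd, ?_, ?_⟩
  · have := (hs.hasSum.mapL (ContinuousLinearMap.apply ℂ ℂ ((1, 0) : ℂ × ℂ))).tsum_eq
    rw [ContinuousLinearMap.apply_apply] at this
    rw [← this]
    refine tsum_congr fun i => ?_
    simp only [f', c₁, ContinuousLinearMap.apply_apply, add_apply,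
      smul_apply, ContinuousLinearMap.coe_fst', ContinuousLinearMap.coe_snd',
      smul_eq_mul, mul_one, mul_zero, add_zero]
    obtain ⟨n, α⟩ := i
    -- At `n = 0` the truncated exponent and the integer exponent `-1` disagree, but the factor `n`
    -- is zero.
    cases n with
    | zero => simp
    | succ n =>
      congr 2
      rw [← zpow_natCast]
      congr 1
      simp
  · have := (hs.hasSum.mapL (ContinuousLinearMap.apply ℂ ℂ ((0, 1) : ℂ × ℂ))).tsum_eq
    rw [ContinuousLinearMap.apply_apply] at this
    rw [← this]
    refine tsum_congr fun i => ?_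
    simp [f', c₂]

theorem differentiableOn_timeT (ht : EntireTimes t) : DifferentiableOn ℂ (timeT t) univ := by
  intro p _
  obtain ⟨T, hT, -⟩ := hasFDerivAt_timeT ht p
  exact hT.differentiableAt.differentiableWithinAt

theorem differentiable_timeM (ht : EntireTimes t) :
    Differentiable ℂ (fun p : ℂ × ℂ => timeM t p.1 p.2) := by
  have : (fun p : ℂ × ℂ => timeM t p.1 p.2) = fun p => fderiv ℂ (timeT t) p (1, 0) := by
    funext p
    obtain ⟨T, hT, h1, -⟩ := hasFDerivAt_timeT ht p
    rw [hT.fderiv, h1]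
  rw [this, ← differentiableOn_univ]
  exact differentiableOn_fderiv_apply isOpen_univ (differentiableOn_timeT ht) _

theorem differentiable_timeV (ht : EntireTimes t) :
    Differentiable ℂ (fun p : ℂ × ℂ => timeV t p.1 p.2) := by
  have : (fun p : ℂ × ℂ => timeV t p.1 p.2) = fun p => fderiv ℂ (timeT t) p (0, 1) := by
    funext p
    obtain ⟨T, hT, -, h1⟩ := hasFDerivAt_timeT ht p
    rw [hT.fderiv, h1]
  rw [this, ← differentiableOn_univ]
  exact differentiableOn_fderiv_apply isOpen_univ (differentiableOn_timeT ht) _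

theorem exp_I_mul_add_two_pi (α : ℤ) (w : ℂ) :
    Complex.exp (Complex.I * α * (w + 2 * π)) = Complex.exp (Complex.I * α * w) := by
  rw [show Complex.I * α * (w + 2 * π) = Complex.I * α * w + α * (2 * π * Complex.I) by ring]
  exact Complex.exp_periodic.int_mul α _

theorem timeM_add_two_pi (l w : ℂ) : timeM t l (w + 2 * π) = timeM t l w := by
  simp only [timeM, exp_I_mul_add_two_pi]

theorem timeV_add_two_pi (l w : ℂ) : timeV t l (w + 2 * π) = timeV t l w := by
  simp only [timeV, exp_I_mul_add_two_pi]

end times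

/-! ### Symbols -/

/-- A symbol as a function on `ℂ × ℂ × ℂ × ℂ`. -/
def uncS (A : Symbol) : ℂ × ℂ × ℂ × ℂ → ℂ := fun p => A p.1 p.2.1 p.2.2.1 p.2.2.2

def dL (A : Symbol) : Symbol := fun l m u v => deriv (fun z => A z m u v) l
def dM (A : Symbol) : Symbol := fun l m u v => deriv (fun z => A l z u v) m
def dU (A : Symbol) : Symbol := fun l m u v => deriv (fun z => A l m z v) u
def dV (A : Symbol) : Symbol := fun l m u v => deriv (fun z => A l m u z) v

theorem isOpen_lt_norm_fst (ρ : ℝ) : IsOpen {p : ℂ × ℂ × ℂ × ℂ | ρ < ‖p.1‖} :=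
  isOpen_lt continuous_const (continuous_norm.comp continuous_fst)

section symbols

variable {A B : Symbol} {p : ℂ × ℂ × ℂ × ℂ}

theorem hasDerivAt_comp_curve {F : ℂ × ℂ × ℂ × ℂ → ℂ} {γ : ℂ → ℂ × ℂ × ℂ × ℂ}
    {v : ℂ × ℂ × ℂ × ℂ} {z : ℂ} (hF : DifferentiableAt ℂ F (γ z)) (hγ : HasDerivAt γ v z) :
    HasDerivAt (fun z => F (γ z)) (fderiv ℂ F (γ z) v) z :=
  hF.hasFDerivAt.comp_hasDerivAt z hγ

theorem hasDerivAt_dL {l m u v : ℂ} (h : DifferentiableAt ℂ (uncS A) (l, m, u, v)) :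
    HasDerivAt (fun z => A z m u v) (fderiv ℂ (uncS A) (l, m, u, v) (1, 0, 0, 0)) l :=
  hasDerivAt_comp_curve (γ := fun z => (z, m, u, v)) h
    ((hasDerivAt_id _).prodMk (hasDerivAt_const _ _))

theorem hasDerivAt_dM {l m u v : ℂ} (h : DifferentiableAt ℂ (uncS A) (l, m, u, v)) :
    HasDerivAt (fun z => A l z u v) (fderiv ℂ (uncS A) (l, m, u, v) (0, 1, 0, 0)) m :=
  hasDerivAt_comp_curve (γ := fun z => (l, z, u, v)) h
    ((hasDerivAt_const _ _).prodMk ((hasDerivAt_id _).prodMk (hasDerivAt_const _ _)))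

theorem hasDerivAt_dU {l m u v : ℂ} (h : DifferentiableAt ℂ (uncS A) (l, m, u, v)) :
    HasDerivAt (fun z => A l m z v) (fderiv ℂ (uncS A) (l, m, u, v) (0, 0, 1, 0)) u :=
  hasDerivAt_comp_curve (γ := fun z => (l, m, z, v)) h
    ((hasDerivAt_const _ _).prodMk ((hasDerivAt_const _ _).prodMk
      ((hasDerivAt_id _).prodMk (hasDerivAt_const _ _))))

theorem hasDerivAt_dV {l m u v : ℂ} (h : DifferentiableAt ℂ (uncS A) (l, m, u, v)) :
    HasDerivAt (fun z => A l m u z) (fderiv ℂ (uncS A) (l, m, u, v) (0, 0, 0, 1)) v :=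
  hasDerivAt_comp_curve (γ := fun z => (l, m, u, z)) h
    ((hasDerivAt_const _ _).prodMk ((hasDerivAt_const _ _).prodMk
      ((hasDerivAt_const _ _).prodMk (hasDerivAt_id _))))

theorem fderiv_uncS (h : DifferentiableAt ℂ (uncS A) p) (x : ℂ × ℂ × ℂ × ℂ) :
    fderiv ℂ (uncS A) p x = x.1 * uncS (dL A) p + x.2.1 * uncS (dM A) p
      + x.2.2.1 * uncS (dU A) p + x.2.2.2 * uncS (dV A) p := by
  obtain ⟨l, m, u, v⟩ := p
  obtain ⟨x1, x2, x3, x4⟩ := x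
  simp only [uncS, dL, dM, dU, dV, (hasDerivAt_dL h).deriv, (hasDerivAt_dM h).deriv,
    (hasDerivAt_dU h).deriv, (hasDerivAt_dV h).deriv]
  simp only [← smul_eq_mul, ← map_smul, ← map_add]
  congr 1
  simp

/-- Symbols built from the values of holomorphic operations on one symbol. -/
theorem IsSymbol.of_fderiv (hA : IsSymbol A) {B : Symbol} (w : ℂ × ℂ × ℂ × ℂ)
    (hB : ∀ p, DifferentiableAt ℂ (uncS A) p → uncS B p = fderiv ℂ (uncS A) p w) :
    IsSymbol B := by
  obtain ⟨ρ, hd, hp⟩ := hA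
  have ho := isOpen_lt_norm_fst ρ
  have hd' : ∀ p : ℂ × ℂ × ℂ × ℂ, ρ < ‖p.1‖ → DifferentiableAt ℂ (uncS A) p := fun p hp =>
    hd.differentiableAt (ho.mem_nhds hp)
  have hshift : ∀ (c p : ℂ × ℂ × ℂ × ℂ), c.1 = 0 → (∀ p' : ℂ × ℂ × ℂ × ℂ, ρ < ‖p'.1‖ →
      uncS A (p' + c) = uncS A p') → ρ < ‖p.1‖ → uncS B (p + c) = uncS B p := by
    intro c p hc h hp
    have hp' : ρ < ‖(p + c).1‖ := by simpa [hc] using hp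
    rw [hB _ (hd' _ hp'), hB _ (hd' _ hp), ← fderiv_comp_add_right]
    congr 1
    refine Filter.EventuallyEq.fderiv_eq ?_
    filter_upwards [ho.mem_nhds hp] with p' hp' using h p' hp'
  refine ⟨ρ, ?_, fun l m u v hl => ⟨?_, ?_⟩⟩
  · refine (differentiableOn_fderiv_apply ho hd w).congr fun p hp => ?_
    exact hB p (hd' p hp)
  · have := hshift (0, 0, 2 * π, 0) (l, m, u, v) rfl (fun p' hp' => by
      have := (hp p'.1 p'.2.1 p'.2.2.1 p'.2.2.2 hp').1
      simpa [uncS] using this) hl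
    simpa [uncS] using this
  · have := hshift (0, 0, 0, 2 * π) (l, m, u, v) rfl (fun p' hp' => by
      have := (hp p'.1 p'.2.1 p'.2.2.1 p'.2.2.2 hp').2
      simpa [uncS] using this) hl
    simpa [uncS] using this

theorem IsSymbol.dL (hA : IsSymbol A) : IsSymbol (dL A) :=
  hA.of_fderiv (1, 0, 0, 0) fun _ h => (hasDerivAt_dL h).deriv

theorem IsSymbol.dM (hA : IsSymbol A) : IsSymbol (dM A) :=
  hA.of_fderiv (0, 1, 0, 0) fun _ h => (hasDerivAt_dM h).deriv

theorem IsSymbol.dU (hA : IsSymbol A) : IsSymbol (dU A) :=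
  hA.of_fderiv (0, 0, 1, 0) fun _ h => (hasDerivAt_dU h).deriv

theorem IsSymbol.dV (hA : IsSymbol A) : IsSymbol (dV A) :=
  hA.of_fderiv (0, 0, 0, 1) fun _ h => (hasDerivAt_dV h).deriv

theorem IsSymbol.eventually (hA : IsSymbol A) : ∃ ρ : ℝ, 0 < ρ ∧ ∀ p : ℂ × ℂ × ℂ × ℂ, ρ < ‖p.1‖ →
    DifferentiableAt ℂ (uncS A) p := by
  obtain ⟨ρ, hd, -⟩ := hA
  refine ⟨max ρ 1, by positivity, fun p hp => ?_⟩
  exact hd.differentiableAt ((isOpen_lt_norm_fst ρ).mem_nhds ((le_max_left _ _).trans_lt hp))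

theorem IsSymbol.const (c : ℂ) : IsSymbol (fun _ _ _ _ => c) :=
  ⟨0, differentiableOn_const c, fun _ _ _ _ _ => ⟨rfl, rfl⟩⟩

theorem IsSymbol.bin (hA : IsSymbol A) (hB : IsSymbol B) {f : ℂ → ℂ → ℂ}
    (hf : Differentiable ℂ (fun p : ℂ × ℂ => f p.1 p.2)) :
    IsSymbol (fun l m u v => f (A l m u v) (B l m u v)) := by
  obtain ⟨ρ, hd, hp⟩ := hA
  obtain ⟨ρ', hd', hp'⟩ := hB
  have h1 : {p : ℂ × ℂ × ℂ × ℂ | max ρ ρ' < ‖p.1‖} ⊆ {p | ρ < ‖p.1‖} :=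
    fun p hp => (le_max_left ρ ρ').trans_lt (show max ρ ρ' < ‖p.1‖ from hp)
  have h2 : {p : ℂ × ℂ × ℂ × ℂ | max ρ ρ' < ‖p.1‖} ⊆ {p | ρ' < ‖p.1‖} :=
    fun p hp => (le_max_right ρ ρ').trans_lt (show max ρ ρ' < ‖p.1‖ from hp)
  refine ⟨max ρ ρ', ?_, fun l m u v hl => ?_⟩
  · exact hf.comp_differentiableOn ((hd.mono h1).prodMk (hd'.mono h2))
  · obtain ⟨a1, a2⟩ := hp l m u v ((le_max_left _ _).trans_lt hl)
    obtain ⟨b1, b2⟩ := hp' l m u v ((le_max_right _ _).trans_lt hl)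
    exact ⟨by simp only [a1, b1], by simp only [a2, b2]⟩

theorem IsSymbol.add (hA : IsSymbol A) (hB : IsSymbol B) :
    IsSymbol (fun l m u v => A l m u v + B l m u v) :=
  hA.bin hB (f := fun x y => x + y) (differentiable_fst.add differentiable_snd)

theorem IsSymbol.sub (hA : IsSymbol A) (hB : IsSymbol B) :
    IsSymbol (fun l m u v => A l m u v - B l m u v) :=
  hA.bin hB (f := fun x y => x - y) (differentiable_fst.sub differentiable_snd)

theorem IsSymbol.mul (hA : IsSymbol A) (hB : IsSymbol B) :
    IsSymbol (fun l m u v => A l m u v * B l m u v) :=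
  hA.bin hB (f := fun x y => x * y) (differentiable_fst.mul differentiable_snd)

theorem poisson_eq (A B : Symbol) : poisson A B = fun l m u v =>
    dL A l m u v * dM B l m u v - dM A l m u v * dL B l m u v
      + dU A l m u v * dV B l m u v - dV A l m u v * dU B l m u v := rfl

theorem IsSymbol.poisson (hA : IsSymbol A) (hB : IsSymbol B) : IsSymbol (poisson A B) :=
  (((hA.dL.mul hB.dM).sub (hA.dM.mul hB.dL)).add (hA.dU.mul hB.dV)).sub (hA.dV.mul hB.dU)

/-- An entire function has an entire primitive `H`, and the left side is `H m - H 0`. -/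
theorem hasDerivAt_mul_integral {G : ℂ → ℂ} (hG : Differentiable ℂ G) (m : ℂ) :
    HasDerivAt (fun m => m * ∫ r in (0 : ℝ)..1, G (r * m)) (G m) m := by
  obtain ⟨H, hH⟩ : ∃ H : ℂ → ℂ, ∀ z, HasDerivAt H (G z) z := by
    obtain ⟨H, hH⟩ := hG.isExactOn_univ
    exact ⟨H, fun z => hH z (mem_univ z)⟩
  have h1 : ∀ m, m * ∫ r in (0 : ℝ)..1, G (r * m) = H m - H 0 := by
    intro m
    have h2 : ∀ r : ℝ, HasDerivAt (fun r : ℝ => H (r * m)) (m * G (r * m)) r := by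
      intro r
      have h3 : HasDerivAt (fun r : ℝ => (r : ℂ) * m) m r := by
        simpa using (Complex.ofRealCLM.hasDerivAt (x := r)).mul_const m
      exact ((hH (r * m)).comp r h3).congr_deriv (mul_comm _ _)
    have h4 := intervalIntegral.integral_eq_sub_of_hasDerivAt (a := 0) (b := 1)
      (fun r _ => h2 r) (Continuous.intervalIntegrable (by
        have := hG.continuous
        fun_prop) _ _)
    rw [← intervalIntegral.integral_const_mul, h4]
    simp
  simp only [h1]
  exact (hH m).sub_const _

/-- The primitive in `mu` of a symbol. -/
theorem primitive_isSymbol (hA : IsSymbol A) : IsSymbol (primitive A) ∧ ∃ ρ : ℝ, 0 < ρ ∧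
    ∀ l m u v, ρ < ‖l‖ → dM (primitive A) l m u v = A l m u v := by
  obtain ⟨ρ, hd, hp⟩ := hA
  have ho := isOpen_lt_norm_fst ρ
  have hc : ContDiffOn ℂ ∞ (uncS A) {p | ρ < ‖p.1‖} := contDiffOn_of_differentiableOn ho hd
  let c₀ : (ℂ × ℂ × ℂ × ℂ) →L[ℂ] (ℂ × ℂ × ℂ × ℂ) :=
    (ContinuousLinearMap.fst ℂ ℂ (ℂ × ℂ × ℂ)).prod ((0 : (ℂ × ℂ × ℂ × ℂ) →L[ℂ] ℂ).prod
    ((ContinuousLinearMap.snd ℂ ℂ (ℂ × ℂ)).comp (ContinuousLinearMap.snd ℂ ℂ (ℂ × ℂ × ℂ))))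
  let c₁ : (ℂ × ℂ × ℂ × ℂ) →L[ℂ] (ℂ × ℂ × ℂ × ℂ) :=
    (0 : (ℂ × ℂ × ℂ × ℂ) →L[ℂ] ℂ).prod (((ContinuousLinearMap.fst ℂ ℂ (ℂ × ℂ)).comp
    (ContinuousLinearMap.snd ℂ ℂ (ℂ × ℂ × ℂ))).prod (0 : (ℂ × ℂ × ℂ × ℂ) →L[ℂ] (ℂ × ℂ)))
  -- Scaling the `mu` coordinate by `r` turns the integral from `0` to `mu` into one over a fixed
  -- interval, with an integrand holomorphic in all variables.
  let sc : ℝ → (ℂ × ℂ × ℂ × ℂ) →L[ℂ] (ℂ × ℂ × ℂ × ℂ) := fun r => c₀ + (r : ℂ) • c₁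
  have hsc : ∀ (r : ℝ) (p : ℂ × ℂ × ℂ × ℂ), sc r p = (p.1, r * p.2.1, p.2.2) := by
    intro r p
    simp [sc, c₀, c₁]
  have hscc : Continuous fun q : (ℂ × ℂ × ℂ × ℂ) × ℝ => sc q.2 := by
    simp only [sc]
    fun_prop
  have hscm : ∀ r p, ρ < ‖(p : ℂ × ℂ × ℂ × ℂ).1‖ → sc r p ∈ {p : ℂ × ℂ × ℂ × ℂ | ρ < ‖p.1‖} := by
    intro r p hp
    rw [hsc]; exact hp
  have hcont : ∀ q : (ℂ × ℂ × ℂ × ℂ) × ℝ, ContinuousAt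
      (fun q : (ℂ × ℂ × ℂ × ℂ) × ℝ => sc q.2 q.1) q := fun q =>
    (hscc.clm_apply continuous_fst).continuousAt
  have hint : ∀ p : ℂ × ℂ × ℂ × ℂ, ρ < ‖p.1‖ → DifferentiableAt ℂ (fun p =>
      ∫ r in (0 : ℝ)..1, uncS A (sc r p)) p := by
    intro p hp
    have hF : ∀ q : (ℂ × ℂ × ℂ × ℂ) × ℝ, ρ < ‖q.1.1‖ → ContinuousAt
        (fun q : (ℂ × ℂ × ℂ × ℂ) × ℝ => uncS A (sc q.2 q.1)) q := fun q hq =>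
      ContinuousAt.comp (f := fun q : (ℂ × ℂ × ℂ × ℂ) × ℝ => sc q.2 q.1)
        (hd.continuousOn.continuousAt (ho.mem_nhds (hscm _ _ hq))) (hcont q)
    refine (hasFDerivAt_intervalIntegral_of_continuousAt (𝕜 := ℂ) zero_le_one
      (F := fun p r => uncS A (sc r p))
      (F' := fun p r => (fderiv ℂ (uncS A) (sc r p)).comp (sc r)) ?_ ?_ ?_).differentiableAt
    · exact fun t _ => hF (p, t) hp
    · intro t _
      refine ContinuousAt.clm_comp (ContinuousAt.comp
        (f := fun q : (ℂ × ℂ × ℂ × ℂ) × ℝ => sc q.2 q.1) (x := (p, t)) ?_ (hcont _))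
        hscc.continuousAt
      exact (hc.continuousOn_fderiv_of_isOpen ho (by simp)).continuousAt
        (ho.mem_nhds (hscm _ _ hp))
    · intro t _
      have : ∀ᶠ q : (ℂ × ℂ × ℂ × ℂ) × ℝ in 𝓝 (p, t), ρ < ‖q.1.1‖ :=
        (continuous_norm.comp (continuous_fst.comp continuous_fst)).continuousAt.eventually
          (lt_mem_nhds hp)
      filter_upwards [this] with q hq
      exact ⟨(hF q hq).comp (f := fun t' : ℝ => (q.1, t')) (by fun_prop),
        (hd.differentiableAt (ho.mem_nhds (hscm _ _ hq))).hasFDerivAt.comp q.1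
          (sc q.2).hasFDerivAt⟩
  have hprim : ∀ l m u v, primitive A l m u v
      = m * ∫ r in (0 : ℝ)..1, uncS A (sc r (l, m, u, v)) := by
    intro l m u v
    simp only [primitive, hsc, uncS]
  refine ⟨⟨ρ, fun p hp => ?_, fun l m u v hl => ?_⟩, max ρ 1, by positivity,
    fun l m u v hl => ?_⟩
  · refine DifferentiableAt.differentiableWithinAt ?_
    simp only [hprim]
    exact (differentiableAt_fst.comp p differentiableAt_snd).mul (hint p hp)
  · simp only [primitive]
    constructor
    · congr 2; funext r; exact (hp _ _ _ _ hl).1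
    · congr 2; funext r; exact (hp _ _ _ _ hl).2
  · exact (hasDerivAt_mul_integral (fun m => (hasDerivAt_dM (hd.differentiableAt
      (ho.mem_nhds ((le_max_left _ _).trans_lt hl)))).differentiableAt) m).deriv

theorem primitive_zero (A : Symbol) (l u v : ℂ) : primitive A l 0 u v = 0 := by
  simp [primitive]

end symbols

/-! ### Changes of the spectral variable that are close to the identity -/

section generic

variable {E : Type} [NormedAddCommGroup E] [NormedSpace ℝ E] {q : E} {f ℓ : ℂ × E → ℂ}

/-- Vanishing at each fixed parameter becomes vanishing uniformly in nearby parameters: `f` is a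
Cauchy integral over one circle, on which it is bounded uniformly by compactness, and the kernel
decays like `1 / |k|`. -/
theorem HolSmooth.tendsto_of_vanishes (hf : HolSmooth f q) (h : HolSmooth.Vanishes f q) :
    Tendsto f (nearInf q) (𝓝 0) := by
  obtain ⟨R, h0, hR⟩ := hf.negU_eq_cauchyNeg
  refine Tendsto.congr' (hf.eq_negU h) ?_
  have hb : ∃ C : ℝ, ∀ᶠ q' in 𝓝 q, ∀ z ∈ Metric.sphere (0 : ℂ) R, ‖f (z, q')‖ ≤ C := by
    obtain ⟨R', -, h2⟩ := eventually_nearInf.1 hR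
    have h1 : ∀ z ∈ Metric.sphere (0 : ℂ) R, ContinuousAt f (z, q) := by
      intro z hz
      have hk : max R' 1 + 1 > R' := by linarith [le_max_left R' 1]
      have := (h2.self_of_nhds ((max R' 1 + 1 : ℝ) : ℂ) (by
        rw [Complex.norm_real, Real.norm_eq_abs, abs_of_pos (by positivity)]; exact hk)).2.1 z
      exact (this (by simp at hz; exact hz.ge)).1.continuousAt
    obtain ⟨C, hC⟩ := (isCompact_sphere (0 : ℂ) R).exists_bound_of_continuousOn
      (f := fun z => f (z, q)) fun z hz => ((h1 z hz).comp
        (f := fun z : ℂ => (z, q)) (by fun_prop)).continuousWithinAt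
    refine ⟨C + 1, (isCompact_sphere (0 : ℂ) R).eventually_forall_of_forall_eventually
      (P := fun q' z => ‖f (z, q')‖ ≤ C + 1) fun z hz => ?_⟩
    have h3 : ContinuousAt (fun y : E × ℂ => ‖f (y.2, y.1)‖) (q, z) :=
      (ContinuousAt.comp (f := fun y : E × ℂ => (y.2, y.1)) (x := (q, z)) (h1 z hz)
        (by fun_prop)).norm
    filter_upwards [h3.eventually (gt_mem_nhds (lt_of_le_of_lt (hC z hz) (lt_add_one C)))]
      with y hy using hy.le
  obtain ⟨C, hC⟩ := hb
  have hC' := (tendsto_snd (f := Bornology.cobounded ℂ) (g := 𝓝 q)).eventually hC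
  have h2R : ∀ᶠ p : ℂ × E in nearInf q, 2 * R < ‖p.1‖ :=
    eventually_nearInf.2 ⟨2 * R, by linarith, Eventually.of_forall fun _ _ hk => hk⟩
  have hlim : Tendsto (fun p : ℂ × E => 2 * R * C * ‖p.1‖⁻¹) (nearInf q) (𝓝 0) := by
    have h1 : Tendsto (fun p : ℂ × E => ‖p.1‖) (nearInf q) atTop :=
      tendsto_norm_cobounded_atTop.comp tendsto_fst
    simpa using (tendsto_inv_atTop_zero.comp h1).const_mul (2 * R * C)
  refine squeeze_zero_norm' ?_ hlim
  filter_upwards [hR, hC', h2R] with p h1 h2 h3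
  have hkp : 0 < ‖p.1‖ := by linarith
  rw [h1.2.2, circ, ← smul_eq_mul]
  refine (circleIntegral.norm_two_pi_i_inv_smul_integral_le_of_norm_le_const h0.le
    (C := C * (2 * ‖p.1‖⁻¹)) fun z hz => ?_).trans (le_of_eq (by ring))
  have hz' : ‖z‖ = R := by simpa using hz
  have h4 : ‖p.1‖ / 2 ≤ ‖p.1 - z‖ := by
    have := norm_sub_norm_le p.1 z
    linarith
  rw [norm_mul, norm_inv]
  have h5 : ‖p.1 - z‖⁻¹ ≤ 2 * ‖p.1‖⁻¹ := by
    rw [← div_eq_mul_inv, ← inv_div]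
    gcongr
  have h6 := h2 z hz
  have h7 : 0 ≤ C := (norm_nonneg _).trans h6
  gcongr

theorem tendsto_fst_add (h : Tendsto ℓ (nearInf q) (𝓝 0)) :
    Tendsto (fun p => p.1 + ℓ p) (nearInf q) (Bornology.cobounded ℂ) := by
  rw [← tendsto_norm_atTop_iff_cobounded]
  have h1 : Tendsto (fun p : ℂ × E => ‖p.1‖ + (-1)) (nearInf q) atTop :=
    tendsto_atTop_add_const_right _ _ (tendsto_norm_cobounded_atTop.comp tendsto_fst)
  refine tendsto_atTop_mono' _ ?_ h1
  filter_upwards [(tendsto_zero_iff_norm_tendsto_zero.1 h).eventually (gt_mem_nhds one_pos)]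
    with p hp
  have := norm_sub_le (p.1 + ℓ p) (ℓ p)
  rw [add_sub_cancel_right] at this
  linarith

theorem HolInf.holSmooth {f : ℂ → ℂ} (hf : HolInf f) : HolSmooth (fun p : ℂ × E => f p.1) q := by
  obtain ⟨R, h0, hR⟩ := eventually_cobounded_iff.1 hf
  refine eventually_nearInf.2 ⟨R, h0, Eventually.of_forall fun q' k hk => ⟨?_, hR k hk⟩⟩
  have ho : IsOpen {w : ℂ | R < ‖w‖} := isOpen_lt continuous_const continuous_norm
  exact (contDiffAt_real_of_differentiableOn ho
    (fun z hz => (hR z hz).differentiableWithinAt) hk).comp (k, q') contDiffAt_fst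

end generic

/-- Along the homotopy `k + ε ℓ(k)` the derivative in `ε` of `f(k + ε ℓ) (1 + ε ℓ')` equals the
`k`-derivative of `f(k + ε ℓ) ℓ`, whose residue is zero. Hence the values at `ε = 1` and `ε = 0`
agree. -/
theorem res_change_of_variable {f ℓ : ℂ → ℂ} (hf : HolInf f) (hℓ : HolInf ℓ)
    (h : Tendsto ℓ (Bornology.cobounded ℂ) (𝓝 0)) :
    res (fun k => f (k + ℓ k) * (1 + deriv ℓ k)) = res f := by
  let e : ℂ × ℝ → ℂ := fun p => (p.2 : ℂ)
  have he : ∀ q : ℝ, HolSmooth e q := fun q => HolSmooth.of_param (g := fun q : ℝ => (q : ℂ))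
    (Eventually.of_forall fun q' => Complex.ofRealCLM.contDiff.contDiffAt)
  have hl : ∀ q : ℝ, HolSmooth (fun p : ℂ × ℝ => ℓ p.1) q := fun q => hℓ.holSmooth
  have hl' : ∀ q : ℝ, HolSmooth (fun p : ℂ × ℝ => deriv ℓ p.1) q := fun q => hℓ.deriv.holSmooth
  have hκ : ∀ q : ℝ, HolSmooth (fun p : ℂ × ℝ => p.1 + e p * ℓ p.1) q := fun q =>
    HolSmooth.fst.add ((he q).mul (hl q))
  have ht : ∀ q : ℝ, Tendsto (fun p : ℂ × ℝ => p.1 + e p * ℓ p.1) (nearInf q)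
      (Bornology.cobounded ℂ) := by
    intro q
    refine tendsto_fst_add ?_
    have h1 : Tendsto e (nearInf q) (𝓝 (q : ℂ)) :=
      (Complex.continuous_ofReal.tendsto q).comp tendsto_snd
    simpa using h1.mul (h.comp tendsto_fst)
  have hfκ : ∀ q : ℝ, HolSmooth (fun p : ℂ × ℝ => f (p.1 + e p * ℓ p.1)) q := fun q =>
    HolSmooth.comp_left (f := fun p : ℂ × ℝ => f p.1) hf.holSmooth (hκ q) (ht q)
  let F : ℂ × ℝ → ℂ := fun p => f (p.1 + e p * ℓ p.1) * (1 + e p * deriv ℓ p.1)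
  have hF : ∀ q : ℝ, HolSmooth F q := fun q =>
    (hfκ q).mul ((HolSmooth.const 1).add ((he q).mul (hl' q)))
  have hzero : ∀ q : ℝ, fderiv ℝ (fun q' => res (fun z => F (z, q'))) q = 0 := by
    intro q
    refine ContinuousLinearMap.ext_ring ?_
    have h1 := (hF q).pd_res (1 : ℝ)
    change pd (1 : ℝ) (fun q' => res (fun z => F (z, q'))) q = 0
    rw [h1]
    have hG := (hfκ q).mul (hl q)
    refine Eq.trans ?_ hG.res_pd_fst
    refine res_congr ?_
    have h3 := (tendsto_param_nearInf (ht q) (continuousAt_id (x := q))).eventually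
      (HolInf.holSmooth (q := id q) hf)
    filter_upwards [Eventually.nearInf_self h3, hℓ, Eventually.nearInf_self (hF q),
      hG.pd_fst_eq_deriv] with z hz hz2 hz3 hz4
    have hfz : HasDerivAt f (deriv f (z + q * ℓ z)) (z + q * ℓ z) := DifferentiableAt.hasDerivAt hz.2
    rw [hz4]
    have h5 : HasDerivAt (fun s : ℝ => F (z, s)) (pd (0, 1) F (z, q)) q :=
      (hz3.1.differentiableAt (by simp)).hasFDerivAt.comp_hasDerivAt q
        ((hasDerivAt_const q z).prodMk (hasDerivAt_id q))
    have h6 : HasDerivAt (fun s : ℝ => z + (s : ℂ) * ℓ z) (ℓ z) q := by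
      simpa using ((Complex.ofRealCLM.hasDerivAt (x := q)).mul_const (ℓ z)).const_add z
    have h7 : HasDerivAt (fun s : ℝ => 1 + (s : ℂ) * deriv ℓ z) (deriv ℓ z) q := by
      simpa using ((Complex.ofRealCLM.hasDerivAt (x := q)).mul_const (deriv ℓ z)).const_add 1
    have h8 : HasDerivAt (fun s : ℝ => F (z, s)) _ q := (hfz.comp q h6).mul h7
    have h9 : HasDerivAt (fun w : ℂ => w + q * ℓ w) (1 + q * deriv ℓ z) z :=
      (hasDerivAt_id z).add (hz2.hasDerivAt.const_mul (q : ℂ))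
    have h10 : HasDerivAt (fun w : ℂ => f (w + q * ℓ w) * ℓ w) _ z :=
      (hfz.comp z h9).mul hz2.hasDerivAt
    rw [h5.unique h8]
    refine Eq.trans ?_ h10.deriv.symm
    simp only [Function.comp_apply]
    ring
  have hd : Differentiable ℝ (fun q' : ℝ => res (fun z => F (z, q'))) := fun q =>
    (hF q).contDiffAt_res.differentiableAt (by simp)
  have h1 := is_const_of_fderiv_eq_zero hd hzero 1 0
  simpa [F, e] using h1

/-! ### The inverse of a change of the spectral variable -/

section inverse

variable {q : Par} {ℓ : ℂ × Par → ℂ}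

/-- Outside the disc of radius `R` the perturbation `ℓ` of the identity is a small contraction. -/
def NearId (R : ℝ) (ℓ : ℂ × Par → ℂ) (q' : Par) : Prop := ∀ k : ℂ, R < ‖k‖ →
  (ContDiffAt ℝ ∞ ℓ (k, q') ∧ DifferentiableAt ℂ (fun z => ℓ (z, q')) k)
    ∧ ‖ℓ (k, q')‖ < 1 ∧ ‖pd (1, 0) ℓ (k, q')‖ < 1 / 2

theorem exists_nearId (hℓ : HolSmooth ℓ q) (hv : HolSmooth.Vanishes ℓ q) :
    ∃ R > 0, ∀ᶠ q' in 𝓝 q, NearId R ℓ q' := by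
  have ht := hℓ.tendsto_of_vanishes hv
  have hv' : HolSmooth.Vanishes (pd (1, 0) ℓ) q := by
    filter_upwards [hv, hℓ.param] with q' h1 h2
    exact (HolSmooth.oInf_pd_fst h2 (OInf.of_tendsto h2.holInf h1)).tendsto
  have ht' := (hℓ.pd (1, 0)).tendsto_of_vanishes hv'
  have hev : ∀ᶠ p in nearInf q, (ContDiffAt ℝ ∞ ℓ p ∧ DifferentiableAt ℂ (fun z => ℓ (z, p.2)) p.1)
      ∧ ‖ℓ p‖ < 1 ∧ ‖pd (1, 0) ℓ p‖ < 1 / 2 := by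
    filter_upwards [hℓ, (tendsto_zero_iff_norm_tendsto_zero.1 ht).eventually (gt_mem_nhds one_pos),
      (tendsto_zero_iff_norm_tendsto_zero.1 ht').eventually (gt_mem_nhds one_half_pos)]
      with p h1 h2 h3 using ⟨h1, h2, h3⟩
  exact eventually_nearInf.1 hev

theorem lt_norm_of_mem_closedBall {R : ℝ} {w z : ℂ} (hw : R + 1 < ‖w‖)
    (hz : z ∈ Metric.closedBall w 1) : R < ‖z‖ := by
  have h1 : ‖w - z‖ ≤ 1 := by rwa [Metric.mem_closedBall, dist_comm, dist_eq_norm] at hz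
  have := norm_sub_norm_le w z
  linarith

namespace NearId

variable {R : ℝ} {q' : Par} {w : ℂ}

theorem lipschitz (hq' : NearId R ℓ q') (hw : R + 1 < ‖w‖) {k k' : ℂ}
    (hk : k ∈ Metric.closedBall w 1) (hk' : k' ∈ Metric.closedBall w 1) :
    ‖ℓ (k, q') - ℓ (k', q')‖ ≤ 1 / 2 * ‖k - k'‖ := by
  refine (convex_closedBall w 1).norm_image_sub_le_of_norm_deriv_le (𝕜 := ℂ)
    (f := fun z => ℓ (z, q')) (fun z hz => (hq' z (lt_norm_of_mem_closedBall hw hz)).1.2)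
    (fun z hz => ?_) hk' hk
  have h1 := hq' z (lt_norm_of_mem_closedBall hw hz)
  have h2 := pd_fst_eq_deriv (p := (z, q')) (h1.1.1.differentiableAt (by simp)) h1.1.2
  rw [← h2]
  exact h1.2.2.le

/-- The map `k ↦ w - ℓ(k)` sends the unit disc about `w` into itself and contracts by `1 / 2`; the
margin in `R + 1 < ‖w‖` keeps that disc where the bounds on `ℓ` hold. -/
theorem exists_solution (hq' : NearId R ℓ q') (hw : R + 1 < ‖w‖) :
    ∃ k ∈ Metric.closedBall w 1, k + ℓ (k, q') = w := by
  have hm : MapsTo (fun k => w - ℓ (k, q')) (Metric.closedBall w 1) (Metric.closedBall w 1) := by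
    intro k hk
    have := (hq' k (lt_norm_of_mem_closedBall hw hk)).2.1
    rw [Metric.mem_closedBall, dist_eq_norm, sub_sub_cancel_left, norm_neg]
    exact this.le
  have hc : ContractingWith (1 / 2 : NNReal) (hm.restrict _ _ _) := by
    refine ⟨by rw [← NNReal.coe_lt_coe]; norm_num, LipschitzWith.of_dist_le_mul ?_⟩
    rintro ⟨k, hk⟩ ⟨k', hk'⟩
    have := hq'.lipschitz hw hk hk'
    rw [Subtype.dist_eq, Subtype.dist_eq, dist_eq_norm, dist_eq_norm]
    change ‖(w - ℓ (k, q')) - (w - ℓ (k', q'))‖ ≤ ((1 / 2 : NNReal) : ℝ) * ‖k - k'‖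
    rw [sub_sub_sub_cancel_left, norm_sub_rev]
    refine this.trans (le_of_eq ?_)
    norm_num
  obtain ⟨k, hk, hfix, -⟩ := hc.exists_fixedPoint' Metric.isClosed_closedBall.isComplete hm
    (Metric.mem_closedBall_self zero_le_one) (edist_ne_top _ _)
  refine ⟨k, hk, ?_⟩
  have h1 : w - ℓ (k, q') = k := hfix
  linear_combination -h1

theorem unique_solution (hq' : NearId R ℓ q') (hw : R + 1 < ‖w‖) {k k' : ℂ} (hk : R < ‖k‖)
    (hk' : R < ‖k'‖) (h1 : k + ℓ (k, q') = w) (h2 : k' + ℓ (k', q') = w) : k = k' := by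
  have hb : ∀ k : ℂ, R < ‖k‖ → k + ℓ (k, q') = w → k ∈ Metric.closedBall w 1 := by
    intro k hk h
    rw [Metric.mem_closedBall, dist_eq_norm, ← h, sub_add_cancel_left, norm_neg]
    exact (hq' k hk).2.1.le
  have h3 := hq'.lipschitz hw (hb k hk h1) (hb k' hk' h2)
  have h4 : k - k' = -(ℓ (k, q') - ℓ (k', q')) := by linear_combination h1 - h2
  rw [h4, norm_neg] at h3
  have h5 : ‖ℓ (k, q') - ℓ (k', q')‖ = 0 := by linarith [norm_nonneg (ℓ (k, q') - ℓ (k', q'))]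
  rw [norm_eq_zero] at h5
  exact sub_eq_zero.1 (by rw [h4, h5, neg_zero])

theorem one_add_ne_zero (hq' : NearId R ℓ q') {k : ℂ} (hk : R < ‖k‖) :
    1 + pd (1, 0) ℓ (k, q') ≠ 0 := by
  intro h
  have h4 := (hq' k hk).2.2
  have h5 : pd (1, 0) ℓ (k, q') = -1 := by linear_combination h
  rw [h5] at h4
  norm_num at h4

/-- The inverse function theorem for `(k, q) ↦ (k + ℓ(k, q), q)` supplies a smooth local inverse,
and uniqueness of solutions identifies it with `K`. -/
theorem smooth_solution {K : ℂ × Par → ℂ} (hq' : ∀ᶠ q'' in 𝓝 q', NearId R ℓ q'')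
    (hw : R + 1 < ‖w‖)
    (hK : ∀ q' w, NearId R ℓ q' → R + 1 < ‖w‖ → K (w, q') ∈ Metric.closedBall w 1 ∧
      K (w, q') + ℓ (K (w, q'), q') = w) : ContDiffAt ℝ ∞ K (w, q') := by
  have hg := hq'.self_of_nhds
  have hkn := lt_norm_of_mem_closedBall hw (hK q' w hg hw).1
  have hkw := (hK q' w hg hw).2
  generalize hk : K (w, q') = k at hkn hkw
  obtain ⟨⟨h1, h2⟩, h3, h4⟩ := hg k hkn
  let Φ : ℂ × Par → ℂ × Par := fun p => (p.1 + ℓ p, p.2)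
  have hΦ : ContDiffAt ℝ ∞ Φ (k, q') := (contDiffAt_fst.add h1).prodMk contDiffAt_snd
  have hc0 := hg.one_add_ne_zero hkn
  let D : ℂ × Par →L[ℝ] ℂ × Par :=
    (ContinuousLinearMap.fst ℝ ℂ Par + fderiv ℝ ℓ (k, q')).prod (ContinuousLinearMap.snd ℝ ℂ Par)
  have hD : HasFDerivAt Φ D (k, q') :=
    (hasFDerivAt_fst.add (h1.differentiableAt (by simp)).hasFDerivAt).prodMk hasFDerivAt_snd
  -- On the kernel the parameter component is zero, and by holomorphy the derivative acts on the
  -- remaining component as multiplication by `1 + ∂ℓ/∂k`, which is not zero.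
  have hinj : Function.Injective (D : ℂ × Par →ₗ[ℝ] ℂ × Par) := by
    rw [← LinearMap.ker_eq_bot, LinearMap.ker_eq_bot']
    rintro ⟨z, v⟩ hzv
    have hv : v = 0 := congrArg Prod.snd hzv
    subst hv
    have hz : z + fderiv ℝ ℓ (k, q') (z, 0) = 0 := congrArg Prod.fst hzv
    have h5 : fderiv ℝ ℓ (k, q') (z, 0) = z * fderiv ℝ ℓ (k, q') (1, 0) :=
      pd_fst_smul (p := (k, q')) (h1.differentiableAt (by simp)) h2 z
    rw [h5] at hz
    have h6 : z * (1 + fderiv ℝ ℓ (k, q') (1, 0)) = 0 := by linear_combination hz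
    have hz0 := (mul_eq_zero.1 h6).resolve_right hc0
    rw [hz0]; rfl
  let De : (ℂ × Par) ≃L[ℝ] (ℂ × Par) :=
    (LinearEquiv.ofInjectiveEndo (D : ℂ × Par →ₗ[ℝ] ℂ × Par) hinj).toContinuousLinearEquiv
  have hDe : HasFDerivAt Φ (De : ℂ × Par →L[ℝ] ℂ × Par) (k, q') := by
    have h7 : (De : ℂ × Par →L[ℝ] ℂ × Par) = D := ContinuousLinearMap.ext fun _ => rfl
    rw [h7]
    exact hD
  have hy : Φ (k, q') = (w, q') := by
    change (k + ℓ (k, q'), q') = _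
    rw [hkw]
  have hne : (∞ : WithTop ℕ∞) ≠ 0 := by simp
  obtain ⟨Ψ, hΨ, hΨ0, hΨr⟩ : ∃ Ψ : ℂ × Par → ℂ × Par, ContDiffAt ℝ ∞ Ψ (w, q') ∧
      Ψ (w, q') = (k, q') ∧ ∀ᶠ y in 𝓝 (w, q'), Φ (Ψ y) = y := by
    rw [← hy]
    exact ⟨hΦ.localInverse hDe hne, hΦ.to_localInverse hDe hne,
      hΦ.localInverse_apply_image hDe hne, (hΦ.hasStrictFDerivAt' hDe hne).eventually_right_inverse⟩
  have hnorm : ∀ᶠ y in 𝓝 (w, q'), R < ‖(Ψ y).1‖ := by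
    have : ContinuousAt (fun y => ‖(Ψ y).1‖) (w, q') := (continuousAt_fst.comp
      hΨ.continuousAt).norm
    refine this.eventually (lt_mem_nhds ?_)
    change R < ‖(Ψ (w, q')).1‖
    rw [hΨ0]; exact hkn
  have hgy : ∀ᶠ y : ℂ × Par in 𝓝 (w, q'), R + 1 < ‖y.1‖ ∧ NearId R ℓ y.2 := by
    rw [nhds_prod_eq]
    exact (continuous_norm.continuousAt.eventually (lt_mem_nhds hw)).prod_mk hq'
  have hKΨ : K =ᶠ[𝓝 (w, q')] fun y => (Ψ y).1 := by
    filter_upwards [hΨr, hnorm, hgy] with y h5 h6 h7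
    have h8 : (Φ (Ψ y)).2 = y.2 := by rw [h5]
    change (Ψ y).2 = y.2 at h8
    have h9 : (Ψ y).1 + ℓ ((Ψ y).1, y.2) = y.1 := by
      have : (Φ (Ψ y)).1 = y.1 := by rw [h5]
      change (Ψ y).1 + ℓ (Ψ y) = y.1 at this
      rw [← h8]; exact this
    have h10 := hK y.2 y.1 h7.2 h7.1
    exact h7.2.unique_solution h7.1 (lt_norm_of_mem_closedBall h7.1 h10.1) h6 h10.2 h9
  exact (contDiffAt_fst.comp (w, q') hΨ).congr_of_eventuallyEq hKΨ

theorem differentiable_solution {K : ℂ × Par → ℂ} (hg : NearId R ℓ q') (hw : R + 1 < ‖w‖)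
    (hKs : ContDiffAt ℝ ∞ K (w, q'))
    (hK : ∀ q' w, NearId R ℓ q' → R + 1 < ‖w‖ → K (w, q') ∈ Metric.closedBall w 1 ∧
      K (w, q') + ℓ (K (w, q'), q') = w) : DifferentiableAt ℂ (fun z => K (z, q')) w := by
  have hkn := lt_norm_of_mem_closedBall hw (hK q' w hg hw).1
  obtain ⟨⟨h1, h2⟩, -, -⟩ := hg _ hkn
  have hder : HasDerivAt (fun z : ℂ => z + ℓ (z, q')) (1 + pd (1, 0) ℓ (K (w, q'), q'))
      (K (w, q')) := by
    refine (hasDerivAt_id _).add ?_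
    have h3 := pd_fst_eq_deriv (p := (K (w, q'), q')) (h1.differentiableAt (by simp)) h2
    rw [h3]
    exact h2.hasDerivAt
  refine (HasDerivAt.of_local_left_inverse (g := fun z => K (z, q')) (a := w)
    (hKs.continuousAt.comp (f := fun z : ℂ => (z, q')) (by fun_prop)) hder
    (hg.one_add_ne_zero hkn) ?_).differentiableAt
  filter_upwards [continuous_norm.continuousAt.eventually (lt_mem_nhds hw)] with z hz
  exact (hK q' z hg hz).2

end NearId

/-- Applied to `λ = L(k)`, this allows functions of `k` to be re-expanded in the spectral variable
with smooth dependence on the parameters. -/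
theorem exists_inverse (hℓ : HolSmooth ℓ q) (hv : HolSmooth.Vanishes ℓ q) :
    ∃ K : ℂ × Par → ℂ, HolSmooth K q ∧ HolSmooth.Vanishes (fun p => K p - p.1) q ∧
      ∀ᶠ p in nearInf q, K (p.1 + ℓ p, p.2) = p.1 := by
  obtain ⟨R, h0, hR⟩ := exists_nearId hℓ hv
  have hKex : ∀ p : ℂ × Par, ∃ k : ℂ, NearId R ℓ p.2 → R + 1 < ‖p.1‖ →
      k ∈ Metric.closedBall p.1 1 ∧ k + ℓ (k, p.2) = p.1 := by
    intro p
    by_cases h : NearId R ℓ p.2 ∧ R + 1 < ‖p.1‖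
    · obtain ⟨k, hk⟩ := h.1.exists_solution h.2
      exact ⟨k, fun _ _ => hk⟩
    · exact ⟨0, fun h1 h2 => absurd ⟨h1, h2⟩ h⟩
  choose K hK' using hKex
  have hK : ∀ q' w, NearId R ℓ q' → R + 1 < ‖w‖ → K (w, q') ∈ Metric.closedBall w 1 ∧
      K (w, q') + ℓ (K (w, q'), q') = w := fun q' w => hK' (w, q')
  have hgood := eventually_eventually_nhds.2 hR
  refine ⟨K, ?_, ?_, ?_⟩
  · refine eventually_nearInf.2 ⟨R + 1, by linarith, ?_⟩
    filter_upwards [hgood] with q' hq' w hw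
    have := NearId.smooth_solution hq' hw hK
    exact ⟨this, hq'.self_of_nhds.differentiable_solution hw this hK⟩
  · filter_upwards [hR, hv] with q' hg hvq
    have hKt : Tendsto (fun z => K (z, q')) (Bornology.cobounded ℂ) (Bornology.cobounded ℂ) := by
      rw [← tendsto_norm_atTop_iff_cobounded]
      refine tendsto_atTop_mono' _ ?_ (tendsto_atTop_add_const_right _ (-1)
        (tendsto_norm_cobounded_atTop (E := ℂ)))
      refine eventually_cobounded_iff.2 ⟨R + 1, by linarith, fun w hw => ?_⟩
      have h1 := (hK q' w hg hw).1
      rw [Metric.mem_closedBall, dist_comm, dist_eq_norm] at h1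
      have := norm_sub_norm_le w (K (w, q'))
      linarith
    have h1 := (hvq.comp hKt).neg
    rw [neg_zero] at h1
    refine h1.congr' (eventually_cobounded_iff.2 ⟨R + 1, by linarith, fun w hw => ?_⟩)
    have := (hK q' w hg hw).2
    change -ℓ (K (w, q'), q') = K (w, q') - w
    linear_combination -this
  -- The extra unit in the radius compensates for `ℓ`, which moves `k` by less than `1`.
  · refine eventually_nearInf.2 ⟨R + 2, by linarith, ?_⟩
    filter_upwards [hR] with q' hg k hk
    have h1 := (hg k (by linarith)).2.1
    have h2 : R + 1 < ‖k + ℓ (k, q')‖ := by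
      have := norm_sub_le (k + ℓ (k, q')) (ℓ (k, q'))
      rw [add_sub_cancel_right] at this
      linarith
    have h3 := hK q' _ hg h2
    exact hg.unique_solution h2 (lt_norm_of_mem_closedBall h2 h3.1) (by linarith) h3.2 rfl

end inverse

/-! ### Families of states -/

theorem OInf.comp_add {n : ℕ} {f ℓ : ℂ → ℂ} (hf : OInf n f)
    (hℓ : Tendsto ℓ (Bornology.cobounded ℂ) (𝓝 0)) : OInf n (fun k => f (k + ℓ k)) := by
  have ht : Tendsto (fun k => k + ℓ k) (Bornology.cobounded ℂ) (Bornology.cobounded ℂ) := by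
    have := tendsto_fst_add (q := (0 : ℝ)) (ℓ := fun p : ℂ × ℝ => ℓ p.1) (hℓ.comp tendsto_fst)
    exact this.comp (tendsto_id.prodMk tendsto_const_nhds)
  refine (hf.comp_tendsto ht).trans ?_
  have h1 : (fun k : ℂ => k + ℓ k)⁻¹ =O[Bornology.cobounded ℂ] fun k : ℂ => k⁻¹ := by
    refine Asymptotics.IsBigO.of_bound 2 ?_
    filter_upwards [(tendsto_zero_iff_norm_tendsto_zero.1 hℓ).eventually (gt_mem_nhds one_pos),
      tendsto_norm_cobounded_atTop.eventually (eventually_ge_atTop 2)] with k h1 h2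
    have h3 : ‖k‖ / 2 ≤ ‖k + ℓ k‖ := by
      have := norm_sub_le (k + ℓ k) (ℓ k)
      rw [add_sub_cancel_right] at this
      linarith
    rw [Pi.inv_apply, norm_inv, norm_inv, show (2 : ℝ) * ‖k‖⁻¹ = (‖k‖ / 2)⁻¹ by
      rw [inv_div, div_eq_mul_inv]]
    exact inv_anti₀ (by linarith) h3
  exact h1.pow n

theorem vanishes_of_forall {Ω : Set ℝ} (hΩ : IsOpen Ω) {f : ℂ × Par → ℂ}
    (h : ∀ q : Par, q.2.1 ∈ Ω → Tendsto (fun z => f (z, q)) (Bornology.cobounded ℂ) (𝓝 0))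
    {q : Par} (hq : q.2.1 ∈ Ω) : HolSmooth.Vanishes f q :=
  (eventually_mem_nearInf hΩ hq).mono fun q' hq' => h q' hq'

/-- The version of `NiceGen.of_laurentCoeff` with a generating function that is given locally. -/
theorem NiceGen.of_local {Ω : Set ℝ} {z : ℝ → ℕ → ℝ → ℝ → ℝ → ℂ}
    (h : ∀ q : Par, q.2.1 ∈ Ω → ∃ G : ℂ × Par → ℂ, HolSmooth G q ∧ HolSmooth.Vanishes G q ∧
      ∀ᶠ q' : Par in 𝓝 q, ∀ n : ℕ, z q'.1 n q'.2.1 q'.2.2.1 q'.2.2.2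
        = laurentCoeff (fun k => G (k, q')) (-(n + 1 : ℤ))) : NiceGen Ω z := by
  intro ε x hx a b
  obtain ⟨G, h1, h2, h3⟩ := h (ε, x, a, b) hx
  have h4 : gen z =ᶠ[nearInf (ε, x, a, b)] negU G := by
    filter_upwards [(tendsto_snd (f := Bornology.cobounded ℂ) (g := 𝓝 (ε, x, a, b))).eventually h3]
      with p hp
    simp only [gen, negU, neg₁, hp]
  have h5 := h4.trans (h1.eq_negU h2)
  refine ⟨h1.congr h5, HolSmooth.vanishes_congr h5 h2, fun n => ?_⟩
  rw [laurentCoeff_congr (Eventually.nearInf_self h5)]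
  exact h3.self_of_nhds n

theorem NiceGen.gen_eventuallyEq {z : ℝ → ℕ → ℝ → ℝ → ℝ → ℂ} {q : Par}
    {G : ℂ × Par → ℂ} (h1 : HolSmooth G q) (h2 : HolSmooth.Vanishes G q)
    (h3 : ∀ᶠ q' : Par in 𝓝 q, ∀ n : ℕ, z q'.1 n q'.2.1 q'.2.2.1 q'.2.2.2
        = laurentCoeff (fun k => G (k, q')) (-(n + 1 : ℤ))) : gen z =ᶠ[nearInf q] G := by
  refine EventuallyEq.trans ?_ (h1.eq_negU h2)
  filter_upwards [(tendsto_snd (f := Bornology.cobounded ℂ) (g := 𝓝 q)).eventually h3] with p hp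
  simp only [gen, negU, neg₁, hp]

/-- A family of states all of whose generating series are smooth near infinity. -/
structure NiceFam (Ω : Set ℝ) (σ : ℝ → State) : Prop where
  g : NiceGen Ω fun ε => (σ ε).g
  h : NiceGen Ω fun ε => (σ ε).h
  u : NiceGen Ω fun ε => (σ ε).u
  v : NiceGen Ω fun ε => (σ ε).v

/-- The prefix `f` marks functions of `k`, with `λ = L` substituted; the prefix `s` marks the series
at an independent `λ`. The negative part `fN` is the Hamiltonian of the variation. -/
def fL (σ : ℝ → State) : ℂ × Par → ℂ := unc fun ε => laxL (σ ε)
def fM (t : ℕ → ℤ → ℂ) (σ : ℝ → State) : ℂ × Par → ℂ := unc fun ε => laxM t (σ ε)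
def fU (σ : ℝ → State) : ℂ × Par → ℂ := unc fun ε => laxU (σ ε)
def fV (t : ℕ → ℤ → ℂ) (σ : ℝ → State) : ℂ × Par → ℂ := unc fun ε => laxV t (σ ε)
def sM (t : ℕ → ℤ → ℂ) (σ : ℝ → State) : ℂ × Par → ℂ := unc fun ε => serM t (σ ε)
def sU (σ : ℝ → State) : ℂ × Par → ℂ := unc fun ε => serU (σ ε)
def sV (t : ℕ → ℤ → ℂ) (σ : ℝ → State) : ℂ × Par → ℂ := unc fun ε => serV t (σ ε)
def fA (t : ℕ → ℤ → ℂ) (A : Symbol) (σ : ℝ → State) : ℂ × Par → ℂ := unc fun ε => subst t A (σ ε)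
def fN (t : ℕ → ℤ → ℂ) (A : Symbol) (σ : ℝ → State) : ℂ × Par → ℂ := negU (fA t A σ)

/-- The part of `𝓜(lambda)` that does not involve the times. -/
def rM (σ : ℝ → State) : ℂ × Par → ℂ := fun p => p.2.2.1 + p.1⁻¹ * gen (fun ε => (σ ε).h) p
/-- The part of `𝓥(lambda)` that does not involve the times. -/
def rV (σ : ℝ → State) : ℂ × Par → ℂ := fun p => p.2.2.2.2 + gen (fun ε => (σ ε).v) p

section fam

variable {Ω : Set ℝ} {t : ℕ → ℤ → ℂ} {σ : ℝ → State} {q : Par} {A : Symbol}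

theorem fL_eq (p : ℂ × Par) : fL σ p = p.1 + gen (fun ε => (σ ε).g) p := rfl

theorem sU_eq (p : ℂ × Par) : sU σ p = p.2.2.2.1 + gen (fun ε => (σ ε).u) p := rfl

theorem sV_eq (p : ℂ × Par) : sV t σ p = timeV t p.1 (sU σ p) + rV σ p := add_assoc _ _ _

theorem sM_eq {p : ℂ × Par} (hp : p.1 ≠ 0) : sM t σ p = timeM t p.1 (sU σ p) + rM σ p := by
  have : ∀ n : ℕ, (σ p.2.1).h n p.2.2.1 p.2.2.2.1 p.2.2.2.2 * p.1 ^ (-(n + 2 : ℤ))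
      = p.1⁻¹ * ((σ p.2.1).h n p.2.2.1 p.2.2.2.1 p.2.2.2.2 * p.1 ^ (-(n + 1 : ℤ))) := by
    intro n
    rw [show (-(n + 2 : ℤ)) = -1 + (-(n + 1 : ℤ)) by ring, zpow_add₀ hp, zpow_neg_one]
    ring
  change timeM t p.1 (sU σ p) + p.2.2.1 + ∑' n : ℕ,
    (σ p.2.1).h n p.2.2.1 p.2.2.2.1 p.2.2.2.2 * p.1 ^ (-(n + 2 : ℤ)) = _
  rw [tsum_congr this, tsum_mul_left, add_assoc]
  rfl

theorem sM_eventuallyEq (q : Par) :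
    sM t σ =ᶠ[nearInf q] fun p => timeM t p.1 (sU σ p) + rM σ p :=
  (HolSmooth.eventually_ne_zero q).mono fun _ hp => sM_eq hp

theorem holSmooth_ofReal {g : Par → ℝ} (hg : ContDiff ℝ ∞ g) :
    HolSmooth (fun p : ℂ × Par => (g p.2 : ℂ)) q :=
  HolSmooth.of_param (g := fun q : Par => (g q : ℂ))
    (Eventually.of_forall fun _ => (Complex.ofRealCLM.contDiff.comp hg).contDiffAt)

namespace NiceFam

variable (hσ : NiceFam Ω σ) (hq : q.2.1 ∈ Ω) (ht : EntireTimes t) (hA : IsSymbol A)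
include hσ hq

theorem gen_g : HolSmooth (gen fun ε => (σ ε).g) q ∧ HolSmooth.Vanishes (gen fun ε => (σ ε).g) q :=
  let h := hσ.g q.1 q.2.1 hq q.2.2.1 q.2.2.2
  ⟨h.1, h.2.1⟩

theorem gen_h : HolSmooth (gen fun ε => (σ ε).h) q ∧ HolSmooth.Vanishes (gen fun ε => (σ ε).h) q :=
  let h := hσ.h q.1 q.2.1 hq q.2.2.1 q.2.2.2
  ⟨h.1, h.2.1⟩

theorem gen_u : HolSmooth (gen fun ε => (σ ε).u) q ∧ HolSmooth.Vanishes (gen fun ε => (σ ε).u) q :=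
  let h := hσ.u q.1 q.2.1 hq q.2.2.1 q.2.2.2
  ⟨h.1, h.2.1⟩

theorem gen_v : HolSmooth (gen fun ε => (σ ε).v) q ∧ HolSmooth.Vanishes (gen fun ε => (σ ε).v) q :=
  let h := hσ.v q.1 q.2.1 hq q.2.2.1 q.2.2.2
  ⟨h.1, h.2.1⟩

theorem holSmooth_fL : HolSmooth (fL σ) q := HolSmooth.fst.add (hσ.gen_g hq).1

theorem tendsto_fL : Tendsto (fL σ) (nearInf q) (Bornology.cobounded ℂ) :=
  tendsto_fst_add ((hσ.gen_g hq).1.tendsto_of_vanishes (hσ.gen_g hq).2)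

theorem tendsto_fL_nearInf : Tendsto (fun p => (fL σ p, p.2)) (nearInf q) (nearInf q) :=
  tendsto_param_nearInf (hσ.tendsto_fL hq) continuousAt_id

theorem fL_ne_zero : ∀ᶠ p in nearInf q, fL σ p ≠ 0 :=
  (hσ.tendsto_fL hq).eventually cobounded_ne_zero

theorem comp_fL {S : ℂ × Par → ℂ} (hS : HolSmooth S q) : HolSmooth (fun p => S (fL σ p, p.2)) q :=
  hS.comp_left (hσ.holSmooth_fL hq) (hσ.tendsto_fL hq)

theorem holSmooth_sU : HolSmooth (sU σ) q :=
  (holSmooth_ofReal (g := fun q : Par => q.2.2.1) contDiff_snd.snd.fst).add (hσ.gen_u hq).1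

theorem holSmooth_rV : HolSmooth (rV σ) q :=
  (holSmooth_ofReal (g := fun q : Par => q.2.2.2) contDiff_snd.snd.snd).add (hσ.gen_v hq).1

theorem holSmooth_rM : HolSmooth (rM σ) q :=
  (holSmooth_ofReal (g := fun q : Par => q.2.1) contDiff_snd.fst).add
    ((HolSmooth.fst.inv (HolSmooth.eventually_ne_zero q)).mul (hσ.gen_h hq).1)

theorem holSmooth_comp_sU {T : ℂ × ℂ → ℂ} (hT : Differentiable ℂ T) :
    HolSmooth (fun p => T (p.1, sU σ p)) q :=
  HolSmooth.holomorphic_comp isOpen_univ hT.differentiableOn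
    (HolSmooth.fst.prodMk (hσ.holSmooth_sU hq)) (Eventually.of_forall fun _ => mem_univ _)

include ht

theorem holSmooth_sM : HolSmooth (sM t σ) q :=
  ((hσ.holSmooth_comp_sU hq (differentiable_timeM ht)).add (hσ.holSmooth_rM hq)).congr
    (sM_eventuallyEq q)

theorem holSmooth_sV : HolSmooth (sV t σ) q :=
  ((hσ.holSmooth_comp_sU hq (differentiable_timeV ht)).add (hσ.holSmooth_rV hq)).congr
    (Eventually.of_forall sV_eq)

omit ht

theorem holSmooth_fU : HolSmooth (fU σ) q := hσ.comp_fL hq (hσ.holSmooth_sU hq)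

include ht

theorem holSmooth_fM : HolSmooth (fM t σ) q := hσ.comp_fL hq (hσ.holSmooth_sM hq ht)

theorem holSmooth_fV : HolSmooth (fV t σ) q := hσ.comp_fL hq (hσ.holSmooth_sV hq ht)

include hA

theorem holSmooth_fA : HolSmooth (fA t A σ) q := by
  obtain ⟨ρ, -, hρ⟩ := hA.eventually
  refine HolSmooth.holomorphic_comp (F := uncS A) (isOpen_lt_norm_fst ρ)
    (fun p hp => (hρ p hp).differentiableWithinAt)
    (c := fun p => (fL σ p, fM t σ p, fU σ p, fV t σ p))
    ((hσ.holSmooth_fL hq).prodMk ((hσ.holSmooth_fM hq ht).prodMk ((hσ.holSmooth_fU hq).prodMk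
      (hσ.holSmooth_fV hq ht)))) ?_
  exact (tendsto_norm_cobounded_atTop.comp (hσ.tendsto_fL hq)).eventually (eventually_gt_atTop ρ)

theorem holSmooth_fN : HolSmooth (fN t A σ) q := (hσ.holSmooth_fA hq ht hA).negU

theorem vanishes_fN : HolSmooth.Vanishes (fN t A σ) q := (hσ.holSmooth_fA hq ht hA).vanishes_negU

end NiceFam

/-! ### The chain rule for the variations -/

/-- The bracket with `N` of `S(lambda)` at fixed `lambda`, at `lambda = L`. -/
def act (L N S : ℂ × Par → ℂ) : ℂ × Par → ℂ := fun p =>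
  pd vk N p * pd vx S (L p, p.2) + pd v₁ N p * pd v₂ S (L p, p.2) - pd v₂ N p * pd v₁ S (L p, p.2)

theorem pd_zero {X : Type} [NormedAddCommGroup X] [NormedSpace ℝ X] (f : X → ℂ) (p : X) :
    pd 0 f p = 0 := by simp [pd]

theorem NiceFam.pd_comp_fL (hσ : NiceFam Ω σ) (hq : q.2.1 ∈ Ω) {S : ℂ × Par → ℂ}
    (hS : HolSmooth S q) : ∀ᶠ p in nearInf q, ∀ v, pd v (fun p => S (fL σ p, p.2)) p
      = pd (0, v.2) S (fL σ p, p.2) + pd vk S (fL σ p, p.2) * pd v (fL σ) p := by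
  filter_upwards [(hσ.tendsto_fL_nearInf hq).eventually hS, hσ.holSmooth_fL hq] with p h1 h2 v
  exact Toroidal.pd_comp_left (dAt h1.1) h1.2 (dAt h2.1) v

/-- The chain rule at `λ = L` splits a bracket with `N` into the part acting at fixed `λ`, which
determines the variation of the coefficients of `S`, and the part caused by the variation of `L`. -/
theorem NiceFam.br_comp_fL (hσ : NiceFam Ω σ) (hq : q.2.1 ∈ Ω) {S : ℂ × Par → ℂ}
    (hS : HolSmooth S q) (N : ℂ × Par → ℂ) : br N (fun p => S (fL σ p, p.2)) =ᶠ[nearInf q]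
      fun p => act (fL σ) N S p + pd vk S (fL σ p, p.2) * br N (fL σ) p := by
  filter_upwards [hσ.pd_comp_fL hq hS] with p hp
  have h0 : pd ((0 : ℂ), vk.2) S (fL σ p, p.2) = 0 := pd_zero _ _
  simp only [br, act, hp, h0]
  change _ * (pd vx S _ + _) - _ + (_ * (pd v₂ S _ + _) - _ * (pd v₁ S _ + _)) = _
  ring

theorem act_congr {L N S S' : ℂ × Par → ℂ} (hL : Tendsto (fun p => (L p, p.2)) (nearInf q) (nearInf q))
    (h : S =ᶠ[nearInf q] S') : act L N S =ᶠ[nearInf q] act L N S' := by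
  filter_upwards [hL.eventually (HolSmooth.pd_congr h vx), hL.eventually (HolSmooth.pd_congr h v₁),
    hL.eventually (HolSmooth.pd_congr h v₂)] with p h1 h2 h3
  simp only [act, h1, h2, h3]

theorem HolSmooth.act {L N S : ℂ × Par → ℂ} (hN : HolSmooth N q) (hS : HolSmooth S q)
    (hL : HolSmooth L q) (ht : Tendsto L (nearInf q) (Bornology.cobounded ℂ)) :
    HolSmooth (act L N S) q :=
  (((hN.pd vk).mul ((hS.pd vx).comp_left hL ht)).add ((hN.pd v₁).mul ((hS.pd v₂).comp_left hL ht))).sub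
    ((hN.pd v₂).mul ((hS.pd v₁).comp_left hL ht))

/-- The terms of the series that involve the times do not contribute. -/
theorem NiceFam.act_add_comp_sU (hσ : NiceFam Ω σ) (hq : q.2.1 ∈ Ω) {T : ℂ × ℂ → ℂ}
    (hT : Differentiable ℂ T) {R : ℂ × Par → ℂ} (hR : HolSmooth R q) (N : ℂ × Par → ℂ) :
    act (fL σ) N (fun p => T (p.1, sU σ p) + R p) =ᶠ[nearInf q] fun p =>
      deriv (fun w => T (fL σ p, w)) (fU σ p) * act (fL σ) N (sU σ) p + act (fL σ) N R p := by
  have h1 : ∀ᶠ p in nearInf q, ∀ v : Par, pd (0, v) (fun p => T (p.1, sU σ p) + R p) p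
      = deriv (fun w => T (p.1, w)) (sU σ p) * pd (0, v) (sU σ) p + pd (0, v) R p := by
    filter_upwards [hσ.holSmooth_sU hq, hR, hσ.holSmooth_comp_sU hq hT] with p h1 h2 h3 v
    rw [pd_add (dAt h3.1) (dAt h2.1)]
    congr 1
    have hc : DifferentiableAt ℝ (fun p : ℂ × Par => (p.1, sU σ p)) p :=
      differentiableAt_fst.prodMk (dAt h1.1)
    rw [pd_holomorphic_comp (F := T) (c := fun p => (p.1, sU σ p)) (hT _) hc]
    have h4 : pd (0, v) (fun p : ℂ × Par => (p.1, sU σ p)) p = (0, pd (0, v) (sU σ) p) := by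
      simp only [pd]
      rw [DifferentiableAt.fderiv_prodMk differentiableAt_fst (dAt h1.1), fderiv_fst]
      rfl
    have h5 : HasDerivAt (fun w => T (p.1, w)) (fderiv ℂ T (p.1, sU σ p) (0, 1)) (sU σ p) :=
      (hT _).hasFDerivAt.comp_hasDerivAt (f := fun w => (p.1, w)) _
        ((hasDerivAt_const _ _).prodMk (hasDerivAt_id _))
    rw [h4, h5.deriv, show ((0 : ℂ), pd (0, v) (sU σ) p) = pd (0, v) (sU σ) p • ((0 : ℂ), (1 : ℂ)) by
      simp, map_smul, smul_eq_mul, mul_comm]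
  filter_upwards [(hσ.tendsto_fL_nearInf hq).eventually h1] with p hp
  have e : ∀ {w : ℂ × Par} {v : Par}, w = (0, v) → _ := fun {w v} h => h ▸ hp v
  simp only [act]
  rw [e (w := vx) rfl, e (w := v₁) rfl, e (w := v₂) rfl]
  change _ = deriv (fun w => T (fL σ p, w)) (sU σ (fL σ p, p.2)) * _ + _
  ring

/-! ### The symmetries as families of states -/

theorem unc_serVariation (hσ : NiceFam Ω σ) (hq : q.2.1 ∈ Ω) (ht : EntireTimes t) (hA : IsSymbol A)
    {Z : ℝ → PhaseFun} (hZ : HolSmooth (unc Z) q) :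
    unc (fun ε => serVariation t A (σ ε) (Z ε) (fun k x a b => Z ε (laxL (σ ε) k x a b) x a b))
      =ᶠ[nearInf q] act (fL σ) (fN t A σ) (unc Z) := by
  have h1 := unc_bracket (F := fun ε => negPart (subst t A (σ ε)))
    (G := fun ε k x a b => Z ε (laxL (σ ε) k x a b) x a b) (hσ.holSmooth_fN hq ht hA) (hσ.comp_fL hq hZ)
  have h2 := unc_bracket (F := fun ε => negPart (subst t A (σ ε)))
    (G := fun ε => laxL (σ ε)) (hσ.holSmooth_fN hq ht hA) (hσ.holSmooth_fL hq)
  filter_upwards [h1, h2, (hσ.tendsto_fL_nearInf hq).eventually (unc_dk hZ),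
    hσ.br_comp_fL hq hZ (fN t A σ)] with p h1 h2 h3 h4
  have h5 : unc (fun ε => serVariation t A (σ ε) (Z ε)
      (fun k x a b => Z ε (laxL (σ ε) k x a b) x a b)) p
    = unc (fun ε => bracket (negPart (subst t A (σ ε)))
        (fun k x a b => Z ε (laxL (σ ε) k x a b) x a b)) p
      - unc (fun ε => dk (Z ε)) (fL σ p, p.2)
        * unc (fun ε => bracket (negPart (subst t A (σ ε))) (laxL (σ ε))) p := rfl
  rw [h5, h1, h2, h3]
  change br (fN t A σ) (fun p => unc Z (fL σ p, p.2)) p - _ * br (fN t A σ) (fL σ) p = _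
  rw [h4]
  ring

/-- The families of coefficients of the expansions in powers of `L`. -/
theorem NiceFam.coeffInL (hΩ : IsOpen Ω) (hσ : NiceFam Ω σ) (m : ℕ) {f : ℝ → PhaseFun}
    (hf : ∀ q : Par, q.2.1 ∈ Ω → HolSmooth (unc f) q)
    (hv : ∀ q : Par, q.2.1 ∈ Ω → OInf (m + 1) (fun k => unc f (k, q))) :
    NiceGen Ω (fun ε n x a b => coeffInL (σ ε) (f ε) (n + 1 + m) x a b) ∧
    ∀ q : Par, q.2.1 ∈ Ω → ∀ᶠ p in nearInf q,
      gen (fun ε n x a b => Toroidal.coeffInL (σ ε) (f ε) (n + 1 + m) x a b) (fL σ p, p.2)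
        = fL σ p ^ m * unc f p := by
  have key : ∀ q : Par, q.2.1 ∈ Ω → ∃ G : ℂ × Par → ℂ, HolSmooth G q ∧ HolSmooth.Vanishes G q ∧
      (∀ᶠ q' : Par in 𝓝 q, ∀ n : ℕ,
        Toroidal.coeffInL (σ q'.1) (f q'.1) (n + 1 + m) q'.2.1 q'.2.2.1 q'.2.2.2
        = laurentCoeff (fun k => G (k, q')) (-(n + 1 : ℤ))) ∧
      ∀ᶠ p in nearInf q, G (fL σ p, p.2) = fL σ p ^ m * unc f p := by
    intro q hq
    -- With `K` inverse to `L`, the function `f(K(λ))` has an ordinary Laurent expansion in `λ`;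
    -- `res_change_of_variable` identifies its coefficients with the residues in `k` that define
    -- `coeffInL`.
    obtain ⟨K, hK, hK0, hKL⟩ := exists_inverse (hσ.gen_g hq).1 (hσ.gen_g hq).2
    have hK1 : Tendsto K (nearInf q) (Bornology.cobounded ℂ) := by
      have := tendsto_fst_add ((hK.sub HolSmooth.fst).tendsto_of_vanishes hK0)
      simpa using this
    let F : ℂ × Par → ℂ := fun p => unc f (K p, p.2)
    have hF : HolSmooth F q := (hf q hq).comp_left hK hK1
    -- The expansion of `f` starts at `λ ^ (-m-1)`, and the factor `λ ^ m` normalizes it to start at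
    -- `λ ^ (-1)`. The offset is `0` for the coefficients of `U` and `V` and `1` for those of `M`.
    let G : ℂ × Par → ℂ := fun p => p.1 ^ (m : ℤ) * F p
    have hG : HolSmooth G q := (HolSmooth.fst_zpow _).mul hF
    have hFL : ∀ᶠ p in nearInf q, F (fL σ p, p.2) = unc f p := by
      filter_upwards [hKL] with p hp
      change unc f (K (p.1 + gen (fun ε => (σ ε).g) p, p.2), p.2) = _
      rw [hp]
    refine ⟨G, hG, ?_, ?_, ?_⟩
    · filter_upwards [eventually_mem_nearInf hΩ hq, hK0] with q' hq' hk0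
      have h1 : OInf (m + 1) (fun z => F (z, q')) := by
        refine (OInf.comp_add (hv q' hq') hk0).congr (Eventually.of_forall fun z => ?_)
        simp only [F, add_sub_cancel]
      have h2 : OInf 1 (fun z => G (z, q')) := by
        have h3 : (fun z : ℂ => z ^ m * (z⁻¹) ^ (m + 1)) =ᶠ[Bornology.cobounded ℂ]
            fun z => (z⁻¹) ^ 1 := by
          filter_upwards [cobounded_ne_zero] with z hz
          rw [pow_succ, ← mul_assoc, ← mul_pow, mul_inv_cancel₀ hz, one_pow, one_mul, pow_one]
        exact ((Asymptotics.isBigO_refl (fun z : ℂ => z ^ m) _).mul h1).trans_eventuallyEq h3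
          |>.congr_left fun z => by simp [G]
      exact h2.tendsto
    · filter_upwards [eventually_mem_nearInf hΩ hq, hF.param, Eventually.nearInf_param hFL]
        with q' hq' hF' hL' n
      have hg := hσ.gen_g hq'
      have h1 := res_change_of_variable (f := fun z => z ^ (((n + 1 + m : ℕ) : ℤ) - 1) * F (z, q'))
        (ℓ := fun z => gen (fun ε => (σ ε).g) (z, q')) ((HolInf.zpow _).mul hF'.holInf)
        hg.1.holInf hg.2.self_of_nhds
      have h2 : laurentCoeff (fun k => G (k, q')) (-(n + 1 : ℤ))
          = res (fun z => z ^ (((n + 1 + m : ℕ) : ℤ) - 1) * F (z, q')) := by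
        refine res_congr ?_
        filter_upwards [cobounded_ne_zero] with z hz
        simp only [G]
        rw [← mul_assoc, ← zpow_add₀ hz]
        congr 2
        push_cast
        ring
      rw [h2, ← h1]
      refine res_congr ?_
      filter_upwards [Eventually.nearInf_self hL', hg.1.holInf] with k hk hgk
      have h3 : F (k + gen (fun ε => (σ ε).g) (k, q'), q') = unc f (k, q') := hk
      have h4 : dk (laxL (σ q'.1)) k q'.2.1 q'.2.2.1 q'.2.2.2
          = 1 + deriv (fun z => gen (fun ε => (σ ε).g) (z, q')) k :=
        ((hasDerivAt_id k).add hgk.hasDerivAt).deriv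
      rw [h3, h4]
      rfl
    · filter_upwards [hFL] with p hp
      simp only [G, hp, zpow_natCast]
  refine ⟨NiceGen.of_local fun q hq => ?_, fun q hq => ?_⟩
  · obtain ⟨G, h1, h2, h3, -⟩ := key q hq
    exact ⟨G, h1, h2, h3⟩
  · obtain ⟨G, h1, h2, h3, h4⟩ := key q hq
    have h5 := NiceGen.gen_eventuallyEq (z := fun ε n x a b =>
      Toroidal.coeffInL (σ ε) (f ε) (n + 1 + m) x a b) h1 h2 h3
    filter_upwards [(hσ.tendsto_fL_nearInf hq).eventually h5, h4] with p h6 h7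
    rw [h6, h7]

end fam

/-! ### The generating series of a symmetry -/

section fam

variable {Ω : Set ℝ} {t : ℕ → ℤ → ℂ} {σ : ℝ → State} {q : Par} {A : Symbol}

theorem HolSmooth.Vanishes.oInf_param {f : ℂ × Par → ℂ} (h : HolSmooth.Vanishes f q)
    (hf : HolSmooth f q) (v : Par) : OInf 1 (fun k => Toroidal.pd (0, v) f (k, q)) :=
  HolSmooth.Vanishes.oInf (HolSmooth.vanishes_pd hf h v) (hf.pd _)

theorem HolSmooth.Vanishes.oInf_fst {f : ℂ × Par → ℂ} (h : HolSmooth.Vanishes f q)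
    (hf : HolSmooth f q) : OInf 2 (fun k => Toroidal.pd vk f (k, q)) :=
  HolSmooth.oInf_pd_fst hf (h.oInf hf)

/-- A function of size `O(k ^ (-n))` at `k = L`. -/
theorem NiceFam.oInf_comp (hσ : NiceFam Ω σ) (hq : q.2.1 ∈ Ω) {f : ℂ × Par → ℂ} {n : ℕ}
    (hf : OInf n (fun k => f (k, q))) : OInf n (fun k => f (fL σ (k, q), q)) :=
  OInf.comp_add hf (hσ.gen_g hq).2.self_of_nhds

theorem OInf.act {L N S : ℂ × Par → ℂ} {m : ℕ} (hk : OInf 2 (fun k => pd vk N (k, q)))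
    (h1 : OInf 1 (fun k => pd v₁ N (k, q))) (h2 : OInf 1 (fun k => pd v₂ N (k, q)))
    (hS0 : OInf 0 (fun k => pd vx S (L (k, q), q))) (hS1 : OInf m (fun k => pd v₁ S (L (k, q), q)))
    (hS2 : OInf m (fun k => pd v₂ S (L (k, q), q))) (hm : m ≤ 1) :
    OInf (m + 1) (fun k => act L N S (k, q)) := by
  refine OInf.sub (OInf.add ?_ ?_) ?_
  · exact (hk.mul hS0).mono (by omega)
  · exact (h1.mul hS2).mono (by omega)
  · exact (h2.mul hS1).mono (by omega)

theorem pd_ofReal_fst {g : Par →L[ℝ] ℝ} {v : Par} {p : ℂ × Par} :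
    pd (0, v) (fun p : ℂ × Par => ((g p.2 : ℝ) : ℂ)) p = g v := by
  have h : HasFDerivAt (fun p : ℂ × Par => ((g p.2 : ℝ) : ℂ))
      (Complex.ofRealCLM ∘L g ∘L ContinuousLinearMap.snd ℝ ℂ Par) p :=
    (Complex.ofRealCLM ∘L g ∘L ContinuousLinearMap.snd ℝ ℂ Par).hasFDerivAt
  simp only [pd, h.fderiv]
  rfl

theorem pd_ofReal_add {g : Par →L[ℝ] ℝ} {f : ℂ × Par → ℂ} (hf : HolSmooth f q) (v : Par) :
    pd (0, v) (fun p : ℂ × Par => ((g p.2 : ℝ) : ℂ) + f p) =ᶠ[nearInf q]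
      fun p => (g v : ℂ) + pd (0, v) f p := by
  filter_upwards [hf] with p hp
  have h : DifferentiableAt ℝ (fun p : ℂ × Par => ((g p.2 : ℝ) : ℂ)) p :=
    (Complex.ofRealCLM ∘L g ∘L ContinuousLinearMap.snd ℝ ℂ Par).differentiableAt
  rw [pd_add h (dAt hp.1), pd_ofReal_fst]

theorem oInf_pd_ofReal_add {g : Par →L[ℝ] ℝ} {f : ℂ × Par → ℂ} (hf : HolSmooth f q)
    {m : ℕ} (v : Par) (h : OInf m (fun k => pd (0, v) f (k, q))) (hm : g v = 0 ∨ m = 0) :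
    OInf m (fun k => pd (0, v) (fun p : ℂ × Par => ((g p.2 : ℝ) : ℂ) + f p) (k, q)) := by
  refine OInf.congr ?_ (Eventually.nearInf_self (pd_ofReal_add hf v))
  rcases hm with hm | rfl
  · simpa [hm] using h
  · exact (OInf.const _).add h

def prX : Par →L[ℝ] ℝ := ContinuousLinearMap.fst ℝ ℝ (ℝ × ℝ) ∘L ContinuousLinearMap.snd ℝ ℝ _
def pr₁ : Par →L[ℝ] ℝ := ContinuousLinearMap.fst ℝ ℝ ℝ ∘L ContinuousLinearMap.snd ℝ ℝ (ℝ × ℝ)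
  ∘L ContinuousLinearMap.snd ℝ ℝ _
def pr₂ : Par →L[ℝ] ℝ := ContinuousLinearMap.snd ℝ ℝ ℝ ∘L ContinuousLinearMap.snd ℝ ℝ (ℝ × ℝ)
  ∘L ContinuousLinearMap.snd ℝ ℝ _

namespace NiceFam

variable (hσ : NiceFam Ω σ) (hq : q.2.1 ∈ Ω) (ht : EntireTimes t) (hA : IsSymbol A)
include hσ hq ht hA

/-- Power counting: `∂_k N` is `O(k⁻²)` and the angular derivatives of `N` are `O(k⁻¹)`. For `U` and
`V` the angular derivatives are only bounded, which gives `O(k⁻¹)`. For `M` without its time terms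
they are `O(k⁻¹)` and the derivative in `x` is bounded, which gives `O(k⁻²)`. These are exactly the
orders at which the coefficient expansions start. -/
theorem oInf_act_ofReal_add {g : Par →L[ℝ] ℝ} {f : ℂ × Par → ℂ} (hf : HolSmooth f q) {m : ℕ}
    (h : ∀ v : Par, OInf m (fun k => pd (0, v) f (k, q))) (hm : m ≤ 1)
    (hg : (g vx.2 = 0 ∨ g vx.2 = 1) ∧ (m = 0 ∨ g v₁.2 = 0) ∧ (m = 0 ∨ g v₂.2 = 0)) :
    OInf (m + 1) (fun k => act (fL σ) (fN t A σ)
      (fun p : ℂ × Par => ((g p.2 : ℝ) : ℂ) + f p) (k, q)) := by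
  have hN := hσ.holSmooth_fN hq ht hA
  have hN0 := hσ.vanishes_fN hq ht hA
  refine OInf.act (hN0.oInf_fst hN) (hN0.oInf_param hN _) (hN0.oInf_param hN _)
    (hσ.oInf_comp hq (f := pd vx _) ?_) (hσ.oInf_comp hq (f := pd v₁ _) ?_)
    (hσ.oInf_comp hq (f := pd v₂ _) ?_) hm
  · exact oInf_pd_ofReal_add hf _ ((h _).mono (Nat.zero_le _)) (Or.inr rfl)
  · exact oInf_pd_ofReal_add hf _ (h _) hg.2.1.symm
  · exact oInf_pd_ofReal_add hf _ (h _) hg.2.2.symm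

theorem oInf_act_sU : OInf 1 (fun k => act (fL σ) (fN t A σ) (sU σ) (k, q)) :=
  hσ.oInf_act_ofReal_add hq ht hA (g := pr₁) (hσ.gen_u hq).1 (m := 0)
    (fun v => ((hσ.gen_u hq).2.oInf_param (hσ.gen_u hq).1 v).mono zero_le_one) zero_le_one
    (by simp [pr₁, vx])

theorem oInf_act_rV : OInf 1 (fun k => act (fL σ) (fN t A σ) (rV σ) (k, q)) :=
  hσ.oInf_act_ofReal_add hq ht hA (g := pr₂) (hσ.gen_v hq).1 (m := 0)
    (fun v => ((hσ.gen_v hq).2.oInf_param (hσ.gen_v hq).1 v).mono zero_le_one) zero_le_one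
    (by simp [pr₂, vx])

theorem oInf_act_rM : OInf 2 (fun k => act (fL σ) (fN t A σ) (rM σ) (k, q)) := by
  have h1 : HolSmooth (fun p : ℂ × Par => p.1⁻¹ * gen (fun ε => (σ ε).h) p) q :=
    (HolSmooth.fst.inv (HolSmooth.eventually_ne_zero q)).mul (hσ.gen_h hq).1
  have h2 : HolSmooth.Vanishes (fun p : ℂ × Par => p.1⁻¹ * gen (fun ε => (σ ε).h) p) q := by
    filter_upwards [(hσ.gen_h hq).2] with q' hq'
    simpa using (Filter.tendsto_inv₀_cobounded (α := ℂ)).mul hq'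
  exact hσ.oInf_act_ofReal_add hq ht hA (g := prX) h1 (m := 1) (fun v => h2.oInf_param h1 v) le_rfl
    (by simp [prX, vx, v₁, v₂])

theorem holSmooth_br : HolSmooth (br (fN t A σ) (fL σ)) q :=
  (hσ.holSmooth_fN hq ht hA).br (hσ.holSmooth_fL hq)

/-- The leading contribution is `-N_x ∂_k L`, of order `k⁻¹`, so the variation preserves the
normalization `L = k + O(k⁻¹)`. -/
theorem oInf_br_fL : OInf 1 (fun k => br (fN t A σ) (fL σ) (k, q)) := by
  have hN := hσ.holSmooth_fN hq ht hA
  have hN0 := hσ.vanishes_fN hq ht hA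
  have hg := hσ.gen_g hq
  have hp : ∀ v : Par, OInf 1 (fun k => pd (0, v) (fL σ) (k, q)) := by
    intro v
    refine (hg.2.oInf_param hg.1 v).congr (Eventually.nearInf_self
      (P := fun p => pd (0, v) (fL σ) p = pd (0, v) (gen fun ε => (σ ε).g) p) ?_)
    filter_upwards [hg.1] with p hp
    change pd (0, v) (fun p => p.1 + gen (fun ε => (σ ε).g) p) p = _
    rw [pd_add (differentiableAt_fst) (dAt hp.1)]
    simp [pd, fderiv_fst]
  have hk : OInf 0 (fun k => pd vk (fL σ) (k, q)) := by
    refine ((OInf.const 1).add ((hg.2.oInf_fst hg.1).mono (Nat.zero_le _))).congr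
      (Eventually.nearInf_self
      (P := fun p => pd vk (fL σ) p = 1 + pd vk (gen fun ε => (σ ε).g) p) ?_)
    filter_upwards [hg.1] with p hp
    change pd vk (fun p => p.1 + gen (fun ε => (σ ε).g) p) p = _
    rw [pd_add (differentiableAt_fst) (dAt hp.1)]
    simp [pd, fderiv_fst, vk]
  refine OInf.add (OInf.sub ?_ ?_) (OInf.sub ?_ ?_)
  · exact ((hN0.oInf_fst hN).mul (hp _)).mono (by omega)
  · exact ((hN0.oInf_param hN _).mul hk)
  · exact ((hN0.oInf_param hN _).mul (hp _)).mono (by omega)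
  · exact ((hN0.oInf_param hN _).mul (hp _)).mono (by omega)

end NiceFam

/-- The symmetry along a family of states. -/
def symF (t : ℕ → ℤ → ℂ) (A : Symbol) (σ : ℝ → State) : ℝ → State := fun ε => symmetry t A (σ ε)

section symmetry

variable (hΩ : IsOpen Ω) (hσ : NiceFam Ω σ) (ht : EntireTimes t) (hA : IsSymbol A)
include hΩ hσ ht hA

/-- The prescribed variation of `L` vanishes at infinity and is therefore the sum of the Laurent
coefficients by which the vector field is defined. The companions for `u`, `v` and `h` play the same
role in powers of `L`. -/
theorem symF_g : NiceGen Ω (fun ε => (symF t A σ ε).g) ∧ ∀ q : Par, q.2.1 ∈ Ω →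
    gen (fun ε => (symF t A σ ε).g) =ᶠ[nearInf q] br (fN t A σ) (fL σ) := by
  have h1 : ∀ q : Par, q.2.1 ∈ Ω → unc (fun ε => variation t A (σ ε) (laxL (σ ε)))
      =ᶠ[nearInf q] br (fN t A σ) (fL σ) := fun q hq =>
    unc_bracket (F := fun ε => negPart (subst t A (σ ε)))
      (G := fun ε => laxL (σ ε)) (hσ.holSmooth_fN hq ht hA) (hσ.holSmooth_fL hq)
  have h2 : ∀ q : Par, q.2.1 ∈ Ω → HolSmooth.Vanishes (br (fN t A σ) (fL σ)) q := fun q hq =>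
    vanishes_of_forall hΩ (fun q hq => (hσ.oInf_br_fL hq ht hA).tendsto) hq
  have h3 : ∀ ε, ∀ x ∈ Ω, ∀ a b, ∀ n : ℕ, (symF t A σ ε).g n x a b
      = laurentCoeff (fun k => br (fN t A σ) (fL σ) (k, ε, x, a, b)) (-(n + 1 : ℤ)) :=
    fun ε x hx a b n => laurentCoeff_congr (Eventually.nearInf_self (h1 (ε, x, a, b) hx)) _
  exact ⟨NiceGen.of_laurentCoeff hΩ (fun q hq => hσ.holSmooth_br hq ht hA) h2 h3,
    fun q hq => gen_eq_of_laurentCoeff hΩ (fun q hq => hσ.holSmooth_br hq ht hA) h2 h3 hq⟩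

theorem symF_u : NiceGen Ω (fun ε => (symF t A σ ε).u) ∧ ∀ q : Par, q.2.1 ∈ Ω →
    ∀ᶠ p in nearInf q, gen (fun ε => (symF t A σ ε).u) (fL σ p, p.2)
      = act (fL σ) (fN t A σ) (sU σ) p := by
  have h1 : ∀ q : Par, q.2.1 ∈ Ω → unc (fun ε => serVariation t A (σ ε) (serU (σ ε)) (laxU (σ ε)))
      =ᶠ[nearInf q] act (fL σ) (fN t A σ) (sU σ) := fun q hq =>
    unc_serVariation hσ hq ht hA (Z := fun ε => serU (σ ε)) (hσ.holSmooth_sU hq)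
  obtain ⟨h2, h3⟩ := hσ.coeffInL hΩ 0
    (f := fun ε => serVariation t A (σ ε) (serU (σ ε)) (laxU (σ ε)))
    (fun q hq => ((hσ.holSmooth_fN hq ht hA).act (hσ.holSmooth_sU hq) (hσ.holSmooth_fL hq)
      (hσ.tendsto_fL hq)).congr (h1 q hq))
    (fun q hq => (hσ.oInf_act_sU hq ht hA).congr (Eventually.nearInf_self (h1 q hq)))
  refine ⟨h2, fun q hq => ?_⟩
  filter_upwards [h1 q hq, h3 q hq] with p h4 h5
  rw [← h4]
  refine Eq.trans h5 ?_
  rw [pow_zero, one_mul]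

/-- The part of the variation of a series that does not come from the explicit sum over the times. -/
theorem unc_serVariation_sub {T : ℂ → ℂ → ℂ} (hT : Differentiable ℂ fun p : ℂ × ℂ => T p.1 p.2)
    {Z : ℝ → PhaseFun} {R : ℂ × Par → ℂ} {q : Par} (hq : q.2.1 ∈ Ω) (hR : HolSmooth R q)
    (hZ : HolSmooth (unc Z) q) (hZR : unc Z =ᶠ[nearInf q] fun p => T p.1 (sU σ p) + R p) :
    unc (fun ε k x a b => serVariation t A (σ ε) (Z ε)
        (fun k x a b => Z ε (laxL (σ ε) k x a b) x a b) k x a b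
      - deriv (fun w => T (laxL (σ ε) k x a b) w) (laxU (σ ε) k x a b)
        * serVariation t A (σ ε) (serU (σ ε)) (laxU (σ ε)) k x a b)
      =ᶠ[nearInf q] act (fL σ) (fN t A σ) R := by
  have h1 := unc_serVariation hσ hq ht hA (Z := fun ε => serU (σ ε)) (hσ.holSmooth_sU hq)
  have h2 := unc_serVariation hσ hq ht hA hZ
  have h3 := act_congr (N := fN t A σ) (hσ.tendsto_fL_nearInf hq) hZR
  have h4 := hσ.act_add_comp_sU hq hT hR (fN t A σ)
  filter_upwards [h1, h2, h3, h4] with p h1 h2 h3 h4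
  have h5 := h2.trans (h3.trans h4)
  simp only [unc] at h1 h5 ⊢
  change _ - deriv (fun w => T (fL σ p) w) (fU σ p) * serVariation t A (σ p.2.1) (serU (σ p.2.1))
    (fun k x a b => serU (σ p.2.1) (laxL (σ p.2.1) k x a b) x a b) p.1 p.2.2.1 p.2.2.2.1 p.2.2.2.2 = _
  rw [h5, h1]
  change _ + _ - _ * act (fL σ) (fN t A σ) (sU σ) p = _
  ring

theorem symF_v : NiceGen Ω (fun ε => (symF t A σ ε).v) ∧ ∀ q : Par, q.2.1 ∈ Ω →
    ∀ᶠ p in nearInf q, gen (fun ε => (symF t A σ ε).v) (fL σ p, p.2)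
      = act (fL σ) (fN t A σ) (rV σ) p := by
  have h1 : ∀ q : Par, q.2.1 ∈ Ω → _ =ᶠ[nearInf q] act (fL σ) (fN t A σ) (rV σ) := fun q hq =>
    unc_serVariation_sub hΩ hσ ht hA (T := timeV t) (differentiable_timeV ht)
      (Z := fun ε => serV t (σ ε)) hq (hσ.holSmooth_rV hq) (hσ.holSmooth_sV hq ht)
      (Eventually.of_forall sV_eq)
  obtain ⟨h2, h3⟩ := hσ.coeffInL hΩ 0
    (f := fun ε k x a b => serVariation t A (σ ε) (serV t (σ ε)) (laxV t (σ ε)) k x a b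
      - deriv (fun w => timeV t (laxL (σ ε) k x a b) w) (laxU (σ ε) k x a b)
        * serVariation t A (σ ε) (serU (σ ε)) (laxU (σ ε)) k x a b)
    (fun q hq => ((hσ.holSmooth_fN hq ht hA).act (hσ.holSmooth_rV hq) (hσ.holSmooth_fL hq)
      (hσ.tendsto_fL hq)).congr (h1 q hq))
    (fun q hq => (hσ.oInf_act_rV hq ht hA).congr (Eventually.nearInf_self (h1 q hq)))
  refine ⟨h2, fun q hq => ?_⟩
  filter_upwards [h1 q hq, h3 q hq] with p h4 h5
  rw [← h4]
  refine Eq.trans h5 ?_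
  rw [pow_zero, one_mul]
  rfl

/-- The extra factor `L` reflects that the coefficients `h` enter `M(λ)` through `λ⁻¹` times their
generating series. -/
theorem symF_h : NiceGen Ω (fun ε => (symF t A σ ε).h) ∧ ∀ q : Par, q.2.1 ∈ Ω →
    ∀ᶠ p in nearInf q, gen (fun ε => (symF t A σ ε).h) (fL σ p, p.2)
      = fL σ p * act (fL σ) (fN t A σ) (rM σ) p := by
  have h1 : ∀ q : Par, q.2.1 ∈ Ω → _ =ᶠ[nearInf q] act (fL σ) (fN t A σ) (rM σ) := fun q hq =>
    unc_serVariation_sub hΩ hσ ht hA (T := timeM t) (differentiable_timeM ht)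
      (Z := fun ε => serM t (σ ε)) hq (hσ.holSmooth_rM hq) (hσ.holSmooth_sM hq ht)
      (sM_eventuallyEq q)
  obtain ⟨h2, h3⟩ := hσ.coeffInL hΩ 1
    (f := fun ε k x a b => serVariation t A (σ ε) (serM t (σ ε)) (laxM t (σ ε)) k x a b
      - deriv (fun w => timeM t (laxL (σ ε) k x a b) w) (laxU (σ ε) k x a b)
        * serVariation t A (σ ε) (serU (σ ε)) (laxU (σ ε)) k x a b)
    (fun q hq => ((hσ.holSmooth_fN hq ht hA).act (hσ.holSmooth_rM hq) (hσ.holSmooth_fL hq)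
      (hσ.tendsto_fL hq)).congr (h1 q hq))
    (fun q hq => (hσ.oInf_act_rM hq ht hA).congr (Eventually.nearInf_self (h1 q hq)))
  refine ⟨h2, fun q hq => ?_⟩
  filter_upwards [h1 q hq, h3 q hq] with p h4 h5
  rw [← h4]
  refine Eq.trans h5 ?_
  rw [pow_one]
  rfl

theorem NiceFam.symF : NiceFam Ω (symF t A σ) :=
  ⟨(symF_g hΩ hσ ht hA).1, (symF_h hΩ hσ ht hA).1, (symF_u hΩ hσ ht hA).1, (symF_v hΩ hσ ht hA).1⟩

end symmetry

end fam

/-! ### Restriction and derivative of a family at the parameter value `0` -/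

/-- The restriction to `ε = 0`. -/
def at0 (f : ℂ × Par → ℂ) : ℂ × Par → ℂ := fun p => f (p.1, 0, p.2.2)

/-- The derivative in `ε` at `ε = 0`. -/
def dε (f : ℂ × Par → ℂ) : ℂ × Par → ℂ := at0 (pd vε f)

section at0

variable {q : Par} {f g : ℂ × Par → ℂ}

theorem tendsto_at0 (q : Par) :
    Tendsto (fun p : ℂ × Par => ((p.1, 0, p.2.2) : ℂ × Par)) (nearInf q) (nearInf (0, q.2)) :=
  tendsto_param_nearInf (φ := fun q : Par => ((0, q.2) : Par)) tendsto_fst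
    (Continuous.continuousAt (by fun_prop))

theorem HolSmooth.at0 (hf : HolSmooth f (0, q.2)) : HolSmooth (at0 f) q :=
  HolSmooth.comp_right (φ := fun q : Par => ((0, q.2) : Par)) hf
    (Eventually.of_forall fun _ => (contDiff_const.prodMk contDiff_snd).contDiffAt)

theorem HolSmooth.dε (hf : HolSmooth f (0, q.2)) : HolSmooth (dε f) q := (hf.pd _).at0

theorem at0_congr (h : f =ᶠ[nearInf (0, q.2)] g) : at0 f =ᶠ[nearInf q] at0 g :=
  (tendsto_at0 q).eventually h

theorem dε_congr (h : f =ᶠ[nearInf (0, q.2)] g) : dε f =ᶠ[nearInf q] dε g :=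
  at0_congr (HolSmooth.pd_congr h vε)

theorem pd_at0 (hf : HolSmooth f (0, q.2)) :
    ∀ᶠ p in nearInf q, ∀ v, pd v (at0 f) p = at0 (pd (v.1, 0, v.2.2) f) p := by
  filter_upwards [(tendsto_at0 q).eventually hf] with p hp v
  have h1 : HasFDerivAt (fun p : ℂ × Par => ((p.1, 0, p.2.2) : ℂ × Par))
      ((ContinuousLinearMap.fst ℝ ℂ Par).prod ((0 : ℂ × Par →L[ℝ] ℝ).prod
        ((ContinuousLinearMap.snd ℝ ℝ _).comp (ContinuousLinearMap.snd ℝ ℂ Par)))) p :=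
    hasFDerivAt_fst.prodMk ((hasFDerivAt_const _ _).prodMk (hasFDerivAt_snd.comp p hasFDerivAt_snd))
  have h2 := HasFDerivAt.comp p (f := fun p : ℂ × Par => ((p.1, 0, p.2.2) : ℂ × Par))
    (dAt hp.1).hasFDerivAt h1
  simp only [pd]
  exact congrArg (fun T => T v) h2.fderiv

theorem br_at0 (hf : HolSmooth f (0, q.2)) (hg : HolSmooth g (0, q.2)) :
    br (at0 f) (at0 g) =ᶠ[nearInf q] at0 (br f g) := by
  filter_upwards [pd_at0 hf, pd_at0 hg] with p h1 h2
  simp only [br, h1, h2]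
  rfl

theorem pd_at0_fst (hf : HolSmooth f (0, q.2)) : pd vk (at0 f) =ᶠ[nearInf q] at0 (pd vk f) := by
  filter_upwards [pd_at0 hf] with p h1
  rw [h1]
  rfl

theorem dε_br (hf : HolSmooth f (0, q.2)) (hg : HolSmooth g (0, q.2)) :
    dε (br f g) =ᶠ[nearInf q] fun p => br (dε f) (at0 g) p + br (at0 f) (dε g) p := by
  filter_upwards [(tendsto_at0 q).eventually hf, (tendsto_at0 q).eventually hg,
    br_at0 (hf.pd vε) hg, br_at0 hf (hg.pd vε)] with p h1 h2 h3 h4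
  exact (pd_br h1.1 h2.1 vε).trans (congrArg₂ (· + ·) h3 h4).symm

theorem dε_mul (hf : HolSmooth f (0, q.2)) (hg : HolSmooth g (0, q.2)) :
    dε (fun p => f p * g p) =ᶠ[nearInf q] fun p => dε f p * at0 g p + at0 f p * dε g p := by
  filter_upwards [(tendsto_at0 q).eventually hf, (tendsto_at0 q).eventually hg] with p h1 h2
  exact pd_mul (dAt h1.1) (dAt h2.1) vε

theorem dε_add (hf : HolSmooth f (0, q.2)) (hg : HolSmooth g (0, q.2)) :
    dε (fun p => f p + g p) =ᶠ[nearInf q] fun p => dε f p + dε g p := by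
  filter_upwards [(tendsto_at0 q).eventually hf, (tendsto_at0 q).eventually hg] with p h1 h2
  exact pd_add (dAt h1.1) (dAt h2.1) vε

theorem dε_negU (hf : HolSmooth f (0, q.2)) : dε (negU f) =ᶠ[nearInf q] negU (dε f) :=
  at0_congr (q := q) (Toroidal.pd_negU hf (1, 0, 0, 0))

theorem dε_pd_fst (hf : HolSmooth f (0, q.2)) : dε (pd vk f) =ᶠ[nearInf q] pd vk (dε f) := by
  filter_upwards [(tendsto_at0 q).eventually hf, pd_at0_fst (hf.pd vε)] with p h1 h2
  rw [dε, dε, h2]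
  exact pd_comm h1.1 vε vk

theorem negU_congr (h : f =ᶠ[nearInf q] g) : negU f =ᶠ[nearInf q] negU g := by
  obtain ⟨R, h0, hR⟩ := eventually_nearInf.1 h
  refine eventually_nearInf.2 ⟨R, h0, hR.mono fun q' hq' k hk => ?_⟩
  exact congrFun (neg₁_congr (eventually_cobounded_iff.2 ⟨R, h0, hq'⟩)) k

theorem dε_eq_of_affine {u w : ℂ × Par → ℂ} (hf : HolSmooth f (0, q.2))
    (h : f =ᶠ[nearInf (0, q.2)] fun p => at0 u p + p.2.1 * at0 w p) :
    dε f =ᶠ[nearInf q] at0 w := by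
  filter_upwards [(tendsto_at0 q).eventually hf,
    (tendsto_at0 q).eventually (Eventually.nearInf_nhds h)] with ⟨k, ε, x, a, b⟩ h1 h2
  have h3 : HasDerivAt (fun s : ℝ => f (k, s, x, a, b)) (pd vε f (k, 0, x, a, b)) 0 :=
    hasDerivAt_ε (dAt h1.1)
  have h4 : HasDerivAt (fun s : ℝ => at0 u (k, 0, x, a, b) + (s : ℂ) * at0 w (k, 0, x, a, b))
      (at0 w (k, 0, x, a, b)) 0 := by
    have := ((Complex.ofRealCLM.hasDerivAt (x := (0 : ℝ))).mul_const
      (at0 w (k, 0, x, a, b))).const_add (at0 u (k, 0, x, a, b))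
    simpa using this
  have h5 : Tendsto (fun s : ℝ => ((k, s, x, a, b) : ℂ × Par)) (𝓝 0) (𝓝 (k, 0, x, a, b)) :=
    Continuous.tendsto (by fun_prop) 0
  exact h3.unique (h4.congr_of_eventuallyEq (h5.eventually h2))

/-- The chain rule for the derivative in `ε`. -/
theorem dε_holomorphic_comp {Y : Type} [NormedAddCommGroup Y] [NormedSpace ℂ Y] {F : Y → ℂ}
    {c : ℂ × Par → Y} (hF : ∀ᶠ p in nearInf (0, q.2), DifferentiableAt ℂ F (c p))
    (hc : HolSmooth c (0, q.2)) : ∀ᶠ p in nearInf q,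
      dε (fun p => F (c p)) p = fderiv ℂ F (c (p.1, 0, p.2.2)) (pd vε c (p.1, 0, p.2.2)) := by
  filter_upwards [(tendsto_at0 q).eventually hc, (tendsto_at0 q).eventually hF] with p h1 h2
  exact pd_holomorphic_comp h2 (h1.1.differentiableAt (by simp)) vε

theorem pd_prodMk {X Y Y' : Type} [NormedAddCommGroup X] [NormedSpace ℝ X] [NormedAddCommGroup Y]
    [NormedSpace ℝ Y] [NormedAddCommGroup Y'] [NormedSpace ℝ Y'] {f : X → Y} {g : X → Y'} {p : X}
    (hf : DifferentiableAt ℝ f p) (hg : DifferentiableAt ℝ g p) (v : X) :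
    fderiv ℝ (fun p => (f p, g p)) p v = (fderiv ℝ f p v, fderiv ℝ g p v) := by
  rw [DifferentiableAt.fderiv_prodMk hf hg]
  rfl

end at0

/-! ### The flow of a state -/

theorem State.shift_zero (s Y : State) : s.shift Y 0 = s := by
  simp [State.shift]

section flow

variable {Ω : Set ℝ} {t : ℕ → ℤ → ℂ} {s Y : State} {q : Par} {A B : Symbol}

theorem NiceFam.shift (hΩ : IsOpen Ω) (hs : NiceFam Ω fun _ => s) (hY : NiceFam Ω fun _ => Y) :
    NiceFam Ω (s.shift Y) :=
  ⟨(hs.g.shift hΩ hY.g).1, (hs.h.shift hΩ hY.h).1, (hs.u.shift hΩ hY.u).1, (hs.v.shift hΩ hY.v).1⟩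

theorem at0_unc (F : ℝ → PhaseFun) : at0 (unc F) = unc fun _ => F 0 := rfl

theorem at0_fL : at0 (fL (s.shift Y)) = fL fun _ => s := by
  rw [fL, at0_unc, State.shift_zero]; rfl

theorem at0_fM : at0 (fM t (s.shift Y)) = fM t fun _ => s := by
  rw [fM, at0_unc, State.shift_zero]; rfl

theorem at0_fU : at0 (fU (s.shift Y)) = fU fun _ => s := by
  rw [fU, at0_unc, State.shift_zero]; rfl

theorem at0_fV : at0 (fV t (s.shift Y)) = fV t fun _ => s := by
  rw [fV, at0_unc, State.shift_zero]; rfl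

theorem at0_sM : at0 (sM t (s.shift Y)) = sM t fun _ => s := by
  rw [sM, at0_unc, State.shift_zero]; rfl

theorem at0_sU : at0 (sU (s.shift Y)) = sU fun _ => s := by
  rw [sU, at0_unc, State.shift_zero]; rfl

theorem at0_sV : at0 (sV t (s.shift Y)) = sV t fun _ => s := by
  rw [sV, at0_unc, State.shift_zero]; rfl

theorem at0_fA : at0 (fA t B (s.shift Y)) = fA t B fun _ => s := by
  rw [fA, at0_unc, State.shift_zero]; rfl

theorem at0_fN : at0 (fN t B (s.shift Y)) = fN t B fun _ => s := by
  change negU (at0 (fA t B (s.shift Y))) = _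
  rw [at0_fA]; rfl

variable (hΩ : IsOpen Ω) (hs : NiceFam Ω fun _ => s) (hY : NiceFam Ω fun _ => Y)
  (ht : EntireTimes t) (hq : q.2.1 ∈ Ω)
include hΩ hs hY hq

theorem dε_fL : dε (fL (s.shift Y)) =ᶠ[nearInf q] gen fun _ => Y.g := by
  refine dε_eq_of_affine (u := fL fun _ => s) (w := gen fun _ => Y.g)
    ((hs.shift hΩ hY).holSmooth_fL hq) ?_
  filter_upwards [(hs.g.shift hΩ hY.g).2 (0, q.2) hq] with p hp
  rw [fL_eq]
  change _ + gen (fun ε n x a b => s.g n x a b + ε * Y.g n x a b) p = _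
  rw [hp, ← add_assoc]
  rfl

theorem dε_sU : dε (sU (s.shift Y)) =ᶠ[nearInf q] gen fun _ => Y.u := by
  refine dε_eq_of_affine (u := sU fun _ => s) (w := gen fun _ => Y.u)
    ((hs.shift hΩ hY).holSmooth_sU hq) ?_
  filter_upwards [(hs.u.shift hΩ hY.u).2 (0, q.2) hq] with p hp
  rw [sU_eq]
  change _ + gen (fun ε n x a b => s.u n x a b + ε * Y.u n x a b) p = _
  rw [hp, ← add_assoc]
  rfl

theorem dε_rV : dε (rV (s.shift Y)) =ᶠ[nearInf q] gen fun _ => Y.v := by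
  refine dε_eq_of_affine (u := rV fun _ => s) (w := gen fun _ => Y.v)
    ((hs.shift hΩ hY).holSmooth_rV hq) ?_
  filter_upwards [(hs.v.shift hΩ hY.v).2 (0, q.2) hq] with p hp
  rw [rV]
  change _ + gen (fun ε n x a b => s.v n x a b + ε * Y.v n x a b) p = _
  rw [hp, ← add_assoc]
  rfl

theorem dε_rM : dε (rM (s.shift Y)) =ᶠ[nearInf q] fun p => p.1⁻¹ * gen (fun _ => Y.h) p := by
  refine dε_eq_of_affine (u := rM fun _ => s) (w := fun p => p.1⁻¹ * gen (fun _ => Y.h) p)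
    ((hs.shift hΩ hY).holSmooth_rM hq) ?_
  filter_upwards [(hs.h.shift hΩ hY.h).2 (0, q.2) hq] with p hp
  rw [rM]
  change _ + _ * gen (fun ε n x a b => s.h n x a b + ε * Y.h n x a b) p = _
  rw [hp]
  simp only [at0, rM, gen]
  ring

omit hY in
theorem fderiv_comp_snd {T : ℂ × ℂ → ℂ} (hT : Differentiable ℂ T) (l w z : ℂ) :
    fderiv ℂ T (l, w) (0, z) = deriv (fun w => T (l, w)) w * z := by
  have h5 : HasDerivAt (fun w => T (l, w)) (fderiv ℂ T (l, w) (0, 1)) w :=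
    (hT _).hasFDerivAt.comp_hasDerivAt (f := fun w => (l, w)) _
      ((hasDerivAt_const _ _).prodMk (hasDerivAt_id _))
  rw [h5.deriv, show ((0 : ℂ), z) = z • ((0 : ℂ), (1 : ℂ)) by simp, map_smul, smul_eq_mul, mul_comm]

theorem dε_comp_sU {T : ℂ × ℂ → ℂ} (hT : Differentiable ℂ T) :
    dε (fun p => T (p.1, sU (s.shift Y) p)) =ᶠ[nearInf q] fun p =>
      deriv (fun w => T (p.1, w)) (sU (fun _ => s) p) * gen (fun _ => Y.u) p := by
  have hτ := hs.shift hΩ hY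
  have hu : HolSmooth (sU (s.shift Y)) (0, q.2) := hτ.holSmooth_sU hq
  filter_upwards [dε_holomorphic_comp (q := q) (F := T) (c := fun p => (p.1, sU (s.shift Y) p))
    (Eventually.of_forall fun p => hT _) (HolSmooth.fst.prodMk hu),
    (tendsto_at0 q).eventually hu, dε_sU hΩ hs hY hq] with p h1 h2 h3
  rw [h1]
  simp only [pd]
  rw [pd_prodMk differentiableAt_fst (dAt h2.1)]
  have h4 : fderiv ℝ Prod.fst ((p.1, 0, p.2.2) : ℂ × Par) vε = 0 := by rw [fderiv_fst]; rfl
  have h5 : fderiv ℝ (sU (s.shift Y)) (p.1, 0, p.2.2) vε = gen (fun _ => Y.u) p := h3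
  have h6 : sU (s.shift Y) (p.1, 0, p.2.2) = sU (fun _ => s) p := congrFun at0_sU p
  change fderiv ℂ T (p.1, sU (s.shift Y) (p.1, 0, p.2.2))
    (fderiv ℝ Prod.fst ((p.1, 0, p.2.2) : ℂ × Par) vε, _) = _
  rw [h4, h5, h6]
  exact fderiv_comp_snd hΩ hs hq hT _ _ _

/-- The chain rule for the derivative in `ε` of a series at `lambda = L`. -/
theorem dε_comp_fL {S : ℂ × Par → ℂ} (hS : HolSmooth S (0, q.2)) :
    dε (fun p => S (fL (s.shift Y) p, p.2)) =ᶠ[nearInf q] fun p =>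
      dε S (fL (fun _ => s) p, p.2) + pd vk (at0 S) (fL (fun _ => s) p, p.2)
        * gen (fun _ => Y.g) p := by
  have hτ := hs.shift hΩ hY
  filter_upwards [(tendsto_at0 q).eventually (hτ.pd_comp_fL (q := (0, q.2)) hq hS),
    (hs.tendsto_fL_nearInf hq).eventually (pd_at0_fst hS), dε_fL hΩ hs hY hq] with p h1 h2 h3
  rw [h2, ← h3]
  refine (h1 vε).trans ?_
  have h6 : fL (s.shift Y) (p.1, 0, p.2.2) = fL (fun _ => s) p := congrFun at0_fL p
  simp only [h6]
  rfl

end flow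

/-! ### Substitution of functions into a symbol -/

/-- The symbol `A` at `(L, M, U, V)`. -/
def sub (A : Symbol) (L M U V : ℂ × Par → ℂ) : ℂ × Par → ℂ := fun p => A (L p) (M p) (U p) (V p)

section sub

variable {A B : Symbol} {L M U V : ℂ × Par → ℂ} {q : Par}

theorem HolSmooth.sub_symbol (hA : IsSymbol A) (hL : HolSmooth L q) (hM : HolSmooth M q)
    (hU : HolSmooth U q) (hV : HolSmooth V q)
    (ht : Tendsto L (nearInf q) (Bornology.cobounded ℂ)) : HolSmooth (Toroidal.sub A L M U V) q := by
  obtain ⟨ρ, -, hρ⟩ := hA.eventually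
  refine HolSmooth.holomorphic_comp (F := uncS A) (isOpen_lt_norm_fst ρ)
    (fun p hp => (hρ p hp).differentiableWithinAt)
    (c := fun p => (L p, M p, U p, V p)) (hL.prodMk (hM.prodMk (hU.prodMk hV))) ?_
  exact (tendsto_norm_cobounded_atTop.comp ht).eventually (eventually_gt_atTop ρ)

theorem pd_sub_symbol (hA : IsSymbol A) (hL : HolSmooth L q) (hM : HolSmooth M q)
    (hU : HolSmooth U q) (hV : HolSmooth V q) (ht : Tendsto L (nearInf q) (Bornology.cobounded ℂ)) :
    ∀ᶠ p in nearInf q, ∀ v, pd v (sub A L M U V) p = sub (dL A) L M U V p * pd v L p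
      + sub (dM A) L M U V p * pd v M p + sub (dU A) L M U V p * pd v U p
      + sub (dV A) L M U V p * pd v V p := by
  obtain ⟨ρ, -, hρ⟩ := hA.eventually
  filter_upwards [hL, hM, hU, hV, (tendsto_norm_cobounded_atTop.comp ht).eventually
    (eventually_gt_atTop ρ)] with p h1 h2 h3 h4 h5 v
  have d3 : DifferentiableAt ℝ (fun p => (U p, V p)) p := (dAt h3.1).prodMk (dAt h4.1)
  have d2 : DifferentiableAt ℝ (fun p => (M p, U p, V p)) p := (dAt h2.1).prodMk d3
  have d1 : DifferentiableAt ℝ (fun p => (L p, M p, U p, V p)) p := (dAt h1.1).prodMk d2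
  have h6 := pd_holomorphic_comp (F := uncS A) (c := fun p => (L p, M p, U p, V p))
    (hρ (L p, M p, U p, V p) h5) d1 v
  refine h6.trans ?_
  rw [fderiv_uncS (hρ (L p, M p, U p, V p) h5)]
  simp only [pd]
  rw [pd_prodMk (dAt h1.1) d2, pd_prodMk (dAt h2.1) d3, pd_prodMk (dAt h3.1) (dAt h4.1)]
  simp only [uncS, sub]
  ring

end sub

/-! ### The variations along a symmetry -/

theorem fA_eq_sub (t : ℕ → ℤ → ℂ) (A : Symbol) (σ : ℝ → State) :
    fA t A σ = sub A (fL σ) (fM t σ) (fU σ) (fV t σ) := rfl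

/-- The variation of `𝓤(lambda)`, `𝓥(lambda)`, `𝓜(lambda)` at fixed `lambda` under a variation of the
coefficients. -/
def velU (Y : ℝ → State) : ℂ × Par → ℂ := gen fun ε => (Y ε).u
def velV (t : ℕ → ℤ → ℂ) (σ Y : ℝ → State) : ℂ × Par → ℂ := fun p =>
  deriv (fun w => timeV t p.1 w) (sU σ p) * gen (fun ε => (Y ε).u) p + gen (fun ε => (Y ε).v) p
def velM (t : ℕ → ℤ → ℂ) (σ Y : ℝ → State) : ℂ × Par → ℂ := fun p =>
  deriv (fun w => timeM t p.1 w) (sU σ p) * gen (fun ε => (Y ε).u) p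
    + p.1⁻¹ * gen (fun ε => (Y ε).h) p

section vel

variable {Ω : Set ℝ} {t : ℕ → ℤ → ℂ} {σ Y : ℝ → State} {q : Par} {A B : Symbol}

theorem differentiable_deriv_snd {T : ℂ × ℂ → ℂ} (hT : Differentiable ℂ T) :
    Differentiable ℂ (fun p : ℂ × ℂ => deriv (fun w => T (p.1, w)) p.2) := by
  have h : (fun p : ℂ × ℂ => deriv (fun w => T (p.1, w)) p.2) = fun p => fderiv ℂ T p (0, 1) := by
    funext p
    exact ((hT p).hasFDerivAt.comp_hasDerivAt (f := fun w => (p.1, w)) _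
      ((hasDerivAt_const _ _).prodMk (hasDerivAt_id _))).deriv
  rw [h]
  exact fun p => (differentiableOn_fderiv_apply isOpen_univ hT.differentiableOn (0, 1)).differentiableAt
    univ_mem

theorem holSmooth_velU (hY : NiceFam Ω Y) (hq : q.2.1 ∈ Ω) : HolSmooth (velU Y) q := (hY.gen_u hq).1

theorem holSmooth_velV (hσ : NiceFam Ω σ) (hY : NiceFam Ω Y) (ht : EntireTimes t) (hq : q.2.1 ∈ Ω) :
    HolSmooth (velV t σ Y) q :=
  ((hσ.holSmooth_comp_sU hq (differentiable_deriv_snd (differentiable_timeV ht))).mul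
    (hY.gen_u hq).1).add (hY.gen_v hq).1

theorem holSmooth_velM (hσ : NiceFam Ω σ) (hY : NiceFam Ω Y) (ht : EntireTimes t) (hq : q.2.1 ∈ Ω) :
    HolSmooth (velM t σ Y) q :=
  ((hσ.holSmooth_comp_sU hq (differentiable_deriv_snd (differentiable_timeM ht))).mul
    (hY.gen_u hq).1).add ((HolSmooth.fst.inv (HolSmooth.eventually_ne_zero q)).mul (hY.gen_h hq).1)

variable (hΩ : IsOpen Ω) (hσ : NiceFam Ω σ) (ht : EntireTimes t) (hA : IsSymbol A)
  (hq : q.2.1 ∈ Ω)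
include hΩ hσ ht hA hq

theorem velU_comp_fL : ∀ᶠ p in nearInf q, velU (symF t A σ) (fL σ p, p.2)
    = act (fL σ) (fN t A σ) (sU σ) p := (symF_u hΩ hσ ht hA).2 q hq

/-- The times enter through `U(λ)` only, with the same factor `∂_w timeV` on both sides; what
remains are the formulas for the coefficients `u` and `v`. -/
theorem velV_comp_fL : ∀ᶠ p in nearInf q, velV t σ (symF t A σ) (fL σ p, p.2)
    = act (fL σ) (fN t A σ) (sV t σ) p := by
  filter_upwards [(symF_u hΩ hσ ht hA).2 q hq, (symF_v hΩ hσ ht hA).2 q hq,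
    act_congr (N := fN t A σ) (hσ.tendsto_fL_nearInf hq)
      (Eventually.of_forall (sV_eq (t := t) (σ := σ)) :
      sV t σ =ᶠ[nearInf q] fun p => timeV t p.1 (sU σ p) + rV σ p),
    hσ.act_add_comp_sU hq (differentiable_timeV ht) (hσ.holSmooth_rV hq) (fN t A σ)]
    with p h1 h2 h3 h4
  rw [h3, h4, velV, h1, h2]
  rfl

theorem velM_comp_fL : ∀ᶠ p in nearInf q, velM t σ (symF t A σ) (fL σ p, p.2)
    = act (fL σ) (fN t A σ) (sM t σ) p := by
  filter_upwards [(symF_u hΩ hσ ht hA).2 q hq, (symF_h hΩ hσ ht hA).2 q hq,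
    act_congr (N := fN t A σ) (hσ.tendsto_fL_nearInf hq) (sM_eventuallyEq (t := t) (σ := σ) q),
    hσ.act_add_comp_sU hq (differentiable_timeM ht) (hσ.holSmooth_rM hq) (fN t A σ),
    hσ.fL_ne_zero hq]
    with p h1 h2 h3 h4 h5
  rw [h3, h4, velM, h1, h2, ← mul_assoc (fL σ p)⁻¹, inv_mul_cancel₀ h5, one_mul]
  rfl

/-- The variation of a function of the form `S(lambda)` at `lambda = L`. -/
theorem br_fN_comp_fL {S W : ℂ × Par → ℂ} (hS : HolSmooth S q)
    (hW : ∀ᶠ p in nearInf q, W (fL σ p, p.2) = act (fL σ) (fN t A σ) S p) :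
    br (fN t A σ) (fun p => S (fL σ p, p.2)) =ᶠ[nearInf q] fun p =>
      W (fL σ p, p.2) + pd vk S (fL σ p, p.2) * gen (fun ε => (symF t A σ ε).g) p := by
  filter_upwards [hW, hσ.br_comp_fL hq hS (fN t A σ), (symF_g hΩ hσ ht hA).2 q hq] with p h1 h2 h3
  rw [h2, h1, h3]

end vel

/-! ### Variations of the Lax functions along a symmetry -/

section flow

variable {Ω : Set ℝ} {t : ℕ → ℤ → ℂ} {s Y : State} {q : Par} {A B : Symbol}
variable (hΩ : IsOpen Ω) (hs : NiceFam Ω fun _ => s) (hY : NiceFam Ω fun _ => Y)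
  (ht : EntireTimes t) (hA : IsSymbol A) (hB : IsSymbol B) (hq : q.2.1 ∈ Ω)
include hΩ hs hq

section vel

include hY

theorem dε_sU_eq_vel : dε (sU (s.shift Y)) =ᶠ[nearInf q] velU fun _ => Y := dε_sU hΩ hs hY hq

include ht

theorem dε_sV_eq_vel : dε (sV t (s.shift Y)) =ᶠ[nearInf q] velV t (fun _ => s) fun _ => Y := by
  have hτ := hs.shift hΩ hY
  filter_upwards [dε_congr (q := q) (Eventually.of_forall (sV_eq (t := t) (σ := s.shift Y))),
    dε_add (hτ.holSmooth_comp_sU (q := (0, q.2)) hq (differentiable_timeV ht)) (hτ.holSmooth_rV hq),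
    dε_comp_sU hΩ hs hY hq (differentiable_timeV ht), dε_rV hΩ hs hY hq] with p h1 h2 h3 h4
  rw [h1, h2, h3, h4]
  rfl

theorem dε_sM_eq_vel : dε (sM t (s.shift Y)) =ᶠ[nearInf q] velM t (fun _ => s) fun _ => Y := by
  have hτ := hs.shift hΩ hY
  filter_upwards [dε_congr (sM_eventuallyEq (t := t) (σ := s.shift Y) (0, q.2)),
    dε_add (hτ.holSmooth_comp_sU (q := (0, q.2)) hq (differentiable_timeM ht)) (hτ.holSmooth_rM hq),
    dε_comp_sU hΩ hs hY hq (differentiable_timeM ht), dε_rM hΩ hs hY hq] with p h1 h2 h3 h4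
  rw [h1, h2, h3, h4]
  rfl

end vel

include ht hA

omit hq in
theorem niceFam_symmetry : NiceFam Ω fun _ => symmetry t A s := NiceFam.symF hΩ hs ht hA

omit hq in
theorem niceFam_shift_symmetry : NiceFam Ω (s.shift (symmetry t A s)) :=
  hs.shift hΩ (niceFam_symmetry hΩ hs ht hA)

theorem dε_flow_fL : dε (fL (s.shift (symmetry t A s))) =ᶠ[nearInf q]
    br (fN t A fun _ => s) (fL fun _ => s) :=
  (dε_fL hΩ hs (niceFam_symmetry hΩ hs ht hA) hq).trans ((symF_g hΩ hs ht hA).2 q hq)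

/-- The variation at fixed `λ` and the variation of `L` reassemble into one bracket, because the
derivative in `ε` and the bracket with `N` obey the same chain rule at `λ = L`. -/
theorem dε_flow_comp_fL {S W : ℂ × Par → ℂ} (hS : HolSmooth S (0, q.2))
    (h : dε S =ᶠ[nearInf q] W)
    (hW : ∀ᶠ p in nearInf q, W (fL (fun _ => s) p, p.2)
      = act (fL fun _ => s) (fN t A fun _ => s) (at0 S) p) :
    dε (fun p => S (fL (s.shift (symmetry t A s)) p, p.2)) =ᶠ[nearInf q]
      br (fN t A fun _ => s) (fun p => at0 S (fL (fun _ => s) p, p.2)) := by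
  filter_upwards [dε_comp_fL hΩ hs (niceFam_symmetry hΩ hs ht hA) hq hS,
    (hs.tendsto_fL_nearInf hq).eventually h, br_fN_comp_fL hΩ hs ht hA hq hS.at0 hW]
    with p h1 h2 h3
  rw [h1, h2, h3]
  rfl

theorem dε_flow_fU : dε (fU (s.shift (symmetry t A s))) =ᶠ[nearInf q]
    br (fN t A fun _ => s) (fU fun _ => s) := by
  have hY := niceFam_symmetry hΩ hs ht hA
  have := dε_flow_comp_fL hΩ hs ht hA hq ((hs.shift hΩ hY).holSmooth_sU (q := (0, q.2)) hq)
    (dε_sU_eq_vel hΩ hs hY hq) (by rw [at0_sU]; exact velU_comp_fL hΩ hs ht hA hq)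
  rw [at0_sU] at this
  exact this

theorem dε_flow_fV : dε (fV t (s.shift (symmetry t A s))) =ᶠ[nearInf q]
    br (fN t A fun _ => s) (fV t fun _ => s) := by
  have hY := niceFam_symmetry hΩ hs ht hA
  have := dε_flow_comp_fL hΩ hs ht hA hq ((hs.shift hΩ hY).holSmooth_sV (q := (0, q.2)) hq ht)
    (dε_sV_eq_vel hΩ hs hY ht hq) (by rw [at0_sV]; exact velV_comp_fL hΩ hs ht hA hq)
  rw [at0_sV] at this
  exact this

theorem dε_flow_fM : dε (fM t (s.shift (symmetry t A s))) =ᶠ[nearInf q]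
    br (fN t A fun _ => s) (fM t fun _ => s) := by
  have hY := niceFam_symmetry hΩ hs ht hA
  have := dε_flow_comp_fL hΩ hs ht hA hq ((hs.shift hΩ hY).holSmooth_sM (q := (0, q.2)) hq ht)
    (dε_sM_eq_vel hΩ hs hY ht hq) (by rw [at0_sM]; exact velM_comp_fL hΩ hs ht hA hq)
  rw [at0_sM] at this
  exact this

include hB

/-- Both the derivative along the symmetry and the bracket with `N` satisfy the chain rule for
substitution into a symbol, and they agree on the four arguments. -/
theorem dε_flow_fA : dε (fA t B (s.shift (symmetry t A s))) =ᶠ[nearInf q]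
    br (fN t A fun _ => s) (fA t B fun _ => s) := by
  have hτ := niceFam_shift_symmetry hΩ hs ht hA
  have hq0 : ((0, q.2) : Par).2.1 ∈ Ω := hq
  filter_upwards [dε_flow_fL hΩ hs ht hA hq, dε_flow_fM hΩ hs ht hA hq, dε_flow_fU hΩ hs ht hA hq,
    dε_flow_fV hΩ hs ht hA hq,
    pd_sub_symbol hB (hs.holSmooth_fL hq) (hs.holSmooth_fM hq ht) (hs.holSmooth_fU hq)
      (hs.holSmooth_fV hq ht) (hs.tendsto_fL hq),
    (tendsto_at0 q).eventually (pd_sub_symbol hB (hτ.holSmooth_fL hq0) (hτ.holSmooth_fM hq0 ht)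
      (hτ.holSmooth_fU hq0) (hτ.holSmooth_fV hq0 ht) (hτ.tendsto_fL hq0))] with p h1 h2 h3 h4 h5 h6
  have e1 : ∀ C : Symbol, sub C (fL (s.shift (symmetry t A s))) (fM t (s.shift (symmetry t A s)))
      (fU (s.shift (symmetry t A s))) (fV t (s.shift (symmetry t A s))) (p.1, 0, p.2.2)
      = sub C (fL fun _ => s) (fM t fun _ => s) (fU fun _ => s) (fV t fun _ => s) p := fun C =>
    congrFun (at0_fA (t := t) (B := C)) p
  have h7 := h6 vε
  simp only [e1] at h7
  simp only [dε, at0] at h1 h2 h3 h4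
  rw [h1, h2, h3, h4] at h7
  refine h7.trans ?_
  simp only [fA_eq_sub]
  simp only [br, h5]
  ring

theorem dε_flow_fN : dε (fN t B (s.shift (symmetry t A s))) =ᶠ[nearInf q]
    negU (br (fN t A fun _ => s) (fA t B fun _ => s)) :=
  (dε_negU ((niceFam_shift_symmetry hΩ hs ht hA).holSmooth_fA (q := (0, q.2)) hq ht hB)).trans
    (negU_congr (dε_flow_fA hΩ hs ht hA hB hq))

end flow

/-! ### The vector field of a symbol -/

section vectorField

variable {Ω : Set ℝ} {t : ℕ → ℤ → ℂ} {s : State} {A : Symbol} {x a b : ℝ}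

theorem hasDerivAt_family {F : ℝ → PhaseFun} {G : ℂ × Par → ℂ} {H : PhaseFun}
    (hF : HolSmooth (unc F) (0, x, a, b)) (h : dε (unc F) =ᶠ[nearInf (0, x, a, b)] G)
    (hG : unc (fun _ => H) =ᶠ[nearInf (0, x, a, b)] G) : ∀ᶠ k in Bornology.cobounded ℂ,
      HasDerivAt (fun ε : ℝ => F ε k x a b) (H k x a b) 0 := by
  filter_upwards [Eventually.nearInf_self hF, Eventually.nearInf_self h,
    Eventually.nearInf_self hG] with k h1 h2 h3
  have h4 : HasDerivAt (fun ε : ℝ => F ε k x a b) (pd vε (unc F) (k, 0, x, a, b)) 0 :=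
    hasDerivAt_ε (f := unc F) (dAt h1.1)
  have h5 : H k x a b = pd vε (unc F) (k, 0, x, a, b) := h3.trans h2.symm
  rw [h5]
  exact h4

variable (hΩ : IsOpen Ω) (hs : NiceFam Ω fun _ => s) (ht : EntireTimes t) (hA : IsSymbol A)
  (hx : x ∈ Ω)
include hΩ hs ht hA hx

theorem symmetry_induces : ∀ᶠ k in Bornology.cobounded ℂ,
    HasDerivAt (fun ε : ℝ => laxL (s.shift (symmetry t A s) ε) k x a b)
      (bracket (negPart (subst t A s)) (laxL s) k x a b) 0 ∧
    HasDerivAt (fun ε : ℝ => laxM t (s.shift (symmetry t A s) ε) k x a b)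
      (bracket (negPart (subst t A s)) (laxM t s) k x a b) 0 ∧
    HasDerivAt (fun ε : ℝ => laxU (s.shift (symmetry t A s) ε) k x a b)
      (bracket (negPart (subst t A s)) (laxU s) k x a b) 0 ∧
    HasDerivAt (fun ε : ℝ => laxV t (s.shift (symmetry t A s) ε) k x a b)
      (bracket (negPart (subst t A s)) (laxV t s) k x a b) 0 := by
  have hq : ((0, x, a, b) : Par).2.1 ∈ Ω := hx
  have hτ := niceFam_shift_symmetry hΩ hs ht hA
  have hN := hs.holSmooth_fN hq ht hA
  filter_upwards [
    hasDerivAt_family (hτ.holSmooth_fL hq) (dε_flow_fL hΩ hs ht hA hq)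
      (unc_bracket (F := fun _ => negPart (subst t A s)) hN (hs.holSmooth_fL hq)),
    hasDerivAt_family (hτ.holSmooth_fM hq ht) (dε_flow_fM hΩ hs ht hA hq)
      (unc_bracket (F := fun _ => negPart (subst t A s)) hN (hs.holSmooth_fM hq ht)),
    hasDerivAt_family (hτ.holSmooth_fU hq) (dε_flow_fU hΩ hs ht hA hq)
      (unc_bracket (F := fun _ => negPart (subst t A s)) hN (hs.holSmooth_fU hq)),
    hasDerivAt_family (hτ.holSmooth_fV hq ht) (dε_flow_fV hΩ hs ht hA hq)
      (unc_bracket (F := fun _ => negPart (subst t A s)) hN (hs.holSmooth_fV hq ht))]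
    with k h1 h2 h3 h4 using ⟨h1, h2, h3, h4⟩

omit hs ht hA in
/-- A pointwise relation between brackets holds near infinity. -/
theorem br_eventuallyEq_const {F G : PhaseFun} {c : ℂ}
    (hF : ∀ q : Par, q.2.1 ∈ Ω → HolSmooth (unc fun _ => F) q)
    (hG : ∀ q : Par, q.2.1 ∈ Ω → HolSmooth (unc fun _ => G) q)
    (h : ∀ x ∈ Ω, ∀ a b : ℝ, ∀ᶠ k in Bornology.cobounded ℂ, bracket F G k x a b = c) {q : Par}
    (hq : q.2.1 ∈ Ω) : br (unc fun _ => F) (unc fun _ => G) =ᶠ[nearInf q] fun _ => c := by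
  refine ((hF q hq).br (hG q hq)).eventuallyEq (HolSmooth.const c) ?_
  filter_upwards [eventually_mem_nearInf hΩ hq] with q' hq'
  filter_upwards [Eventually.nearInf_self (unc_bracket (hF q' hq') (hG q' hq')),
    h q'.2.1 hq' q'.2.2.1 q'.2.2.2] with k h1 h2
  exact h1.symm.trans h2

/-- The vector field is tangent to a relation between two brackets. -/
theorem hasDerivAt_bracket {F G : ℝ → PhaseFun} {c : ℂ} (hF : HolSmooth (unc F) (0, x, a, b))
    (hG : HolSmooth (unc G) (0, x, a, b))
    (hF' : dε (unc F) =ᶠ[nearInf (0, x, a, b)] br (fN t A fun _ => s) (at0 (unc F)))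
    (hG' : dε (unc G) =ᶠ[nearInf (0, x, a, b)] br (fN t A fun _ => s) (at0 (unc G)))
    (h : br (at0 (unc F)) (at0 (unc G)) =ᶠ[nearInf (0, x, a, b)] fun _ => c) :
    ∀ᶠ k in Bornology.cobounded ℂ,
      HasDerivAt (fun ε : ℝ => bracket (F ε) (G ε) k x a b) 0 0 := by
  have hN := hs.holSmooth_fN (q := (0, x, a, b)) hx ht hA
  have h1 : dε (br (unc F) (unc G)) =ᶠ[nearInf (0, x, a, b)] fun _ => 0 := by
    filter_upwards [dε_br (q := (0, x, a, b)) hF hG,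
      br_congr_nearInf hF' (EventuallyEq.refl _ (at0 (unc G))),
      br_congr_nearInf (EventuallyEq.refl _ (at0 (unc F))) hG',
      br_congr_nearInf (EventuallyEq.refl _ (fN t A fun _ => s)) h, hN,
      HolSmooth.at0 (q := (0, x, a, b)) hF, HolSmooth.at0 (q := (0, x, a, b)) hG]
      with p h1 h2 h3 h4 h5 h6 h7
    -- By Jacobi `{{N, F}, G} + {F, {N, G}} = {N, {F, G}}`, and `{F, G}` is the constant `c`.
    rw [h1, h2, h3, ← br_jacobi h5.1 h6.1 h7.1, h4, br_const_right]
  filter_upwards [Eventually.nearInf_self (hF.br hG), Eventually.nearInf_self h1,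
    Eventually.nearInf_self (Eventually.nearInf_nhds (unc_bracket hF hG))] with k h2 h3 h4
  have h5 := hasDerivAt_ε (dAt h2.1)
  have h6 : pd vε (br (unc F) (unc G)) (k, 0, x, a, b) = 0 := h3
  rw [h6] at h5
  refine h5.congr_of_eventuallyEq ?_
  have h7 : Tendsto (fun s : ℝ => ((k, s, x, a, b) : ℂ × Par)) (𝓝 0) (𝓝 (k, 0, x, a, b)) :=
    Continuous.tendsto (by fun_prop) 0
  exact h7.eventually h4

omit hA

/-- The canonical relations as relations near infinity. -/
theorem canonical_br (hC : Canonical t Ω s) {q : Par} (hq : q.2.1 ∈ Ω) :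
    br (fL fun _ => s) (fM t fun _ => s) =ᶠ[nearInf q] (fun _ => 1) ∧
    br (fU fun _ => s) (fV t fun _ => s) =ᶠ[nearInf q] (fun _ => 1) ∧
    br (fL fun _ => s) (fU fun _ => s) =ᶠ[nearInf q] (fun _ => 0) ∧
    br (fL fun _ => s) (fV t fun _ => s) =ᶠ[nearInf q] (fun _ => 0) ∧
    br (fM t fun _ => s) (fU fun _ => s) =ᶠ[nearInf q] (fun _ => 0) ∧
    br (fM t fun _ => s) (fV t fun _ => s) =ᶠ[nearInf q] (fun _ => 0) := by
  have hL := fun (q : Par) (hq : q.2.1 ∈ Ω) => hs.holSmooth_fL hq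
  have hM := fun (q : Par) (hq : q.2.1 ∈ Ω) => hs.holSmooth_fM hq ht
  have hU := fun (q : Par) (hq : q.2.1 ∈ Ω) => hs.holSmooth_fU hq
  have hV := fun (q : Par) (hq : q.2.1 ∈ Ω) => hs.holSmooth_fV hq ht
  refine ⟨br_eventuallyEq_const hΩ hx hL hM (fun x hx a b => (hC x hx a b).mono fun _ h => h.1) hq,
    br_eventuallyEq_const hΩ hx hU hV (fun x hx a b => (hC x hx a b).mono fun _ h => h.2.1) hq,
    br_eventuallyEq_const hΩ hx hL hU (fun x hx a b => (hC x hx a b).mono fun _ h => h.2.2.1) hq,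
    br_eventuallyEq_const hΩ hx hL hV (fun x hx a b => (hC x hx a b).mono fun _ h => h.2.2.2.1) hq,
    br_eventuallyEq_const hΩ hx hM hU (fun x hx a b => (hC x hx a b).mono fun _ h => h.2.2.2.2.1) hq,
    br_eventuallyEq_const hΩ hx hM hV
      (fun x hx a b => (hC x hx a b).mono fun _ h => h.2.2.2.2.2) hq⟩

include hA

theorem symmetry_tangent (hC : Canonical t Ω s) : ∀ᶠ k in Bornology.cobounded ℂ,
    HasDerivAt (fun ε : ℝ => bracket (laxL (s.shift (symmetry t A s) ε))
      (laxM t (s.shift (symmetry t A s) ε)) k x a b) 0 0 ∧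
    HasDerivAt (fun ε : ℝ => bracket (laxU (s.shift (symmetry t A s) ε))
      (laxV t (s.shift (symmetry t A s) ε)) k x a b) 0 0 ∧
    HasDerivAt (fun ε : ℝ => bracket (laxL (s.shift (symmetry t A s) ε))
      (laxU (s.shift (symmetry t A s) ε)) k x a b) 0 0 ∧
    HasDerivAt (fun ε : ℝ => bracket (laxL (s.shift (symmetry t A s) ε))
      (laxV t (s.shift (symmetry t A s) ε)) k x a b) 0 0 ∧
    HasDerivAt (fun ε : ℝ => bracket (laxM t (s.shift (symmetry t A s) ε))
      (laxU (s.shift (symmetry t A s) ε)) k x a b) 0 0 ∧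
    HasDerivAt (fun ε : ℝ => bracket (laxM t (s.shift (symmetry t A s) ε))
      (laxV t (s.shift (symmetry t A s) ε)) k x a b) 0 0 := by
  have hq : ((0, x, a, b) : Par).2.1 ∈ Ω := hx
  have hτ := niceFam_shift_symmetry hΩ hs ht hA
  obtain ⟨c1, c2, c3, c4, c5, c6⟩ := canonical_br hΩ hs ht hx hC hq
  have hL := hτ.holSmooth_fL hq
  have hM := hτ.holSmooth_fM hq ht
  have hU := hτ.holSmooth_fU hq
  have hV := hτ.holSmooth_fV hq ht
  have dL := dε_flow_fL hΩ hs ht hA hq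
  have dM := dε_flow_fM hΩ hs ht hA hq
  have dU := dε_flow_fU hΩ hs ht hA hq
  have dV := dε_flow_fV hΩ hs ht hA hq
  rw [← at0_fL (Y := symmetry t A s)] at c1 c3 c4
  rw [← at0_fM (Y := symmetry t A s)] at c1 c5 c6
  rw [← at0_fU (Y := symmetry t A s)] at c2 c3 c5
  rw [← at0_fV (Y := symmetry t A s)] at c2 c4 c6
  rw [← at0_fL (s := s) (Y := symmetry t A s)] at dL
  rw [← at0_fM (s := s) (Y := symmetry t A s)] at dM
  rw [← at0_fU (s := s) (Y := symmetry t A s)] at dU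
  rw [← at0_fV (s := s) (Y := symmetry t A s)] at dV
  filter_upwards [hasDerivAt_bracket hΩ hs ht hA hx hL hM dL dM c1,
    hasDerivAt_bracket hΩ hs ht hA hx hU hV dU dV c2,
    hasDerivAt_bracket hΩ hs ht hA hx hL hU dL dU c3,
    hasDerivAt_bracket hΩ hs ht hA hx hL hV dL dV c4,
    hasDerivAt_bracket hΩ hs ht hA hx hM hU dM dU c5,
    hasDerivAt_bracket hΩ hs ht hA hx hM hV dM dV c6] with k h1 h2 h3 h4 h5 h6
    using ⟨h1, h2, h3, h4, h5, h6⟩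

end vectorField

/-! ### Commutators of the variations of the fields -/

section negative

variable {f g : ℂ × Par → ℂ} {q : Par}

/-- The difference of a function and its negative part. -/
def posU (f : ℂ × Par → ℂ) : ℂ × Par → ℂ := fun p => f p - negU f p

theorem HolSmooth.posU (hf : HolSmooth f q) : HolSmooth (posU f) q := hf.sub hf.negU

theorem entireAtInf_posU (hf : HolSmooth f q) : EntireAtInf fun k => posU f (k, q) :=
  hf.holInf.entireAtInf_sub_neg₁

theorem entireAtInf_pd_posU (hf : HolSmooth f q) (v : Par) :
    EntireAtInf fun k => pd (0, v) (posU f) (k, q) := by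
  refine (hf.pd (0, v)).holInf.entireAtInf_sub_neg₁.congr (Eventually.nearInf_self
    (P := fun p => pd (0, v) (posU f) p = pd (0, v) f p - negU (pd (0, v) f) p) ?_)
  filter_upwards [hf, hf.negU, pd_negU hf v] with p h1 h2 h3
  rw [← h3]
  exact pd_sub (dAt h1.1) (dAt h2.1) _

theorem entireAtInf_pd_fst_posU (hf : HolSmooth f q) : EntireAtInf fun k => pd vk (posU f) (k, q) :=
  (entireAtInf_posU hf).deriv.congr hf.posU.pd_fst_eq_deriv

theorem entireAtInf_br_posU (hf : HolSmooth f q) (hg : HolSmooth g q) :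
    EntireAtInf fun k => br (posU f) (posU g) (k, q) :=
  (((entireAtInf_pd_fst_posU hf).mul (entireAtInf_pd_posU hg _)).sub
    ((entireAtInf_pd_posU hf _).mul (entireAtInf_pd_fst_posU hg))).add
  (((entireAtInf_pd_posU hf _).mul (entireAtInf_pd_posU hg _)).sub
    ((entireAtInf_pd_posU hf _).mul (entireAtInf_pd_posU hg _)))

theorem oInf_br {N N' : ℂ × Par → ℂ} (hN : HolSmooth N q) (hN' : HolSmooth N' q)
    (h : HolSmooth.Vanishes N q) (h' : HolSmooth.Vanishes N' q) :
    OInf 2 (fun k => br N N' (k, q)) :=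
  ((((h.oInf_fst hN).mul (h'.oInf_param hN' _)).mono (by omega)).sub
    (((h.oInf_param hN _).mul (h'.oInf_fst hN')).mono (by omega))).add
  ((((h.oInf_param hN _).mul (h'.oInf_param hN' _)).mono (by omega)).sub
    (((h.oInf_param hN _).mul (h'.oInf_param hN' _)).mono (by omega)))

/-- With `f = f₊ + f₋` and likewise for `g`, one has `{f, g} = {f₊, g₊} + {f₋, g} - {g₋, f} - {f₋,
g₋}`. The first term is entire and has no negative part, while the last is `O(k⁻²)` and so is its
own negative part. -/
theorem negU_br (hf : HolSmooth f q) (hg : HolSmooth g q) :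
    negU (br f g) =ᶠ[nearInf q] fun p =>
      negU (br (negU f) g) p - negU (br (negU g) f) p - br (negU f) (negU g) p := by
  have h1 := (hf.negU.br hg)
  have h2 := (hg.negU.br hf)
  have h3 := (hf.negU.br hg.negU)
  refine (hf.br hg).negU.eventuallyEq ((h1.negU.sub h2.negU).sub h3) ?_
  filter_upwards [hf.param, hg.param, hf.vanishes_negU.eventually_nhds,
    hg.vanishes_negU.eventually_nhds] with q' hf hg hvf hvg
  have h1 := (hf.negU.br hg)
  have h2 := (hg.negU.br hf)
  have h3 := (hf.negU.br hg.negU)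
  have hP := (hf.posU.br hg.posU)
  have e0 := (entireAtInf_br_posU hf hg).neg₁_eq_zero
  have e1 : (fun k => br f g (k, q')) =ᶠ[Bornology.cobounded ℂ] fun k =>
      (br (posU f) (posU g) (k, q') + br (negU f) g (k, q')) -
        (br (negU g) f (k, q') + br (negU f) (negU g) (k, q')) := by
    refine Eventually.nearInf_self (P := fun p => br f g p = (br (posU f) (posU g) p
      + br (negU f) g p) - (br (negU g) f p + br (negU f) (negU g) p)) ?_
    filter_upwards [hf, hg, hf.negU, hg.negU] with p a1 a2 a3 a4
    have e2 : ∀ v, pd v (posU f) p = pd v f p - pd v (negU f) p := pd_sub (dAt a1.1) (dAt a3.1)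
    have e3 : ∀ v, pd v (posU g) p = pd v g p - pd v (negU g) p := pd_sub (dAt a2.1) (dAt a4.1)
    simp only [br, e2, e3]
    ring
  have e4 : neg₁ (fun k => br (negU f) (negU g) (k, q')) =ᶠ[Bornology.cobounded ℂ]
      fun k => br (negU f) (negU g) (k, q') :=
    neg₁_eventuallyEq h3.holInf (oInf_br hf.negU hg.negU hvf hvg).tendsto
  filter_upwards [neg₁_sub (hP.add h1).holInf (h2.add h3).holInf, neg₁_add hP.holInf h1.holInf,
    neg₁_add h2.holInf h3.holInf, e4] with k a1 a2 a3 a4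
  change neg₁ (fun k => br f g (k, q')) k = neg₁ (fun k => br (negU f) g (k, q')) k
    - neg₁ (fun k => br (negU g) f (k, q')) k - br (negU f) (negU g) (k, q')
  rw [neg₁_congr e1, a1, a2, a3, a4, e0]
  ring

end negative

theorem fV_eq (t : ℕ → ℤ → ℂ) (σ : ℝ → State) : fV t σ = fun p => sV t σ (fL σ p, p.2) := rfl

theorem fM_eq (t : ℕ → ℤ → ℂ) (σ : ℝ → State) : fM t σ = fun p => sM t σ (fL σ p, p.2) := rfl

/-! ### Zero-curvature identity and commutators on the coefficient fields -/

section commutator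

variable {Ω : Set ℝ} {t : ℕ → ℤ → ℂ} {s : State} {q : Par} {A B : Symbol}

theorem NiceFam.eventuallyEq_of_comp_fL {σ : ℝ → State} (hσ : NiceFam Ω σ) (hq : q.2.1 ∈ Ω)
    {f g : ℂ × Par → ℂ} (h : ∀ᶠ p in nearInf q, f (fL σ p, p.2) = g (fL σ p, p.2)) :
    f =ᶠ[nearInf q] g := by
  obtain ⟨K, hK, hK0, hKL⟩ := exists_inverse (hσ.gen_g hq).1 (hσ.gen_g hq).2
  have hK' := hK.sub HolSmooth.fst
  -- `exists_inverse` yields only left inverses: `K` of `L`, and `K'` of `K`. Together they show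
  -- that `K` is also a right inverse of `L`, as `L(K(w)) = K'(K(L(K(w)))) = K'(K(w)) = w`.
  obtain ⟨K', -, -, hKK⟩ := exists_inverse hK' hK0
  have hKt : Tendsto (fun p => (K p, p.2)) (nearInf q) (nearInf q) := by
    refine tendsto_param_nearInf ?_ continuousAt_id
    have := tendsto_fst_add (hK'.tendsto_of_vanishes hK0)
    simpa using this
  have hLK : ∀ᶠ p in nearInf q, fL σ (K p, p.2) = p.1 := by
    filter_upwards [hKt.eventually ((hσ.tendsto_fL_nearInf hq).eventually hKK),
      hKt.eventually hKL, hKK] with p h1 h2 h3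
    rw [add_sub_cancel] at h1 h3
    have h4 : K (fL σ (K p, p.2), p.2) = K p := h2
    have h5 : K' (K (fL σ (K p, p.2), p.2), p.2) = fL σ (K p, p.2) := h1
    rw [h4] at h5
    rw [← h5]
    exact h3
  filter_upwards [hKt.eventually h, hLK] with p h1 h2
  rw [h2] at h1
  exact h1

variable (hΩ : IsOpen Ω) (hs : NiceFam Ω fun _ => s) (ht : EntireTimes t) (hA : IsSymbol A)
  (hB : IsSymbol B) (hC : Canonical t Ω s) (hq : q.2.1 ∈ Ω)
include hΩ hs ht hA hB hq

section canonical

include hC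

/-- The canonical relations say that `(L, M)` and `(U, V)` are two commuting canonical pairs, so
substitution of them into symbols is a Poisson map. -/
theorem br_fA_fA : br (fA t A fun _ => s) (fA t B fun _ => s) =ᶠ[nearInf q]
    fA t (poisson A B) fun _ => s := by
  obtain ⟨c1, c2, c3, c4, c5, c6⟩ := canonical_br hΩ hs ht hq hC hq
  filter_upwards [c1, c2, c3, c4, c5, c6,
    pd_sub_symbol hA (hs.holSmooth_fL hq) (hs.holSmooth_fM hq ht) (hs.holSmooth_fU hq)
      (hs.holSmooth_fV hq ht) (hs.tendsto_fL hq),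
    pd_sub_symbol hB (hs.holSmooth_fL hq) (hs.holSmooth_fM hq ht) (hs.holSmooth_fU hq)
      (hs.holSmooth_fV hq ht) (hs.tendsto_fL hq)] with p c1 c2 c3 c4 c5 c6 hA hB
  have h : fA t (poisson A B) (fun _ => s) p
    = fA t (dL A) (fun _ => s) p * fA t (dM B) (fun _ => s) p
      - fA t (dM A) (fun _ => s) p * fA t (dL B) (fun _ => s) p
      + fA t (dU A) (fun _ => s) p * fA t (dV B) (fun _ => s) p
      - fA t (dV A) (fun _ => s) p * fA t (dU B) (fun _ => s) p := rfl
  rw [h]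
  simp only [← fA_eq_sub] at hA hB
  unfold br at c1 c2 c3 c4 c5 c6 ⊢
  simp only [hA, hB]
  generalize fA t (dL A) (fun _ => s) p = a1 at *
  generalize fA t (dM A) (fun _ => s) p = a2 at *
  generalize fA t (dU A) (fun _ => s) p = a3 at *
  generalize fA t (dV A) (fun _ => s) p = a4 at *
  generalize fA t (dL B) (fun _ => s) p = b1 at *
  generalize fA t (dM B) (fun _ => s) p = b2 at *
  generalize fA t (dU B) (fun _ => s) p = b3 at *
  generalize fA t (dV B) (fun _ => s) p = b4 at *
  -- The coefficient of each canonical relation is the minor of the gradients of `A` and `B` that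
  -- belongs to the corresponding pair of coordinates.
  linear_combination (a1 * b2 - a2 * b1) * c1 + (a3 * b4 - a4 * b3) * c2 + (a1 * b3 - a3 * b1) * c3
    + (a1 * b4 - a4 * b1) * c4 + (a2 * b3 - a3 * b2) * c5 + (a2 * b4 - a4 * b2) * c6

/-- The zero-curvature identity that drives all commutators: it is `negU_br` for `f_A` and `f_B`,
where the negative part of `{N_A, f_B}` is recognized as the variation of `N_B` along `A`. -/
theorem fN_poisson : fN t (poisson A B) (fun _ => s) =ᶠ[nearInf q] fun p =>
    dε (fN t B (s.shift (symmetry t A s))) p - dε (fN t A (s.shift (symmetry t B s))) p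
      - br (fN t A fun _ => s) (fN t B fun _ => s) p := by
  filter_upwards [negU_congr (br_fA_fA hΩ hs ht hA hB hC hq),
    negU_br (hs.holSmooth_fA hq ht hA) (hs.holSmooth_fA hq ht hB),
    dε_flow_fN hΩ hs ht hA hB hq, dε_flow_fN hΩ hs ht hB hA hq] with p h1 h2 h3 h4
  rw [h3, h4]
  exact h1.symm.trans h2

end canonical

/-- The variation along `A` of the relation that determines the variation along `B`. -/
theorem dε_br_fN_eq {S V : ℂ × Par → ℂ} (hS : HolSmooth S (0, q.2)) (hV : HolSmooth V (0, q.2))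
    (hf : dε (fun p => S (fL (s.shift (symmetry t A s)) p, p.2)) =ᶠ[nearInf q]
      br (fN t A fun _ => s) (fun p => at0 S (fL (fun _ => s) p, p.2)))
    (h : br (fN t B (s.shift (symmetry t A s)))
      (fun p => S (fL (s.shift (symmetry t A s)) p, p.2)) =ᶠ[nearInf (0, q.2)] fun p =>
      V (fL (s.shift (symmetry t A s)) p, p.2) + pd vk S (fL (s.shift (symmetry t A s)) p, p.2)
        * gen (fun ε => (symF t B (s.shift (symmetry t A s)) ε).g) p) :
    ∀ᶠ p in nearInf q,
      br (dε (fN t B (s.shift (symmetry t A s)))) (fun p => at0 S (fL (fun _ => s) p, p.2)) p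
      + br (fN t B fun _ => s)
        (br (fN t A fun _ => s) (fun p => at0 S (fL (fun _ => s) p, p.2))) p
      = dε V (fL (fun _ => s) p, p.2)
        + pd vk (at0 V) (fL (fun _ => s) p, p.2) * gen (fun _ => (symmetry t A s).g) p
        + ((pd vk (dε S) (fL (fun _ => s) p, p.2)
          + pd vk (pd vk (at0 S)) (fL (fun _ => s) p, p.2) * gen (fun _ => (symmetry t A s).g) p)
          * gen (fun _ => (symmetry t B s).g) p
        + pd vk (at0 S) (fL (fun _ => s) p, p.2)
          * dε (gen (fun ε => (symF t B (s.shift (symmetry t A s)) ε).g)) p) := by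
  have hq0 : ((0, q.2) : Par).2.1 ∈ Ω := hq
  have hY := niceFam_symmetry hΩ hs ht hA
  have hτ := niceFam_shift_symmetry hΩ hs ht hA
  have hτB := NiceFam.symF hΩ hτ ht hB
  have e1 := dε_br (q := q) (hτ.holSmooth_fN hq0 ht hB) (hτ.comp_fL hq0 hS)
  have e2 := br_congr_nearInf (EventuallyEq.refl (nearInf q) (fN t B fun _ => s)) hf
  have e3 := dε_congr (q := q) h
  have e4 := dε_add (q := q) (hτ.comp_fL hq0 hV)
    ((hτ.comp_fL hq0 (hS.pd vk)).mul (hτB.gen_g hq0).1)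
  have e5 := dε_mul (q := q) (hτ.comp_fL hq0 (hS.pd vk)) (hτB.gen_g hq0).1
  have e6 := dε_comp_fL hΩ hs hY hq hV
  have e7 := dε_comp_fL hΩ hs hY hq (hS.pd vk)
  have hL := hs.tendsto_fL_nearInf hq
  filter_upwards [e1, e2, e3, e4, e5, e6, e7, hL.eventually (dε_pd_fst hS),
    hL.eventually (HolSmooth.pd_congr (pd_at0_fst hS) vk), hL.eventually (pd_at0_fst hS)]
    with p e1 e2 e3 e4 e5 e6 e7 e8 e9 e10
  rw [e1, e4, e5, e6, e7, e8] at e3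
  have e11 : at0 (fun p => S (fL (s.shift (symmetry t A s)) p, p.2))
      = fun p => at0 S (fL (fun _ => s) p, p.2) := by
    funext p
    have : fL (s.shift (symmetry t A s)) (p.1, 0, p.2.2) = fL (fun _ => s) p :=
      congrFun at0_fL p
    simp only [at0, this]
  have e12 : at0 (fun p => pd vk S (fL (s.shift (symmetry t A s)) p, p.2)) p
      = at0 (pd vk S) (fL (fun _ => s) p, p.2) := by
    have : fL (s.shift (symmetry t A s)) (p.1, 0, p.2.2) = fL (fun _ => s) p :=
      congrFun at0_fL p
    simp only [at0, this]
  have e13 : at0 (gen fun ε => (symF t B (s.shift (symmetry t A s)) ε).g) p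
      = gen (fun _ => (symmetry t B s).g) p := by
    change gen (fun _ => (symmetry t B (s.shift (symmetry t A s) 0)).g) p = _
    rw [State.shift_zero]
  rw [e11, at0_fN, e2, e12, e13, ← e9, ← e10] at e3
  exact e3

theorem dε_gen_g : dε (gen (fun ε => (symF t B (s.shift (symmetry t A s)) ε).g)) =ᶠ[nearInf q]
    fun p => br (dε (fN t B (s.shift (symmetry t A s)))) (fL fun _ => s) p
      + br (fN t B fun _ => s) (br (fN t A fun _ => s) (fL fun _ => s)) p := by
  have hq0 : ((0, q.2) : Par).2.1 ∈ Ω := hq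
  have hτ := niceFam_shift_symmetry hΩ hs ht hA
  have e1 := dε_br (q := q) (hτ.holSmooth_fN hq0 ht hB) (hτ.holSmooth_fL hq0)
  filter_upwards [dε_congr (q := q) ((symF_g hΩ hτ ht hB).2 (0, q.2) hq), e1,
    br_congr_nearInf (EventuallyEq.refl (nearInf q) (fN t B fun _ => s))
    (dε_flow_fL hΩ hs ht hA hq)] with p h1 h2 h3
  rw [h1, h2, at0_fN, at0_fL, h3]

include hC

/-- Differentiating `δ_B L = {N_B, L}` along `A` gives `{δ_A N_B, L} + {N_B, {N_A, L}}`; after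
antisymmetrization, Jacobi and `fN_poisson` leave `{N_{A,B}, L}`. -/
theorem commutator_g : ∀ᶠ p in nearInf q,
    dε (gen (fun ε => (symF t B (s.shift (symmetry t A s)) ε).g)) p
      - dε (gen (fun ε => (symF t A (s.shift (symmetry t B s)) ε).g)) p
      = gen (fun _ => (symmetry t (poisson A B) s).g) p := by
  have hAB := hA.poisson hB
  have hq0 : ((0, q.2) : Par).2.1 ∈ Ω := hq
  have hNB := (niceFam_shift_symmetry hΩ hs ht hA).holSmooth_fN hq0 ht hB
  have hNA := (niceFam_shift_symmetry hΩ hs ht hB).holSmooth_fN hq0 ht hA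
  filter_upwards [dε_gen_g hΩ hs ht hA hB hq, dε_gen_g hΩ hs ht hB hA hq,
    (symF_g hΩ hs ht hAB).2 q hq,
    br_congr_nearInf (fN_poisson hΩ hs ht hA hB hC hq) (EventuallyEq.refl _ (fL fun _ => s)),
    hNB.dε, hNA.dε, hs.holSmooth_fN hq ht hA, hs.holSmooth_fN hq ht hB, hs.holSmooth_fL hq]
    with p h1 h2 h3 h4 a1 a2 a3 a4 a5
  have h5 : gen (fun _ => (symmetry t (poisson A B) s).g) p
    = br (fN t (poisson A B) fun _ => s) (fL fun _ => s) p := h3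
  rw [h1, h2, h5, h4, br_sub_left (dAt (a1.1.sub a2.1)) (dAt (contDiffAt_br a3.1 a4.1)),
    br_sub_left (dAt a1.1) (dAt a2.1)]
  linear_combination - br_jacobi a3.1 a4.1 a5.1

/-- The index `1` refers to varying `δ_B` along `A`, the index `2` to the opposite order. In the
second variation of `S(L)` the terms `S_λλ δ_A L δ_B L` and the products of a `λ`-derivative of one
velocity with the variation of `L` under the other symbol are symmetric in `A` and `B`; hence they
cancel. The term with `S_λ` is removed by `commutator_g`, and the substitution `λ = L` is undone at
the end. -/
theorem commutator_vel {S₁ S₂ S₀ V₁ V₂ V₃ : ℂ × Par → ℂ} (hS₁ : HolSmooth S₁ (0, q.2))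
    (hS₂ : HolSmooth S₂ (0, q.2)) (hV₁ : HolSmooth V₁ (0, q.2)) (hV₂ : HolSmooth V₂ (0, q.2))
    (e₁ : at0 S₁ = S₀) (e₂ : at0 S₂ = S₀) (d₁ : dε S₁ =ᶠ[nearInf q] at0 V₂)
    (d₂ : dε S₂ =ᶠ[nearInf q] at0 V₁)
    (f₁ : dε (fun p => S₁ (fL (s.shift (symmetry t A s)) p, p.2)) =ᶠ[nearInf q]
      br (fN t A fun _ => s) (fun p => at0 S₁ (fL (fun _ => s) p, p.2)))
    (f₂ : dε (fun p => S₂ (fL (s.shift (symmetry t B s)) p, p.2)) =ᶠ[nearInf q]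
      br (fN t B fun _ => s) (fun p => at0 S₂ (fL (fun _ => s) p, p.2)))
    (h₁ : br (fN t B (s.shift (symmetry t A s)))
      (fun p => S₁ (fL (s.shift (symmetry t A s)) p, p.2)) =ᶠ[nearInf (0, q.2)] fun p =>
      V₁ (fL (s.shift (symmetry t A s)) p, p.2) + pd vk S₁ (fL (s.shift (symmetry t A s)) p, p.2)
        * gen (fun ε => (symF t B (s.shift (symmetry t A s)) ε).g) p)
    (h₂ : br (fN t A (s.shift (symmetry t B s)))
      (fun p => S₂ (fL (s.shift (symmetry t B s)) p, p.2)) =ᶠ[nearInf (0, q.2)] fun p =>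
      V₂ (fL (s.shift (symmetry t B s)) p, p.2) + pd vk S₂ (fL (s.shift (symmetry t B s)) p, p.2)
        * gen (fun ε => (symF t A (s.shift (symmetry t B s)) ε).g) p)
    (h₃ : br (fN t (poisson A B) fun _ => s) (fun p => S₀ (fL (fun _ => s) p, p.2)) =ᶠ[nearInf q]
      fun p => V₃ (fL (fun _ => s) p, p.2) + pd vk S₀ (fL (fun _ => s) p, p.2)
        * gen (fun _ => (symmetry t (poisson A B) s).g) p) :
    ∀ᶠ p in nearInf q, dε V₁ p - dε V₂ p = V₃ p := by
  have hq0 : ((0, q.2) : Par).2.1 ∈ Ω := hq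
  have hNB := (niceFam_shift_symmetry hΩ hs ht hA).holSmooth_fN hq0 ht hB
  have hNA := (niceFam_shift_symmetry hΩ hs ht hB).holSmooth_fN hq0 ht hA
  have hS₀ : HolSmooth S₀ q := e₁ ▸ hS₁.at0
  refine hs.eventuallyEq_of_comp_fL hq (f := fun p => dε V₁ p - dε V₂ p) ?_
  have hL := hs.tendsto_fL_nearInf hq
  filter_upwards [dε_br_fN_eq hΩ hs ht hA hB hq hS₁ hV₁ f₁ h₁,
    dε_br_fN_eq hΩ hs ht hB hA hq hS₂ hV₂ f₂ h₂, h₃, commutator_g hΩ hs ht hA hB hC hq,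
    br_congr_nearInf (fN_poisson hΩ hs ht hA hB hC hq)
      (EventuallyEq.refl _ (fun p => S₀ (fL (fun _ => s) p, p.2))),
    hL.eventually (HolSmooth.pd_congr d₁ vk), hL.eventually (HolSmooth.pd_congr d₂ vk),
    hNB.dε, hNA.dε, hs.holSmooth_fN hq ht hA, hs.holSmooth_fN hq ht hB, hs.comp_fL hq hS₀]
    with p g1 g2 g3 g4 g5 g6 g7 a1 a2 a3 a4 a5
  rw [g5, br_sub_left (dAt (a1.1.sub a2.1)) (dAt (contDiffAt_br a3.1 a4.1)),
    br_sub_left (dAt a1.1) (dAt a2.1)] at g3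
  rw [e₁, g6] at g1
  rw [e₂, g7] at g2
  linear_combination g3 - g1 + g2 - br_jacobi a3.1 a4.1 a5.1
    - pd vk S₀ (fL (fun _ => s) p, p.2) * g4

omit hB hC in
theorem at0_gen_symF (z : State → ℕ → ℝ → ℝ → ℝ → ℂ) :
    at0 (gen fun ε => z (symF t B (s.shift (symmetry t A s)) ε))
      = gen fun _ => z (symmetry t B s) := by
  change gen (fun _ => z (symmetry t B (s.shift (symmetry t A s) 0))) = _
  rw [State.shift_zero]

theorem commutator_u : ∀ᶠ p in nearInf q,
    dε (gen (fun ε => (symF t B (s.shift (symmetry t A s)) ε).u)) p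
      - dε (gen (fun ε => (symF t A (s.shift (symmetry t B s)) ε).u)) p
      = gen (fun _ => (symmetry t (poisson A B) s).u) p := by
  have hq0 : ((0, q.2) : Par).2.1 ∈ Ω := hq
  have hYA := niceFam_symmetry hΩ hs ht hA
  have hYB := niceFam_symmetry hΩ hs ht hB
  have hτA := niceFam_shift_symmetry hΩ hs ht hA
  have hτB := niceFam_shift_symmetry hΩ hs ht hB
  have hAB := hA.poisson hB
  refine commutator_vel hΩ hs ht hA hB hC hq (S₀ := sU fun _ => s) (hτA.holSmooth_sU hq0)
    (hτB.holSmooth_sU hq0) (NiceFam.symF hΩ hτA ht hB |>.gen_u hq0).1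
    (NiceFam.symF hΩ hτB ht hA |>.gen_u hq0).1 at0_sU at0_sU ?_ ?_ ?_ ?_
    (br_fN_comp_fL hΩ hτA ht hB hq0 (hτA.holSmooth_sU hq0) (velU_comp_fL hΩ hτA ht hB hq0))
    (br_fN_comp_fL hΩ hτB ht hA hq0 (hτB.holSmooth_sU hq0) (velU_comp_fL hΩ hτB ht hA hq0))
    (br_fN_comp_fL hΩ hs ht hAB hq (hs.holSmooth_sU hq) (velU_comp_fL hΩ hs ht hAB hq))
  · rw [at0_gen_symF hΩ hs ht hB hq fun s => s.u]
    exact dε_sU_eq_vel hΩ hs hYA hq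
  · rw [at0_gen_symF hΩ hs ht hA hq fun s => s.u]
    exact dε_sU_eq_vel hΩ hs hYB hq
  · rw [at0_sU]; exact dε_flow_fU hΩ hs ht hA hq
  · rw [at0_sU]; exact dε_flow_fU hΩ hs ht hB hq

omit hC in
theorem at0_velV : at0 (velV t (s.shift (symmetry t A s)) (symF t B (s.shift (symmetry t A s))))
    = velV t (fun _ => s) fun _ => symmetry t B s := by
  have e1 := at0_gen_symF (A := A) (B := B) hΩ hs ht hA hq fun s => s.u
  have e2 := at0_gen_symF (A := A) (B := B) hΩ hs ht hA hq fun s => s.v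
  funext p
  have e3 := congrFun (at0_sU (s := s) (Y := symmetry t A s)) p
  have e1 := congrFun e1 p
  have e2 := congrFun e2 p
  simp only [at0, velV] at e1 e2 e3 ⊢
  rw [e1, e2, e3]

omit hC in
theorem at0_velM : at0 (velM t (s.shift (symmetry t A s)) (symF t B (s.shift (symmetry t A s))))
    = velM t (fun _ => s) fun _ => symmetry t B s := by
  have e1 := at0_gen_symF (A := A) (B := B) hΩ hs ht hA hq fun s => s.u
  have e2 := at0_gen_symF (A := A) (B := B) hΩ hs ht hA hq fun s => s.h
  funext p
  have e3 := congrFun (at0_sU (s := s) (Y := symmetry t A s)) p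
  have e1 := congrFun e1 p
  have e2 := congrFun e2 p
  simp only [at0, velM] at e1 e2 e3 ⊢
  rw [e1, e2, e3]

theorem commutator_velV : ∀ᶠ p in nearInf q,
    dε (velV t (s.shift (symmetry t A s)) (symF t B (s.shift (symmetry t A s)))) p
      - dε (velV t (s.shift (symmetry t B s)) (symF t A (s.shift (symmetry t B s)))) p
      = velV t (fun _ => s) (fun _ => symmetry t (poisson A B) s) p := by
  have hq0 : ((0, q.2) : Par).2.1 ∈ Ω := hq
  have hYA := niceFam_symmetry hΩ hs ht hA
  have hYB := niceFam_symmetry hΩ hs ht hB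
  have hτA := niceFam_shift_symmetry hΩ hs ht hA
  have hτB := niceFam_shift_symmetry hΩ hs ht hB
  have hAB := hA.poisson hB
  refine commutator_vel hΩ hs ht hA hB hC hq (S₀ := sV t fun _ => s) (hτA.holSmooth_sV hq0 ht)
    (hτB.holSmooth_sV hq0 ht) (holSmooth_velV hτA (NiceFam.symF hΩ hτA ht hB) ht hq0)
    (holSmooth_velV hτB (NiceFam.symF hΩ hτB ht hA) ht hq0) at0_sV at0_sV ?_ ?_ ?_ ?_
    (br_fN_comp_fL hΩ hτA ht hB hq0 (hτA.holSmooth_sV hq0 ht) (velV_comp_fL hΩ hτA ht hB hq0))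
    (br_fN_comp_fL hΩ hτB ht hA hq0 (hτB.holSmooth_sV hq0 ht) (velV_comp_fL hΩ hτB ht hA hq0))
    (br_fN_comp_fL hΩ hs ht hAB hq (hs.holSmooth_sV hq ht) (velV_comp_fL hΩ hs ht hAB hq))
  · rw [at0_velV hΩ hs ht hB hA hq]; exact dε_sV_eq_vel hΩ hs hYA ht hq
  · rw [at0_velV hΩ hs ht hA hB hq]; exact dε_sV_eq_vel hΩ hs hYB ht hq
  · rw [at0_sV, ← fV_eq, ← fV_eq]; exact dε_flow_fV hΩ hs ht hA hq
  · rw [at0_sV, ← fV_eq, ← fV_eq]; exact dε_flow_fV hΩ hs ht hB hq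

theorem commutator_velM : ∀ᶠ p in nearInf q,
    dε (velM t (s.shift (symmetry t A s)) (symF t B (s.shift (symmetry t A s)))) p
      - dε (velM t (s.shift (symmetry t B s)) (symF t A (s.shift (symmetry t B s)))) p
      = velM t (fun _ => s) (fun _ => symmetry t (poisson A B) s) p := by
  have hq0 : ((0, q.2) : Par).2.1 ∈ Ω := hq
  have hYA := niceFam_symmetry hΩ hs ht hA
  have hYB := niceFam_symmetry hΩ hs ht hB
  have hτA := niceFam_shift_symmetry hΩ hs ht hA
  have hτB := niceFam_shift_symmetry hΩ hs ht hB
  have hAB := hA.poisson hB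
  refine commutator_vel hΩ hs ht hA hB hC hq (S₀ := sM t fun _ => s) (hτA.holSmooth_sM hq0 ht)
    (hτB.holSmooth_sM hq0 ht) (holSmooth_velM hτA (NiceFam.symF hΩ hτA ht hB) ht hq0)
    (holSmooth_velM hτB (NiceFam.symF hΩ hτB ht hA) ht hq0) at0_sM at0_sM ?_ ?_ ?_ ?_
    (br_fN_comp_fL hΩ hτA ht hB hq0 (hτA.holSmooth_sM hq0 ht) (velM_comp_fL hΩ hτA ht hB hq0))
    (br_fN_comp_fL hΩ hτB ht hA hq0 (hτB.holSmooth_sM hq0 ht) (velM_comp_fL hΩ hτB ht hA hq0))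
    (br_fN_comp_fL hΩ hs ht hAB hq (hs.holSmooth_sM hq ht) (velM_comp_fL hΩ hs ht hAB hq))
  · rw [at0_velM hΩ hs ht hB hA hq]; exact dε_sM_eq_vel hΩ hs hYA ht hq
  · rw [at0_velM hΩ hs ht hA hB hq]; exact dε_sM_eq_vel hΩ hs hYB ht hq
  · rw [at0_sM, ← fM_eq, ← fM_eq]; exact dε_flow_fM hΩ hs ht hA hq
  · rw [at0_sM, ← fM_eq, ← fM_eq]; exact dε_flow_fM hΩ hs ht hB hq

omit hC in
/-- The variation along `A` of the time-dependent part of a variation along `B`. -/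
theorem dε_deriv_comp_sU_mul {T : ℂ × ℂ → ℂ} (hT : Differentiable ℂ T) : ∀ᶠ p in nearInf q,
    dε (fun p => deriv (fun w => T (p.1, w)) (sU (s.shift (symmetry t A s)) p)
      * gen (fun ε => (symF t B (s.shift (symmetry t A s)) ε).u) p) p
    = deriv (fun w => deriv (fun w' => T (p.1, w')) w) (sU (fun _ => s) p)
        * gen (fun _ => (symmetry t A s).u) p * gen (fun _ => (symmetry t B s).u) p
      + deriv (fun w => T (p.1, w)) (sU (fun _ => s) p)
        * dε (gen (fun ε => (symF t B (s.shift (symmetry t A s)) ε).u)) p := by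
  have hq0 : ((0, q.2) : Par).2.1 ∈ Ω := hq
  have hτ := niceFam_shift_symmetry hΩ hs ht hA
  have hT' := differentiable_deriv_snd hT
  have hu := (NiceFam.symF hΩ hτ ht hB |>.gen_u hq0).1
  have e1 := dε_mul (q := q) (hτ.holSmooth_comp_sU hq0 hT') hu
  filter_upwards [e1, dε_comp_sU hΩ hs (niceFam_symmetry hΩ hs ht hA) hq hT'] with p h1 h2
  have e2 := congrFun (at0_gen_symF (A := A) (B := B) hΩ hs ht hA hq fun s => s.u) p
  have e3 := congrFun (at0_sU (s := s) (Y := symmetry t A s)) p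
  refine h1.trans ?_
  rw [h2, e2]
  simp only [at0] at e3 ⊢
  rw [e3]

/-- The velocity of `V(λ)` is that of the coefficients `v` plus `∂_w timeV` times the velocity of
`U(λ)`. The second `w`-derivative enters multiplied by both velocities of `U`, symmetrically, and
drops out of the commutator. -/
theorem commutator_v : ∀ᶠ p in nearInf q,
    dε (gen (fun ε => (symF t B (s.shift (symmetry t A s)) ε).v)) p
      - dε (gen (fun ε => (symF t A (s.shift (symmetry t B s)) ε).v)) p
      = gen (fun _ => (symmetry t (poisson A B) s).v) p := by
  have hq0 : ((0, q.2) : Par).2.1 ∈ Ω := hq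
  have hT := differentiable_timeV ht
  have split : ∀ {A B : Symbol}, IsSymbol A → IsSymbol B →
      dε (velV t (s.shift (symmetry t A s)) (symF t B (s.shift (symmetry t A s)))) =ᶠ[nearInf q]
      fun p => dε (fun p => deriv (fun w => timeV t p.1 w) (sU (s.shift (symmetry t A s)) p)
      * gen (fun ε => (symF t B (s.shift (symmetry t A s)) ε).u) p) p
      + dε (gen (fun ε => (symF t B (s.shift (symmetry t A s)) ε).v)) p := by
    intro A B hA hB
    have hτ := niceFam_shift_symmetry hΩ hs ht hA
    have hn := NiceFam.symF hΩ hτ ht hB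
    exact dε_add (q := q) ((hτ.holSmooth_comp_sU hq0 (differentiable_deriv_snd hT)).mul
      (hn.gen_u hq0).1) (hn.gen_v hq0).1
  filter_upwards [commutator_u hΩ hs ht hA hB hC hq, commutator_velV hΩ hs ht hA hB hC hq,
    split hA hB, split hB hA, dε_deriv_comp_sU_mul hΩ hs ht hA hB hq hT,
    dε_deriv_comp_sU_mul hΩ hs ht hB hA hq hT] with p h1 h2 h3 h4 h5 h6
  rw [h3, h4, h5, h6, velV] at h2
  linear_combination h2 - deriv (fun w => timeV t p.1 w) (sU (fun _ => s) p) * h1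

theorem commutator_h : ∀ᶠ p in nearInf q,
    dε (gen (fun ε => (symF t B (s.shift (symmetry t A s)) ε).h)) p
      - dε (gen (fun ε => (symF t A (s.shift (symmetry t B s)) ε).h)) p
      = gen (fun _ => (symmetry t (poisson A B) s).h) p := by
  have hq0 : ((0, q.2) : Par).2.1 ∈ Ω := hq
  have hT := differentiable_timeM ht
  have split : ∀ {A B : Symbol}, IsSymbol A → IsSymbol B →
      ∀ᶠ p in nearInf q,
      dε (velM t (s.shift (symmetry t A s)) (symF t B (s.shift (symmetry t A s)))) p
      = dε (fun p => deriv (fun w => timeM t p.1 w) (sU (s.shift (symmetry t A s)) p)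
      * gen (fun ε => (symF t B (s.shift (symmetry t A s)) ε).u) p) p
      + p.1⁻¹ * dε (gen (fun ε => (symF t B (s.shift (symmetry t A s)) ε).h)) p := by
    intro A B hA hB
    have hτ := niceFam_shift_symmetry hΩ hs ht hA
    have hn := NiceFam.symF hΩ hτ ht hB
    have hi : HolSmooth (fun p : ℂ × Par => p.1⁻¹) (0, q.2) :=
      HolSmooth.fst.inv (HolSmooth.eventually_ne_zero _)
    filter_upwards [dε_add (q := q) ((hτ.holSmooth_comp_sU hq0 (differentiable_deriv_snd hT)).mul
      (hn.gen_u hq0).1) (hi.mul (hn.gen_h hq0).1), dε_mul (q := q) hi (hn.gen_h hq0).1,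
      dε_eq_of_affine (q := q) (u := fun p => p.1⁻¹) (w := fun _ => 0) hi
        (Eventually.of_forall fun p => by simp [at0])] with p h1 h2 h3
    refine h1.trans ?_
    rw [h2, h3]
    simp only [at0, zero_mul, zero_add]
  filter_upwards [commutator_u hΩ hs ht hA hB hC hq, commutator_velM hΩ hs ht hA hB hC hq,
    split hA hB, split hB hA, dε_deriv_comp_sU_mul hΩ hs ht hA hB hq hT,
    dε_deriv_comp_sU_mul hΩ hs ht hB hA hq hT, HolSmooth.eventually_ne_zero q]
    with p h1 h2 h3 h4 h5 h6 h7
  rw [h3, h4, h5, h6, velM] at h2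
  have h8 : p.1⁻¹ * (dε (gen (fun ε => (symF t B (s.shift (symmetry t A s)) ε).h)) p
      - dε (gen (fun ε => (symF t A (s.shift (symmetry t B s)) ε).h)) p)
      = p.1⁻¹ * gen (fun _ => (symmetry t (poisson A B) s).h) p := by
    linear_combination h2 - deriv (fun w => timeM t p.1 w) (sU (fun _ => s) p) * h1
  exact mul_left_cancel₀ (inv_ne_zero h7) h8

end commutator

/-! ### Averages over the torus -/

section torus

theorem contDiff_inner {X : Type} [NormedAddCommGroup X] [NormedSpace ℝ X] {H : X × ℝ → ℂ}
    (hH : ContDiff ℝ ∞ H) : ContDiff ℝ ∞ (fun y => ∫ b in (0 : ℝ)..(2 * π), H (y, b)) :=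
  contDiff_iff_contDiffAt.2 fun _ => contDiffAt_intervalIntegral (by positivity)
    fun _ _ => hH.contDiffAt

theorem pd_inner {X : Type} [NormedAddCommGroup X] [NormedSpace ℝ X] {H : X × ℝ → ℂ}
    (hH : ContDiff ℝ ∞ H) (v y : X) : pd v (fun y => ∫ b in (0 : ℝ)..(2 * π), H (y, b)) y
      = ∫ b in (0 : ℝ)..(2 * π), pd (v, 0) H (y, b) := by
  refine (fderiv_intervalIntegral_apply (by positivity)
    (fun b _ => (hH.of_le (by exact_mod_cast le_top)).contDiffAt) v).trans ?_
  refine intervalIntegral.integral_congr fun b _ => ?_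
  have h1 : HasFDerivAt (fun y : X => (y, b)) (ContinuousLinearMap.inl ℝ X ℝ) y :=
    hasFDerivAt_prodMk_left y b
  have h2 := (hH.differentiable (by simp) (y, b)).hasFDerivAt.comp y h1
  exact congrArg (fun T => T v) h2.fderiv

theorem contDiff_pd {X : Type} [NormedAddCommGroup X] [NormedSpace ℝ X] {H : X → ℂ}
    (hH : ContDiff ℝ ∞ H) (v : X) : ContDiff ℝ ∞ (pd v H) :=
  contDiff_iff_contDiffAt.2 fun _ => contDiffAt_pd hH.contDiffAt v

theorem hasDerivAt_torusMean {H : (ℝ × ℝ) × ℝ → ℂ} (hH : ContDiff ℝ ∞ H) (ε : ℝ) :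
    HasDerivAt (fun ε => torusMean fun a b => H ((ε, a), b))
      (torusMean fun a b => pd ((1, 0), 0) H ((ε, a), b)) ε := by
  have h1 := contDiff_inner hH
  have h2 := contDiff_inner h1
  have h3 : HasDerivAt (fun ε : ℝ => ∫ a in (0 : ℝ)..(2 * π), ∫ b in (0 : ℝ)..(2 * π), H ((ε, a), b))
      (pd (1 : ℝ) (fun ε : ℝ => ∫ a in (0 : ℝ)..(2 * π), ∫ b in (0 : ℝ)..(2 * π), H ((ε, a), b)) ε)
      ε := (h2.differentiable (by simp) ε).hasFDerivAt.hasDerivAt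
  rw [pd_inner h1] at h3
  refine (h3.const_mul (((2 * π : ℂ) ^ 2)⁻¹)).congr_deriv ?_
  unfold torusMean
  congr 1
  exact intervalIntegral.integral_congr fun a _ => pd_inner hH _ _

theorem torusMean_pd₁ {R : ℝ × ℝ → ℂ} (hR : ContDiff ℝ ∞ R) (hp : ∀ b, R (2 * π, b) = R (0, b)) :
    torusMean (fun a b => pd (1, 0) R (a, b)) = 0 := by
  have h1 := contDiff_inner hR
  have h2 : ∀ a, HasDerivAt (fun a => ∫ b in (0 : ℝ)..(2 * π), R (a, b))
      (∫ b in (0 : ℝ)..(2 * π), pd (1, 0) R (a, b)) a := by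
    intro a
    rw [← pd_inner hR]
    exact (h1.differentiable (by simp) a).hasFDerivAt.hasDerivAt
  unfold torusMean
  rw [intervalIntegral.integral_eq_sub_of_hasDerivAt (fun a _ => h2 a)
    ((contDiff_inner (contDiff_pd hR _)).continuous.intervalIntegrable _ _)]
  simp only [hp, sub_self, mul_zero]

theorem torusMean_pd₂ {R : ℝ × ℝ → ℂ} (hR : ContDiff ℝ ∞ R) (hp : ∀ a, R (a, 2 * π) = R (a, 0)) :
    torusMean (fun a b => pd (0, 1) R (a, b)) = 0 := by
  have h1 : ∀ a, ∫ b in (0 : ℝ)..(2 * π), pd (0, 1) R (a, b) = 0 := by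
    intro a
    have h2 : ∀ b, HasDerivAt (fun b => R (a, b)) (pd (0, 1) R (a, b)) b := fun b =>
      (hR.differentiable (by simp) (a, b)).hasFDerivAt.comp_hasDerivAt b
        ((hasDerivAt_const b a).prodMk (hasDerivAt_id b))
    rw [intervalIntegral.integral_eq_sub_of_hasDerivAt (fun b _ => h2 b)
      (((contDiff_pd hR _).continuous.comp (by fun_prop : Continuous fun b : ℝ => (a, b))).intervalIntegrable _ _)]
    rw [hp, sub_self]
  unfold torusMean
  simp only [h1, intervalIntegral.integral_zero, mul_zero]

theorem torusMean_add {R S : ℝ × ℝ → ℂ} (hR : ContDiff ℝ ∞ R) (hS : ContDiff ℝ ∞ S) :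
    torusMean (fun a b => R (a, b) + S (a, b))
      = torusMean (fun a b => R (a, b)) + torusMean (fun a b => S (a, b)) := by
  unfold torusMean
  rw [← mul_add, ← intervalIntegral.integral_add
    ((contDiff_inner hR).continuous.intervalIntegrable _ _)
    ((contDiff_inner hS).continuous.intervalIntegrable _ _)]
  congr 1
  refine intervalIntegral.integral_congr fun a _ => ?_
  exact intervalIntegral.integral_add
    ((hR.continuous.comp (by fun_prop : Continuous fun b : ℝ => (a, b))).intervalIntegrable _ _)
    ((hS.continuous.comp (by fun_prop : Continuous fun b : ℝ => (a, b))).intervalIntegrable _ _)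

theorem torusMean_const_mul (c : ℂ) (R : ℝ → ℝ → ℂ) :
    torusMean (fun a b => c * R a b) = c * torusMean R := by
  unfold torusMean
  simp only [intervalIntegral.integral_const_mul]
  ring

end torus

/-- The average over the torus of the residue in the spectral variable. -/
def mres (f : ℂ × Par → ℂ) (ε x : ℝ) : ℂ := torusMean fun a b => res fun k => f (k, ε, x, a, b)

/-! ### Averaged residues: linearity, parameter derivatives, integration by parts -/

section mres

variable {Ω : Set ℝ} {f g h : ℂ × Par → ℂ} {ε x : ℝ}

/-- `f` is smooth and holomorphic near infinity for `x` in `Ω`. -/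
def SmoothOn (Ω : Set ℝ) (f : ℂ × Par → ℂ) : Prop := ∀ q : Par, q.2.1 ∈ Ω → HolSmooth f q

theorem mres_congr (h : ∀ a b, f =ᶠ[nearInf (ε, x, a, b)] g) : mres f ε x = mres g ε x := by
  unfold mres
  congr 1
  funext a b
  exact res_congr (Eventually.nearInf_self (h a b))

theorem contDiff_res (hf : SmoothOn Ω f) (hx : x ∈ Ω) (ε : ℝ) :
    ContDiff ℝ ∞ (fun y : ℝ × ℝ => res fun k => f (k, ε, x, y.1, y.2)) :=
  contDiff_iff_contDiffAt.2 fun y => ((hf (ε, x, y.1, y.2) hx).contDiffAt_res).comp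
    (f := fun y : ℝ × ℝ => ((ε, x, y.1, y.2) : Par)) y (ContDiff.contDiffAt (by fun_prop))

theorem mres_add (hf : SmoothOn Ω f) (hg : SmoothOn Ω g) (hx : x ∈ Ω) :
    mres (fun p => f p + g p) ε x = mres f ε x + mres g ε x := by
  unfold mres
  rw [← torusMean_add (contDiff_res hf hx ε) (contDiff_res hg hx ε)]
  congr 1
  funext a b
  exact res_add (hf (ε, x, a, b) hx).holInf (hg (ε, x, a, b) hx).holInf

theorem mres_const_mul (c : ℂ) (hf : SmoothOn Ω f) (hx : x ∈ Ω) :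
    mres (fun p => c * f p) ε x = c * mres f ε x := by
  unfold mres
  rw [← torusMean_const_mul]
  congr 1
  funext a b
  exact res_const_mul c (hf (ε, x, a, b) hx).holInf

theorem SmoothOn.add (hf : SmoothOn Ω f) (hg : SmoothOn Ω g) : SmoothOn Ω fun p => f p + g p :=
  fun q hq => (hf q hq).add (hg q hq)

theorem SmoothOn.sub (hf : SmoothOn Ω f) (hg : SmoothOn Ω g) : SmoothOn Ω fun p => f p - g p :=
  fun q hq => (hf q hq).sub (hg q hq)

theorem SmoothOn.mul (hf : SmoothOn Ω f) (hg : SmoothOn Ω g) : SmoothOn Ω fun p => f p * g p :=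
  fun q hq => (hf q hq).mul (hg q hq)

theorem SmoothOn.pd (hf : SmoothOn Ω f) (v : ℂ × Par) : SmoothOn Ω (pd v f) :=
  fun q hq => (hf q hq).pd v

theorem SmoothOn.brθ (hf : SmoothOn Ω f) (hg : SmoothOn Ω g) : SmoothOn Ω (brθ f g) :=
  fun q hq => (hf q hq).brθ (hg q hq)

theorem mres_sub (hf : SmoothOn Ω f) (hg : SmoothOn Ω g) (hx : x ∈ Ω) :
    mres (fun p => f p - g p) ε x = mres f ε x - mres g ε x := by
  have h1 : SmoothOn Ω fun p => (-1) * g p := fun q hq => (HolSmooth.const _).mul (hg q hq)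
  have h2 := mres_add (ε := ε) hf h1 hx
  rw [mres_const_mul _ hg hx] at h2
  rw [sub_eq_add_neg, ← neg_one_mul, ← h2]
  exact congrArg (fun f => mres f ε x) (funext fun p => by ring)

theorem mres_pd_fst (hf : SmoothOn Ω f) (hx : x ∈ Ω) : mres (pd vk f) ε x = 0 := by
  have h1 : ∀ a b, res (fun k => pd vk f (k, ε, x, a, b)) = 0 := fun a b =>
    (hf (ε, x, a, b) hx).res_pd_fst
  simp [mres, h1, torusMean]

theorem hasDerivAt_mres (hf : SmoothOn Ω f) (hx : x ∈ Ω) (ε : ℝ) :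
    HasDerivAt (fun ε => mres f ε x) (mres (pd vε f) ε x) ε := by
  let φ : (ℝ × ℝ) × ℝ → Par := fun y => (y.1.1, x, y.1.2, y.2)
  have hφ : ContDiff ℝ ∞ φ := by unfold φ; fun_prop
  have hR : ContDiff ℝ ∞ (fun y : (ℝ × ℝ) × ℝ => res fun k => f (k, φ y)) :=
    contDiff_iff_contDiffAt.2 fun y => ((hf (φ y) hx).contDiffAt_res).comp y hφ.contDiffAt
  have h1 := hasDerivAt_torusMean hR ε
  refine h1.congr_deriv ?_
  unfold mres
  congr 1
  funext a b
  have h2 : HasDerivAt (fun s : ℝ => res fun k => f (k, φ ((s, a), b)))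
      (pd ((1, 0), 0) (fun y : (ℝ × ℝ) × ℝ => res fun k => f (k, φ y)) ((ε, a), b)) ε :=
    HasFDerivAt.comp_hasDerivAt (f := fun s : ℝ => ((s, a), b)) ε
      (hR.differentiable (by simp) ((ε, a), b)).hasFDerivAt
      (((hasDerivAt_id ε).prodMk (hasDerivAt_const ε a)).prodMk (hasDerivAt_const ε b))
  have h3 : HasDerivAt (fun s : ℝ => res fun k => f (k, φ ((s, a), b)))
      (pd (1, 0, 0, 0) (fun q => res fun k => f (k, q)) (ε, x, a, b)) ε := by
    have h4 : DifferentiableAt ℝ (fun q : Par => res fun k => f (k, q)) (ε, x, a, b) :=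
      (hf (ε, x, a, b) hx).contDiffAt_res.differentiableAt (by simp)
    exact HasFDerivAt.comp_hasDerivAt (f := fun s : ℝ => ((s, x, a, b) : Par)) ε h4.hasFDerivAt
      ((hasDerivAt_id ε).prodMk ((hasDerivAt_const ε x).prodMk ((hasDerivAt_const ε a).prodMk
      (hasDerivAt_const ε b))))
  rw [h2.unique h3, (hf (ε, x, a, b) hx).pd_res]
  rfl

/-! ### Periodicity -/

def w₁ : ℂ × Par := (0, 0, 0, 2 * π, 0)
def w₂ : ℂ × Par := (0, 0, 0, 0, 2 * π)

/-- `f` increases by `c₁` and `c₂` along the two periods of the torus. -/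
def QPer (Ω : Set ℝ) (c₁ c₂ : ℂ) (f : ℂ × Par → ℂ) : Prop := ∀ q : Par, q.2.1 ∈ Ω →
  ∀ᶠ p in nearInf q, f (p + w₁) = f p + c₁ ∧ f (p + w₂) = f p + c₂

/-- `f` is doubly periodic. -/
abbrev Per (Ω : Set ℝ) (f : ℂ × Par → ℂ) : Prop := QPer Ω 0 0 f

theorem QPer.pd {c₁ c₂ : ℂ} (hf : QPer Ω c₁ c₂ f) (v : ℂ × Par) : Per Ω (pd v f) := by
  intro q hq
  filter_upwards [Eventually.nearInf_nhds (hf q hq)] with p hp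
  have key : ∀ {w : ℂ × Par} {c : ℂ}, (∀ᶠ p in 𝓝 p, f (p + w) = f p + c) →
      Toroidal.pd v f (p + w) = Toroidal.pd v f p + 0 := by
    intro w c h
    have h1 : (fun p => f (p + w)) =ᶠ[𝓝 p] fun p => f p + c := h
    have h2 := h1.fderiv_eq (𝕜 := ℝ)
    rw [fderiv_comp_add_right, fderiv_add_const] at h2
    simp only [Toroidal.pd, h2, add_zero]
  exact ⟨key (hp.mono fun _ h => h.1), key (hp.mono fun _ h => h.2)⟩

theorem Per.mul (hf : Per Ω f) (hg : Per Ω g) : Per Ω fun p => f p * g p := by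
  intro q hq
  filter_upwards [hf q hq, hg q hq] with p h1 h2
  simp only [add_zero] at h1 h2 ⊢
  exact ⟨by rw [h1.1, h2.1], by rw [h1.2, h2.2]⟩

theorem Per.add (hf : Per Ω f) (hg : Per Ω g) : Per Ω fun p => f p + g p := by
  intro q hq
  filter_upwards [hf q hq, hg q hq] with p h1 h2
  simp only [add_zero] at h1 h2 ⊢
  exact ⟨by rw [h1.1, h2.1], by rw [h1.2, h2.2]⟩

theorem Per.sub (hf : Per Ω f) (hg : Per Ω g) : Per Ω fun p => f p - g p := by
  intro q hq
  filter_upwards [hf q hq, hg q hq] with p h1 h2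
  simp only [add_zero] at h1 h2 ⊢
  exact ⟨by rw [h1.1, h2.1], by rw [h1.2, h2.2]⟩

theorem Per.res {q : Par} (hf : Per Ω f) (hq : q.2.1 ∈ Ω) :
    res (fun k => f (k, q + w₁.2)) = res (fun k => f (k, q)) ∧
    res (fun k => f (k, q + w₂.2)) = res (fun k => f (k, q)) := by
  have h := Eventually.nearInf_self (hf q hq)
  constructor
  · refine res_congr (h.mono fun k hk => ?_)
    have := hk.1
    rw [add_zero, w₁, Prod.mk_add_mk, add_zero] at this
    exact this
  · refine res_congr (h.mono fun k hk => ?_)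
    have := hk.2
    rw [add_zero, w₂, Prod.mk_add_mk, add_zero] at this
    exact this

theorem pd_res_torus (hf : SmoothOn Ω f) (hx : x ∈ Ω) (a b α β : ℝ) :
    pd (α, β) (fun y : ℝ × ℝ => res fun k => f (k, ε, x, y.1, y.2)) (a, b)
      = res fun k => pd (0, 0, 0, α, β) f (k, ε, x, a, b) := by
  have h2 : HasFDerivAt (fun y : ℝ × ℝ => ((ε, x, y.1, y.2) : Par))
      ((0 : ℝ × ℝ →L[ℝ] ℝ).prod ((0 : ℝ × ℝ →L[ℝ] ℝ).prod (ContinuousLinearMap.id ℝ (ℝ × ℝ)))) (a, b) :=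
    (hasFDerivAt_const _ _).prodMk ((hasFDerivAt_const _ _).prodMk (hasFDerivAt_id _))
  have h3 : DifferentiableAt ℝ (fun q : Par => res fun k => f (k, q)) (ε, x, a, b) :=
    (hf (ε, x, a, b) hx).contDiffAt_res.differentiableAt (by simp)
  have h4 := h3.hasFDerivAt.comp (f := fun y : ℝ × ℝ => ((ε, x, y.1, y.2) : Par)) (a, b) h2
  refine (congrArg (fun T => T (α, β)) h4.fderiv).trans ?_
  exact (hf (ε, x, a, b) hx).pd_res (0, 0, α, β)

theorem mres_pd₁ (hf : SmoothOn Ω f) (hp : Per Ω f) (hx : x ∈ Ω) : mres (pd v₁ f) ε x = 0 := by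
  have h := torusMean_pd₁ (contDiff_res hf hx ε) fun b => by
    have := (hp.res (q := (ε, x, 0, b)) hx).1
    simpa [w₁] using this
  simp only [pd_res_torus hf hx] at h
  exact h

theorem mres_pd₂ (hf : SmoothOn Ω f) (hp : Per Ω f) (hx : x ∈ Ω) : mres (pd v₂ f) ε x = 0 := by
  have h := torusMean_pd₂ (contDiff_res hf hx ε) fun a => by
    have := (hp.res (q := (ε, x, a, 0)) hx).2
    simpa [w₂] using this
  simp only [pd_res_torus hf hx] at h
  exact h

variable {c₁ c₂ d₁ d₂ : ℂ}

/-- The bracket is the divergence `∂₁(h ∂₂f) - ∂₂(h ∂₁f)`. Only derivatives of `f` occur in it, so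
`f` itself may have nonzero constant increments along the periods. -/
theorem mres_brθ (hh : SmoothOn Ω h) (hf : SmoothOn Ω f) (ph : Per Ω h) (pf : QPer Ω c₁ c₂ f)
    (hx : x ∈ Ω) : mres (brθ h f) ε x = 0 := by
  have s1 := hh.mul (hf.pd v₂)
  have s2 := hh.mul (hf.pd v₁)
  have e : ∀ a b, brθ h f =ᶠ[nearInf (ε, x, a, b)] fun p =>
      pd v₁ (fun p => h p * pd v₂ f p) p - pd v₂ (fun p => h p * pd v₁ f p) p := by
    intro a b
    filter_upwards [hh (ε, x, a, b) hx, hf (ε, x, a, b) hx] with p h1 h2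
    rw [pd_mul (dAt h1.1) (dAt (contDiffAt_pd h2.1 _)), pd_mul (dAt h1.1) (dAt (contDiffAt_pd h2.1 _)),
      pd_comm h2.1 v₁ v₂, Toroidal.brθ]
    ring
  rw [mres_congr e, mres_sub (s1.pd v₁) (s2.pd v₂) hx, mres_pd₁ s1 (ph.mul (pf.pd _)) hx,
    mres_pd₂ s2 (ph.mul (pf.pd _)) hx, sub_zero]

/-- A Jacobian determinant in `(k, θ₁, θ₂)` is a divergence with `h` undifferentiated inside it.
Residues kill `k`-derivatives and torus averages kill angular ones; periodicity is needed for `h`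
and for the derivatives of `f` and `g`. -/
theorem mres_jacobian (hf : SmoothOn Ω f) (hg : SmoothOn Ω g) (hh : SmoothOn Ω h)
    (pf : QPer Ω c₁ c₂ f) (pg : QPer Ω d₁ d₂ g) (ph : Per Ω h) (hx : x ∈ Ω) :
    mres (fun p => brθ f g p * pd vk h p + brθ g h p * pd vk f p + brθ h f p * pd vk g p) ε x = 0 := by
  have s0 := hh.mul (hf.brθ hg)
  have s1 := hh.mul (((hf.pd v₂).mul (hg.pd vk)).sub ((hf.pd vk).mul (hg.pd v₂)))
  have s2 := hh.mul (((hf.pd vk).mul (hg.pd v₁)).sub ((hf.pd v₁).mul (hg.pd vk)))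
  have e : ∀ a b, (fun p => brθ f g p * pd vk h p + brθ g h p * pd vk f p + brθ h f p * pd vk g p)
      =ᶠ[nearInf (ε, x, a, b)] fun p => (pd vk (fun p => h p * brθ f g p) p
        + pd v₁ (fun p => h p * (pd v₂ f p * pd vk g p - pd vk f p * pd v₂ g p)) p)
        + pd v₂ (fun p => h p * (pd vk f p * pd v₁ g p - pd v₁ f p * pd vk g p)) p := by
    intro a b
    filter_upwards [hh (ε, x, a, b) hx, hf (ε, x, a, b) hx, hg (ε, x, a, b) hx] with p h1 h2 h3
    have df : ∀ w, DifferentiableAt ℝ (pd w f) p := fun w => dAt (contDiffAt_pd h2.1 w)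
    have dg : ∀ w, DifferentiableAt ℝ (pd w g) p := fun w => dAt (contDiffAt_pd h3.1 w)
    have dm : ∀ w w', DifferentiableAt ℝ (fun p => pd w f p * pd w' g p) p := fun w w' =>
      (df w).fun_mul (dg w')
    unfold Toroidal.brθ
    rw [pd_mul (dAt h1.1) ((dm _ _).fun_sub (dm _ _)), pd_mul (dAt h1.1) ((dm _ _).fun_sub (dm _ _)),
      pd_mul (dAt h1.1) ((dm _ _).fun_sub (dm _ _)), pd_sub (dm _ _) (dm _ _),
      pd_sub (dm _ _) (dm _ _), pd_sub (dm _ _) (dm _ _)]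
    simp only [pd_mul (df _) (dg _)]
    rw [pd_comm h2.1 v₁ v₂, pd_comm h3.1 v₁ v₂, pd_comm h2.1 vk v₁, pd_comm h2.1 vk v₂,
      pd_comm h3.1 vk v₁, pd_comm h3.1 vk v₂]
    ring
  rw [mres_congr e, mres_add ((s0.pd vk).add (s1.pd v₁)) (s2.pd v₂) hx,
    mres_add (s0.pd vk) (s1.pd v₁) hx, mres_pd_fst s0 hx,
    mres_pd₁ s1 (ph.mul (Per.sub (Per.mul (pf.pd _) (pg.pd _)) (Per.mul (pf.pd _) (pg.pd _)))) hx,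
    mres_pd₂ s2 (ph.mul (Per.sub (Per.mul (pf.pd _) (pg.pd _)) (Per.mul (pf.pd _) (pg.pd _)))) hx,
    add_zero, add_zero]

end mres

/-! ### The degree of a map of the torus -/

section degree

variable {Ω : Set ℝ} {U V : ℂ × Par → ℂ} {G : Symbol} {x : ℝ}

def pθ₁ : ℂ × Par → ℂ := fun p => p.2.2.2.1
def pθ₂ : ℂ × Par → ℂ := fun p => p.2.2.2.2

theorem smoothOn_pθ₁ : SmoothOn Ω pθ₁ := fun _ _ =>
  holSmooth_ofReal (g := fun q : Par => q.2.2.1) contDiff_snd.snd.fst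
theorem smoothOn_pθ₂ : SmoothOn Ω pθ₂ := fun _ _ =>
  holSmooth_ofReal (g := fun q : Par => q.2.2.2) contDiff_snd.snd.snd

theorem contDiffAt_pθ₁ (p : ℂ × Par) : ContDiffAt ℝ ∞ pθ₁ p :=
  (Complex.ofRealCLM ∘L pr₁ ∘L ContinuousLinearMap.snd ℝ ℂ Par).contDiff.contDiffAt
theorem contDiffAt_pθ₂ (p : ℂ × Par) : ContDiffAt ℝ ∞ pθ₂ p :=
  (Complex.ofRealCLM ∘L pr₂ ∘L ContinuousLinearMap.snd ℝ ℂ Par).contDiff.contDiffAt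

theorem pd_pθ₁ (v p : ℂ × Par) : pd v pθ₁ p = v.2.2.2.1 := by
  have h : HasFDerivAt pθ₁ (Complex.ofRealCLM ∘L pr₁ ∘L ContinuousLinearMap.snd ℝ ℂ Par) p :=
    (Complex.ofRealCLM ∘L pr₁ ∘L ContinuousLinearMap.snd ℝ ℂ Par).hasFDerivAt
  simp only [pd, h.fderiv]
  rfl

theorem pd_pθ₂ (v p : ℂ × Par) : pd v pθ₂ p = v.2.2.2.2 := by
  have h : HasFDerivAt pθ₂ (Complex.ofRealCLM ∘L pr₂ ∘L ContinuousLinearMap.snd ℝ ℂ Par) p :=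
    (Complex.ofRealCLM ∘L pr₂ ∘L ContinuousLinearMap.snd ℝ ℂ Par).hasFDerivAt
  simp only [pd, h.fderiv]
  rfl

/-- The segment from the identity to `W`, parametrized by `ε`. -/
def seg (θ W : ℂ × Par → ℂ) : ℂ × Par → ℂ := fun p => θ p + p.2.1 * (W p - θ p)

theorem smoothOn_ε : SmoothOn Ω (fun p : ℂ × Par => ((p.2.1 : ℝ) : ℂ)) := fun _ _ =>
  holSmooth_ofReal (g := fun q : Par => q.1) contDiff_fst

theorem smoothOn_seg {θ W : ℂ × Par → ℂ} (hθ : SmoothOn Ω θ) (hW : SmoothOn Ω W) :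
    SmoothOn Ω (seg θ W) := hθ.add (smoothOn_ε.mul (hW.sub hθ))

theorem pd_seg {θ W : ℂ × Par → ℂ} {p : ℂ × Par} (hθ : DifferentiableAt ℝ θ p)
    (hW : DifferentiableAt ℝ W p) (v : ℂ × Par) : pd v (seg θ W) p
      = pd v θ p + v.2.1 * (W p - θ p) + p.2.1 * (pd v W p - pd v θ p) := by
  have h : HasFDerivAt (fun p : ℂ × Par => ((p.2.1 : ℝ) : ℂ)) (Complex.ofRealCLM ∘L
      ContinuousLinearMap.fst ℝ ℝ (ℝ × ℝ × ℝ) ∘L ContinuousLinearMap.snd ℝ ℂ Par) p :=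
    (Complex.ofRealCLM ∘L ContinuousLinearMap.fst ℝ ℝ (ℝ × ℝ × ℝ)
      ∘L ContinuousLinearMap.snd ℝ ℂ Par).hasFDerivAt
  have h' : pd v (fun p : ℂ × Par => ((p.2.1 : ℝ) : ℂ)) p = v.2.1 := by
    simp only [pd, h.fderiv]; rfl
  unfold seg
  rw [pd_add hθ (h.differentiableAt.fun_mul (hW.fun_sub hθ)), pd_mul h.differentiableAt (hW.fun_sub hθ),
    pd_sub hW hθ, h']
  ring

theorem smoothOn_const (c : ℂ) : SmoothOn Ω (fun _ => c) := fun _ _ => HolSmooth.const c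

theorem SmoothOn.sub_symbol {A : Symbol} {M U V : ℂ × Par → ℂ} (hA : IsSymbol A) (hM : SmoothOn Ω M)
    (hU : SmoothOn Ω U) (hV : SmoothOn Ω V) : SmoothOn Ω (Toroidal.sub A (fun p => p.1) M U V) :=
  fun q hq => HolSmooth.sub_symbol hA HolSmooth.fst (hM q hq) (hU q hq) (hV q hq) tendsto_fst

theorem per_const (c : ℂ) : Per Ω (fun _ => c) := fun _ _ => Eventually.of_forall fun _ => by simp

/-- Substitution into a symbol of functions that are periodic modulo the periods of the symbol. -/
theorem per_sub_symbol {A : Symbol} {L M U V : ℂ × Par → ℂ} (hA : IsSymbol A)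
    (hL : Per Ω L) (ht : ∀ q : Par, q.2.1 ∈ Ω → Tendsto L (nearInf q) (Bornology.cobounded ℂ))
    (hM : Per Ω M) (hU : QPer Ω (2 * π) 0 U) (hV : QPer Ω 0 (2 * π) V) :
    Per Ω (Toroidal.sub A L M U V) := by
  obtain ⟨ρ, -, hρ⟩ := hA
  intro q hq
  filter_upwards [hL q hq, hM q hq, hU q hq, hV q hq,
    (tendsto_norm_cobounded_atTop.comp (ht q hq)).eventually (eventually_gt_atTop ρ)]
    with p h1 h2 h3 h4 h5
  simp only [add_zero] at h1 h2 h3 h4 ⊢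
  unfold sub
  rw [h1.1, h1.2, h2.1, h2.2, h3.1, h3.2, h4.1, h4.2]
  exact ⟨(hρ _ _ _ _ h5).1, (hρ _ _ _ _ h5).2⟩

theorem per_fst : Per Ω (fun p : ℂ × Par => p.1) := fun _ _ => Eventually.of_forall fun p => by
  simp [w₁, w₂]

theorem qPer_pθ₁ : QPer Ω (2 * π) 0 pθ₁ := fun _ _ => Eventually.of_forall fun p => by
  simp [w₁, w₂, pθ₁]

theorem qPer_pθ₂ : QPer Ω 0 (2 * π) pθ₂ := fun _ _ => Eventually.of_forall fun p => by
  simp [w₁, w₂, pθ₂]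

theorem per_ε : Per Ω (fun p : ℂ × Par => ((p.2.1 : ℝ) : ℂ)) := fun _ _ =>
  Eventually.of_forall fun p => by simp [w₁, w₂]

theorem QPer.add {c₁ c₂ d₁ d₂ : ℂ} {f g : ℂ × Par → ℂ} (hf : QPer Ω c₁ c₂ f)
    (hg : QPer Ω d₁ d₂ g) : QPer Ω (c₁ + d₁) (c₂ + d₂) fun p => f p + g p := by
  intro q hq
  filter_upwards [hf q hq, hg q hq] with p h1 h2
  exact ⟨by rw [h1.1, h2.1]; ring, by rw [h1.2, h2.2]; ring⟩

theorem QPer.sub {c₁ c₂ d₁ d₂ : ℂ} {f g : ℂ × Par → ℂ} (hf : QPer Ω c₁ c₂ f)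
    (hg : QPer Ω d₁ d₂ g) : QPer Ω (c₁ - d₁) (c₂ - d₂) fun p => f p - g p := by
  intro q hq
  filter_upwards [hf q hq, hg q hq] with p h1 h2
  exact ⟨by rw [h1.1, h2.1]; ring, by rw [h1.2, h2.2]; ring⟩

theorem qPer_seg {c₁ c₂ : ℂ} {θ W : ℂ × Par → ℂ} (hθ : QPer Ω c₁ c₂ θ) (hW : QPer Ω c₁ c₂ W) :
    QPer Ω c₁ c₂ (seg θ W) ∧ Per Ω (fun p => W p - θ p) := by
  have h1 : Per Ω (fun p => W p - θ p) := by simpa using hW.sub hθ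
  have h2 := hθ.add (per_ε.mul h1)
  simp only [add_zero] at h2
  exact ⟨h2, h1⟩

theorem pd_brθ {f g : ℂ × Par → ℂ} {p : ℂ × Par} (hf : ContDiffAt ℝ ∞ f p)
    (hg : ContDiffAt ℝ ∞ g p) (v : ℂ × Par) :
    pd v (brθ f g) p = brθ (pd v f) g p + brθ f (pd v g) p := by
  have df : ∀ w, DifferentiableAt ℝ (pd w f) p := fun w => dAt (contDiffAt_pd hf w)
  have dg : ∀ w, DifferentiableAt ℝ (pd w g) p := fun w => dAt (contDiffAt_pd hg w)
  unfold brθ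
  rw [pd_sub ((df v₁).fun_mul (dg v₂)) ((df v₂).fun_mul (dg v₁)), pd_mul (df _) (dg _),
    pd_mul (df _) (dg _), pd_comm hf v, pd_comm hf v, pd_comm hg v, pd_comm hg v]
  ring

theorem brθ_congr {f g f' g' : ℂ × Par → ℂ} {p : ℂ × Par} (hf : f =ᶠ[𝓝 p] f') (hg : g =ᶠ[𝓝 p] g') :
    brθ f g p = brθ f' g' p := by
  simp only [brθ, pd_congr hf, pd_congr hg]

theorem pd_fst (v p : ℂ × Par) : pd v (fun p : ℂ × Par => p.1) p = v.1 := by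
  simp [pd, fderiv_fst]

/-- Along the straight homotopy from `(θ₁, θ₂)` to `(U, V)` the derivative of `G {U_ε, V_ε}_θ` is
`{G U', V_ε}_θ - {G V', U_ε}_θ`, where `U' = U - θ₁` and `V' = V - θ₂` are periodic; by `mres_brθ`
its average is zero. The map thus has degree one whether or not it is invertible. Complex values of
`U` and `V` are harmless since `G` is entire in `u` and `v`. -/
theorem mres_degree (hG : IsSymbol G) (hU : SmoothOn Ω U) (hV : SmoothOn Ω V)
    (pU : QPer Ω (2 * π) 0 U) (pV : QPer Ω 0 (2 * π) V) (eU : at0 U = U) (eV : at0 V = V)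
    (hx : x ∈ Ω) :
    mres (fun p => sub G (fun p => p.1) (fun _ => 0) U V p * brθ U V p) 0 x
      = mres (sub G (fun p => p.1) (fun _ => 0) pθ₁ pθ₂) 0 x := by
  set Ur := seg pθ₁ U with hUr
  set Vr := seg pθ₂ V with hVr
  have sU : SmoothOn Ω Ur := smoothOn_seg smoothOn_pθ₁ hU
  have sV : SmoothOn Ω Vr := smoothOn_seg smoothOn_pθ₂ hV
  obtain ⟨qU, qU'⟩ := qPer_seg qPer_pθ₁ pU
  obtain ⟨qV, qV'⟩ := qPer_seg qPer_pθ₂ pV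
  let Gr := sub G (fun p => p.1) (fun _ => 0) Ur Vr
  have sG : SmoothOn Ω Gr := SmoothOn.sub_symbol hG (smoothOn_const 0) sU sV
  have pG : Per Ω Gr := per_sub_symbol hG per_fst (fun _ _ => tendsto_fst) (per_const 0) qU qV
  let U' : ℂ × Par → ℂ := fun p => U p - pθ₁ p
  let V' : ℂ × Par → ℂ := fun p => V p - pθ₂ p
  have sU' : SmoothOn Ω U' := hU.sub smoothOn_pθ₁
  have sV' : SmoothOn Ω V' := hV.sub smoothOn_pθ₂
  -- Neither `U` nor `V` depends on `ε`, which is therefore free to serve as the homotopy parameter.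
  have hstat : ∀ {W : ℂ × Par → ℂ} {q : Par}, SmoothOn Ω W → q.2.1 ∈ Ω → at0 W = W →
      ∀ᶠ p in nearInf q, pd vε W p = 0 := by
    intro W q hW hq h0
    filter_upwards [pd_at0 (q := q) (f := W) (hW (0, q.2) hq)] with p hp
    rw [h0] at hp
    rw [hp]
    exact pd_zero _ _
  let F : ℂ × Par → ℂ := fun p => Gr p * brθ Ur Vr p
  have sF : SmoothOn Ω F := sG.mul (sU.brθ sV)
  have hzero : ∀ ε, mres (pd vε F) ε x = 0 := by
    intro ε
    have e : ∀ a b, pd vε F =ᶠ[nearInf (ε, x, a, b)] fun p =>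
        brθ (fun p => Gr p * U' p) Vr p - brθ (fun p => Gr p * V' p) Ur p := by
      intro a b
      have hq : ((ε, x, a, b) : Par).2.1 ∈ Ω := hx
      have hdU : pd vε Ur =ᶠ[nearInf (ε, x, a, b)] U' := by
        filter_upwards [hU _ hq, hstat hU hq eU] with p h1 h2
        rw [hUr, pd_seg (dAt (contDiffAt_pθ₁ p)) (dAt h1.1), h2, pd_pθ₁]
        simp [vε, U']
      have hdV : pd vε Vr =ᶠ[nearInf (ε, x, a, b)] V' := by
        filter_upwards [hV _ hq, hstat hV hq eV] with p h1 h2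
        rw [hVr, pd_seg (dAt (contDiffAt_pθ₂ p)) (dAt h1.1), h2, pd_pθ₂]
        simp [vε, V']
      filter_upwards [Eventually.nearInf_nhds hdU, Eventually.nearInf_nhds hdV, sU _ hq, sV _ hq,
        sG _ hq, sU' _ hq, sV' _ hq, pd_sub_symbol hG HolSmooth.fst (HolSmooth.const 0) (sU _ hq)
        (sV _ hq) tendsto_fst] with p h1 h2 h3 h4 h5 h6 h7 h8
      have h9 : ∀ v, pd v Gr p = _ := h8
      have b1 : brθ (pd vε Ur) Vr p = brθ U' Vr p := brθ_congr h1 (EventuallyEq.refl _ _)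
      have b2 : brθ Ur (pd vε Vr) p = brθ Ur V' p := brθ_congr (EventuallyEq.refl _ _) h2
      have hb : ContDiffAt ℝ ∞ (brθ Ur Vr) p := ((contDiffAt_pd h3.1 _).mul
        (contDiffAt_pd h4.1 _)).sub ((contDiffAt_pd h3.1 _).mul (contDiffAt_pd h4.1 _))
      simp only [F]
      rw [pd_mul (dAt h5.1) (dAt hb), pd_brθ h3.1 h4.1, b1, b2]
      have g1 : pd v₁ Gr p = _ := h9 v₁
      have g2 : pd v₂ Gr p = _ := h9 v₂
      have gε : pd vε Gr p = _ := h9 vε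
      rw [pd_fst, pd_const, show v₁.1 = 0 from rfl] at g1
      rw [pd_fst, pd_const, show v₂.1 = 0 from rfl] at g2
      rw [pd_fst, pd_const, show vε.1 = 0 from rfl, h1.self_of_nhds, h2.self_of_nhds] at gε
      rw [gε]
      unfold brθ
      rw [pd_mul (dAt h5.1) (dAt h6.1), pd_mul (dAt h5.1) (dAt h6.1), pd_mul (dAt h5.1) (dAt h7.1),
        pd_mul (dAt h5.1) (dAt h7.1), g1, g2]
      ring
    rw [mres_congr e, mres_sub ((sG.mul sU').brθ sV) ((sG.mul sV').brθ sU) hx,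
      mres_brθ (sG.mul sU') sV (pG.mul qU') qV hx, mres_brθ (sG.mul sV') sU (pG.mul qV') qU hx,
      sub_zero]
  have hconst : mres F 1 x = mres F 0 x := by
    refine is_const_of_deriv_eq_zero (f := fun ε => mres F ε x)
      (fun ε => (hasDerivAt_mres sF hx ε).differentiableAt) (fun ε => ?_) 1 0
    rw [(hasDerivAt_mres sF hx ε).deriv, hzero]
  have hsl : ∀ (H : ℂ × Par → ℂ) (ε ε' : ℝ) (H' : ℂ × Par → ℂ), (∀ a b,
      ∀ᶠ k in Bornology.cobounded ℂ, H (k, ε, x, a, b) = H' (k, ε', x, a, b)) →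
      mres H ε x = mres H' ε' x := by
    intro H ε ε' H' h
    unfold mres
    congr 1
    funext a b
    exact res_congr (h a b)
  have hst : ∀ (W : ℂ × Par → ℂ), at0 W = W → ∀ k ε a b, W (k, ε, x, a, b) = W (k, 0, x, a, b) :=
    fun W hW k ε a b => (congrFun hW (k, ε, x, a, b)).symm
  have hpst : ∀ (W : ℂ × Par → ℂ), SmoothOn Ω W → at0 W = W → ∀ a b, ∀ᶠ k in Bornology.cobounded ℂ,
      pd v₁ W (k, 1, x, a, b) = pd v₁ W (k, 0, x, a, b) ∧
      pd v₂ W (k, 1, x, a, b) = pd v₂ W (k, 0, x, a, b) := by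
    intro W hW h0 a b
    have := pd_at0 (q := (1, x, a, b)) (f := W) (hW _ hx)
    rw [h0] at this
    exact (Eventually.nearInf_self this).mono fun k hk => ⟨hk v₁, hk v₂⟩
  have h1 : mres F 1 x
      = mres (fun p => sub G (fun p => p.1) (fun _ => 0) U V p * brθ U V p) 0 x := by
    refine hsl _ _ _ _ fun a b => ?_
    filter_upwards [Eventually.nearInf_self (hU (1, x, a, b) hx),
      Eventually.nearInf_self (hV (1, x, a, b) hx), hpst U hU eU a b, hpst V hV eV a b]
      with k h1 h2 h3 h4
    simp only [F, Gr, sub, brθ, hUr, hVr, pd_seg (dAt (contDiffAt_pθ₁ _)) (dAt h1.1),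
      pd_seg (dAt (contDiffAt_pθ₂ _)) (dAt h2.1), seg, h3, h4, hst U eU k 1, hst V eV k 1]
    simp [v₁, v₂, pd_pθ₁, pd_pθ₂]
  have h2 : mres F 0 x = mres (sub G (fun p => p.1) (fun _ => 0) pθ₁ pθ₂) 0 x := by
    refine hsl _ _ _ _ fun a b => ?_
    filter_upwards [Eventually.nearInf_self (hU (0, x, a, b) hx),
      Eventually.nearInf_self (hV (0, x, a, b) hx)] with k h1 h2
    simp only [F, Gr, sub, brθ, hUr, hVr, pd_seg (dAt (contDiffAt_pθ₁ _)) (dAt h1.1),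
      pd_seg (dAt (contDiffAt_pθ₂ _)) (dAt h2.1), seg]
    simp [v₁, v₂, pd_pθ₁, pd_pθ₂]
  rw [← h1, hconst, h2]

end degree

/-! ### The cocycle -/

/-- The restriction of a symbol to `mu = 0` and real `u, v`. -/
def atZero (A : Symbol) : ℂ × Par → ℂ := sub A (fun p => p.1) (fun _ => 0) pθ₁ pθ₂

section cocycle

variable {Ω : Set ℝ} {A B C : Symbol} {ε x : ℝ}

theorem smoothOn_atZero (hA : IsSymbol A) : SmoothOn Ω (atZero A) :=
  SmoothOn.sub_symbol hA (smoothOn_const 0) smoothOn_pθ₁ smoothOn_pθ₂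

theorem per_atZero (hA : IsSymbol A) : Per Ω (atZero A) :=
  per_sub_symbol hA per_fst (fun _ _ => tendsto_fst) (per_const 0) qPer_pθ₁ qPer_pθ₂

theorem pd_atZero (hA : IsSymbol A) (q : Par) : ∀ᶠ p in nearInf q,
    pd vk (atZero A) p = atZero (dL A) p ∧ pd v₁ (atZero A) p = atZero (dU A) p ∧
    pd v₂ (atZero A) p = atZero (dV A) p := by
  filter_upwards [pd_sub_symbol hA (q := q) HolSmooth.fst (HolSmooth.const 0)
    (smoothOn_pθ₁ (Ω := univ) q trivial) (smoothOn_pθ₂ (Ω := univ) q trivial) tendsto_fst] with p hp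
  simp only [atZero, hp, pd_fst, pd_const, pd_pθ₁, pd_pθ₂]
  simp [vk, v₁, v₂]

/-- Here `ε` and `x` are dummies; the averaged-residue form makes integration by parts available. -/
theorem cocycle_eq_mres (hB : IsSymbol B) (ε x : ℝ) :
    cocycle A B = mres (fun p => atZero A p * pd vk (atZero B) p) ε x := by
  unfold cocycle mres
  congr 1
  funext a b
  refine res_congr ?_
  filter_upwards [Eventually.nearInf_self (pd_atZero hB (ε, x, a, b))] with k hk
  rw [hk.1]
  rfl

theorem cocycle_linear (hA : IsSymbol A) (hB : IsSymbol B) (hC : IsSymbol C) (r : ℂ) :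
    cocycle (fun l m u v => r * A l m u v + B l m u v) C = r * cocycle A C + cocycle B C := by
  rw [cocycle_eq_mres hC 0 0, cocycle_eq_mres hC 0 0, cocycle_eq_mres hC 0 0]
  have h1 : SmoothOn univ (fun p => atZero A p * pd vk (atZero C) p) :=
    (smoothOn_atZero hA).mul ((smoothOn_atZero hC).pd _)
  have h2 : SmoothOn univ (fun p => atZero B p * pd vk (atZero C) p) :=
    (smoothOn_atZero hB).mul ((smoothOn_atZero hC).pd _)
  rw [← mres_const_mul r h1 trivial, ← mres_add ((smoothOn_const r).mul h1) h2 trivial]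
  refine congrArg (fun f => mres f 0 0) (funext fun p => ?_)
  simp only [atZero, sub]
  ring

/-- The sum of the two sides is the averaged residue of the derivative `∂_λ(A B)` at `μ = 0`. -/
theorem cocycle_antisymm (hA : IsSymbol A) (hB : IsSymbol B) : cocycle A B = - cocycle B A := by
  rw [cocycle_eq_mres hA 0 0, cocycle_eq_mres hB 0 0, eq_neg_iff_add_eq_zero]
  have sA := smoothOn_atZero (Ω := univ) hA
  have sB := smoothOn_atZero (Ω := univ) hB
  rw [← mres_add (sA.mul (sB.pd _)) (sB.mul (sA.pd _)) trivial,
    ← mres_pd_fst (sA.mul sB) (x := 0) (ε := 0) trivial]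
  refine mres_congr fun a b => ?_
  filter_upwards [sA _ trivial, sB _ trivial] with p h1 h2
  rw [pd_mul (dAt h1.1) (dAt h2.1)]
  ring

theorem atZero_poisson (hA : IsSymbol A) (hB : IsSymbol B) (q : Par) :
    atZero (poisson A B) =ᶠ[nearInf q] fun p => pd vk (atZero A) p * atZero (dM B) p
      - atZero (dM A) p * pd vk (atZero B) p + brθ (atZero A) (atZero B) p := by
  filter_upwards [pd_atZero hA q, pd_atZero hB q] with p h1 h2
  simp only [brθ, h1, h2]
  simp only [poisson_eq, atZero, sub]
  ring

/-- At `μ = 0` the bracket is `A_λ B_μ - A_μ B_λ + {A, B}_{uv}`. Multiplied by `C_λ` and summed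
cyclically, the terms with `μ`-derivatives cancel algebraically, and the rest is the Jacobian of
`(A, B, C)` in `(λ, u, v)`. -/
theorem cocycle_cyclic (hA : IsSymbol A) (hB : IsSymbol B) (hC : IsSymbol C) :
    cocycle (poisson A B) C + cocycle (poisson B C) A + cocycle (poisson C A) B = 0 := by
  rw [cocycle_eq_mres hA 0 0, cocycle_eq_mres hB 0 0, cocycle_eq_mres hC 0 0]
  have sA := smoothOn_atZero (Ω := univ) hA
  have sB := smoothOn_atZero (Ω := univ) hB
  have sC := smoothOn_atZero (Ω := univ) hC
  have s1 := (smoothOn_atZero (Ω := univ) (hA.poisson hB)).mul (sC.pd vk)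
  have s2 := (smoothOn_atZero (Ω := univ) (hB.poisson hC)).mul (sA.pd vk)
  have s3 := (smoothOn_atZero (Ω := univ) (hC.poisson hA)).mul (sB.pd vk)
  rw [← mres_add s1 s2 trivial, ← mres_add (s1.add s2) s3 trivial,
    ← mres_jacobian sA sB sC (per_atZero hA) (per_atZero hB) (per_atZero hC) (x := 0) (ε := 0) trivial]
  refine mres_congr fun a b => ?_
  filter_upwards [atZero_poisson hA hB _, atZero_poisson hB hC _, atZero_poisson hC hA _]
    with p h1 h2 h3
  rw [h1, h2, h3]
  ring

end cocycle

/-! ### An identity between primitives of symbols -/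

section primitive

variable {A B : Symbol}

def eL : ℂ × ℂ × ℂ × ℂ := (1, 0, 0, 0)
def eM : ℂ × ℂ × ℂ × ℂ := (0, 1, 0, 0)
def eU : ℂ × ℂ × ℂ × ℂ := (0, 0, 1, 0)
def eV : ℂ × ℂ × ℂ × ℂ := (0, 0, 0, 1)

theorem IsSymbol.pd (hA : IsSymbol A) : ∃ ρ : ℝ, 0 < ρ ∧ ∀ p : ℂ × ℂ × ℂ × ℂ, ρ < ‖p.1‖ →
    ContDiffAt ℝ ∞ (uncS A) p ∧ DifferentiableAt ℂ (uncS A) p ∧ pd eL (uncS A) p = uncS (Toroidal.dL A) p ∧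
    pd eM (uncS A) p = uncS (Toroidal.dM A) p ∧ pd eU (uncS A) p = uncS (Toroidal.dU A) p ∧
    pd eV (uncS A) p = uncS (Toroidal.dV A) p := by
  obtain ⟨ρ, h0, h⟩ := hA.eventually
  refine ⟨ρ, h0, fun p hp => ?_⟩
  have hd : DifferentiableOn ℂ (uncS A) {p | ρ < ‖p.1‖} := fun p hp => (h p hp).differentiableWithinAt
  have hc := (contDiffOn_of_differentiableOn (isOpen_lt_norm_fst ρ) hd).contDiffAt
    ((isOpen_lt_norm_fst ρ).mem_nhds hp)
  have h1 : ∀ w, Toroidal.pd w (uncS A) p = fderiv ℂ (uncS A) p w := fun w => by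
    rw [Toroidal.pd, (h p hp).fderiv_restrictScalars ℝ]
    rfl
  refine ⟨hc.restrict_scalars ℝ, h p hp, ?_, ?_, ?_, ?_⟩ <;> rw [h1, fderiv_uncS (h p hp)] <;>
    simp [eL, eM, eU, eV, uncS]

/-- The derivatives of a symbol commute. -/
theorem IsSymbol.dM_comm (hA : IsSymbol A) : ∃ ρ : ℝ, 0 < ρ ∧ ∀ p : ℂ × ℂ × ℂ × ℂ, ρ < ‖p.1‖ →
    Toroidal.pd eM (uncS (Toroidal.dL A)) p = Toroidal.pd eL (uncS (Toroidal.dM A)) p ∧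
    Toroidal.pd eM (uncS (Toroidal.dU A)) p = Toroidal.pd eU (uncS (Toroidal.dM A)) p ∧
    Toroidal.pd eM (uncS (Toroidal.dV A)) p = Toroidal.pd eV (uncS (Toroidal.dM A)) p := by
  obtain ⟨ρ, h0, h⟩ := hA.pd
  refine ⟨ρ, h0, fun p hp => ?_⟩
  have hn : ∀ᶠ p' in 𝓝 p, ρ < ‖p'.1‖ := (isOpen_lt_norm_fst ρ).mem_nhds hp
  have hM : Toroidal.pd eM (uncS A) =ᶠ[𝓝 p] uncS (Toroidal.dM A) :=
    hn.mono fun p' hp' => (h p' hp').2.2.2.1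
  have hc := (h p hp).1
  refine ⟨?_, ?_, ?_⟩
  · have h1 : Toroidal.pd eL (uncS A) =ᶠ[𝓝 p] uncS (Toroidal.dL A) :=
      hn.mono fun p' hp' => (h p' hp').2.2.1
    rw [← pd_congr h1, ← pd_congr hM, pd_comm hc]
  · have h1 : Toroidal.pd eU (uncS A) =ᶠ[𝓝 p] uncS (Toroidal.dU A) :=
      hn.mono fun p' hp' => (h p' hp').2.2.2.2.1
    rw [← pd_congr h1, ← pd_congr hM, pd_comm hc]
  · have h1 : Toroidal.pd eV (uncS A) =ᶠ[𝓝 p] uncS (Toroidal.dV A) :=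
      hn.mono fun p' hp' => (h p' hp').2.2.2.2.2
    rw [← pd_congr h1, ← pd_congr hM, pd_comm hc]

theorem IsSymbol.eq_of_dM_eq_zero (hA : IsSymbol A) {ρ : ℝ}
    (h : ∀ p : ℂ × ℂ × ℂ × ℂ, ρ < ‖p.1‖ → Toroidal.pd eM (uncS A) p = 0) :
    ∃ ρ : ℝ, 0 < ρ ∧ ∀ l m u v : ℂ, ρ < ‖l‖ → A l m u v = A l 0 u v := by
  obtain ⟨ρ', h0, hd⟩ := hA.pd
  refine ⟨max ρ ρ', lt_max_of_lt_right h0, fun l m u v hl => ?_⟩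
  have h1 : ∀ z, HasDerivAt (fun z => A l z u v) 0 z := fun z => by
    obtain ⟨-, h2, -, h3, -⟩ := hd (l, z, u, v) ((le_max_right _ _).trans_lt hl)
    have h4 := hasDerivAt_dM h2
    rw [h ((l, z, u, v) : ℂ × ℂ × ℂ × ℂ) ((le_max_left _ _).trans_lt hl)] at h3
    rw [← (hasDerivAt_dM h2).deriv] at h4
    exact h4.congr_deriv h3.symm
  exact is_const_of_deriv_eq_zero (fun z => (h1 z).differentiableAt) (fun z => (h1 z).deriv) m 0

/-- The primitive of a Poisson bracket is, up to derivatives, a function of the restrictions to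
`mu = 0`. -/
theorem primitive_poisson (hA : IsSymbol A) (hB : IsSymbol B) : ∃ ρ : ℝ, 0 < ρ ∧
    ∀ l m u v : ℂ, ρ < ‖l‖ → primitive (poisson A B) l m u v
      = A l 0 u v * dL B l 0 u v - A l m u v * dL B l m u v
        + dL (primitive fun l m u v => A l m u v * dM B l m u v) l m u v
        + dU (primitive fun l m u v => A l m u v * dV B l m u v) l m u v
        - dV (primitive fun l m u v => A l m u v * dU B l m u v) l m u v := by
  set q := primitive fun l m u v => A l m u v * dM B l m u v with hq
  set w := primitive fun l m u v => A l m u v * dV B l m u v with hw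
  set z := primitive fun l m u v => A l m u v * dU B l m u v with hz
  set r := primitive (poisson A B) with hr
  obtain ⟨sq, ρ1, -, dq⟩ := primitive_isSymbol (hA.mul hB.dM)
  obtain ⟨sw, ρ2, -, dw⟩ := primitive_isSymbol (hA.mul hB.dV)
  obtain ⟨sz, ρ3, -, dz⟩ := primitive_isSymbol (hA.mul hB.dU)
  obtain ⟨sr, ρ4, -, dr⟩ := primitive_isSymbol (hA.poisson hB)
  rw [← hq] at sq dq
  rw [← hw] at sw dw
  rw [← hz] at sz dz
  rw [← hr] at sr dr
  -- Equality of mixed derivatives gives `{A, B} = ∂_λ(A B_μ) - ∂_μ(A B_λ) + ∂_u(A B_v) - ∂_v(A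
  -- B_u)`, so `E` does not depend on `μ`. At `μ = 0` all primitives vanish together with their
  -- other derivatives, and `E` reduces to `A B_λ` there.
  let E : Symbol := fun l m u v => r l m u v + A l m u v * dL B l m u v - dL q l m u v - dU w l m u v
    + dV z l m u v
  have sE : IsSymbol E := (((sr.add (hA.mul hB.dL)).sub sq.dL).sub sw.dU).add sz.dV
  obtain ⟨σ1, -, c1⟩ := sq.dM_comm
  obtain ⟨σ2, -, c2⟩ := sw.dM_comm
  obtain ⟨σ3, -, c3⟩ := sz.dM_comm
  obtain ⟨σ4, -, c4⟩ := hB.dM_comm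
  obtain ⟨τ1, -, pA⟩ := hA.pd
  obtain ⟨τ2, -, pB⟩ := hB.dL.pd
  obtain ⟨τ3, -, pr⟩ := sr.pd
  obtain ⟨τ4, -, pq⟩ := sq.dL.pd
  obtain ⟨τ5, -, pw⟩ := sw.dU.pd
  obtain ⟨τ6, -, pz⟩ := sz.dV.pd
  obtain ⟨υ1, -, pBM⟩ := hB.dM.pd
  obtain ⟨υ2, -, pBU⟩ := hB.dU.pd
  obtain ⟨υ3, -, pBV⟩ := hB.dV.pd
  obtain ⟨κ, -, pB0⟩ := hB.pd
  obtain ⟨ρ, hρ⟩ : ∃ ρ : ℝ, ∀ ξ : ℝ, ρ < ξ → (ρ1 < ξ ∧ ρ2 < ξ ∧ ρ3 < ξ ∧ ρ4 < ξ) ∧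
      (σ1 < ξ ∧ σ2 < ξ ∧ σ3 < ξ ∧ σ4 < ξ) ∧ (τ1 < ξ ∧ τ2 < ξ ∧ τ3 < ξ ∧ τ4 < ξ ∧ τ5 < ξ ∧ τ6 < ξ) ∧
      (υ1 < ξ ∧ υ2 < ξ ∧ υ3 < ξ ∧ κ < ξ) := by
    refine ⟨|ρ1| + |ρ2| + |ρ3| + |ρ4| + |σ1| + |σ2| + |σ3| + |σ4| + |τ1| + |τ2| + |τ3| + |τ4| + |τ5|
      + |τ6| + |υ1| + |υ2| + |υ3| + |κ|, fun ξ hξ => ?_⟩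
    have := fun y : ℝ => le_abs_self y
    have := fun y : ℝ => abs_nonneg y
    refine ⟨⟨?_, ?_, ?_, ?_⟩, ⟨?_, ?_, ?_, ?_⟩, ⟨?_, ?_, ?_, ?_, ?_, ?_⟩, ?_, ?_, ?_, ?_⟩ <;>
    linarith [le_abs_self ρ1, le_abs_self ρ2, le_abs_self ρ3, le_abs_self ρ4, le_abs_self σ1,
      le_abs_self σ2, le_abs_self σ3, le_abs_self σ4, le_abs_self τ1, le_abs_self τ2, le_abs_self τ3,
      le_abs_self τ4, le_abs_self τ5, le_abs_self τ6, le_abs_self υ1, le_abs_self υ2, le_abs_self υ3,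
      abs_nonneg ρ1, abs_nonneg ρ2, abs_nonneg ρ3, abs_nonneg ρ4, abs_nonneg σ1, abs_nonneg σ2,
      abs_nonneg σ3, abs_nonneg σ4, abs_nonneg τ1, abs_nonneg τ2, abs_nonneg τ3, abs_nonneg τ4,
      abs_nonneg τ5, abs_nonneg τ6, abs_nonneg υ1, abs_nonneg υ2, abs_nonneg υ3, abs_nonneg κ,
      le_abs_self κ]
  obtain ⟨ρ', h0, h⟩ := sE.eq_of_dM_eq_zero (ρ := ρ) fun p hp => by
    obtain ⟨⟨a1, a2, a3, a4⟩, ⟨b1, b2, b3, b4⟩, ⟨t1, t2, t3, t4, t5, t6⟩, u1, u2, u3, k1⟩ := hρ _ hp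
    have hn : ∀ᶠ p' : ℂ × ℂ × ℂ × ℂ in 𝓝 p, ρ < ‖p'.1‖ := (isOpen_lt_norm_fst ρ).mem_nhds hp
    have eq : uncS (dM q) =ᶠ[𝓝 p] fun p => uncS A p * uncS (dM B) p :=
      hn.mono fun p' hp' => dq _ _ _ _ (hρ _ hp').1.1
    have ew : uncS (dM w) =ᶠ[𝓝 p] fun p => uncS A p * uncS (dV B) p :=
      hn.mono fun p' hp' => dw _ _ _ _ (hρ _ hp').1.2.1
    have ez : uncS (dM z) =ᶠ[𝓝 p] fun p => uncS A p * uncS (dU B) p :=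
      hn.mono fun p' hp' => dz _ _ _ _ (hρ _ hp').1.2.2.1
    obtain ⟨pA1, -, pA2, pA3, pA4, pA5⟩ := pA p t1
    obtain ⟨pB1, -⟩ := pB p t2
    obtain ⟨pr1, -, -, pr2, -⟩ := pr p t3
    obtain ⟨pq1, -⟩ := pq p t4
    obtain ⟨pw1, -⟩ := pw p t5
    obtain ⟨pz1, -⟩ := pz p t6
    obtain ⟨pM1, -⟩ := pBM p u1
    obtain ⟨pU1, -⟩ := pBU p u2
    obtain ⟨pV1, -⟩ := pBV p u3
    obtain ⟨pB2, -, x1, x2, x3, x4⟩ := pB0 p k1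
    have n0 : ∀ᶠ p' : ℂ × ℂ × ℂ × ℂ in 𝓝 p, κ < ‖p'.1‖ := (isOpen_lt_norm_fst κ).mem_nhds k1
    have eBU : Toroidal.pd eU (uncS B) =ᶠ[𝓝 p] uncS (dU B) := n0.mono fun p' hp' => (pB0 p' hp').2.2.2.2.1
    have eBV : Toroidal.pd eV (uncS B) =ᶠ[𝓝 p] uncS (dV B) := n0.mono fun p' hp' => (pB0 p' hp').2.2.2.2.2
    have cUV : Toroidal.pd eU (uncS (dV B)) p = Toroidal.pd eV (uncS (dU B)) p := by
      rw [← pd_congr eBU, ← pd_congr eBV, pd_comm pB2]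
    have e0 : uncS E = fun p => uncS r p + uncS A p * uncS (dL B) p - uncS (dL q) p - uncS (dU w) p
      + uncS (dV z) p := rfl
    have s1 := dAt pr1
    have s2 := (dAt pA1).fun_mul (dAt pB1)
    have s3 := s1.fun_add s2
    have s4 := s3.fun_sub (dAt pq1)
    have s5 := s4.fun_sub (dAt pw1)
    have er : uncS (dM r) p = uncS (dL A) p * uncS (dM B) p - uncS (dM A) p * uncS (dL B) p
      + uncS (dU A) p * uncS (dV B) p - uncS (dV A) p * uncS (dU B) p := dr _ _ _ _ a4
    rw [e0, pd_add s5 (dAt pz1), pd_sub s4 (dAt pw1), pd_sub s3 (dAt pq1), pd_add s1 s2,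
      pd_mul (dAt pA1) (dAt pB1), (c1 p b1).1, (c2 p b2).2.1, (c3 p b3).2.2, pd_congr eq, pd_congr ew,
      pd_congr ez, pd_mul (dAt pA1) (dAt pM1), pd_mul (dAt pA1) (dAt pV1), pd_mul (dAt pA1) (dAt pU1),
      (c4 p b4).1, cUV, pr2, pA2, pA3, pA4, pA5, er]
    ring
  refine ⟨ρ', h0, fun l m u v hl => ?_⟩
  have h1 := h l m u v hl
  have z1 : ∀ (G : Symbol) (l u v : ℂ), dL (primitive G) l 0 u v = 0 := fun G l u v => by
    simp only [dL, primitive_zero, deriv_const]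
  have z2 : ∀ (G : Symbol) (l u v : ℂ), dU (primitive G) l 0 u v = 0 := fun G l u v => by
    simp only [dU, primitive_zero, deriv_const]
  have z3 : ∀ (G : Symbol) (l u v : ℂ), dV (primitive G) l 0 u v = 0 := fun G l u v => by
    simp only [dV, primitive_zero, deriv_const]
  simp only [E] at h1
  rw [hr, hq, hw, hz, primitive_zero, z1, z2, z3] at h1
  rw [hr, hq, hw, hz]
  linear_combination h1

end primitive

/-! ### Periodicity of the series -/

/-- The coefficient fields are doubly periodic. -/
structure PerState (Ω : Set ℝ) (s : State) : Prop where
  g : ∀ n, ∀ x ∈ Ω, ∀ a b, s.g n x (a + 2 * π) b = s.g n x a b ∧ s.g n x a (b + 2 * π) = s.g n x a b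
  h : ∀ n, ∀ x ∈ Ω, ∀ a b, s.h n x (a + 2 * π) b = s.h n x a b ∧ s.h n x a (b + 2 * π) = s.h n x a b
  u : ∀ n, ∀ x ∈ Ω, ∀ a b, s.u n x (a + 2 * π) b = s.u n x a b ∧ s.u n x a (b + 2 * π) = s.u n x a b
  v : ∀ n, ∀ x ∈ Ω, ∀ a b, s.v n x (a + 2 * π) b = s.v n x a b ∧ s.v n x a (b + 2 * π) = s.v n x a b

theorem add_w₁ (p : ℂ × Par) : p + w₁ = (p.1, p.2.1, p.2.2.1, p.2.2.2.1 + 2 * π, p.2.2.2.2) := by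
  simp [w₁, Prod.ext_iff]

theorem add_w₂ (p : ℂ × Par) : p + w₂ = (p.1, p.2.1, p.2.2.1, p.2.2.2.1, p.2.2.2.2 + 2 * π) := by
  simp [w₂, Prod.ext_iff]

section periodicity

variable {Ω : Set ℝ} {t : ℕ → ℤ → ℂ} {s : State} {A : Symbol}

theorem per_gen (hΩ : IsOpen Ω) {z : ℕ → ℝ → ℝ → ℝ → ℂ} (hz : ∀ n, ∀ x ∈ Ω, ∀ a b,
    z n x (a + 2 * π) b = z n x a b ∧ z n x a (b + 2 * π) = z n x a b) :
    Per Ω (gen fun _ => z) := by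
  intro q hq
  filter_upwards [tendsto_snd.eventually (eventually_mem_nearInf hΩ hq)] with p hp
  rw [add_w₁, add_w₂]
  simp only [gen, (hz _ _ hp _ _).1, (hz _ _ hp _ _).2, add_zero, and_self]

variable (hΩ : IsOpen Ω) (hs : NiceFam Ω fun _ => s) (hp : PerState Ω s)
include hΩ hp

theorem per_fL : Per Ω (fL fun _ => s) := per_fst.add (per_gen hΩ hp.g)

theorem qPer_sU : QPer Ω (2 * π) 0 (sU fun _ => s) := by
  have h : QPer Ω (2 * π + 0) (0 + 0) (sU fun _ => s) := qPer_pθ₁.add (per_gen hΩ hp.u)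
  rwa [add_zero, add_zero] at h

theorem qPer_rV : QPer Ω 0 (2 * π) (rV fun _ => s) := by
  have h : QPer Ω (0 + 0) (2 * π + 0) (rV fun _ => s) := qPer_pθ₂.add (per_gen hΩ hp.v)
  rwa [add_zero, add_zero] at h

theorem per_comp_sU {T : ℂ → ℂ → ℂ} (hT : ∀ l w, T l (w + 2 * π) = T l w) :
    Per Ω (fun p => T p.1 (sU (fun _ => s) p)) := by
  intro q hq
  filter_upwards [qPer_sU hΩ hp q hq] with p h
  rw [h.1, h.2, add_zero, add_zero, hT]
  simp [w₁, w₂]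

theorem qPer_sV : QPer Ω 0 (2 * π) (sV t fun _ => s) := by
  have h : QPer Ω (0 + 0) (0 + 2 * π) (fun p => timeV t p.1 (sU (fun _ => s) p) + rV (fun _ => s) p) :=
    QPer.add (per_comp_sU hΩ hp timeV_add_two_pi) (qPer_rV hΩ hp)
  rw [zero_add, zero_add] at h
  rwa [show sV t (fun _ => s) = _ from funext sV_eq]

theorem per_sM : Per Ω (sM t fun _ => s) := by
  intro q hq
  filter_upwards [per_comp_sU hΩ hp timeM_add_two_pi q hq, per_gen hΩ hp.h q hq,
    HolSmooth.eventually_ne_zero q] with p h1 h2 h3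
  have h4 : (p + w₁).1 ≠ 0 := by simpa [w₁] using h3
  have h5 : (p + w₂).1 ≠ 0 := by simpa [w₂] using h3
  rw [sM_eq h3, sM_eq h4, sM_eq h5, rM, rM, rM, h1.1, h1.2, h2.1, h2.2]
  simp [w₁, w₂]

include hs

theorem QPer.comp_fL {c₁ c₂ : ℂ} {S : ℂ × Par → ℂ} (hS : QPer Ω c₁ c₂ S) :
    QPer Ω c₁ c₂ (fun p => S (fL (fun _ => s) p, p.2)) := by
  intro q hq
  filter_upwards [(hs.tendsto_fL_nearInf hq).eventually (hS q hq), per_fL hΩ hp q hq] with p h1 h2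
  rw [h2.1, h2.2, ← h1.1, ← h1.2]
  simp [w₁, w₂]

theorem per_fA (hA : IsSymbol A) : Per Ω (fA t A fun _ => s) :=
  per_sub_symbol hA (per_fL hΩ hp) (fun _ hq => hs.tendsto_fL hq)
    (QPer.comp_fL hΩ hs hp (per_sM hΩ hp)) (QPer.comp_fL hΩ hs hp (qPer_sU hΩ hp))
    (QPer.comp_fL hΩ hs hp (qPer_sV hΩ hp))

omit hΩ hs hp in
theorem Per.negU {f : ℂ × Par → ℂ} (hf : Per Ω f) : Per Ω (negU f) := by
  intro q hq
  have h := hf q hq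
  filter_upwards [tendsto_snd.eventually (Eventually.nearInf_param h)] with p hp
  simp only [add_zero] at hp
  refine ⟨?_, ?_⟩
  · rw [add_zero]
    simp only [Toroidal.negU]
    have e : (p + w₁).1 = p.1 := by simp [w₁]
    rw [e]
    refine congrFun (neg₁_congr ?_) _
    filter_upwards [Eventually.nearInf_self hp] with k hk
    have := hk.1
    rw [w₁, Prod.mk_add_mk, add_zero] at this
    exact this
  · rw [add_zero]
    simp only [Toroidal.negU]
    have e : (p + w₂).1 = p.1 := by simp [w₂]
    rw [e]
    refine congrFun (neg₁_congr ?_) _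
    filter_upwards [Eventually.nearInf_self hp] with k hk
    have := hk.2
    rw [w₂, Prod.mk_add_mk, add_zero] at this
    exact this

end periodicity

/-! ### The commutator on the function `F` -/

section residues

variable {f g : ℂ × Par → ℂ} {q : Par}

/-- The residue of a product in terms of the negative parts of the factors. -/
theorem res_mul_pd_fst (hf : HolSmooth f q) (hg : HolSmooth g q) :
    res (fun k => f (k, q) * pd vk g (k, q))
      = res (fun k => pd vk (negU g) (k, q) * f (k, q) - pd vk (negU f) (k, q) * g (k, q)) := by
  have h1 : EntireAtInf fun k => posU f (k, q) * pd vk (posU g) (k, q) :=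
    (entireAtInf_posU hf).mul (entireAtInf_pd_fst_posU hg)
  have s1 := hf.posU.mul (hg.posU.pd vk)
  have s2 := hf.negU.mul hg.posU
  have s3 := (hf.negU.pd vk).mul hg.negU
  have s0 := ((hg.negU.pd vk).mul hf).sub ((hf.negU.pd vk).mul hg)
  have h3 : OInf 2 fun k => pd vk (negU f) (k, q) * negU g (k, q) :=
    ((hf.vanishes_negU.oInf_fst hf.negU).mul (hg.vanishes_negU.oInf hg.negU)).mono (by omega)
  have r1 : res (fun k => posU f (k, q) * pd vk (posU g) (k, q)) = 0 := h1.res_eq_zero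
  have r3 := res_eq_zero_of_OInf s3.holInf h3
  have r2 : res (fun k => pd vk (fun p => negU f p * posU g p) (k, q)) = 0 := s2.res_pd_fst
  -- Of the four groups the first is entire, the second a total derivative and the third `O(k⁻²)`;
  -- only the last one has a residue.
  have e : (fun k => f (k, q) * pd vk g (k, q)) =ᶠ[Bornology.cobounded ℂ] fun k =>
      ((posU f (k, q) * pd vk (posU g) (k, q)) + pd vk (fun p => negU f p * posU g p) (k, q))
      + (pd vk (negU f) (k, q) * negU g (k, q)
      + (pd vk (negU g) (k, q) * f (k, q) - pd vk (negU f) (k, q) * g (k, q))) := by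
    refine Eventually.nearInf_self (P := fun p => f p * pd vk g p
      = ((posU f p * pd vk (posU g) p) + pd vk (fun p => negU f p * posU g p) p)
        + (pd vk (negU f) p * negU g p + (pd vk (negU g) p * f p - pd vk (negU f) p * g p))) ?_
    filter_upwards [hf, hg, hf.negU, hg.negU, hg.posU] with p a1 a2 a3 a4 a5
    rw [pd_mul (dAt a3.1) (dAt a5.1), show pd vk (posU g) p = pd vk g p - pd vk (negU g) p from
      pd_sub (dAt a2.1) (dAt a4.1) _]
    simp only [posU]
    ring
  rw [res_congr e, res_add (s1.add (s2.pd vk)).holInf (s3.add s0).holInf,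
    res_add s1.holInf (s2.pd vk).holInf, res_add s3.holInf s0.holInf, r1, r2, r3]
  simp

end residues

/-! ### The second variation of `F` and the anomaly -/

section F

variable {Ω : Set ℝ} {t : ℕ → ℤ → ℂ} {s : State} {A B : Symbol} {ε x : ℝ}
variable (hΩ : IsOpen Ω) (hs : NiceFam Ω fun _ => s) (hp : PerState Ω s) (ht : EntireTimes t)
  (hA : IsSymbol A) (hB : IsSymbol B) (hC : Canonical t Ω s) (hx : x ∈ Ω)

-- The substitution `λ = L(k)` under the residue, averaged over the torus; it connects the series at
-- independent `λ` with the Lax functions of `k`.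
include hs hx in
theorem mres_comp_fL {f : ℂ × Par → ℂ} (hf : SmoothOn Ω f) :
    mres (fun p => f (fL (fun _ => s) p, p.2) * pd vk (fL fun _ => s) p) ε x = mres f ε x := by
  unfold mres
  congr 1
  funext a b
  have hq : ((ε, x, a, b) : Par).2.1 ∈ Ω := hx
  obtain ⟨h1, h2⟩ := hs.gen_g hq
  rw [← res_change_of_variable (hf (ε, x, a, b) hx).holInf h1.holInf h2.self_of_nhds]
  refine res_congr ?_
  filter_upwards [Eventually.nearInf_self (hs.holSmooth_fL hq), h1.holInf] with k h3 h4
  have h5 : pd vk (fL fun _ => s) (k, ε, x, a, b) = _ := pd_fst_eq_deriv (dAt h3.1) h3.2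
  rw [h5]
  congr 1
  exact ((hasDerivAt_id k).add h4.hasDerivAt).deriv

/-- The symbol `A` at the series in `lambda`. -/
abbrev sA (t : ℕ → ℤ → ℂ) (A : Symbol) (s : State) : ℂ × Par → ℂ :=
  sub A (fun p => p.1) (sM t fun _ => s) (sU fun _ => s) (sV t fun _ => s)

section smooth

include hs

omit hx in
theorem smoothOn_fL : SmoothOn Ω (fL fun _ => s) := fun _ hq => hs.holSmooth_fL hq
theorem smoothOn_sU : SmoothOn Ω (sU fun _ => s) := fun _ hq => hs.holSmooth_sU hq
include ht
theorem smoothOn_sM : SmoothOn Ω (sM t fun _ => s) := fun _ hq => hs.holSmooth_sM hq ht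
theorem smoothOn_sV : SmoothOn Ω (sV t fun _ => s) := fun _ hq => hs.holSmooth_sV hq ht
include hA
theorem smoothOn_fA : SmoothOn Ω (fA t A fun _ => s) := fun _ hq => hs.holSmooth_fA hq ht hA
theorem smoothOn_fN : SmoothOn Ω (fN t A fun _ => s) := fun _ hq => hs.holSmooth_fN hq ht hA
theorem smoothOn_sA : SmoothOn Ω (sA t A s) :=
  SmoothOn.sub_symbol hA (smoothOn_sM hs ht) (smoothOn_sU hs) (smoothOn_sV hs ht)

theorem pd_sA {q : Par} (hq : q.2.1 ∈ Ω) : ∀ᶠ p in nearInf q, ∀ v, pd v (sA t A s) p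
    = sA t (dL A) s p * v.1 + sA t (dM A) s p * pd v (sM t fun _ => s) p
      + sA t (dU A) s p * pd v (sU fun _ => s) p + sA t (dV A) s p * pd v (sV t fun _ => s) p := by
  filter_upwards [pd_sub_symbol hA HolSmooth.fst (hs.holSmooth_sM hq ht) (hs.holSmooth_sU hq)
    (hs.holSmooth_sV hq ht) tendsto_fst] with p hp v
  rw [hp, pd_fst]

end smooth

include hΩ hs hp ht hA in
theorem per_sA : Per Ω (sA t A s) :=
  per_sub_symbol hA per_fst (fun _ _ => tendsto_fst) (per_sM hΩ hp) (qPer_sU hΩ hp) (qPer_sV hΩ hp)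

include hs hx ht hA hB in
theorem mres_fA_mul_pd :
    mres (fun p => fA t A (fun _ => s) p * pd vk (fA t B fun _ => s) p) ε x
      = mres (fun p => sA t A s p * pd vk (sA t B s) p) ε x := by
  rw [← mres_comp_fL hs hx ((smoothOn_sA hs ht hA).mul ((smoothOn_sA hs ht hB).pd vk))]
  refine mres_congr fun a b => ?_
  have hq : ((ε, x, a, b) : Par).2.1 ∈ Ω := hx
  filter_upwards [hs.pd_comp_fL hq (smoothOn_sA hs ht hB _ hq)] with p h
  have h1 : pd vk (fA t B fun _ => s) p = _ := h vk
  rw [h1, show pd ((0 : ℂ), vk.2) (sA t B s) (fL (fun _ => s) p, p.2) = 0 from pd_zero _ _, zero_add,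
    mul_assoc]
  rfl

-- This averages `res_mul_pd_fst`. The left side is the antisymmetrized second variation of `F` in
-- the form delivered by `mres_dε`.
include hs hx ht hA hB in
theorem mres_fN_sub : mres (fun p => pd vk (fN t B fun _ => s) p * fA t A (fun _ => s) p) ε x
    - mres (fun p => pd vk (fN t A fun _ => s) p * fA t B (fun _ => s) p) ε x
      = mres (fun p => fA t A (fun _ => s) p * pd vk (fA t B fun _ => s) p) ε x := by
  have a1 := smoothOn_fA hs ht hA
  have a2 := smoothOn_fA hs ht hB
  rw [← mres_sub (((smoothOn_fN hs ht hB).pd vk).mul a1) (((smoothOn_fN hs ht hA).pd vk).mul a2) hx]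
  unfold mres
  congr 1
  funext a b
  exact (res_mul_pd_fst (a1 (ε, x, a, b) hx) (a2 (ε, x, a, b) hx)).symm

section canonical

include hΩ hs ht hC

/-- The canonical relations in terms of the series in `lambda`. -/
theorem canonical_ser {q : Par} (hq : q.2.1 ∈ Ω) :
    brθ (sU fun _ => s) (sV t fun _ => s) =ᶠ[nearInf q] (fun _ => 1) ∧
    brθ (sM t fun _ => s) (sV t fun _ => s) =ᶠ[nearInf q] pd vk (sV t fun _ => s) ∧
    brθ (sM t fun _ => s) (sU fun _ => s) =ᶠ[nearInf q] pd vk (sU fun _ => s) := by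
  obtain ⟨c1, c2, c3, c4, c5, c6⟩ := canonical_br hΩ hs ht hq hC hq
  have hM := smoothOn_sM hs ht q hq
  have hU := smoothOn_sU hs q hq
  have hV := smoothOn_sV hs ht q hq
  -- At fixed `λ` the series have no `k`-dependence, so their mutual bracket is the angular one; the
  -- two remaining terms come from the motion of `L`, since `{L, L} = 0`.
  have key : ∀ {S T : ℂ × Par → ℂ}, HolSmooth S q → HolSmooth T q → ∀ᶠ p in nearInf q,
      br (fun p => S (fL (fun _ => s) p, p.2)) (fun p => T (fL (fun _ => s) p, p.2)) p
      = brθ S T (fL (fun _ => s) p, p.2)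
        + pd vk S (fL (fun _ => s) p, p.2)
          * br (fL fun _ => s) (fun p => T (fL (fun _ => s) p, p.2)) p
        - pd vk T (fL (fun _ => s) p, p.2)
          * br (fL fun _ => s) (fun p => S (fL (fun _ => s) p, p.2)) p := by
    intro S T hS hT
    filter_upwards [hs.pd_comp_fL hq hS, hs.pd_comp_fL hq hT] with p h1 h2
    have e0 : ∀ S : ℂ × Par → ℂ, pd ((0 : ℂ), vk.2) S (fL (fun _ => s) p, p.2) = 0 :=
      fun S => pd_zero _ _
    simp only [br, brθ, h1, h2, e0, show ((0 : ℂ), v₁.2) = v₁ from rfl,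
      show ((0 : ℂ), v₂.2) = v₂ from rfl, show ((0 : ℂ), vx.2) = vx from rfl]
    ring
  refine ⟨hs.eventuallyEq_of_comp_fL hq ?_, hs.eventuallyEq_of_comp_fL hq ?_,
    hs.eventuallyEq_of_comp_fL hq ?_⟩
  · filter_upwards [key hU hV, c2, c3, c4] with p h c2 c3 c4
    change br (fU fun _ => s) (fV t fun _ => s) p = _ + _ * br (fL fun _ => s) (fV t fun _ => s) p
      - _ * br (fL fun _ => s) (fU fun _ => s) p at h
    rw [c2, c3, c4] at h
    linear_combination -h
  · filter_upwards [key hM hV, c1, c6, c4] with p h c1 c6 c4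
    change br (fM t fun _ => s) (fV t fun _ => s) p
      = _ + _ * br (fL fun _ => s) (fV t fun _ => s) p
      - _ * br (fL fun _ => s) (fM t fun _ => s) p at h
    rw [c6, c1, c4] at h
    linear_combination -h
  · filter_upwards [key hM hU, c1, c5, c3] with p h c1 c5 c3
    change br (fM t fun _ => s) (fU fun _ => s) p
      = _ + _ * br (fL fun _ => s) (fU fun _ => s) p
      - _ * br (fL fun _ => s) (fM t fun _ => s) p at h
    rw [c5, c1, c3] at h
    linear_combination -h

include hp hA hB hx

/-- The origin of the cocycle. -/
theorem mres_primitive_poisson : mres (sA t (primitive (poisson A B)) s) 0 x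
    + mres (fun p => sA t A s p * pd vk (sA t B s) p) 0 x = cocycle A B := by
  obtain ⟨sq, ρ1, -, dq⟩ := primitive_isSymbol (hA.mul hB.dM)
  obtain ⟨sw, ρ2, -, dw⟩ := primitive_isSymbol (hA.mul hB.dV)
  obtain ⟨sz, ρ3, -, dz⟩ := primitive_isSymbol (hA.mul hB.dU)
  obtain ⟨ρ4, -, hid⟩ := primitive_poisson hA hB
  have sr := (primitive_isSymbol (hA.poisson hB)).1
  set Q := primitive fun l m u v => A l m u v * dM B l m u v
  set W := primitive fun l m u v => A l m u v * dV B l m u v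
  set Z := primitive fun l m u v => A l m u v * dU B l m u v
  let G : Symbol := fun l m u v => A l m u v * dL B l m u v
  have hG : IsSymbol G := hA.mul hB.dL
  have hU := smoothOn_sU hs
  have hV := smoothOn_sV hs ht
  have pU := qPer_sU hΩ hp
  have pV := qPer_sV (t := t) hΩ hp
  have kQ := smoothOn_sA hs ht sq
  have kW := smoothOn_sA hs ht sw
  have kZ := smoothOn_sA hs ht sz
  let f1 : ℂ × Par → ℂ := fun p => sub G (fun p => p.1) (fun _ => 0) (sU fun _ => s) (sV t fun _ => s) p
    * brθ (sU fun _ => s) (sV t fun _ => s) p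
  let f2 : ℂ × Par → ℂ := fun p => brθ (sU fun _ => s) (sV t fun _ => s) p * pd vk (sA t Q s) p
    + brθ (sV t fun _ => s) (sA t Q s) p * pd vk (sU fun _ => s) p
    + brθ (sA t Q s) (sU fun _ => s) p * pd vk (sV t fun _ => s) p
  have k1 : SmoothOn Ω f1 := (SmoothOn.sub_symbol hG (smoothOn_const 0) hU hV).mul (hU.brθ hV)
  have k2 : SmoothOn Ω f2 := (((hU.brθ hV).mul (kQ.pd vk)).add ((hV.brθ kQ).mul (hU.pd vk))).add
    ((kQ.brθ hU).mul (hV.pd vk))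
  have k3 := kW.brθ hV
  have k4 := kZ.brθ hU
  -- By `primitive_poisson` the left side is the boundary term at `μ = 0`, plus the explicit
  -- derivatives `Q_λ + W_u - Z_v`, plus the implicit part `A (B_μ ∂_λM + B_u ∂_λU + B_v ∂_λV)` of
  -- `A ∂_λB`. The relations `{U, V}_θ = 1`, `{M, V}_θ = ∂_λV` and `{M, U}_θ = ∂_λU` assemble the
  -- last two into the Jacobian of `(U, V, Q)` and the angular brackets of `W` with `V` and of `Z`
  -- with `U`, all of zero average.
  have e : ∀ a b, (fun p => sA t (primitive (poisson A B)) s p + sA t A s p * pd vk (sA t B s) p)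
      =ᶠ[nearInf (0, x, a, b)] fun p => (f1 p + f2 p) + (brθ (sA t W s) (sV t fun _ => s) p
        + brθ (sA t Z s) (sU fun _ => s) p) := by
    intro a b
    have hq : ((0, x, a, b) : Par).2.1 ∈ Ω := hx
    obtain ⟨c1, c2, c3⟩ := canonical_ser hΩ hs ht hC hq
    have hr := fun ρ : ℝ => (tendsto_norm_cobounded_atTop.comp
      (tendsto_fst (f := Bornology.cobounded ℂ) (g := 𝓝 ((0, x, a, b) : Par)))).eventually
      (eventually_gt_atTop ρ)
    filter_upwards [c1, c2, c3, pd_sA hs ht hB hq, pd_sA hs ht sq hq, pd_sA hs ht sw hq,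
      pd_sA hs ht sz hq, hr ρ1, hr ρ2, hr ρ3, hr ρ4] with p c1 c2 c3 dB dQ dW dZ r1 r2 r3 r4
    have i1 : sA t (dM Q) s p = sA t A s p * sA t (dM B) s p := dq _ _ _ _ r1
    have i2 : sA t (dM W) s p = sA t A s p * sA t (dV B) s p := dw _ _ _ _ r2
    have i3 : sA t (dM Z) s p = sA t A s p * sA t (dU B) s p := dz _ _ _ _ r3
    have i4 : sA t (primitive (poisson A B)) s p
      = sub G (fun p => p.1) (fun _ => 0) (sU fun _ => s) (sV t fun _ => s) p
        - sA t A s p * sA t (dL B) s p + sA t (dL Q) s p + sA t (dU W) s p - sA t (dV Z) s p :=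
      hid _ _ _ _ r4
    simp only [f1, f2]
    rw [i4]
    unfold brθ at c1 c2 c3 ⊢
    simp only [dB, dQ, dW, dZ, i1, i2, i3]
    simp only [show vk.1 = 1 from rfl, show v₁.1 = 0 from rfl, show v₂.1 = 0 from rfl]
    generalize sub G (fun p => p.1) (fun _ => 0) (sU fun _ => s) (sV t fun _ => s) p = g0
    generalize sA t A s p = a0
    generalize sA t (dL B) s p = b1
    generalize sA t (dM B) s p = b2
    generalize sA t (dU B) s p = b3
    generalize sA t (dV B) s p = b4
    generalize sA t (dL Q) s p = q1
    generalize sA t (dU Q) s p = q3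
    generalize sA t (dV Q) s p = q4
    generalize sA t (dU W) s p = w3
    generalize sA t (dV W) s p = w4
    generalize sA t (dU Z) s p = z3
    generalize sA t (dV Z) s p = z4
    generalize pd vk (sM t fun _ => s) p = mk at *
    generalize pd vk (sU fun _ => s) p = uk at *
    generalize pd vk (sV t fun _ => s) p = vvk at *
    generalize pd v₁ (sM t fun _ => s) p = m1 at *
    generalize pd v₁ (sU fun _ => s) p = u1 at *
    generalize pd v₁ (sV t fun _ => s) p = vv1 at *
    generalize pd v₂ (sM t fun _ => s) p = m2 at *
    generalize pd v₂ (sU fun _ => s) p = u2 at *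
    generalize pd v₂ (sV t fun _ => s) p = vv2 at *
    linear_combination (-g0 - q1 - a0 * b2 * mk - w3 + z4) * c1
      + (a0 * b2 * uk - a0 * b4) * c2 + (-a0 * b2 * vvk - a0 * b3) * c3
  rw [← mres_add (smoothOn_sA hs ht sr) ((smoothOn_sA hs ht hA).mul ((smoothOn_sA hs ht hB).pd vk)) hx,
    mres_congr e, mres_add (k1.add k2) (k3.add k4) hx, mres_add k1 k2 hx, mres_add k3 k4 hx,
    mres_jacobian hU hV kQ pU pV (per_sA hΩ hs hp ht sq) hx,
    mres_brθ kW hV (per_sA hΩ hs hp ht sw) pV hx, mres_brθ kZ hU (per_sA hΩ hs hp ht sz) pU hx,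
    mres_degree hG hU hV pU pV rfl rfl hx, cocycle_eq_mres hB 0 x, add_zero, add_zero, add_zero]
  refine mres_congr fun a b => ?_
  filter_upwards [pd_atZero hB (0, x, a, b)] with p h
  rw [h.1]
  rfl

omit hA in
/-- The variation along `A` of the residue that defines the variation of `F` along `B`. -/
theorem mres_dε (hA : IsSymbol A) :
    mres (dε (sub (primitive B) (fun p => p.1) (sM t (s.shift (symmetry t A s)))
      (sU (s.shift (symmetry t A s))) (sV t (s.shift (symmetry t A s))))) 0 x
    = mres (fun p => pd vk (fN t A fun _ => s) p * fA t B (fun _ => s) p) 0 x := by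
  have hτ := niceFam_shift_symmetry hΩ hs ht hA
  have hY := niceFam_symmetry hΩ hs ht hA
  obtain ⟨sP, ρ, -, dP⟩ := primitive_isSymbol hB
  set P := primitive B
  let W : ℂ × Par → ℂ := fun p => sA t (dM P) s p * velM t (fun _ => s) (fun _ => symmetry t A s) p
    + sA t (dU P) s p * velU (fun _ => symmetry t A s) p
    + sA t (dV P) s p * velV t (fun _ => s) (fun _ => symmetry t A s) p
  have kP := smoothOn_sA hs ht sP
  have kf := smoothOn_fA hs ht sP
  have kL := smoothOn_fL hs
  have kN := smoothOn_fN hs ht hA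
  have pL := per_fL hΩ hp
  have pf := per_fA (t := t) hΩ hs hp sP
  have pN : Per Ω (fN t A fun _ => s) := (per_fA (t := t) hΩ hs hp hA).negU
  have kW : SmoothOn Ω W := fun q hq => (((smoothOn_sA hs ht sP.dM q hq).mul
    (holSmooth_velM hs hY ht hq)).add ((smoothOn_sA hs ht sP.dU q hq).mul (holSmooth_velU hY hq))).add
    ((smoothOn_sA hs ht sP.dV q hq).mul (holSmooth_velV hs hY ht hq))
  let J : ℂ × Par → ℂ := fun p => brθ (fL fun _ => s) (fA t P fun _ => s) p * pd vk (fN t A fun _ => s) p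
    + brθ (fA t P fun _ => s) (fN t A fun _ => s) p * pd vk (fL fun _ => s) p
    + brθ (fN t A fun _ => s) (fL fun _ => s) p * pd vk (fA t P fun _ => s) p
  have kJ : SmoothOn Ω J := (((kL.brθ kf).mul (kN.pd vk)).add ((kf.brθ kN).mul (kL.pd vk))).add
    ((kN.brθ kL).mul (kf.pd vk))
  have e1 : ∀ a b, dε (sub P (fun p => p.1) (sM t (s.shift (symmetry t A s)))
      (sU (s.shift (symmetry t A s))) (sV t (s.shift (symmetry t A s))))
      =ᶠ[nearInf (0, x, a, b)] W := by
    intro a b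
    have hq : ((0, x, a, b) : Par).2.1 ∈ Ω := hx
    filter_upwards [dε_sU_eq_vel hΩ hs hY hq, dε_sV_eq_vel hΩ hs hY ht hq,
      dε_sM_eq_vel hΩ hs hY ht hq, (tendsto_at0 ((0, x, a, b) : Par)).eventually
      (pd_sub_symbol sP HolSmooth.fst (hτ.holSmooth_sM (q := (0, x, a, b)) hq ht)
        (hτ.holSmooth_sU hq) (hτ.holSmooth_sV hq ht) tendsto_fst)] with p h1 h2 h3 h4
    have h5 := h4 vε
    have e0 : ∀ D : Symbol, sub D (fun p => p.1) (sM t (s.shift (symmetry t A s)))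
      (sU (s.shift (symmetry t A s))) (sV t (s.shift (symmetry t A s))) (p.1, 0, p.2.2)
      = sA t D s p := by
      intro D
      have i1 := congrFun (at0_sM (t := t) (s := s) (Y := symmetry t A s)) p
      have i2 := congrFun (at0_sU (s := s) (Y := symmetry t A s)) p
      have i3 := congrFun (at0_sV (t := t) (s := s) (Y := symmetry t A s)) p
      simp only [at0] at i1 i2 i3
      simp only [sA, sub, i1, i2, i3]
    simp only [dε, at0] at h1 h2 h3
    rw [h1, h2, h3, pd_fst] at h5
    simp only [e0, show vε.1 = 0 from rfl, mul_zero, zero_add] at h5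
    exact h5
  -- By the chain rule the integrand after `λ = L(k)` is `{N, P} ∂_kL - (∂_kP) {N, L}`, with `P`
  -- evaluated at the Lax functions. Regrouping gives `(∂_kN) {L, P}` minus the Jacobian of `(L, P,
  -- N)` in `(k, θ₁, θ₂)`, and on shell `{L, P}` is the `μ`-derivative of `P`, that is `B`.
  have e2 : ∀ a b, (fun p => W (fL (fun _ => s) p, p.2) * pd vk (fL fun _ => s) p)
      =ᶠ[nearInf (0, x, a, b)] fun p =>
        pd vk (fN t A fun _ => s) p * fA t B (fun _ => s) p - J p := by
    intro a b
    have hq : ((0, x, a, b) : Par).2.1 ∈ Ω := hx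
    obtain ⟨c1, -, c3, c4, -, -⟩ := canonical_br hΩ hs ht hq hC hq
    have hr := (tendsto_norm_cobounded_atTop.comp (hs.tendsto_fL hq)).eventually
      (eventually_gt_atTop ρ)
    filter_upwards [velU_comp_fL hΩ hs ht hA hq, velV_comp_fL hΩ hs ht hA hq,
      velM_comp_fL hΩ hs ht hA hq, hs.br_comp_fL hq (kP _ hq) (fN t A fun _ => s),
      (hs.tendsto_fL_nearInf hq).eventually (pd_sA hs ht sP hq), hs.pd_comp_fL hq (kP _ hq),
      pd_sub_symbol sP (hs.holSmooth_fL hq) (hs.holSmooth_fM hq ht) (hs.holSmooth_fU hq)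
      (hs.holSmooth_fV hq ht) (hs.tendsto_fL hq), c1, c3, c4, hr]
      with p h1 h2 h3 h4 h5 h6 h7 c1 c3 c4 hr
    have i1 : W (fL (fun _ => s) p, p.2) = act (fL fun _ => s) (fN t A fun _ => s) (sA t P s) p := by
      simp only [W]
      have h1' : velU (fun _ => symmetry t A s) (fL (fun _ => s) p, p.2) = _ := h1
      have h2' : velV t (fun _ => s) (fun _ => symmetry t A s) (fL (fun _ => s) p, p.2) = _ := h2
      have h3' : velM t (fun _ => s) (fun _ => symmetry t A s) (fL (fun _ => s) p, p.2) = _ := h3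
      rw [h1', h2', h3']
      simp only [act, h5, show vx.1 = 0 from rfl, show v₁.1 = 0 from rfl, show v₂.1 = 0 from rfl]
      ring
    have i2 : br (fN t A fun _ => s) (fA t P fun _ => s) p = _ := h4
    have i3 : pd vk (fA t P fun _ => s) p = _ := h6 vk
    rw [show pd ((0 : ℂ), vk.2) (sA t P s) (fL (fun _ => s) p, p.2) = 0 from pd_zero _ _,
      zero_add] at i3
    have i4 : fA t (dM P) (fun _ => s) p = fA t B (fun _ => s) p := dP _ _ _ _ hr
    have i5 : br (fL fun _ => s) (fA t P fun _ => s) p = fA t B (fun _ => s) p := by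
      rw [← i4]
      have h7' : ∀ v, pd v (fA t P fun _ => s) p = _ := h7
      have h8 : br (fL fun _ => s) (fA t P fun _ => s) p
        = fA t (dM P) (fun _ => s) p * br (fL fun _ => s) (fM t fun _ => s) p
        + fA t (dU P) (fun _ => s) p * br (fL fun _ => s) (fU fun _ => s) p
        + fA t (dV P) (fun _ => s) p * br (fL fun _ => s) (fV t fun _ => s) p := by
        unfold br
        simp only [h7']
        simp only [fA_eq_sub]
        ring
      rw [h8, c1, c3, c4]
      ring
    rw [i1]
    have i6 : act (fL fun _ => s) (fN t A fun _ => s) (sA t P s) p * pd vk (fL fun _ => s) p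
      = br (fN t A fun _ => s) (fA t P fun _ => s) p * pd vk (fL fun _ => s) p
        - pd vk (fA t P fun _ => s) p * br (fN t A fun _ => s) (fL fun _ => s) p := by
      rw [i2, i3]; ring
    rw [i6, ← i5]
    simp only [J, br, brθ]
    ring
  rw [mres_congr e1, ← mres_comp_fL hs hx kW, mres_congr e2,
    mres_sub ((kN.pd vk).mul (smoothOn_fA hs ht hB)) kJ hx,
    mres_jacobian kL kf kN pL pf pN hx, sub_zero]

omit hp hC in
/-- The variation of `F` along `B` is differentiable along `A`. -/
theorem hasDerivAt_symmetry_F :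
    HasDerivAt (fun ε : ℝ => (symmetry t B (s.shift (symmetry t A s) ε)).F x)
      (- mres (dε (sub (primitive B) (fun p => p.1) (sM t (s.shift (symmetry t A s)))
      (sU (s.shift (symmetry t A s))) (sV t (s.shift (symmetry t A s))))) 0 x) 0 := by
  have hτ := niceFam_shift_symmetry hΩ hs ht hA
  have h : SmoothOn Ω (sub (primitive B) (fun p => p.1) (sM t (s.shift (symmetry t A s)))
      (sU (s.shift (symmetry t A s))) (sV t (s.shift (symmetry t A s)))) :=
    SmoothOn.sub_symbol (primitive_isSymbol hB).1 (fun q hq => hτ.holSmooth_sM hq ht)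
      (fun q hq => hτ.holSmooth_sU hq) (fun q hq => hτ.holSmooth_sV hq ht)
  exact (hasDerivAt_mres h hx 0).neg

/-- `mres_dε` evaluates the two second variations, `mres_fN_sub` turns their difference into the
average of `A ∂_λB`, and `mres_primitive_poisson` splits that average into the variation of `F`
along the Poisson bracket and the cocycle. -/
theorem commutator_F :
    - mres (dε (sub (primitive B) (fun p => p.1) (sM t (s.shift (symmetry t A s)))
      (sU (s.shift (symmetry t A s))) (sV t (s.shift (symmetry t A s))))) 0 x
    - - mres (dε (sub (primitive A) (fun p => p.1) (sM t (s.shift (symmetry t B s)))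
      (sU (s.shift (symmetry t B s))) (sV t (s.shift (symmetry t B s))))) 0 x
    = (symmetry t (poisson A B) s).F x + cocycle A B := by
  have h1 := mres_dε hΩ hs hp ht hB hC hx hA
  have h2 := mres_dε hΩ hs hp ht hA hC hx hB
  have h3 := mres_fN_sub (ε := 0) hs ht hA hB hx
  rw [mres_fA_mul_pd hs ht hA hB hx] at h3
  have h4 := mres_primitive_poisson hΩ hs hp ht hA hB hC hx
  have h5 : (symmetry t (poisson A B) s).F x = - mres (sA t (primitive (poisson A B)) s) 0 x := rfl
  rw [h1, h2, h5, ← h4]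
  linear_combination h3

end canonical

end F

/-! ### Series of smooth functions -/

section series

/-- A series of functions that are smooth on an open set, with summable bounds on the derivatives. -/
theorem contDiffOn_tsum_nat {E : Type} [NormedAddCommGroup E] [NormedSpace ℝ E] {S : Set E}
    (hS : IsOpen S) (m : ℕ) : ∀ {F : Type} [NormedAddCommGroup F] [NormedSpace ℝ F] [CompleteSpace F]
      {f : ℕ → E → F} {v : ℕ → ℕ → ℝ}, (∀ n, ContDiffOn ℝ ∞ (f n) S) → (∀ j, Summable (v j)) →
      (∀ j n, ∀ x ∈ S, ‖iteratedFDeriv ℝ j (f n) x‖ ≤ v j n) →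
      ContDiffOn ℝ m (fun x => ∑' n, f n x) S := by
  induction m with
  | zero =>
    intro F _ _ _ f v hf hv hb
    rw [Nat.cast_zero, contDiffOn_zero]
    exact continuousOn_tsum (fun n => (hf n).continuousOn) (hv 0) fun n x hx => by
      simpa using hb 0 n x hx
  | succ m ih =>
    intro F _ _ _ f v hf hv hb
    have hd : ∀ x ∈ S, HasFDerivAt (fun y => ∑' n, f n y) (∑' n, fderiv ℝ (f n) x) x := by
      intro x hx
      obtain ⟨r, hr, hb'⟩ := Metric.isOpen_iff.1 hS x hx
      refine hasFDerivAt_tsum_of_isPreconnected (hv 1) Metric.isOpen_ball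
        (convex_ball x r).isPreconnected (fun n y hy => ?_) (fun n y hy => ?_)
        (Metric.mem_ball_self hr) ?_ (Metric.mem_ball_self hr)
      · exact (((hf n).contDiffAt (hS.mem_nhds (hb' hy))).differentiableAt (by simp)).hasFDerivAt
      · rw [← norm_iteratedFDeriv_one]
        exact hb 1 n y (hb' hy)
      · exact Summable.of_norm_bounded (hv 0) fun n => by simpa using hb 0 n x hx
    rw [Nat.cast_succ, contDiffOn_succ_iff_fderiv_of_isOpen hS]
    refine ⟨fun x hx => (hd x hx).differentiableAt.differentiableWithinAt, fun h => by simp at h, ?_⟩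
    refine (ih (f := fun n => fderiv ℝ (f n)) (v := fun j => v (j + 1)) (fun n => ?_)
      (fun j => hv (j + 1)) fun j n x hx => ?_).congr fun x hx => (hd x hx).fderiv
    · exact (hf n).fderiv_of_isOpen hS (by simp)
    · rw [norm_iteratedFDeriv_fderiv]
      exact hb (j + 1) n x hx

theorem contDiffOn_tsum {E F : Type} [NormedAddCommGroup E] [NormedSpace ℝ E]
    [NormedAddCommGroup F] [NormedSpace ℝ F] [CompleteSpace F] {S : Set E}
    (hS : IsOpen S) {f : ℕ → E → F} {v : ℕ → ℕ → ℝ} (hf : ∀ n, ContDiffOn ℝ ∞ (f n) S)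
    (hv : ∀ j, Summable (v j)) (hb : ∀ j n, ∀ x ∈ S, ‖iteratedFDeriv ℝ j (f n) x‖ ≤ v j n) :
    ContDiffOn ℝ ∞ (fun x => ∑' n, f n x) S :=
  contDiffOn_infty.2 fun m => contDiffOn_tsum_nat hS m hf hv hb

theorem norm_iteratedFDeriv_comp_le {E E' F : Type} [NormedAddCommGroup E] [NormedSpace ℝ E]
    [NormedAddCommGroup E'] [NormedSpace ℝ E'] [NormedAddCommGroup F] [NormedSpace ℝ F]
    {g : E' →L[ℝ] E} (hg : ‖g‖ ≤ 1) {f : E → F} {s : Set E} (hs : IsOpen s)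
    (hf : ContDiffOn ℝ ∞ f s) {x : E'} (hx : g x ∈ s) (j : ℕ) :
    ‖iteratedFDeriv ℝ j (fun y => f (g y)) x‖ ≤ ‖iteratedFDeriv ℝ j f (g x)‖ := by
  have hs' : IsOpen (g ⁻¹' s) := hs.preimage g.continuous
  rw [← iteratedFDerivWithin_of_isOpen j hs hx,
    ← iteratedFDerivWithin_of_isOpen j hs' (show x ∈ g ⁻¹' s from hx),
    show (fun y => f (g y)) = f ∘ g from rfl,
    g.iteratedFDerivWithin_comp_right hf hs.uniqueDiffOn hs'.uniqueDiffOn hx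
      (by exact_mod_cast le_top)]
  refine (ContinuousMultilinearMap.norm_compContinuousLinearMap_le _ _).trans ?_
  exact mul_le_of_le_one_right (norm_nonneg _) (Finset.prod_le_one (fun _ _ => norm_nonneg _)
    fun _ _ => hg)

theorem norm_zpow_le {r : ℝ} (hr : 1 ≤ r) {k : ℂ} (hk : r ≤ ‖k‖) (n : ℕ) :
    ‖k ^ (-(n + 1 : ℤ))‖ ≤ ‖k‖⁻¹ * (r⁻¹) ^ n := by
  have h0 : 0 < ‖k‖ := by linarith
  rw [norm_zpow, show (-(n + 1 : ℤ)) = -((n + 1 : ℕ) : ℤ) by push_cast; ring, zpow_neg, zpow_natCast,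
    pow_succ', mul_inv, ← inv_pow]
  gcongr

/-- Cauchy's estimate on the unit disc about `k`, where the modulus stays at least `r`; the
factorial does not depend on `n`. -/
theorem norm_iteratedFDeriv_zpow_le {r : ℝ} (hr : 1 ≤ r) {k : ℂ} (hk : r + 1 < ‖k‖) (j n : ℕ) :
    ‖iteratedFDeriv ℝ j (fun z : ℂ => z ^ (-(n + 1 : ℤ))) k‖ ≤ j.factorial * (r⁻¹) ^ n := by
  have hz : ∀ z ∈ Metric.closedBall k 1, r ≤ ‖z‖ := by
    intro z hz
    have h1 : ‖k - z‖ ≤ 1 := by rwa [mem_closedBall_iff_norm'] at hz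
    have h2 := norm_sub_norm_le k z
    linarith
  have hd : ∀ z : ℂ, r ≤ ‖z‖ → DifferentiableAt ℂ (fun z : ℂ => z ^ (-(n + 1 : ℤ))) z := by
    intro z hz
    exact differentiableAt_zpow.2 (Or.inl (norm_pos_iff.1 (by linarith)))
  have hc : ContDiffAt ℂ j (fun z : ℂ => z ^ (-(n + 1 : ℤ))) k := by
    have h1 : DifferentiableOn ℂ (fun z : ℂ => z ^ (-(n + 1 : ℤ))) (Metric.ball k 1) := fun z h =>
      (hd z (hz z (Metric.ball_subset_closedBall h))).differentiableWithinAt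
    exact (contDiffOn_of_differentiableOn Metric.isOpen_ball h1).contDiffAt
      (Metric.ball_mem_nhds k one_pos) |>.of_le (by exact_mod_cast le_top)
  rw [← hc.restrictScalars_iteratedFDeriv, Function.comp_apply,
    ContinuousMultilinearMap.norm_restrictScalars, norm_iteratedFDeriv_eq_norm_iteratedDeriv]
  have h2 := Complex.norm_iteratedDeriv_le_of_forall_mem_sphere_norm_le (c := k) (R := 1)
    (C := (r⁻¹) ^ n) (f := fun z : ℂ => z ^ (-(n + 1 : ℤ))) j one_pos ?_ ?_
  · simpa using h2
  · refine DifferentiableOn.diffContOnCl fun z h => (hd z (hz z ?_)).differentiableWithinAt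
    rwa [closure_ball _ one_ne_zero] at h
  · intro z h
    have h3 := hz z (Metric.sphere_subset_closedBall h)
    refine (norm_zpow_le hr h3 n).trans (mul_le_of_le_one_left (by positivity) ?_)
    exact inv_le_one_of_one_le₀ (hr.trans h3)

end series

/-! ### Laurent series in one variable -/

section laurent

variable {c : ℕ → ℂ} {C r : ℝ}

theorem res_inv : res (fun k : ℂ => k⁻¹) = 1 := by
  rw [res_eq_circ one_pos fun z hz => differentiableAt_inv (norm_pos_iff.1 (by linarith))]
  have h := circleIntegral.integral_sub_inv_of_mem_ball (c := 0) (w := 0) (R := 1) (by simp)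
  simp only [sub_zero] at h
  rw [circ, h, inv_mul_cancel₀ Complex.two_pi_I_ne_zero]

variable (hr : 1 ≤ r) (hc : ∀ n, ‖c n‖ ≤ C * r ^ n)
include hr hc

theorem norm_term_le {k : ℂ} (hk : 2 * r ≤ ‖k‖) (n : ℕ) :
    ‖c n * k ^ (-(n + 1 : ℤ))‖ ≤ C * ‖k‖⁻¹ * (1 / 2) ^ n := by
  have hC : 0 ≤ C := by simpa using (norm_nonneg _).trans (hc 0)
  rw [norm_mul]
  refine (mul_le_mul (hc n) (norm_zpow_le (by linarith) hk n) (norm_nonneg _) (by positivity)).trans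
    (le_of_eq ?_)
  rw [mul_inv, mul_pow, one_div, inv_pow, inv_pow]
  have : r ^ n ≠ 0 := by positivity
  field_simp

theorem summable_term {k : ℂ} (hk : 2 * r ≤ ‖k‖) : Summable fun n : ℕ => c n * k ^ (-(n + 1 : ℤ)) :=
  Summable.of_norm_bounded (summable_geometric_two.mul_left _) (norm_term_le hr hc hk)

theorem norm_series_le {k : ℂ} (hk : 2 * r ≤ ‖k‖) :
    ‖∑' n : ℕ, c n * k ^ (-(n + 1 : ℤ))‖ ≤ C * ‖k‖⁻¹ * 2 := by
  have h := tsum_of_norm_bounded (summable_geometric_two.mul_left _).hasSum (norm_term_le hr hc hk)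
  rwa [tsum_mul_left, tsum_geometric_two] at h

theorem oInf_series : OInf 1 fun k : ℂ => ∑' n : ℕ, c n * k ^ (-(n + 1 : ℤ)) := by
  refine Asymptotics.IsBigO.of_bound (C * 2) ?_
  filter_upwards [tendsto_norm_cobounded_atTop.eventually (eventually_ge_atTop (2 * r))] with k hk
  refine (norm_series_le hr hc hk).trans (le_of_eq ?_)
  rw [pow_one, norm_inv]
  ring

theorem differentiableAt_series {k : ℂ} (hk : 2 * r < ‖k‖) :
    DifferentiableAt ℂ (fun k : ℂ => ∑' n : ℕ, c n * k ^ (-(n + 1 : ℤ))) k := by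
  have hC : 0 ≤ C := by simpa using (norm_nonneg _).trans (hc 0)
  have ho : IsOpen {k : ℂ | 2 * r < ‖k‖} := isOpen_lt continuous_const continuous_norm
  refine (Complex.differentiableOn_tsum_of_summable_norm (u := fun n : ℕ => C * (1 / 2) ^ n)
    (summable_geometric_two.mul_left _) (fun n z hz => ?_) ho fun n z hz => ?_).differentiableAt
    (ho.mem_nhds hk)
  · have : z ≠ 0 := norm_pos_iff.1 (by linarith [show 2 * r < ‖z‖ from hz])
    exact ((differentiableAt_zpow.2 (Or.inl this)).const_mul _).differentiableWithinAt
  · have hz' : 2 * r < ‖z‖ := hz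
    refine (norm_term_le hr hc hz'.le n).trans ?_
    gcongr
    exact mul_le_of_le_one_right hC (inv_le_one_of_one_le₀ (by linarith))

theorem holInf_series : HolInf fun k : ℂ => ∑' n : ℕ, c n * k ^ (-(n + 1 : ℤ)) := by
  filter_upwards [tendsto_norm_cobounded_atTop.eventually (eventually_gt_atTop (2 * r))] with k hk
  exact differentiableAt_series hr hc hk

theorem series_succ {k : ℂ} (hk : 2 * r ≤ ‖k‖) : ∑' n : ℕ, c n * k ^ (-(n + 1 : ℤ))
    = c 0 * k⁻¹ + k⁻¹ * ∑' n : ℕ, c (n + 1) * k ^ (-(n + 1 : ℤ)) := by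
  have h0 : k ≠ 0 := norm_pos_iff.1 (by linarith)
  rw [(summable_term hr hc hk).tsum_eq_zero_add, ← tsum_mul_left]
  congr 1
  · simp
  · refine tsum_congr fun n => ?_
    rw [show (-(((n + 1 : ℕ) : ℤ) + 1)) = -1 + -(n + 1 : ℤ) by push_cast; ring, zpow_add₀ h0, zpow_neg_one]
    ring

-- Peeling off the leading term shifts the coefficients by one and leaves a multiple of a
-- nonnegative power of `k`, whose residue is zero. The bound on the coefficients grows by a factor
-- `r` at each step, so it is quantified inside the induction.
omit hc in
theorem laurentCoeff_series (n : ℕ) : ∀ {c : ℕ → ℂ} {C : ℝ}, (∀ n, ‖c n‖ ≤ C * r ^ n) →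
    laurentCoeff (fun k : ℂ => ∑' n : ℕ, c n * k ^ (-(n + 1 : ℤ))) (-(n + 1 : ℤ)) = c n := by
  induction n with
  | zero =>
    intro c C hc
    have hc' : ∀ n, ‖c (n + 1)‖ ≤ C * r * r ^ n := fun n => (hc (n + 1)).trans_eq (by ring)
    have h1 := holInf_series hr hc'
    have hi : HolInf fun k : ℂ => k⁻¹ := by simpa using HolInf.zpow (-1)
    have h2 : OInf 2 fun k : ℂ => k⁻¹ * ∑' n : ℕ, c (n + 1) * k ^ (-(n + 1 : ℤ)) := by
      have h3 : OInf 1 fun k : ℂ => k⁻¹ := by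
        simpa [OInf] using Asymptotics.isBigO_refl (fun k : ℂ => k⁻¹) _
      exact h3.mul (oInf_series hr hc')
    have e : (fun k : ℂ => k ^ (-(-(((0 : ℕ) : ℤ) + 1)) - 1) * ∑' n : ℕ, c n * k ^ (-(n + 1 : ℤ)))
        =ᶠ[Bornology.cobounded ℂ] fun k => c 0 * k⁻¹
          + k⁻¹ * ∑' n : ℕ, c (n + 1) * k ^ (-(n + 1 : ℤ)) := by
      filter_upwards [tendsto_norm_cobounded_atTop.eventually (eventually_ge_atTop (2 * r))] with k hk
      rw [series_succ hr hc hk]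
      simp
    rw [laurentCoeff, res_congr e, res_add ((HolInf.const _).mul hi) (hi.mul h1),
      res_const_mul _ hi, res_inv, res_eq_zero_of_OInf (hi.mul h1) h2]
    ring
  | succ n ih =>
    intro c C hc
    have hc' : ∀ n, ‖c (n + 1)‖ ≤ C * r * r ^ n := fun n => (hc (n + 1)).trans_eq (by ring)
    have h1 := (HolInf.zpow (n : ℤ)).mul (holInf_series hr hc')
    have e : (fun k : ℂ => k ^ (-(-(((n + 1 : ℕ) : ℤ) + 1)) - 1) * ∑' n : ℕ, c n * k ^ (-(n + 1 : ℤ)))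
        =ᶠ[Bornology.cobounded ℂ] fun k => c 0 * k ^ n
          + k ^ (n : ℤ) * ∑' n : ℕ, c (n + 1) * k ^ (-(n + 1 : ℤ)) := by
      filter_upwards [tendsto_norm_cobounded_atTop.eventually (eventually_ge_atTop (2 * r))] with k hk
      have h0 : k ≠ 0 := norm_pos_iff.1 (by linarith)
      rw [series_succ hr hc hk, show (-(-(((n + 1 : ℕ) : ℤ) + 1)) - 1) = (n : ℤ) + 1 by push_cast; ring,
        zpow_add₀ h0, zpow_one, zpow_natCast]
      field_simp
    have hn : HolInf fun k : ℂ => k ^ n := by simpa using HolInf.zpow (n : ℤ)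
    rw [laurentCoeff, res_congr e, res_add ((HolInf.const _).mul hn) h1, res_const_mul _ hn,
      res_eq_zero_of_differentiable (differentiable_pow n), mul_zero, zero_add, ← ih hc', laurentCoeff]
    refine res_congr (Eventually.of_forall fun k => ?_)
    simp

end laurent

/-! ### Regular families -/

section regular

variable {Ω : Set ℝ} {z : ℕ → ℝ → ℝ → ℝ → ℂ}

/-- By the Leibniz rule a derivative of order `j` of the `n`-th term combines bounds `C i * r ^ n`
on the fields with `(j - i)! * (2 * r)⁻¹ ^ n` on the powers of `k`. For `|k| > 2 * r + 1` the series
of derivatives of every order is thus dominated by a geometric series of ratio `1 / 2`. -/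
theorem RegularFamily.niceGen (hΩ : IsOpen Ω) (hz : RegularFamily Ω z) : NiceGen Ω fun _ => z := by
  intro ε x₀ hx₀ a₀ b₀
  obtain ⟨hs, -, hb⟩ := hz
  obtain ⟨ρ, W, hW, hb⟩ := hb x₀ hx₀
  obtain ⟨V, hV, hVo, hxV⟩ := mem_nhds_iff.1 (Filter.inter_mem hW (hΩ.mem_nhds hx₀))
  set r := |ρ| + 1 with hr
  have hr1 : 1 ≤ r := by rw [hr]; linarith [abs_nonneg ρ]
  have hb' : ∀ j, ∃ C : ℝ, 0 ≤ C ∧ ∀ n, ∀ x ∈ V, ∀ a b : ℝ,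
      ‖iteratedFDeriv ℝ j (fun q : ℝ × ℝ × ℝ => z n q.1 q.2.1 q.2.2) (x, a, b)‖ ≤ C * r ^ n := by
    intro j
    obtain ⟨C, hC⟩ := hb j
    refine ⟨|C|, abs_nonneg C, fun n x hx a b => (hC n x (hV hx).1 a b).trans ?_⟩
    refine (le_abs_self _).trans ?_
    rw [abs_mul, abs_pow]
    gcongr
    rw [hr]
    linarith
  choose C hC0 hC using hb'
  have hc : ∀ x ∈ V, ∀ a b n, ‖z n x a b‖ ≤ C 0 * r ^ n := fun x hx a b n => by
    simpa using hC 0 n x hx a b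
  let O : Set (ℝ × ℝ × ℝ) := V ×ˢ univ
  have hO : IsOpen O := hVo.prod isOpen_univ
  have hzO : ∀ n, ContDiffOn ℝ ∞ (fun q : ℝ × ℝ × ℝ => z n q.1 q.2.1 q.2.2) O := fun n =>
    (hs n).mono (prod_mono (fun x hx => (hV hx).2) Subset.rfl)
  let T : Set ℂ := {k | 2 * r + 1 < ‖k‖}
  have hT : IsOpen T := isOpen_lt continuous_const continuous_norm
  have hT0 : ∀ k ∈ T, k ≠ 0 := fun k hk => norm_pos_iff.1 (by
    linarith [show 2 * r + 1 < ‖k‖ from hk])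
  let g₁ : ℂ × Par →L[ℝ] ℂ := ContinuousLinearMap.fst ℝ ℂ Par
  let g₂ : ℂ × Par →L[ℝ] ℝ × ℝ × ℝ :=
    (ContinuousLinearMap.snd ℝ ℝ (ℝ × ℝ × ℝ)).comp (ContinuousLinearMap.snd ℝ ℂ Par)
  have hg₁ : ‖g₁‖ ≤ 1 := ContinuousLinearMap.norm_fst_le ..
  have hg₂ : ‖g₂‖ ≤ 1 := by
    refine (ContinuousLinearMap.opNorm_comp_le _ _).trans ?_
    exact mul_le_one₀ (ContinuousLinearMap.norm_snd_le ..) (norm_nonneg _)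
      (ContinuousLinearMap.norm_snd_le ..)
  let S : Set (ℂ × Par) := g₁ ⁻¹' T ∩ g₂ ⁻¹' O
  have hS : IsOpen S := (hT.preimage g₁.continuous).inter (hO.preimage g₂.continuous)
  have hpow : ∀ n : ℕ, ContDiffOn ℝ ∞ (fun k : ℂ => k ^ (-(n + 1 : ℤ))) T := fun n =>
    (contDiffOn_of_differentiableOn hT fun k hk =>
      (differentiableAt_zpow.2 (Or.inl (hT0 k hk))).differentiableWithinAt).restrict_scalars ℝ
  have hf₁ : ∀ n : ℕ, ContDiffOn ℝ ∞ (fun p : ℂ × Par => (g₁ p) ^ (-(n + 1 : ℤ))) S := fun n =>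
    (hpow n).comp g₁.contDiff.contDiffOn fun p hp => hp.1
  have hf₂ : ∀ n : ℕ, ContDiffOn ℝ ∞ (fun p : ℂ × Par => z n (g₂ p).1 (g₂ p).2.1 (g₂ p).2.2) S :=
    fun n => (hzO n).comp g₂.contDiff.contDiffOn fun p hp => hp.2
  have hsmooth : ContDiffOn ℝ ∞ (gen fun _ => z) S := by
    refine contDiffOn_tsum hS (f := fun n p => z n (g₂ p).1 (g₂ p).2.1 (g₂ p).2.2
      * (g₁ p) ^ (-(n + 1 : ℤ))) (v := fun j n => (∑ i ∈ Finset.range (j + 1),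
        (j.choose i : ℝ) * C i * (j - i).factorial) * (1 / 2) ^ n)
      (fun n => (hf₂ n).mul (hf₁ n)) (fun j => summable_geometric_two.mul_left _) fun j n p hp => ?_
    rw [← iteratedFDerivWithin_of_isOpen j hS hp]
    refine (norm_iteratedFDerivWithin_mul_le (hf₂ n) (hf₁ n) hS.uniqueDiffOn hp
      (by exact_mod_cast le_top)).trans ?_
    rw [Finset.sum_mul]
    refine Finset.sum_le_sum fun i _ => ?_
    rw [iteratedFDerivWithin_of_isOpen i hS hp, iteratedFDerivWithin_of_isOpen (j - i) hS hp]
    have e1 := (norm_iteratedFDeriv_comp_le hg₂ hO (hzO n) hp.2 i).trans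
      (hC i n _ hp.2.1 (g₂ p).2.1 (g₂ p).2.2)
    have e2 := (norm_iteratedFDeriv_comp_le hg₁ hT (hpow n) hp.1 (j - i)).trans
      (norm_iteratedFDeriv_zpow_le (r := 2 * r) (by linarith) hp.1 (j - i) n)
    have e3 : (1 / 2 : ℝ) ^ n = r ^ n * ((2 * r)⁻¹) ^ n := by
      rw [← mul_pow]
      congr 1
      field_simp
    have hCi := hC0 i
    calc _ ≤ (j.choose i : ℝ) * (C i * r ^ n) * ((j - i).factorial * ((2 * r)⁻¹) ^ n) := by
          gcongr
      _ = _ := by rw [e3]; ring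
  have hxS : ∀ᶠ p : ℂ × Par in nearInf ((ε, x₀, a₀, b₀) : Par), p ∈ S := by
    filter_upwards [(tendsto_norm_cobounded_atTop.comp
      (tendsto_fst (f := Bornology.cobounded ℂ) (g := 𝓝 ((ε, x₀, a₀, b₀) : Par)))).eventually
      (eventually_gt_atTop (2 * r + 1)),
      tendsto_snd.eventually (eventually_mem_nearInf hVo (q := (ε, x₀, a₀, b₀)) hxV)] with p h1 h2
    exact ⟨h1, h2, trivial⟩
  refine ⟨?_, ?_, fun n => ?_⟩
  · filter_upwards [hxS] with p hpS
    refine ⟨hsmooth.contDiffAt (hS.mem_nhds hpS), ?_⟩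
    exact differentiableAt_series (c := fun n => z n p.2.2.1 p.2.2.2.1 p.2.2.2.2) hr1
      (hc p.2.2.1 hpS.2.1 p.2.2.2.1 p.2.2.2.2)
      (lt_trans (by linarith) (show 2 * r + 1 < ‖p.1‖ from hpS.1))
  · filter_upwards [eventually_mem_nearInf hVo (q := (ε, x₀, a₀, b₀)) hxV] with q hq
    exact (oInf_series (c := fun n => z n q.2.1 q.2.2.1 q.2.2.2) hr1
      (hc q.2.1 hq q.2.2.1 q.2.2.2)).tendsto
  · exact (laurentCoeff_series hr1 n (c := fun n => z n x₀ a₀ b₀) (hc x₀ hxV a₀ b₀)).symm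

theorem Regular.niceFam {s : State} (hΩ : IsOpen Ω) (hs : Regular Ω s) : NiceFam Ω fun _ => s :=
  ⟨hs.1.niceGen hΩ, hs.2.1.niceGen hΩ, hs.2.2.1.niceGen hΩ, hs.2.2.2.niceGen hΩ⟩

theorem Regular.perState {s : State} (hs : Regular Ω s) : PerState Ω s :=
  ⟨hs.1.2.1, hs.2.1.2.1, hs.2.2.1.2.1, hs.2.2.2.2.1⟩

end regular

/-! ### Iterated partial derivatives -/

/-- `f` is smooth at the points with `x` in `Ω`. -/
def ParSmooth (Ω : Set ℝ) (f : Par → ℂ) : Prop := ∀ q : Par, q.2.1 ∈ Ω → ContDiffAt ℝ ∞ f q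

/-- The partial derivative of order `(i, j, l)` in `(x, θ₁, θ₂)` with parameter `ε`. -/
def jp (i j l : ℕ) (f : Par → ℂ) : Par → ℂ := (pd vx.2)^[i] ((pd v₁.2)^[j] ((pd v₂.2)^[l] f))

section jets

variable {Ω : Set ℝ} {f g : Par → ℂ} {v w : Par} {q : Par}

theorem ParSmooth.iterate (hf : ParSmooth Ω f) (v : Par) (m : ℕ) : ParSmooth Ω ((pd v)^[m] f) := by
  induction m with
  | zero => exact hf
  | succ m ih =>
    rw [Function.iterate_succ_apply']
    exact fun q hq => contDiffAt_pd (ih q hq) v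

theorem ParSmooth.jp (hf : ParSmooth Ω f) (i j l : ℕ) : ParSmooth Ω (jp i j l f) :=
  ((hf.iterate _ l).iterate _ j).iterate _ i

variable (hΩ : IsOpen Ω)
include hΩ

theorem iterate_pd_congr (h : ∀ q : Par, q.2.1 ∈ Ω → f q = g q) (v : Par) (m : ℕ) :
    ∀ q : Par, q.2.1 ∈ Ω → (pd v)^[m] f q = (pd v)^[m] g q := by
  induction m with
  | zero => exact h
  | succ m ih =>
    intro q hq
    rw [Function.iterate_succ_apply', Function.iterate_succ_apply']
    exact pd_congr ((eventually_mem_nearInf hΩ hq).mono ih) v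

theorem iterate_pd_comm (hf : ParSmooth Ω f) (v w : Par) (m : ℕ) :
    ∀ q : Par, q.2.1 ∈ Ω → pd w ((pd v)^[m] f) q = (pd v)^[m] (pd w f) q := by
  induction m with
  | zero => exact fun _ _ => rfl
  | succ m ih =>
    intro q hq
    rw [Function.iterate_succ_apply', Function.iterate_succ_apply', pd_comm (hf.iterate v m q hq)]
    exact pd_congr ((eventually_mem_nearInf hΩ hq).mono ih) v

theorem iterate_pd_linear (hf : ParSmooth Ω f) (hg : ParSmooth Ω g) (r : ℂ) (v : Par) (m : ℕ) :
    ∀ q : Par, q.2.1 ∈ Ω → (pd v)^[m] (fun q => r * f q + g q) q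
      = r * (pd v)^[m] f q + (pd v)^[m] g q := by
  induction m with
  | zero => exact fun _ _ => rfl
  | succ m ih =>
    intro q hq
    simp only [Function.iterate_succ_apply']
    rw [pd_congr ((eventually_mem_nearInf hΩ hq).mono ih) v]
    have h1 := dAt (hf.iterate v m q hq)
    have h2 := dAt (hg.iterate v m q hq)
    rw [pd_add ((differentiableAt_const r).fun_mul h1) h2, pd_mul (differentiableAt_const r) h1, pd_const]
    ring

theorem pd_jp (hf : ParSmooth Ω f) (w : Par) (i j l : ℕ) (hq : q.2.1 ∈ Ω) :
    pd w (jp i j l f) q = jp i j l (pd w f) q := by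
  unfold jp
  rw [iterate_pd_comm hΩ ((hf.iterate _ l).iterate _ j) _ _ _ _ hq]
  refine iterate_pd_congr hΩ (fun q hq => ?_) _ _ _ hq
  rw [iterate_pd_comm hΩ (hf.iterate _ l) _ _ _ _ hq]
  exact iterate_pd_congr hΩ (iterate_pd_comm hΩ hf _ _ _) _ _ _ hq

theorem jp_linear (hf : ParSmooth Ω f) (hg : ParSmooth Ω g) (r : ℂ) (i j l : ℕ) (hq : q.2.1 ∈ Ω) :
    jp i j l (fun q => r * f q + g q) q = r * jp i j l f q + jp i j l g q := by
  have h1 := iterate_pd_linear hΩ hf hg r v₂.2 l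
  have h2 := iterate_pd_linear hΩ (hf.iterate v₂.2 l) (hg.iterate v₂.2 l) r v₁.2 j
  have h3 := iterate_pd_linear hΩ ((hf.iterate v₂.2 l).iterate v₁.2 j)
    ((hg.iterate v₂.2 l).iterate v₁.2 j) r vx.2 i
  unfold jp
  rw [← h3 q hq]
  refine iterate_pd_congr hΩ (fun q hq => ?_) _ _ _ hq
  rw [← h2 q hq]
  exact iterate_pd_congr hΩ h1 _ _ _ hq

omit hΩ in
theorem iteratedDeriv_curve (hf : ParSmooth Ω f) {T : Set ℝ} (hT : IsOpen T) {γ : ℝ → Par}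
    (hγ : ∀ s ∈ T, HasDerivAt γ v s ∧ (γ s).2.1 ∈ Ω) {φ : ℝ → ℂ} (hφ : ∀ s ∈ T, φ s = f (γ s)) (m : ℕ) :
    ∀ s ∈ T, iteratedDeriv m φ s = (pd v)^[m] f (γ s) := by
  induction m with
  | zero => exact fun s hs => by simpa using hφ s hs
  | succ m ih =>
    intro s hs
    have h1 : iteratedDeriv m φ =ᶠ[𝓝 s] fun s => (pd v)^[m] f (γ s) :=
      Filter.mem_of_superset (hT.mem_nhds hs) ih
    rw [iteratedDeriv_succ, h1.deriv_eq, Function.iterate_succ_apply']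
    exact ((dAt (hf.iterate v m (γ s) (hγ s hs).2)).hasFDerivAt.comp_hasDerivAt s (hγ s hs).1).deriv

theorem jet_eq_jp (hf : ParSmooth Ω f) (i j l : ℕ) (ε : ℝ) {x : ℝ} (hx : x ∈ Ω) (a b : ℝ) :
    jet i j l (fun x a b => f (ε, x, a, b)) x a b = jp i j l f (ε, x, a, b) := by
  refine iteratedDeriv_curve ((hf.iterate v₂.2 l).iterate v₁.2 j) hΩ
    (γ := fun s => (ε, s, a, b)) (fun s hs => ⟨?_, hs⟩) (fun s hs => ?_) i x hx
  · exact (hasDerivAt_const s ε).prodMk ((hasDerivAt_id s).prodMk ((hasDerivAt_const s a).prodMk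
      (hasDerivAt_const s b)))
  · refine iteratedDeriv_curve (hf.iterate v₂.2 l) isOpen_univ
      (γ := fun a => (ε, s, a, b)) (fun a _ => ⟨?_, hs⟩) (fun a _ => ?_) j a trivial
    · exact (hasDerivAt_const a ε).prodMk ((hasDerivAt_const a s).prodMk ((hasDerivAt_id a).prodMk
        (hasDerivAt_const a b)))
    · refine iteratedDeriv_curve hf isOpen_univ
        (γ := fun b => (ε, s, a, b)) (fun b _ => ⟨?_, hs⟩) (fun b _ => rfl) l b trivial
      exact (hasDerivAt_const b ε).prodMk ((hasDerivAt_const b s).prodMk ((hasDerivAt_const b a).prodMk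
        (hasDerivAt_id b)))

theorem jet_congr {z y : ℝ → ℝ → ℝ → ℂ} (h : ∀ x ∈ Ω, ∀ a b, z x a b = y x a b) (i j l : ℕ) {x : ℝ}
    (hx : x ∈ Ω) (a b : ℝ) : jet i j l z x a b = jet i j l y x a b := by
  refine Filter.EventuallyEq.iteratedDeriv_eq i ?_
  filter_upwards [hΩ.mem_nhds hx] with x' hx'
  simp only [h x' hx']

/-- The derivative in `ε` commutes with the partial derivatives in `(x, θ)` by joint smoothness, so
a variation of a jet is the jet of the variation. -/
theorem hasDerivAt_jet (hf : ParSmooth Ω f) (i j l : ℕ) {x : ℝ} (hx : x ∈ Ω) (a b : ℝ) :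
    HasDerivAt (fun ε => jet i j l (fun x a b => f (ε, x, a, b)) x a b)
      (jet i j l (fun x a b => pd vε.2 f (0, x, a, b)) x a b) 0 := by
  have h1 : ParSmooth Ω (pd vε.2 f) := fun q hq => contDiffAt_pd (hf q hq) _
  simp only [jet_eq_jp hΩ hf i j l _ hx a b]
  rw [jet_eq_jp hΩ h1 i j l 0 hx a b, ← pd_jp hΩ hf _ i j l (show ((0, x, a, b) : Par).2.1 ∈ Ω from hx)]
  exact (dAt (hf.jp i j l (0, x, a, b) hx)).hasFDerivAt.comp_hasDerivAt (f := fun ε : ℝ => (ε, x, a, b)) 0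
    ((hasDerivAt_id 0).prodMk (hasDerivAt_const 0 (x, a, b)))

end jets

/-! ### The coefficient fields -/

/-- One of the four families of coefficient fields. -/
def IsField (c : State → ℕ → ℝ → ℝ → ℝ → ℂ) : Prop :=
  c = State.g ∨ c = State.h ∨ c = State.u ∨ c = State.v

section fields

variable {Ω : Set ℝ} {t : ℕ → ℤ → ℂ} {σ : ℝ → State} {s Y : State} {A B : Symbol}
  {c : State → ℕ → ℝ → ℝ → ℝ → ℂ} {z : ℝ → ℕ → ℝ → ℝ → ℝ → ℂ}

theorem NiceGen.parSmooth (hΩ : IsOpen Ω) (hz : NiceGen Ω z) (n : ℕ) :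
    ParSmooth Ω (fun q => z q.1 n q.2.1 q.2.2.1 q.2.2.2) ∧ ∀ q : Par, q.2.1 ∈ Ω → ∀ v : Par,
      pd v (fun q : Par => z q.1 n q.2.1 q.2.2.1 q.2.2.2) q
        = laurentCoeff (fun k => pd (0, v) (gen z) (k, q)) (-(n + 1 : ℤ)) := by
  have key : ∀ q : Par, q.2.1 ∈ Ω → (fun q : Par => z q.1 n q.2.1 q.2.2.1 q.2.2.2) =ᶠ[𝓝 q] fun q =>
      res fun k => (fun p : ℂ × Par => p.1 ^ (-(-(n + 1 : ℤ)) - 1) * gen z p) (k, q) := fun q hq => by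
    filter_upwards [eventually_mem_nearInf hΩ hq] with q' hq'
    exact (hz q'.1 q'.2.1 hq' q'.2.2.1 q'.2.2.2).2.2 n
  have hs : ∀ q : Par, q.2.1 ∈ Ω →
      HolSmooth (fun p : ℂ × Par => p.1 ^ (-(-(n + 1 : ℤ)) - 1) * gen z p) q := fun q hq =>
    (HolSmooth.fst_zpow _).mul (hz q.1 q.2.1 hq q.2.2.1 q.2.2.2).1
  refine ⟨fun q hq => (hs q hq).contDiffAt_res.congr_of_eventuallyEq (key q hq), fun q hq v => ?_⟩
  rw [pd_congr (key q hq), (hs q hq).pd_res, laurentCoeff]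
  refine res_congr (Eventually.nearInf_self (P := fun p => pd (0, v) (fun p : ℂ × Par =>
    p.1 ^ (-(-(n + 1 : ℤ)) - 1) * gen z p) p = p.1 ^ (-(-(n + 1 : ℤ)) - 1) * pd (0, v) (gen z) p) ?_)
  filter_upwards [(hz q.1 q.2.1 hq q.2.2.1 q.2.2.2).1, HolSmooth.eventually_ne_zero q] with p h1 h2
  have h3 : DifferentiableAt ℂ (fun z : ℂ => z ^ (-(-(n + 1 : ℤ)) - 1)) p.1 :=
    differentiableAt_zpow.2 (Or.inl h2)
  have h4 : DifferentiableAt ℝ (fun p : ℂ × Par => p.1) p := differentiableAt_fst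
  have h5 : DifferentiableAt ℝ (fun p : ℂ × Par => p.1 ^ (-(-(n + 1 : ℤ)) - 1)) p :=
    (h3.restrictScalars ℝ).comp p h4
  rw [pd_mul h5 (dAt h1.1), pd_holomorphic_comp (F := fun z : ℂ => z ^ (-(-(n + 1 : ℤ)) - 1)) h3 h4,
    pd_fst, map_zero]
  ring

theorem NiceFam.field (hσ : NiceFam Ω σ) (hc : IsField c) : NiceGen Ω fun ε => c (σ ε) := by
  rcases hc with rfl | rfl | rfl | rfl
  exacts [hσ.g, hσ.h, hσ.u, hσ.v]

theorem IsField.shift (hc : IsField c) (s Y : State) (ε : ℝ) (n : ℕ) (x a b : ℝ) :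
    c (s.shift Y ε) n x a b = c s n x a b + ε * c Y n x a b := by
  rcases hc with rfl | rfl | rfl | rfl <;> rfl

theorem NiceFam.slice (hσ : NiceFam Ω σ) (ε : ℝ) : NiceFam Ω fun _ => σ ε :=
  ⟨hσ.g.slice ε, hσ.h.slice ε, hσ.u.slice ε, hσ.v.slice ε⟩

variable (hΩ : IsOpen Ω)
include hΩ

theorem hasDerivAt_jet_shift (hs : NiceFam Ω fun _ => s) (hY : NiceFam Ω fun _ => Y) (hc : IsField c)
    (n i j l : ℕ) {x : ℝ} (hx : x ∈ Ω) (a b : ℝ) :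
    HasDerivAt (fun ε => jet i j l (c (s.shift Y ε) n) x a b) (jet i j l (c Y n) x a b) 0 := by
  have h1 := (((hs.shift hΩ hY).field hc).parSmooth hΩ n).1
  refine (hasDerivAt_jet hΩ h1 i j l hx a b).congr_deriv (jet_congr hΩ (fun x hx a b => ?_) i j l hx a b)
  have h2 : HasDerivAt (fun ε : ℝ => c (s.shift Y ε) n x a b) _ 0 :=
    (dAt (h1 (0, x, a, b) hx)).hasFDerivAt.comp_hasDerivAt (f := fun ε : ℝ => (ε, x, a, b)) 0
    ((hasDerivAt_id 0).prodMk (hasDerivAt_const 0 (x, a, b)))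
  refine h2.unique ?_
  simp only [hc.shift]
  simpa using ((Complex.ofRealCLM.hasDerivAt (x := 0)).mul_const (c Y n x a b)).const_add (c s n x a b)

variable (hs : NiceFam Ω fun _ => s) (ht : EntireTimes t) (hA : IsSymbol A) (hB : IsSymbol B)
include hs ht hA hB

theorem commutator_field (hC : Canonical t Ω s) (hc : IsField c) {q : Par} (hq : q.2.1 ∈ Ω) :
    ∀ᶠ p in nearInf q, dε (gen (fun ε => c (symF t B (s.shift (symmetry t A s)) ε))) p
      - dε (gen (fun ε => c (symF t A (s.shift (symmetry t B s)) ε))) p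
      = gen (fun _ => c (symmetry t (poisson A B) s)) p := by
  rcases hc with rfl | rfl | rfl | rfl
  exacts [commutator_g hΩ hs ht hA hB hC hq, commutator_h hΩ hs ht hA hB hC hq,
    commutator_u hΩ hs ht hA hB hC hq, commutator_v hΩ hs ht hA hB hC hq]

omit hB in
theorem hasDerivAt_jet_symmetry (hB : IsSymbol B) (hc : IsField c) (n i j l : ℕ) {x : ℝ} (hx : x ∈ Ω)
    (a b : ℝ) : HasDerivAt (fun ε => jet i j l (c (symmetry t B (s.shift (symmetry t A s) ε)) n) x a b)
      (jet i j l (fun x a b => laurentCoeff (fun k => dε (gen (fun ε =>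
        c (symF t B (s.shift (symmetry t A s)) ε))) (k, 0, x, a, b)) (-(n + 1 : ℤ))) x a b) 0 := by
  have h := ((NiceFam.symF hΩ (niceFam_shift_symmetry hΩ hs ht hA) ht hB).field hc).parSmooth hΩ n
  refine (hasDerivAt_jet hΩ h.1 i j l hx a b).congr_deriv
    (jet_congr hΩ (fun x hx a b => ?_) i j l hx a b)
  exact h.2 (0, x, a, b) hx _

omit hs ht hA hB in
theorem jet_sub {f g : Par → ℂ} (hf : ParSmooth Ω f) (hg : ParSmooth Ω g) {y z w : ℝ → ℝ → ℝ → ℂ}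
    (hy : ∀ x ∈ Ω, ∀ a b, y x a b = f (0, x, a, b)) (hz : ∀ x ∈ Ω, ∀ a b, z x a b = g (0, x, a, b))
    (r : ℂ) (hw : ∀ x ∈ Ω, ∀ a b, w x a b = r * y x a b + z x a b) (i j l : ℕ) {x : ℝ} (hx : x ∈ Ω)
    (a b : ℝ) : jet i j l w x a b = r * jet i j l y x a b + jet i j l z x a b := by
  have hfg : ParSmooth Ω fun q => r * f q + g q := fun q hq =>
    (contDiffAt_const.mul (hf q hq)).add (hg q hq)
  rw [jet_congr hΩ hy i j l hx, jet_congr hΩ hz i j l hx, jet_congr hΩ (z := w)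
    (y := fun x a b => r * f (0, x, a, b) + g (0, x, a, b)) (fun x hx a b => by
      rw [hw x hx, hy x hx, hz x hx]) i j l hx, jet_eq_jp hΩ hf i j l 0 hx, jet_eq_jp hΩ hg i j l 0 hx,
    ← jp_linear hΩ hf hg r i j l (show ((0, x, a, b) : Par).2.1 ∈ Ω from hx)]
  exact jet_eq_jp hΩ hfg i j l 0 hx a b

theorem jet_commutator (hC : Canonical t Ω s) (hc : IsField c) (n i j l : ℕ) {x : ℝ} (hx : x ∈ Ω)
    (a b : ℝ) : jet i j l (fun x a b => laurentCoeff (fun k => dε (gen (fun ε =>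
        c (symF t B (s.shift (symmetry t A s)) ε))) (k, 0, x, a, b)) (-(n + 1 : ℤ))) x a b
      - jet i j l (fun x a b => laurentCoeff (fun k => dε (gen (fun ε =>
        c (symF t A (s.shift (symmetry t B s)) ε))) (k, 0, x, a, b)) (-(n + 1 : ℤ))) x a b
      = jet i j l (c (symmetry t (poisson A B) s) n) x a b := by
  have n1 := (NiceFam.symF hΩ (niceFam_shift_symmetry hΩ hs ht hA) ht hB).field hc
  have n2 := (NiceFam.symF hΩ (niceFam_shift_symmetry hΩ hs ht hB) ht hA).field hc
  have n3 := (niceFam_symmetry hΩ hs ht (hA.poisson hB)).field hc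
  have h2 := n2.parSmooth hΩ n
  have h3 := n3.parSmooth hΩ n
  have key : ∀ x ∈ Ω, ∀ a b, laurentCoeff (fun k => dε (gen (fun ε =>
        c (symF t B (s.shift (symmetry t A s)) ε))) (k, 0, x, a, b)) (-(n + 1 : ℤ))
      = 1 * laurentCoeff (fun k => dε (gen (fun ε =>
        c (symF t A (s.shift (symmetry t B s)) ε))) (k, 0, x, a, b)) (-(n + 1 : ℤ))
        + c (symmetry t (poisson A B) s) n x a b := by
    intro x hx a b
    have hq : ((0, x, a, b) : Par).2.1 ∈ Ω := hx
    have k2 := (n2 0 x hx a b).1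
    have k3 := n3 0 x hx a b
    have e2 : HolSmooth (dε (gen fun ε => c (symF t A (s.shift (symmetry t B s)) ε))) (0, x, a, b) :=
      HolSmooth.dε (q := (0, x, a, b)) k2
    have e3 : c (symmetry t (poisson A B) s) n x a b = laurentCoeff _ _ := k3.2.2 n
    rw [e3, one_mul, ← laurentCoeff_add e2.holInf k3.1.holInf]
    refine laurentCoeff_congr ?_ _
    filter_upwards [Eventually.nearInf_self (commutator_field hΩ hs ht hA hB hC hc hq)] with k hk
    rw [← hk]
    ring
  have h := jet_sub hΩ (y := fun x a b => laurentCoeff (fun k => dε (gen (fun ε =>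
      c (symF t A (s.shift (symmetry t B s)) ε))) (k, 0, x, a, b)) (-(n + 1 : ℤ)))
    (z := c (symmetry t (poisson A B) s) n) (fun q hq => contDiffAt_pd (h2.1 q hq) vε.2) h3.1
    (fun x hx a b => (h2.2 (0, x, a, b) hx vε.2).symm) (fun _ _ _ _ => rfl) 1 key i j l hx a b
  rw [h]
  ring

end fields

/-! ### Linearity in the symbol -/

section linear

variable {Ω : Set ℝ} {t : ℕ → ℤ → ℂ} {s : State} {A B : Symbol}
  {c : State → ℕ → ℝ → ℝ → ℝ → ℂ}
variable (hΩ : IsOpen Ω) (hs : NiceFam Ω fun _ => s) (ht : EntireTimes t) (hA : IsSymbol A)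
  (hB : IsSymbol B) (r : ℂ)

theorem IsSymbol.linear (hA : IsSymbol A) (hB : IsSymbol B) (r : ℂ) :
    IsSymbol (fun l m u v => r * A l m u v + B l m u v) := ((IsSymbol.const r).mul hA).add hB

include hs ht hA hB

theorem fN_linear {q : Par} (hq : q.2.1 ∈ Ω) :
    fN t (fun l m u v => r * A l m u v + B l m u v) (fun _ => s) =ᶠ[nearInf q] fun p =>
      r * fN t A (fun _ => s) p + fN t B (fun _ => s) p := by
  have h1 := hs.holSmooth_fA hq ht hA
  have h2 := hs.holSmooth_fA hq ht hB
  refine (hs.holSmooth_fN hq ht (hA.linear hB r)).eventuallyEq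
    (((HolSmooth.const r).mul h1.negU).add h2.negU) ?_
  filter_upwards [h1.param, h2.param] with q' h1 h2
  filter_upwards [neg₁_add ((HolInf.const r).mul h1.holInf) h2.holInf] with k hk
  rw [neg₁_const_mul _ h1.holInf] at hk
  exact hk

theorem pd_fN_linear {q : Par} (hq : q.2.1 ∈ Ω) : ∀ᶠ p in nearInf q, ∀ v,
    pd v (fN t (fun l m u v => r * A l m u v + B l m u v) (fun _ => s)) p
      = r * pd v (fN t A (fun _ => s)) p + pd v (fN t B (fun _ => s)) p := by
  filter_upwards [Eventually.nearInf_nhds (fN_linear hs ht hA hB r hq), hs.holSmooth_fN hq ht hA,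
    hs.holSmooth_fN hq ht hB] with p h1 h2 h3 v
  rw [pd_congr h1, pd_add ((differentiableAt_const r).fun_mul (dAt h2.1)) (dAt h3.1),
    pd_mul (differentiableAt_const r) (dAt h2.1), pd_const]
  ring

include hΩ

theorem gen_field_linear (hc : IsField c) {q : Par} (hq : q.2.1 ∈ Ω) :
    gen (fun _ => c (symmetry t (fun l m u v => r * A l m u v + B l m u v) s)) =ᶠ[nearInf q] fun p =>
      r * gen (fun _ => c (symmetry t A s)) p + gen (fun _ => c (symmetry t B s)) p := by
  have hAB := hA.linear hB r
  have hN := pd_fN_linear hs ht hA hB r hq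
  rcases hc with rfl | rfl | rfl | rfl
  · filter_upwards [hN, (symF_g hΩ hs ht hA).2 q hq, (symF_g hΩ hs ht hB).2 q hq,
      (symF_g hΩ hs ht hAB).2 q hq] with p h h1 h2 h3
    refine h3.trans ((congrArg₂ (fun y z => r * y + z) h1 h2).trans ?_).symm
    simp only [br, h]
    ring
  · refine hs.eventuallyEq_of_comp_fL hq ?_
    filter_upwards [hN, (symF_h hΩ hs ht hA).2 q hq, (symF_h hΩ hs ht hB).2 q hq,
      (symF_h hΩ hs ht hAB).2 q hq] with p h h1 h2 h3
    refine h3.trans ((congrArg₂ (fun y z => r * y + z) h1 h2).trans ?_).symm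
    simp only [act, h]
    ring
  · refine hs.eventuallyEq_of_comp_fL hq ?_
    filter_upwards [hN, (symF_u hΩ hs ht hA).2 q hq, (symF_u hΩ hs ht hB).2 q hq,
      (symF_u hΩ hs ht hAB).2 q hq] with p h h1 h2 h3
    refine h3.trans ((congrArg₂ (fun y z => r * y + z) h1 h2).trans ?_).symm
    simp only [act, h]
    ring
  · refine hs.eventuallyEq_of_comp_fL hq ?_
    filter_upwards [hN, (symF_v hΩ hs ht hA).2 q hq, (symF_v hΩ hs ht hB).2 q hq,
      (symF_v hΩ hs ht hAB).2 q hq] with p h h1 h2 h3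
    refine h3.trans ((congrArg₂ (fun y z => r * y + z) h1 h2).trans ?_).symm
    simp only [act, h]
    ring

theorem jet_linear (hc : IsField c) (n i j l : ℕ) {x : ℝ} (hx : x ∈ Ω) (a b : ℝ) :
    jet i j l (c (symmetry t (fun l m u v => r * A l m u v + B l m u v) s) n) x a b
      = r * jet i j l (c (symmetry t A s) n) x a b + jet i j l (c (symmetry t B s) n) x a b := by
  have n1 := (niceFam_symmetry hΩ hs ht hA).field hc
  have n2 := (niceFam_symmetry hΩ hs ht hB).field hc
  have n3 := (niceFam_symmetry hΩ hs ht (hA.linear hB r)).field hc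
  refine jet_sub hΩ (n1.parSmooth hΩ n).1 (n2.parSmooth hΩ n).1 (fun _ _ _ _ => rfl)
    (fun _ _ _ _ => rfl) r (fun x hx a b => ?_) i j l hx a b
  have k1 := n1 0 x hx a b
  have k2 := n2 0 x hx a b
  have e1 : c (symmetry t A s) n x a b = laurentCoeff _ _ := k1.2.2 n
  have e2 : c (symmetry t B s) n x a b = laurentCoeff _ _ := k2.2.2 n
  have e3 : c (symmetry t (fun l m u v => r * A l m u v + B l m u v) s) n x a b
    = laurentCoeff _ _ := (n3 0 x hx a b).2.2 n
  rw [e1, e2, e3, ← laurentCoeff_const_mul r k1.1.holInf,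
    ← laurentCoeff_add ((HolInf.const r).mul k1.1.holInf) k2.1.holInf]
  exact laurentCoeff_congr (Eventually.nearInf_self
    (gen_field_linear hΩ hs ht hA hB r hc (q := (0, x, a, b)) hx)) _

omit hΩ hs ht in
theorem primitive_linear : ∃ ρ : ℝ, ∀ l m u v : ℂ, ρ < ‖l‖ →
    primitive (fun l m u v => r * A l m u v + B l m u v) l m u v
      = r * primitive A l m u v + primitive B l m u v := by
  obtain ⟨ρ, -, h⟩ := hA.eventually
  obtain ⟨ρ', -, h'⟩ := hB.eventually
  refine ⟨max ρ ρ', fun l m u v hl => ?_⟩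
  have key : ∀ {A : Symbol} {ρ : ℝ}, (∀ p : ℂ × ℂ × ℂ × ℂ, ρ < ‖p.1‖ → DifferentiableAt ℂ (uncS A) p) →
      ρ < ‖l‖ → IntervalIntegrable (fun r : ℝ => A l (r * m) u v) volume 0 1 := by
    intro A ρ h hl
    refine Continuous.intervalIntegrable (continuous_iff_continuousAt.2 fun r => ?_) _ _
    exact ContinuousAt.comp (f := fun r : ℝ => ((l, r * m, u, v) : ℂ × ℂ × ℂ × ℂ)) (g := uncS A)
      (h (l, r * m, u, v) hl).continuousAt (Continuous.continuousAt (by fun_prop))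
  have i1 := key h ((le_max_left _ _).trans_lt hl)
  have i2 := key h' ((le_max_right _ _).trans_lt hl)
  unfold primitive
  rw [intervalIntegral.integral_add (i1.const_mul r) i2, intervalIntegral.integral_const_mul]
  ring

omit hΩ in
theorem symmetry_F_linear {x : ℝ} (hx : x ∈ Ω) :
    (symmetry t (fun l m u v => r * A l m u v + B l m u v) s).F x
      = r * (symmetry t A s).F x + (symmetry t B s).F x := by
  have h1 := smoothOn_sA hs ht (primitive_isSymbol hA).1
  have h2 := smoothOn_sA hs ht (primitive_isSymbol hB).1
  obtain ⟨ρ, hρ⟩ := primitive_linear hA hB r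
  have e : ∀ C, (symmetry t C s).F x = - mres (sA t (primitive C) s) 0 x := fun C => rfl
  rw [e, e, e, mul_neg, ← neg_add, ← mres_const_mul r h1 hx, ← mres_add ((smoothOn_const r).mul h1) h2 hx]
  congr 1
  refine mres_congr fun a b => ?_
  filter_upwards [(tendsto_norm_cobounded_atTop.comp
      (tendsto_fst (f := Bornology.cobounded ℂ) (g := 𝓝 ((0, x, a, b) : Par)))).eventually
      (eventually_gt_atTop ρ)] with p hp
  exact hρ _ _ _ _ hp

end linear

/-! ### Derivations of the ring of functions of the state -/

/-- The direction of `F`. -/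
def unitF : State where
  g _ _ _ _ := 0
  h _ _ _ _ := 0
  u _ _ _ _ := 0
  v _ _ _ _ := 0
  F _ := 1

/-- No component of the vector field involves `F`. This is why the extension by the direction of `F`
is central. -/
theorem symmetry_shift_unitF (t : ℕ → ℤ → ℂ) (A : Symbol) (s : State) (ε : ℝ) :
    symmetry t A (s.shift unitF ε) = symmetry t A s := by
  have h : s.shift unitF ε = { s with F := fun x => s.F x + ε * 1 } := by
    simp [State.shift, unitF]
  rw [h]
  rfl

theorem niceFam_unitF {Ω : Set ℝ} (hΩ : IsOpen Ω) : NiceFam Ω fun _ => unitF := by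
  have h : NiceGen Ω fun _ _ _ _ _ => 0 := by
    refine NiceGen.of_laurentCoeff hΩ (G := fun _ => 0) (fun q _ => HolSmooth.const 0)
      (fun q _ => ?_) (fun ε x _ a b n => ?_)
    · exact Eventually.of_forall fun _ => tendsto_const_nhds
    · simp [laurentCoeff, res, circleIntegral, tendsto_const_nhds.limUnder_eq]
  exact ⟨h, h, h, h⟩

/-- The symmetries and the direction of `F`. -/
def symmetryFields (t : ℕ → ℤ → ℂ) : Set (State → State) :=
  {X | (∃ A, IsSymbol A ∧ X = symmetry t A) ∨ X = fun _ => unitF}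

/-- Differentiability, to the extent that is needed to form the commutators of the symmetries. -/
structure Tame (Ω : Set ℝ) (t : ℕ → ℤ → ℂ) (Φ : State → ℂ) : Prop where
  diff : ∀ s Y : State, NiceFam Ω (fun _ => s) → NiceFam Ω (fun _ => Y) →
    DifferentiableAt ℝ (fun ε : ℝ => Φ (s.shift Y ε)) 0
  diff_along : ∀ X ∈ symmetryFields t, ∀ Y ∈ symmetryFields t, ∀ s : State, NiceFam Ω (fun _ => s) →
    DifferentiableAt ℝ (fun ε : ℝ => along Y Φ (s.shift (X s) ε)) 0

/-- The rules of a derivation at the state `s`. -/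
structure DerAt (Ω : Set ℝ) (t : ℕ → ℤ → ℂ) (s : State) (D : (State → ℂ) → ℂ) : Prop where
  const : ∀ c : ℂ, D (fun _ => c) = 0
  add : ∀ Φ Ψ : State → ℂ, Tame Ω t Φ → Tame Ω t Ψ → D (Φ + Ψ) = D Φ + D Ψ
  mul : ∀ Φ Ψ : State → ℂ, Tame Ω t Φ → Tame Ω t Ψ → D (Φ * Ψ) = D Φ * Ψ s + Φ s * D Ψ

section tame

variable {Ω : Set ℝ} {t : ℕ → ℤ → ℂ} {s Y : State} {A B : Symbol} {Φ Ψ : State → ℂ}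
  {X Z : State → State} {D E : (State → ℂ) → ℂ}

theorem along_const (X : State → State) (r : ℂ) : along X (fun _ => r) = fun _ => 0 :=
  funext fun _ => deriv_const _ _

theorem Tame.along_add (hΦ : Tame Ω t Φ) (hΨ : Tame Ω t Ψ) (hs : NiceFam Ω fun _ => s)
    (hX : NiceFam Ω fun _ => X s) : along X (Φ + Ψ) s = along X Φ s + along X Ψ s :=
  deriv_fun_add (hΦ.diff s _ hs hX) (hΨ.diff s _ hs hX)

theorem Tame.along_mul (hΦ : Tame Ω t Φ) (hΨ : Tame Ω t Ψ) (hs : NiceFam Ω fun _ => s)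
    (hX : NiceFam Ω fun _ => X s) :
    along X (Φ * Ψ) s = along X Φ s * Ψ s + Φ s * along X Ψ s := by
  refine (deriv_fun_mul (hΦ.diff s _ hs hX) (hΨ.diff s _ hs hX)).trans ?_
  rw [State.shift_zero]
  rfl

theorem DerAt.zero : DerAt Ω t s fun _ => 0 :=
  ⟨fun _ => rfl, fun _ _ _ _ => (add_zero 0).symm, fun _ _ _ _ => by simp⟩

theorem DerAt.linear (hD : DerAt Ω t s D) (hE : DerAt Ω t s E) (r : ℂ) :
    DerAt Ω t s fun Φ => r * D Φ + E Φ where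
  const c := by rw [hD.const, hE.const, mul_zero, add_zero]
  add Φ Ψ hΦ hΨ := by rw [hD.add Φ Ψ hΦ hΨ, hE.add Φ Ψ hΦ hΨ]; ring
  mul Φ Ψ hΦ hΨ := by rw [hD.mul Φ Ψ hΦ hΨ, hE.mul Φ Ψ hΦ hΨ]; ring

theorem DerAt.along (hs : NiceFam Ω fun _ => s) (hX : NiceFam Ω fun _ => X s) :
    DerAt Ω t s fun Φ => along X Φ s where
  const c := congrFun (along_const X c) s
  add _ _ hΦ hΨ := hΦ.along_add hΨ hs hX
  mul _ _ hΦ hΨ := hΦ.along_mul hΨ hs hX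

theorem nice_of_mem (hΩ : IsOpen Ω) (ht : EntireTimes t) (hX : X ∈ symmetryFields t)
    (hs : NiceFam Ω fun _ => s) : NiceFam Ω fun _ => X s := by
  rcases hX with ⟨A, hA, rfl⟩ | rfl
  exacts [niceFam_symmetry hΩ hs ht hA, niceFam_unitF hΩ]

variable (hΩ : IsOpen Ω) (ht : EntireTimes t)
include hΩ ht

theorem along_along_add (hΦ : Tame Ω t Φ) (hΨ : Tame Ω t Ψ) (hX : X ∈ symmetryFields t)
    (hZ : Z ∈ symmetryFields t) (hs : NiceFam Ω fun _ => s) :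
    HasDerivAt (fun ε : ℝ => along Z (Φ + Ψ) (s.shift (X s) ε))
      (along X (along Z Φ) s + along X (along Z Ψ) s) 0 := by
  have h1 := (hΦ.diff_along X hX Z hZ s hs).hasDerivAt.add (hΨ.diff_along X hX Z hZ s hs).hasDerivAt
  refine h1.congr_of_eventuallyEq (Eventually.of_forall fun ε => ?_)
  have h2 := (hs.shift hΩ (nice_of_mem hΩ ht hX hs)).slice ε
  exact hΦ.along_add hΨ h2 (nice_of_mem hΩ ht hZ h2)

theorem along_along_mul (hΦ : Tame Ω t Φ) (hΨ : Tame Ω t Ψ) (hX : X ∈ symmetryFields t)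
    (hZ : Z ∈ symmetryFields t) (hs : NiceFam Ω fun _ => s) :
    HasDerivAt (fun ε : ℝ => along Z (Φ * Ψ) (s.shift (X s) ε))
      (along X (along Z Φ) s * Ψ s + along Z Φ s * along X Ψ s
        + (along X Φ s * along Z Ψ s + Φ s * along X (along Z Ψ) s)) 0 := by
  have hXs := nice_of_mem hΩ ht hX hs
  have h1 := ((hΦ.diff_along X hX Z hZ s hs).hasDerivAt.mul (hΨ.diff s _ hs hXs).hasDerivAt).add
    ((hΦ.diff s _ hs hXs).hasDerivAt.mul (hΨ.diff_along X hX Z hZ s hs).hasDerivAt)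
  rw [State.shift_zero] at h1
  refine h1.congr_of_eventuallyEq (Eventually.of_forall fun ε => ?_)
  have h2 := (hs.shift hΩ hXs).slice ε
  exact hΦ.along_mul hΨ h2 (nice_of_mem hΩ ht hZ h2)

/-- The mixed products of first derivatives are the same in both orders and cancel, so the
commutator again satisfies the Leibniz rule; tameness supplies the second derivatives. -/
theorem DerAt.commutator (hX : X ∈ symmetryFields t) (hZ : Z ∈ symmetryFields t)
    (hs : NiceFam Ω fun _ => s) :
    DerAt Ω t s fun Φ => Toroidal.along X (Toroidal.along Z Φ) s
      - Toroidal.along Z (Toroidal.along X Φ) s where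
  const c := by
    rw [along_const, along_const, along_const, along_const, sub_zero]
  add Φ Ψ hΦ hΨ := by
    have h1 : Toroidal.along X (Toroidal.along Z (Φ + Ψ)) s = _ :=
      (along_along_add hΩ ht hΦ hΨ hX hZ hs).deriv
    have h2 : Toroidal.along Z (Toroidal.along X (Φ + Ψ)) s = _ :=
      (along_along_add hΩ ht hΦ hΨ hZ hX hs).deriv
    rw [h1, h2]
    ring
  mul Φ Ψ hΦ hΨ := by
    have h1 : Toroidal.along X (Toroidal.along Z (Φ * Ψ)) s = _ :=
      (along_along_mul hΩ ht hΦ hΨ hX hZ hs).deriv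
    have h2 : Toroidal.along Z (Toroidal.along X (Φ * Ψ)) s = _ :=
      (along_along_mul hΩ ht hΦ hΨ hZ hX hs).deriv
    rw [h1, h2]
    ring

omit ht in
theorem jet_unitF {c : State → ℕ → ℝ → ℝ → ℝ → ℂ} (hs : NiceFam Ω fun _ => s)
    (hc : IsField c) (n i j l : ℕ) {x : ℝ} (hx : x ∈ Ω) (a b : ℝ) :
    jet i j l (c unitF n) x a b = 0 := by
  refine (hasDerivAt_jet_shift hΩ hs (niceFam_unitF hΩ) hc n i j l hx a b).unique ?_
  refine (hasDerivAt_const 0 (jet i j l (c s n) x a b)).congr_of_eventuallyEq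
    (Eventually.of_forall fun ε => ?_)
  have h : c (s.shift unitF ε) = c s := by
    rcases hc with rfl | rfl | rfl | rfl <;> simp [State.shift, unitF]
  simp only [h]

omit ht in
theorem along_jet {c : State → ℕ → ℝ → ℝ → ℝ → ℂ} (hs : NiceFam Ω fun _ => s)
    (hX : NiceFam Ω fun _ => X s) (hc : IsField c) (n i j l : ℕ) {x : ℝ} (hx : x ∈ Ω) (a b : ℝ) :
    along X (fun s => jet i j l (c s n) x a b) s = jet i j l (c (X s) n) x a b :=
  (hasDerivAt_jet_shift hΩ hs hX hc n i j l hx a b).deriv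

omit hΩ ht in
theorem hasDerivAt_F (s Y : State) (x : ℝ) :
    HasDerivAt (fun ε : ℝ => (s.shift Y ε).F x) (Y.F x) 0 := by
  simpa [State.shift] using
    ((Complex.ofRealCLM.hasDerivAt (x := 0)).mul_const (Y.F x)).const_add (s.F x)

omit hΩ ht in
theorem along_F (X : State → State) (s : State) (x : ℝ) :
    along X (fun s => s.F x) s = (X s).F x := (hasDerivAt_F s (X s) x).deriv

theorem tame_jet {c : State → ℕ → ℝ → ℝ → ℝ → ℂ} (hc : IsField c) (n i j l : ℕ) {x : ℝ}
    (hx : x ∈ Ω) (a b : ℝ) : Tame Ω t fun s => jet i j l (c s n) x a b where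
  diff s Y hs hY := (hasDerivAt_jet_shift hΩ hs hY hc n i j l hx a b).differentiableAt
  diff_along X hX Z hZ s hs := by
    have h : ∀ ε : ℝ, along Z (fun s => jet i j l (c s n) x a b) (s.shift (X s) ε)
        = jet i j l (c (Z (s.shift (X s) ε)) n) x a b := fun ε => by
      have h2 := (hs.shift hΩ (nice_of_mem hΩ ht hX hs)).slice ε
      exact along_jet hΩ h2 (nice_of_mem hΩ ht hZ h2) hc n i j l hx a b
    simp only [h]
    rcases hZ with ⟨B, hB, rfl⟩ | rfl
    · rcases hX with ⟨A, hA, rfl⟩ | rfl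
      · exact (hasDerivAt_jet_symmetry hΩ hs ht hA hB hc n i j l hx a b).differentiableAt
      · simp only [symmetry_shift_unitF]
        exact differentiableAt_const _
    · exact differentiableAt_const _

theorem tame_F {x : ℝ} (hx : x ∈ Ω) : Tame Ω t fun s => s.F x where
  diff s Y _ _ := (hasDerivAt_F s Y x).differentiableAt
  diff_along X hX Z hZ s hs := by
    simp only [along_F]
    rcases hZ with ⟨B, hB, rfl⟩ | rfl
    · rcases hX with ⟨A, hA, rfl⟩ | rfl
      · exact (hasDerivAt_symmetry_F hΩ hs ht hA hB hx).differentiableAt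
      · simp only [symmetry_shift_unitF]
        exact differentiableAt_const _
    · exact differentiableAt_const _

omit hΩ ht in
theorem generators_induction {P : (State → ℂ) → Prop}
    (jet : ∀ c, IsField c → ∀ n i j l : ℕ, ∀ x ∈ Ω, ∀ a b, P fun s => jet i j l (c s n) x a b)
    (F : ∀ x ∈ Ω, P fun s => s.F x) : ∀ Φ ∈ generators Ω, P Φ := by
  rintro Φ (⟨x, hx, a, b, n, i, j, l, rfl | rfl | rfl | rfl⟩ | ⟨x, hx, rfl⟩)
  exacts [jet _ (Or.inl rfl) n i j l x hx a b, jet _ (Or.inr (Or.inl rfl)) n i j l x hx a b,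
    jet _ (Or.inr (Or.inr (Or.inl rfl))) n i j l x hx a b,
    jet _ (Or.inr (Or.inr (Or.inr rfl))) n i j l x hx a b, F x hx]

/-- Differentiability is not available for arbitrary functions of the state; it is known for the
generators and carried along sums and products by the formulas for the second derivatives. -/
theorem tame_of_mem_ringRF (hΦ : Φ ∈ ringRF Ω) : Tame Ω t Φ := by
  induction hΦ using Algebra.adjoin_induction with
  | mem Φ hΦ =>
    exact generators_induction (fun c hc n i j l x hx a b => tame_jet hΩ ht hc n i j l hx a b)
      (fun x hx => tame_F hΩ ht hx) Φ hΦ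
  | algebraMap r =>
    refine ⟨fun _ _ _ _ => differentiableAt_const r, fun X _ Z _ s _ => ?_⟩
    have h : along Z (algebraMap ℂ (State → ℂ) r) = fun _ => 0 := along_const Z r
    rw [h]
    exact differentiableAt_const _
  | add Φ Ψ _ _ hΦ hΨ =>
    exact ⟨fun s Y hs hY => (hΦ.diff s Y hs hY).add (hΨ.diff s Y hs hY), fun X hX Z hZ s hs =>
      (along_along_add hΩ ht hΦ hΨ hX hZ hs).differentiableAt⟩
  | mul Φ Ψ _ _ hΦ hΨ =>
    exact ⟨fun s Y hs hY => (hΦ.diff s Y hs hY).mul (hΨ.diff s Y hs hY), fun X hX Z hZ s hs =>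
      (along_along_mul hΩ ht hΦ hΨ hX hZ hs).differentiableAt⟩

/-- Derivations that agree on the generators agree on the ring. -/
theorem DerAt.eq_on_ringRF (hD : DerAt Ω t s D) (hE : DerAt Ω t s E)
    (h : ∀ Φ ∈ generators Ω, D Φ = E Φ) (hΦ : Φ ∈ ringRF Ω) : D Φ = E Φ := by
  induction hΦ using Algebra.adjoin_induction with
  | mem Φ hΦ => exact h Φ hΦ
  | algebraMap r => exact (hD.const r).trans (hE.const r).symm
  | add Φ Ψ h1 h2 hΦ hΨ =>
    have t1 := tame_of_mem_ringRF hΩ ht h1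
    have t2 := tame_of_mem_ringRF hΩ ht h2
    rw [hD.add Φ Ψ t1 t2, hE.add Φ Ψ t1 t2, hΦ, hΨ]
  | mul Φ Ψ h1 h2 hΦ hΨ =>
    have t1 := tame_of_mem_ringRF hΩ ht h1
    have t2 := tame_of_mem_ringRF hΩ ht h2
    rw [hD.mul Φ Ψ t1 t2, hE.mul Φ Ψ t1 t2, hΦ, hΨ]

variable (hs : NiceFam Ω fun _ => s) (hA : IsSymbol A)
include hs hA

/-- Every state on the segment still has smooth generating series, so the inner derivative of a jet
is the jet of the vector field there and only one derivative in `ε` remains. -/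
theorem along_along_jet (hX : X ∈ symmetryFields t) (hB : IsSymbol B)
    {c : State → ℕ → ℝ → ℝ → ℝ → ℂ} (hc : IsField c) (n i j l : ℕ) {x : ℝ} (hx : x ∈ Ω)
    (a b : ℝ) : along X (along (symmetry t B) fun s => jet i j l (c s n) x a b) s
      = deriv (fun ε : ℝ => jet i j l (c (symmetry t B (s.shift (X s) ε)) n) x a b) 0 := by
  refine congrArg (fun f : ℝ → ℂ => deriv f 0) (funext fun ε => ?_)
  have h2 := (hs.shift hΩ (nice_of_mem hΩ ht hX hs)).slice ε
  exact along_jet hΩ h2 (niceFam_symmetry hΩ h2 ht hB) hc n i j l hx a b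

/-- Both sides are derivations at `s`, so the generators decide. On jets of the fields the direction
of `F` contributes nothing and `jet_commutator` applies; on `F` the anomaly of `commutator_F`
appears. -/
theorem delta_commutator (hp : PerState Ω s) (hB : IsSymbol B) (hC : Canonical t Ω s)
    (hΦ : Φ ∈ ringRF Ω) : delta t A (delta t B Φ) s - delta t B (delta t A Φ) s
      = delta t (poisson A B) Φ s + cocycle A B * partialF Φ s := by
  have mA : symmetry t A ∈ symmetryFields t := Or.inl ⟨A, hA, rfl⟩
  have mB : symmetry t B ∈ symmetryFields t := Or.inl ⟨B, hB, rfl⟩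
  have nP := niceFam_symmetry hΩ hs ht (hA.poisson hB)
  have h2 : DerAt Ω t s fun Φ => cocycle A B * along (fun _ => unitF) Φ s
      + along (symmetry t (poisson A B)) Φ s :=
    (DerAt.along hs (niceFam_unitF hΩ)).linear (DerAt.along hs nP) _
  refine ((DerAt.commutator hΩ ht mA mB hs).eq_on_ringRF hΩ ht h2
    (generators_induction ?_ ?_) hΦ).trans (add_comm _ _)
  · intro c hc n i j l x hx a b
    rw [along_along_jet hΩ ht hs hA mA hB hc n i j l hx,
      along_along_jet hΩ ht hs hA mB hA hc n i j l hx, along_jet hΩ hs (niceFam_unitF hΩ) hc n i j l hx,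
      along_jet hΩ hs nP hc n i j l hx, jet_unitF hΩ hs hc n i j l hx, mul_zero, zero_add,
      ← jet_commutator hΩ hs ht hA hB hC hc n i j l hx a b,
      (hasDerivAt_jet_symmetry hΩ hs ht hA hB hc n i j l hx a b).deriv,
      (hasDerivAt_jet_symmetry hΩ hs ht hB hA hc n i j l hx a b).deriv]
  · intro x hx
    have e : ∀ X : State → State, along X (fun s => s.F x) = fun s => (X s).F x := fun X =>
      funext fun s => along_F X s x
    simp only [e]
    have h := commutator_F hΩ hs hp ht hA hB hC hx
    rw [← (hasDerivAt_symmetry_F hΩ hs ht hA hB hx).deriv,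
      ← (hasDerivAt_symmetry_F hΩ hs ht hB hA hx).deriv] at h
    refine h.trans ?_
    simp [unitF, add_comm]

theorem delta_partialF (hΦ : Φ ∈ ringRF Ω) :
    delta t A (partialF Φ) s = partialF (delta t A Φ) s := by
  have mA : symmetry t A ∈ symmetryFields t := Or.inl ⟨A, hA, rfl⟩
  have mF : (fun _ => unitF) ∈ symmetryFields t := Or.inr rfl
  refine sub_eq_zero.1 ((DerAt.commutator hΩ ht mA mF hs).eq_on_ringRF hΩ ht DerAt.zero
    (generators_induction ?_ ?_) hΦ)
  · intro c hc n i j l x hx a b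
    rw [along_along_jet hΩ ht hs hA mF hA hc n i j l hx]
    simp only [symmetry_shift_unitF, deriv_const, sub_zero]
    refine ((hasDerivAt_const (0 : ℝ) (0 : ℂ)).congr_of_eventuallyEq
      (Eventually.of_forall fun ε => ?_)).deriv
    have h2 := (hs.shift hΩ (niceFam_symmetry hΩ hs ht hA)).slice ε
    exact (along_jet hΩ h2 (niceFam_unitF hΩ) hc n i j l hx a b).trans
      (jet_unitF hΩ h2 hc n i j l hx a b)
  · intro x hx
    have e : ∀ X : State → State, along X (fun s => s.F x) = fun s => (X s).F x := fun X =>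
      funext fun s => along_F X s x
    simp only [e]
    simp [along, symmetry_shift_unitF]

theorem delta_linear (hB : IsSymbol B) (r : ℂ) (hΦ : Φ ∈ ringRF Ω) :
    delta t (fun l m u v => r * A l m u v + B l m u v) Φ s = r * delta t A Φ s + delta t B Φ s := by
  have nA := niceFam_symmetry hΩ hs ht hA
  have nB := niceFam_symmetry hΩ hs ht hB
  have nL := niceFam_symmetry hΩ hs ht (hA.linear hB r)
  refine (DerAt.along hs nL).eq_on_ringRF hΩ ht ((DerAt.along hs nA).linear (DerAt.along hs nB) r)
    (generators_induction ?_ ?_) hΦ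
  · intro c hc n i j l x hx a b
    rw [along_jet hΩ hs nL hc n i j l hx, along_jet hΩ hs nA hc n i j l hx,
      along_jet hΩ hs nB hc n i j l hx]
    exact jet_linear hΩ hs ht hA hB r hc n i j l hx a b
  · intro x hx
    simp only [along_F]
    exact symmetry_F_linear hs ht hA hB r hx

end tame

end

end Toroidal

theorem mainTheorem1 (t : ℕ → ℤ → ℂ) (ht : EntireTimes t) (Ω : Set ℝ) (hΩ : IsOpen Ω) :
    -- the vector field of a symbol induces the prescribed variations of the four series
    (∀ A : Symbol, IsSymbol A → ∀ s : State, Regular Ω s →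
      ∀ x ∈ Ω, ∀ a b : ℝ, ∀ᶠ k in Bornology.cobounded ℂ,
        HasDerivAt (fun ε : ℝ => laxL (s.shift (symmetry t A s) ε) k x a b)
          (bracket (negPart (subst t A s)) (laxL s) k x a b) 0 ∧
        HasDerivAt (fun ε : ℝ => laxM t (s.shift (symmetry t A s) ε) k x a b)
          (bracket (negPart (subst t A s)) (laxM t s) k x a b) 0 ∧
        HasDerivAt (fun ε : ℝ => laxU (s.shift (symmetry t A s) ε) k x a b)
          (bracket (negPart (subst t A s)) (laxU s) k x a b) 0 ∧
        HasDerivAt (fun ε : ℝ => laxV t (s.shift (symmetry t A s) ε) k x a b)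
          (bracket (negPart (subst t A s)) (laxV t s) k x a b) 0) ∧
    -- it is tangent to the canonical relations
    (∀ A : Symbol, IsSymbol A → ∀ s : State, Regular Ω s → Canonical t Ω s →
      ∀ x ∈ Ω, ∀ a b : ℝ, ∀ᶠ k in Bornology.cobounded ℂ,
        HasDerivAt (fun ε : ℝ => bracket (laxL (s.shift (symmetry t A s) ε))
          (laxM t (s.shift (symmetry t A s) ε)) k x a b) 0 0 ∧
        HasDerivAt (fun ε : ℝ => bracket (laxU (s.shift (symmetry t A s) ε))
          (laxV t (s.shift (symmetry t A s) ε)) k x a b) 0 0 ∧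
        HasDerivAt (fun ε : ℝ => bracket (laxL (s.shift (symmetry t A s) ε))
          (laxU (s.shift (symmetry t A s) ε)) k x a b) 0 0 ∧
        HasDerivAt (fun ε : ℝ => bracket (laxL (s.shift (symmetry t A s) ε))
          (laxV t (s.shift (symmetry t A s) ε)) k x a b) 0 0 ∧
        HasDerivAt (fun ε : ℝ => bracket (laxM t (s.shift (symmetry t A s) ε))
          (laxU (s.shift (symmetry t A s) ε)) k x a b) 0 0 ∧
        HasDerivAt (fun ε : ℝ => bracket (laxM t (s.shift (symmetry t A s) ε))
          (laxV t (s.shift (symmetry t A s) ε)) k x a b) 0 0) ∧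
    -- the anomalous commutation relations; the anomaly is central
    (∀ A B : Symbol, IsSymbol A → IsSymbol B →
      ∀ s : State, Regular Ω s → Canonical t Ω s → ∀ Φ ∈ ringRF Ω,
        DifferentiableAt ℝ (fun ε : ℝ => Φ (s.shift (symmetry t A s) ε)) 0 ∧
        DifferentiableAt ℝ (fun ε : ℝ => delta t B Φ (s.shift (symmetry t A s) ε)) 0 ∧
        delta t A (delta t B Φ) s - delta t B (delta t A Φ) s
          = delta t (poisson A B) Φ s + cocycle A B * partialF Φ s ∧
        delta t A (partialF Φ) s = partialF (delta t A Φ) s) ∧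
    -- the symbols form a Poisson algebra on which the derivations depend linearly
    (∀ A B : Symbol, IsSymbol A → IsSymbol B → IsSymbol (poisson A B)) ∧
    (∀ A B : Symbol, IsSymbol A → IsSymbol B → ∀ r : ℂ,
      ∀ s : State, Regular Ω s → ∀ Φ ∈ ringRF Ω,
        delta t (fun l m u v => r * A l m u v + B l m u v) Φ s
          = r * delta t A Φ s + delta t B Φ s) ∧
    -- the 2-cocycle property
    (∀ A B C : Symbol, IsSymbol A → IsSymbol B → IsSymbol C →
      (∀ r : ℂ, cocycle (fun l m u v => r * A l m u v + B l m u v) C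
        = r * cocycle A C + cocycle B C) ∧
      cocycle A B = - cocycle B A ∧
      cocycle (poisson A B) C + cocycle (poisson B C) A + cocycle (poisson C A) B = 0) := by
  refine ⟨fun A hA s hs x hx a b => symmetry_induces hΩ (hs.niceFam hΩ) ht hA hx,
    fun A hA s hs hC x hx a b => symmetry_tangent hΩ (hs.niceFam hΩ) ht hA hx hC,
    fun A B hA hB s hs hC Φ hΦ => ?_, fun A B hA hB => hA.poisson hB,
    fun A B hA hB r s hs Φ hΦ => delta_linear hΩ ht (hs.niceFam hΩ) hA hB r hΦ,
    fun A B C hA hB hC => ⟨cocycle_linear hA hB hC, cocycle_antisymm hA hB,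
      cocycle_cyclic hA hB hC⟩⟩
  have nice := hs.niceFam hΩ
  have tame := tame_of_mem_ringRF hΩ ht hΦ
  exact ⟨tame.diff s _ nice (niceFam_symmetry hΩ nice ht hA),
    tame.diff_along _ (Or.inl ⟨A, hA, rfl⟩) _ (Or.inl ⟨B, hB, rfl⟩) s nice,
    delta_commutator hΩ ht nice hA hs.perState hB hC hΦ, delta_partialF hΩ ht nice hA hΦ⟩
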